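/- **Setting.** Let $d,D\in\mathbb N$, $H\in(1/2,1)$, $\alpha\in[0,d)$ with $0<d-\alpha<4H$, $0<t_0<T$, $M>0$, and put $I=[t_0,T]$, $J=[-M,M]^d$. Let $\Lambda$ be a nonnegative tempered Borel measure on $\mathbb R^d$ (for instance $\Lambda(dx)=f(x)\,dx$, or $\Lambda=\delta_0$) whose Fourier transform is a tempered nonnegative measure $\mu$ (the spectral measure), i.e. $\int\varphi\,d\Lambda=(2\pi)^{-d}\int\mathcal F\varphi\,d\mu$ for all Schwartz functions $\varphi$, where $\mathcal F\varphi(\xi)=\int e^{ix\cdot\xi}\varphi(x)\,dx$. Assume $\mu(d\xi)\asymp|\xi|^{-\alpha}d\xi$, i.e. there are $c_1,c_2>0$ with $c_1\int h(\xi)|\xi|^{-\alpha}d\xi\le\int h\,d\mu\le c_2\int h(\xi)|\xi|^{-\alpha}d\xi$ for all measurable $h\ge0$. Let $W_1,\dots,W_D$ be independent centred Gaussian fields, indexed by $t\in[0,T]$ and bounded Borel sets $A\subset\mathbb R^d$, with $$E\big(W_j(t,A)W_j(s,B)\big)=\tfrac12\big(t^{2H}+s^{2H}-|t-s|^{2H}\big)\int_A\int_B\Lambda(z-w)\,dz\,dw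 ,$$ the double integral being $\int_{\mathbb R^d}|\{w\in B:\ w+v\in A\}|\,\Lambda(dv)$. Let $G(t,x)=(4\pi t)^{-d/2}e^{-|x|^2/(4t)}$ for $t>0$ and let $v_0:\mathbb R^d\to\mathbb R$ be such that $G(t,x-\cdot)v_0\in L^1(\mathbb R^d)$ for all $(t,x)\in(0,T]\times\mathbb R^d$. Put $I_0(t,x)=\int G(t,x-y)v_0(y)\,dy$ and $$U_j(t,x)=I_0(t,x)+\int_0^t\!\int_{\mathbb R^d}G(t-s,x-y)\,W_j(ds,dy),\qquad j=1,\dots,D$$ (Wiener integrals), the random field solution of the system $\partial_tU_j=\Delta U_j+\dot W_j$, $U_j(0,\cdot)=v_0$, in a version $U=(U_1,\dots,U_D)$ with a.s. continuous sample paths on $I\times J$. Let $q_1(\tau)=\tau^{H-(d-\alpha)/4}$. If $4H-(d-\alpha)\ne2$, let $q_2(\tau)=\tau^{1\wedge(2H-(d-\alpha)/2)}$. If $4H-(d-\alpha)=2$, let $q_2(\tau)=\tau\big(\log\frac{2e\sqrt d\,M}{\tau}\big)^{1/2}$ for $0<\tau\le2\sqrt d\,M=\operatorname{diam}J$, $q_2(0)=0$,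 and $q_2(\tau)=\tau$ for $\tau>2\sqrt d\,M$, so that $q_2$ is an increasing bijection of $[0,\infty)$. Assume that for some constant $K$ $$|I_0(t,x)-I_0(s,y)|\le K\big(q_1(|t-s|)+q_2(|x-y|)\big),\qquad (t,x),(s,y)\in I\times J .$$ For $g:[0,\infty)\to[0,\infty)$ and $A\subset\mathbb R^D$, let $$\mathcal H_g(A)=\lim_{\varepsilon\downarrow0}\inf\Big\{\sum_{i\ge1}g(2r_i):\ A\subset\bigcup_{i\ge1}B_{r_i}(x_i),\ \sup_ir_i\le\varepsilon\Big\},\qquad \mathrm{Cap}_{g^{-1}}(A)=\Big[\inf_{m}\int\!\!\int\frac{m(dy)\,m(d\bar y)}{g(|y-\bar y|)}\Big]^{-1},$$ where the second infimum is over all probability measures $m$ on $A$, $1/0=\infty$ and $1/\infty=0$. **Theorem.** 1. *Case $4H-(d-\alpha)\ne2$.* Suppose $D>Q:=\dfrac1{H-\frac{d-\alpha}4}+\dfrac d{1\wedge(2H-\frac{d-\alpha}2)}$ and let $\bar g_q(\tau)=\tau^{D-Q}$. (a) There is a constant $C>0$ such that $P(U(I\times J)\cap A\ne\emptyset)\le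 C\,\mathcal H_{\bar g_q}(A)$ for every Borel set $A\subset\mathbb R^D$. (b) For every $N>0$ there is a constant $c>0$ such that $P(U(I\times J)\cap A\ne\emptyset)\ge c\,\mathrm{Cap}_{(\bar g_q)^{-1}}(A)$ for every Borel set $A\subset B_N(0)\subset\mathbb R^D$. 2. *Case $4H-(d-\alpha)=2$.* Suppose $D>\dfrac1{H-\frac{d-\alpha}4}+d$ and let $\bar g_q(\tau)=\tau^{D-1/(H-\frac{d-\alpha}4)}\big(q_2^{-1}(\tau)\big)^{-d}$ for $\tau>0$, $\bar g_q(0)=0$. Then (a) and (b) hold with this $\bar g_q$. The constant $C$ depends only on $I,J,D,d$ and the data of the system ($H$, $\alpha$, $\Lambda$, $v_0$), and $c$ depends in addition on $N$; neither depends on $A$, on the probability space, or on the realisation of the noise and of $U$. -/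

import Mathlib

open MeasureTheory ProbabilityTheory Filter Topology Set
open scoped ENNReal NNReal

universe u

noncomputable section

namespace FracHeat

/-! ### Gauge Hausdorff measures and capacities -/

section Geometry

variable {F : Type*} [NormedAddCommGroup F]

/-- The `g`-Hausdorff measure of `A`: the limit as `ε ↓ 0` (that is, the supremum over `ε > 0`) of
the infimum of `∑ g (2 rᵢ)` over countable covers of `A` by open balls with radii `rᵢ ≤ ε`. -/
def hausdorffGauge (g : ℝ → ℝ) (A : Set F) : ℝ≥0∞ :=
  ⨆ (ε : ℝ) (_ : 0 < ε),
    ⨅ (x : ℕ → F) (r : ℕ → ℝ) (_ : ∀ i, 0 ≤ r i ∧ r i ≤ ε)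
      (_ : A ⊆ ⋃ i, Metric.ball (x i) (r i)), ∑' i, ENNReal.ofReal (g (2 * r i))

variable [MeasurableSpace F]

/-- The energy of a measure `m` relative to the kernel `k`. -/
def energy (k : F → ℝ≥0∞) (m : Measure F) : ℝ≥0∞ :=
  ∫⁻ y, ∫⁻ z, k (y - z) ∂m ∂m

/-- The `k`-capacity of `A`: the inverse of the least energy of a probability measure on `A`
(with `1 / ∞ = 0`, in particular the empty set has capacity zero). -/
def capacity (k : F → ℝ≥0∞) (A : Set F) : ℝ≥0∞ :=
  (⨅ (m : Measure F) (_ : IsProbabilityMeasure m) (_ : m Aᶜ = 0), energy k m)⁻¹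

/-- The potential kernel `z ↦ 1 / g |z|`, with value `∞` where `g |z| = 0`. -/
def invKernel (g : ℝ → ℝ) (z : F) : ℝ≥0∞ := (ENNReal.ofReal (g ‖z‖))⁻¹

end Geometry

/-! ### The gauge functions -/

/-- The exponent of the time gauge. -/
def timeExp (d : ℕ) (H α : ℝ) : ℝ := H - (d - α) / 4

/-- The exponent of the space gauge off the logarithmic case. -/
def spaceExp (d : ℕ) (H α : ℝ) : ℝ := min 1 (2 * H - (d - α) / 2)

/-- The time gauge `q₁`. -/
def timeGauge (d : ℕ) (H α : ℝ) (τ : ℝ) : ℝ := τ ^ timeExp d H α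

/-- The logarithmic gauge `τ (log (2 e √d M / τ))^{1/2}`. The logarithm is at least `1` exactly for
`τ ≤ 2 √d M`, the diameter of `[-M, M]^d`; for larger `τ` it is replaced by `1`, so that the gauge
is an increasing bijection of `[0, ∞)`. -/
def logGauge (d : ℕ) (M : ℝ) (τ : ℝ) : ℝ :=
  τ * Real.sqrt (max 1 (Real.log (2 * Real.exp 1 * Real.sqrt d * M / τ)))

/-- The inverse of the logarithmic gauge on `[0, ∞)`. -/
def logGaugeInv (d : ℕ) (M : ℝ) : ℝ → ℝ := Function.invFunOn (logGauge d M) (Ici 0)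

open Classical in
/-- The space gauge `q₂`. -/
def spaceGauge (d : ℕ) (H α M : ℝ) (τ : ℝ) : ℝ :=
  if 4 * H - (d - α) = 2 then logGauge d M τ else τ ^ spaceExp d H α

/-- The function `ḡ_q` in the case `4H - (d - α) ≠ 2`. -/
def powerGbar (d D : ℕ) (H α : ℝ) (τ : ℝ) : ℝ :=
  τ ^ ((D : ℝ) - (1 / timeExp d H α + d / spaceExp d H α))

/-- The function `ḡ_q` in the case `4H - (d - α) = 2`. -/
def logGbar (d D : ℕ) (H α M : ℝ) (τ : ℝ) : ℝ :=
  τ ^ ((D : ℝ) - 1 / timeExp d H α) * logGaugeInv d M τ ^ (-(d : ℝ))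

/-! ### The noise -/

/-- `μ` is the spectral measure of `Λ`: both are tempered, and `μ` is the Fourier transform of `Λ`
in the sense of tempered distributions, normalised so that Lebesgue measure is the spectral measure
of the Dirac measure at the origin. -/
structure IsSpectralMeasure {d : ℕ} (Λ μ : Measure (EuclideanSpace ℝ (Fin d))) : Prop where
  temperate : Λ.HasTemperateGrowth
  temperate_spectral : μ.HasTemperateGrowth
  fourier : ∀ φ : SchwartzMap (EuclideanSpace ℝ (Fin d)) ℂ,
    ∫ x, φ x ∂Λ = (((2 * Real.pi) ^ d : ℝ) : ℂ)⁻¹ *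
      ∫ ξ, (∫ x, Complex.exp (Complex.I * ((inner ℝ x ξ : ℝ) : ℂ)) * φ x) ∂μ

/-- `μ(dξ) ≍ |ξ|^{-α} dξ`. -/
def IsComparableRiesz {d : ℕ} (α : ℝ) (μ : Measure (EuclideanSpace ℝ (Fin d))) : Prop :=
  ∃ c₁ c₂ : ℝ, 0 < c₁ ∧ 0 < c₂ ∧ ∀ h : EuclideanSpace ℝ (Fin d) → ℝ≥0∞, Measurable h →
    ENNReal.ofReal c₁ * ∫⁻ ξ, h ξ * ENNReal.ofReal (‖ξ‖ ^ (-α)) ≤ ∫⁻ ξ, h ξ ∂μ ∧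
    ∫⁻ ξ, h ξ ∂μ ≤ ENNReal.ofReal c₂ * ∫⁻ ξ, h ξ * ENNReal.ofReal (‖ξ‖ ^ (-α))

/-- The covariance of fractional Brownian motion with Hurst index `H`. -/
def fbmCov (H t s : ℝ) : ℝ := (t ^ (2 * H) + s ^ (2 * H) - |t - s| ^ (2 * H)) / 2

/-- The spatial covariance `∫_A ∫_B Λ(z - w) dz dw`, that is `∫ |{w ∈ B : w + v ∈ A}| Λ(dv)`.
It is `∫_A ∫_B f (z - w) dz dw` if `Λ(dx) = f(x) dx`, and `|A ∩ B|` if `Λ = δ₀`. -/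
def spatialCov {d : ℕ} (Λ : Measure (EuclideanSpace ℝ (Fin d)))
    (A B : Set (EuclideanSpace ℝ (Fin d))) : ℝ :=
  ∫ v, (volume : Measure (EuclideanSpace ℝ (Fin d))).real {w | w ∈ B ∧ w + v ∈ A} ∂Λ

/-- The index set of the noise: times in `[0, T]` and bounded Borel sets. -/
def NoiseIndex (d : ℕ) (T : ℝ) : Type :=
  {p : ℝ × Set (EuclideanSpace ℝ (Fin d)) //
    p.1 ∈ Icc 0 T ∧ MeasurableSet p.2 ∧ Bornology.IsBounded p.2}

/-- The restriction of a set-indexed field to the index set of the noise. -/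
def onIndex {d : ℕ} {Ω : Type u} (T : ℝ) (W : ℝ → Set (EuclideanSpace ℝ (Fin d)) → Ω → ℝ)
    (p : NoiseIndex d T) (ω : Ω) : ℝ := W p.1.1 p.1.2 ω

/-- `W` is a noise on `[0, T] × ℝ^d`, fractional in time with Hurst index `H` and with spatial
covariance `Λ`. -/
structure IsNoise {d : ℕ} {Ω : Type u} [MeasurableSpace Ω] (P : Measure Ω) (H T : ℝ)
    (Λ : Measure (EuclideanSpace ℝ (Fin d)))
    (W : ℝ → Set (EuclideanSpace ℝ (Fin d)) → Ω → ℝ) : Prop where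
  gaussian : IsGaussianProcess (onIndex T W) P
  centred : ∀ p : NoiseIndex d T, ∫ ω, onIndex T W p ω ∂P = 0
  covariance : ∀ p q : NoiseIndex d T,
    ∫ ω, onIndex T W p ω * onIndex T W q ω ∂P =
      fbmCov H p.1.1 q.1.1 * spatialCov Λ p.1.2 q.1.2

/-! ### The Wiener integral -/

/-- An elementary integrand `∑ᵢ cᵢ 1_{(aᵢ, bᵢ]}(r) 1_{Aᵢ}(z)`. -/
structure Elementary (d : ℕ) (T : ℝ) where
  n : ℕ
  coef : Fin n → ℝ
  left : Fin n → ℝ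
  right : Fin n → ℝ
  base : Fin n → Set (EuclideanSpace ℝ (Fin d))
  left_nonneg : ∀ i, 0 ≤ left i
  left_le_right : ∀ i, left i ≤ right i
  right_le : ∀ i, right i ≤ T
  measurable_base : ∀ i, MeasurableSet (base i)
  bounded_base : ∀ i, Bornology.IsBounded (base i)

/-- The function on `[0, T] × ℝ^d` given by an elementary integrand. -/
def Elementary.toFun {d : ℕ} {T : ℝ} (φ : Elementary d T) (r : ℝ)
    (z : EuclideanSpace ℝ (Fin d)) : ℝ :=
  ∑ i, φ.coef i * (Ioc (φ.left i) (φ.right i)).indicator 1 r * (φ.base i).indicator 1 z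

/-- The integral of an elementary integrand against `W`. -/
def Elementary.integral {d : ℕ} {T : ℝ} (φ : Elementary d T) {Ω : Type u}
    (W : ℝ → Set (EuclideanSpace ℝ (Fin d)) → Ω → ℝ) (ω : Ω) : ℝ :=
  ∑ i, φ.coef i * (W (φ.right i) (φ.base i) ω - W (φ.left i) (φ.base i) ω)

/-- The square of the norm of an integrand,
`H(2H-1) ∫₀ᵀ∫₀ᵀ |r-s|^{2H-2} ∫∫ |h(r,z)| |h(s,w)| Λ(z-w) dz dw dr ds`. It dominates the square of
the norm of the Hilbert space of the noise, in which the absolute values are missing. -/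
def noiseNormSq {d : ℕ} (H T : ℝ) (Λ : Measure (EuclideanSpace ℝ (Fin d)))
    (h : ℝ → EuclideanSpace ℝ (Fin d) → ℝ) : ℝ≥0∞ :=
  ENNReal.ofReal (H * (2 * H - 1)) *
    ∫⁻ r in Ioc 0 T, ∫⁻ s in Ioc 0 T, ENNReal.ofReal (|r - s| ^ (2 * H - 2)) *
      ∫⁻ v, (∫⁻ w, ‖h r (w + v)‖ₑ * ‖h s w‖ₑ) ∂Λ

/-- `X` is (a version of) the Wiener integral `∫∫ g(r,z) W(dr,dz)`: the limit in `L²` of the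
integrals of elementary integrands that converge to `g`. -/
def IsWienerIntegral {d : ℕ} {Ω : Type u} [MeasurableSpace Ω] (P : Measure Ω) (H T : ℝ)
    (Λ : Measure (EuclideanSpace ℝ (Fin d)))
    (W : ℝ → Set (EuclideanSpace ℝ (Fin d)) → Ω → ℝ)
    (g : ℝ → EuclideanSpace ℝ (Fin d) → ℝ) (X : Ω → ℝ) : Prop :=
  MemLp X 2 P ∧ ∃ φ : ℕ → Elementary d T,
    Tendsto (fun n => noiseNormSq H T Λ (fun r z => (φ n).toFun r z - g r z)) atTop (𝓝 0) ∧
    Tendsto (fun n => eLpNorm (fun ω => (φ n).integral W ω - X ω) 2 P) atTop (𝓝 0)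

/-! ### The system of stochastic heat equations -/

/-- The heat kernel of `∂/∂t - Δ`, zero for `t ≤ 0`. -/
def heatKernel {d : ℕ} (t : ℝ) (x : EuclideanSpace ℝ (Fin d)) : ℝ :=
  if 0 < t then (4 * Real.pi * t) ^ (-(d : ℝ) / 2) * Real.exp (-‖x‖ ^ 2 / (4 * t)) else 0

/-- The solution `I₀` of the heat equation with initial value `v₀`. -/
def initialPart {d : ℕ} (v₀ : EuclideanSpace ℝ (Fin d) → ℝ) (t : ℝ)
    (x : EuclideanSpace ℝ (Fin d)) : ℝ :=
  ∫ y, heatKernel t (x - y) * v₀ y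

/-- `U` is the random field solution on `(0, T] × ℝ^d` of the system
`∂U_j/∂t = ΔU_j + Ẇ_j`, `U_j(0, ·) = v₀`, `j = 1, …, D`, driven by independent noises `W_j`:
`U_j(t,x) = I₀(t,x) + ∫₀ᵗ∫ G(t-r, x-z) W_j(dr,dz)`. -/
structure IsSolution {d D : ℕ} {Ω : Type u} [MeasurableSpace Ω] (P : Measure Ω) (H T : ℝ)
    (Λ : Measure (EuclideanSpace ℝ (Fin d))) (v₀ : EuclideanSpace ℝ (Fin d) → ℝ)
    (W : Fin D → ℝ → Set (EuclideanSpace ℝ (Fin d)) → Ω → ℝ)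
    (U : ℝ → EuclideanSpace ℝ (Fin d) → Ω → EuclideanSpace ℝ (Fin D)) : Prop where
  noise : ∀ j, IsNoise P H T Λ (W j)
  indep : iIndepFun (fun j ω (p : NoiseIndex d T) => onIndex T (W j) p ω) P
  mild : ∀ t ∈ Ioc 0 T, ∀ x j,
    IsWienerIntegral P H T Λ (W j) (fun r z => heatKernel (t - r) (x - z))
      (fun ω => U t x ω j - initialPart v₀ t x)

/-- The cube `[-M, M]^d`. -/
def cube (d : ℕ) (M : ℝ) : Set (EuclideanSpace ℝ (Fin d)) := {x | ∀ i, x i ∈ Icc (-M) M}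

/-- The sample paths of `U` are almost surely continuous on `[t₀, T] × [-M, M]^d`. -/
def HasContinuousPaths {d D : ℕ} {Ω : Type u} [MeasurableSpace Ω] (P : Measure Ω) (t₀ T M : ℝ)
    (U : ℝ → EuclideanSpace ℝ (Fin d) → Ω → EuclideanSpace ℝ (Fin D)) : Prop :=
  ∀ᵐ ω ∂P, ContinuousOn (fun p : ℝ × EuclideanSpace ℝ (Fin d) => U p.1 p.2 ω)
    (Icc t₀ T ×ˢ cube d M)

/-- The event `U([t₀, T] × [-M, M]^d) ∩ A ≠ ∅`. -/
def hitting {d D : ℕ} {Ω : Type u} (t₀ T M : ℝ)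
    (U : ℝ → EuclideanSpace ℝ (Fin d) → Ω → EuclideanSpace ℝ (Fin D))
    (A : Set (EuclideanSpace ℝ (Fin D))) : Set Ω :=
  {ω | ∃ t ∈ Icc t₀ T, ∃ x ∈ cube d M, U t x ω ∈ A}

/-- There is a constant `C` such that, for every solution with continuous paths,
`P(U(I × J) ∩ A ≠ ∅) ≤ C 𝓗_g(A)` for all Borel sets `A`. -/
def UpperBound (d D : ℕ) (H T t₀ M : ℝ) (Λ : Measure (EuclideanSpace ℝ (Fin d)))
    (v₀ : EuclideanSpace ℝ (Fin d) → ℝ) (g : ℝ → ℝ) : Prop :=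
  ∃ C : ℝ, 0 < C ∧ ∀ (Ω : Type u) [MeasurableSpace Ω] (P : Measure Ω) [IsProbabilityMeasure P]
    (W : Fin D → ℝ → Set (EuclideanSpace ℝ (Fin d)) → Ω → ℝ)
    (U : ℝ → EuclideanSpace ℝ (Fin d) → Ω → EuclideanSpace ℝ (Fin D)),
    IsSolution P H T Λ v₀ W U → HasContinuousPaths P t₀ T M U →
    ∀ A : Set (EuclideanSpace ℝ (Fin D)), MeasurableSet A →
      P (hitting t₀ T M U A) ≤ ENNReal.ofReal C * hausdorffGauge g A

/-- For every `N > 0` there is a constant `c > 0` such that, for every solution with continuous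
paths, `P(U(I × J) ∩ A ≠ ∅) ≥ c Cap_{1/g}(A)` for all Borel sets `A ⊆ B_N(0)`. -/
def LowerBound (d D : ℕ) (H T t₀ M : ℝ) (Λ : Measure (EuclideanSpace ℝ (Fin d)))
    (v₀ : EuclideanSpace ℝ (Fin d) → ℝ) (g : ℝ → ℝ) : Prop :=
  ∀ N : ℝ, 0 < N → ∃ c : ℝ, 0 < c ∧
    ∀ (Ω : Type u) [MeasurableSpace Ω] (P : Measure Ω) [IsProbabilityMeasure P]
    (W : Fin D → ℝ → Set (EuclideanSpace ℝ (Fin d)) → Ω → ℝ)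
    (U : ℝ → EuclideanSpace ℝ (Fin d) → Ω → EuclideanSpace ℝ (Fin D)),
    IsSolution P H T Λ v₀ W U → HasContinuousPaths P t₀ T M U →
    ∀ A : Set (EuclideanSpace ℝ (Fin D)), MeasurableSet A → A ⊆ Metric.ball 0 N →
      ENNReal.ofReal c * capacity (invKernel g) A ≤ P (hitting t₀ T M U A)

end FracHeat

end

noncomputable section

namespace FracHeat

/-! ### One-dimensional Gaussian estimates -/

/-! The solution is `U = m + V`, where `m` is the heat flow of `v₀` and `V₁, …, V_D` are independent
copies of one centred Gaussian field. Everything about hitting follows from a few facts on that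
field, expressed through the gauge distance `ρ(p,p') = |t-s|^θ + q₂(|x-y|)` with `θ = H - (d-α)/4`.
Variances are bounded above and below, the increments of `V` and `m` are `O(ρ)` (`IsControlled`),
and the regression of a later value on an earlier one leaves a variance of order `ρ²`
(`IsNondegenerate`).

Upper bound (`exists_upper_bound`). Cut `I × J` into cells with time side `r^{1/θ}` and space side
`q₂⁻¹(r)/d`, so that the field varies by `O(r)` on a cell. Regress the field on its value at the
corner of the cell. The residual field is independent of the corner value, and chaining bounds its
supremum by `O(r)` in mean. As the corner value has a bounded density, one coordinate comes within
`r` of a given target somewhere in the cell with probability `O(r)` (`exists_cell_bound`).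
Independence of the coordinates gives `O(r^D)` per cell, and there are `O(r^{-1/θ} q₂⁻¹(r)^{-d})`
cells; the product is the gauge `ḡ(r)`. Subadditivity over a cover of `A` then gives the Hausdorff
measure.

Lower bound (`exists_lower_bound`). For a probability measure `ν` on `A`, apply the second moment
method to the `dp ν(dz)`-measure of the set where `U(p)` is `ε`-close to `z`. Its mean is at least
of order `ε^D`. The two-point probability is at most of order `ε^{2D} max(ρ(p,p'), |z-z'|)^{-D}`
(`exists_two_point_bound`), and integration over `p'` turns this into `ε^{2D}/ḡ(|z-z'|)`
(`exists_lintegral_gaugeDist_le`). So the second moment is bounded by `ε^{2D}` times the energy of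
`ν`; the powers of `ε` cancel, and compactness allows `ε → 0`.

Verification for the heat equation. The isometry (`IsWienerIntegral.integral_mul`) expresses the
covariance through `Λ` and the kernel `|r-r'|^{2H-2}`. That kernel is a multiple of `∫
(r-u)₊^{H-3/2} (r'-u)₊^{H-3/2} du`, and the heat kernel is diagonalised by the Fourier transform.
The covariance becomes `κ ∫∫ cos⟨x-y,ξ⟩ A_t(ξ,u) A_s(ξ,u) μ(dξ) du`, where `A_t(ξ,u)` integrates
`exp(-(t-r)|ξ|²) (r-u)₊^{H-3/2}` over `0 < r < t`. The variance of `V(p) - b V(p')` therefore has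
the integrand `A_t² - 2b cos⟨x-y,ξ⟩ A_t A_s + b² A_s²`. For `s < t` it equals `A_t²` where `s ≤ u`,
since `A_s` vanishes there; this yields the time part of nondegeneracy. Everywhere it is at least
`sin²⟨x-y,ξ⟩ A_t²`, which yields the space part. Radial integrals of `min(h, |ξ|⁻²)^{2H}` then
produce exactly the two gauges, with a logarithm at the exponent where the middle range of
frequencies diverges (`exists_heatCov_bounds`). -/

lemma gaussianReal_le_of_pdf_le {v : ℝ≥0} (hv : v ≠ 0) {s : Set ℝ} (_hs : MeasurableSet s)
    {w r B : ℝ} (hsub : s ⊆ Icc (w - r) (w + r)) (hB : ∀ x ∈ s, gaussianPDFReal 0 v x ≤ B) :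
    gaussianReal 0 v s ≤ ENNReal.ofReal B * ENNReal.ofReal (2 * r) := by
  rw [gaussianReal_apply 0 hv]
  calc ∫⁻ x in s, gaussianPDF 0 v x ≤ ∫⁻ _ in s, ENNReal.ofReal B :=
        setLIntegral_mono measurable_const fun x hx => ENNReal.ofReal_le_ofReal (hB x hx)
    _ = ENNReal.ofReal B * volume s := by simp
    _ ≤ ENNReal.ofReal B * ENNReal.ofReal (2 * r) := by
        gcongr
        refine (measure_mono hsub).trans ?_
        rw [Real.volume_Icc]
        exact ENNReal.ofReal_le_ofReal (by linarith)

lemma gaussianPDFReal_zero_le {v : ℝ≥0} {c : ℝ} (hc : 0 < c) (hv : c ≤ v) (x : ℝ) :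
    gaussianPDFReal 0 v x ≤ (√c)⁻¹ := by
  have hv0 : (0 : ℝ) < v := hc.trans_le hv
  rw [gaussianPDFReal]
  have h1 : (√(2 * Real.pi * v))⁻¹ ≤ (√c)⁻¹ := by
    gcongr
    nlinarith [Real.pi_gt_three]
  have h2 : Real.exp (-(x - 0) ^ 2 / (2 * v)) ≤ 1 := by
    rw [Real.exp_le_one_iff]
    apply div_nonpos_of_nonpos_of_nonneg <;> nlinarith [sq_nonneg (x - 0)]
  calc _ ≤ (√c)⁻¹ * 1 := by gcongr
    _ = _ := mul_one _

/-- This is `yⁿ/n! ≤ exp y`. Polynomial decay of a prescribed order is all that the two-point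
estimate for distant targets needs from the Gaussian tail. -/
lemma gaussianPDFReal_zero_le_tail {v : ℝ≥0} {c : ℝ} (hc : 0 < c) (hv : c ≤ v) (n : ℕ) {x : ℝ}
    (hx : x ≠ 0) :
    gaussianPDFReal 0 v x ≤ (√c)⁻¹ * (n.factorial * (2 * v / x ^ 2) ^ n) := by
  have hv0 : (0 : ℝ) < v := hc.trans_le hv
  rw [gaussianPDFReal]
  have h1 : (√(2 * Real.pi * v))⁻¹ ≤ (√c)⁻¹ := by
    gcongr
    nlinarith [Real.pi_gt_three]
  have hx2 : 0 < x ^ 2 := by positivity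
  have h2 : Real.exp (-(x - 0) ^ 2 / (2 * v)) ≤ n.factorial * (2 * v / x ^ 2) ^ n := by
    have h := Real.pow_div_factorial_le_exp (x ^ 2 / (2 * v)) (by positivity) n
    have : -(x - 0) ^ 2 / (2 * (v : ℝ)) = -(x ^ 2 / (2 * v)) := by ring
    rw [this, Real.exp_neg]
    have hp : 0 < (x ^ 2 / (2 * v)) ^ n / (n.factorial : ℝ) := by positivity
    calc (Real.exp (x ^ 2 / (2 * v)))⁻¹ ≤ ((x ^ 2 / (2 * v)) ^ n / (n.factorial : ℝ))⁻¹ := by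
          gcongr
      _ = _ := by
          rw [inv_div, div_eq_mul_inv, ← inv_pow, inv_div]
  gcongr

/-- The weight `1 + |x|` arises because a regression coefficient within `O(r)` of `1` produces an
error `O(r |x|)`. The density absorbs it by `1 + y ≤ exp y`. -/
lemma one_add_abs_mul_gaussianPDFReal_le {v : ℝ≥0} {c C : ℝ} (hc : 0 < c) (hv : c ≤ v)
    (hvC : v ≤ C) (x : ℝ) :
    (1 + |x|) * gaussianPDFReal 0 v x ≤ 2 * (1 + 2 * C) * (√c)⁻¹ := by
  have hv0 : (0 : ℝ) < v := hc.trans_le hv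
  have hC0 : 0 < C := hv0.trans_le hvC
  rw [gaussianPDFReal]
  have h1 : (√(2 * Real.pi * v))⁻¹ ≤ (√c)⁻¹ := by
    gcongr
    nlinarith [Real.pi_gt_three]
  have h2 : (1 + |x|) * Real.exp (-(x - 0) ^ 2 / (2 * v)) ≤ 2 * (1 + 2 * C) := by
    have : -(x - 0) ^ 2 / (2 * (v : ℝ)) = -(x ^ 2 / (2 * v)) := by ring
    rw [this, Real.exp_neg, ← div_eq_mul_inv, div_le_iff₀ (Real.exp_pos _)]
    have h := Real.add_one_le_exp (x ^ 2 / (2 * v))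
    have h3 : x ^ 2 / (2 * C) ≤ x ^ 2 / (2 * v) := by gcongr
    have h4 : 2 * (1 + 2 * C) * (x ^ 2 / (2 * C) + 1) ≤
        2 * (1 + 2 * C) * Real.exp (x ^ 2 / (2 * v)) := by gcongr; linarith
    refine le_trans ?_ h4
    have h5 : 2 * (1 + 2 * C) * (x ^ 2 / (2 * C) + 1) = 2 + 4 * C + 2 * x ^ 2 + x ^ 2 / C := by
      field_simp; ring
    rw [h5]
    have : 0 ≤ x ^ 2 / C := by positivity
    have h6 := abs_nonneg x
    nlinarith [sq_abs x, sq_nonneg (|x| - 1)]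
  calc _ = (√(2 * Real.pi * v))⁻¹ * ((1 + |x|) * Real.exp (-(x - 0) ^ 2 / (2 * v))) := by ring
    _ ≤ (√c)⁻¹ * (2 * (1 + 2 * C)) := by gcongr
    _ = _ := by ring

lemma gaussianReal_abs_sub_le {v : ℝ≥0} {c : ℝ} (hc : 0 < c) (hv : c ≤ v) (w r : ℝ) :
    gaussianReal 0 v {x | |x - w| ≤ r} ≤ ENNReal.ofReal (√c)⁻¹ * ENNReal.ofReal (2 * r) := by
  have hv0 : v ≠ 0 := by
    rintro rfl
    simp at hv; linarith
  refine gaussianReal_le_of_pdf_le (w := w) hv0 (measurableSet_le (by fun_prop) (by fun_prop)) ?_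
    fun x _ => gaussianPDFReal_zero_le hc hv x
  intro x hx
  have := abs_le.1 (show |x - w| ≤ r from hx)
  constructor <;> linarith

lemma gaussianReal_abs_sub_le_tail {v : ℝ≥0} {c : ℝ} (hc : 0 < c) (hv : c ≤ v) (n : ℕ)
    {w r : ℝ} (hr : 0 < r) (hw : 2 * r ≤ |w|) :
    gaussianReal 0 v {x | |x - w| ≤ r} ≤
      ENNReal.ofReal ((√c)⁻¹ * (n.factorial * (8 * v / w ^ 2) ^ n)) * ENNReal.ofReal (2 * r) := by
  have hv0 : v ≠ 0 := by
    rintro rfl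
    simp at hv; linarith
  have hw0 : 0 < |w| := by linarith
  refine gaussianReal_le_of_pdf_le (w := w) hv0 (measurableSet_le (by fun_prop) (by fun_prop)) ?_ ?_
  · intro x hx
    have := abs_le.1 (show |x - w| ≤ r from hx)
    constructor <;> linarith
  · intro x hx
    have hx1 : |x - w| ≤ r := hx
    have hx2 : |w| / 2 ≤ |x| := by
      have := abs_sub_abs_le_abs_sub w x
      rw [abs_sub_comm] at this
      linarith
    have hx0 : x ≠ 0 := by
      rintro rfl
      simp at hx2; linarith [abs_pos.2 (show w ≠ 0 from abs_pos.1 hw0)]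
    refine (gaussianPDFReal_zero_le_tail hc hv n hx0).trans ?_
    have h1 : w ^ 2 / 4 ≤ x ^ 2 := by
      rw [← sq_abs w, ← sq_abs x]
      nlinarith [abs_nonneg x]
    have hw2 : 0 < w ^ 2 := by rw [← sq_abs]; positivity
    have h2 : 2 * (v : ℝ) / x ^ 2 ≤ 8 * v / w ^ 2 := by
      calc 2 * (v : ℝ) / x ^ 2 ≤ 2 * v / (w ^ 2 / 4) := by gcongr
        _ = _ := by field_simp; ring
    gcongr

/-- The width of the window grows with `|x|`, so a uniform density bound would not do for large `w`.
For small `a` the quantities `1 + |x|` and `1 + |w|` are comparable on the event. It then lies in an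
interval of length `O(a (1 + |w|))`, on which the density is `O(1 / (1 + |w|))`. -/
lemma gaussianReal_abs_sub_le_mul {v : ℝ≥0} {c C : ℝ} (hc : 0 < c) (hv : c ≤ v) (hvC : v ≤ C)
    (w : ℝ) {a : ℝ} (ha : 0 ≤ a) :
    gaussianReal 0 v {x | |x - w| ≤ 2 * a * (1 + |x|)} ≤
      ENNReal.ofReal ((8 + 15 * (1 + 2 * C) * (√c)⁻¹) * a) := by
  have hv0' : v ≠ 0 := by
    rintro rfl
    simp at hv; linarith
  have hv0 : (0 : ℝ) < v := hc.trans_le hv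
  have hC0 : 0 < C := hv0.trans_le hvC
  have hK : 0 ≤ 15 * (1 + 2 * C) * (√c)⁻¹ := by positivity
  rcases le_or_gt (1 / 8) a with h | h
  -- For `a ≥ 1/8` the summand `8 a` of the constant already exceeds one.
  · refine prob_le_one.trans ?_
    rw [← ENNReal.ofReal_one]
    apply ENNReal.ofReal_le_ofReal
    nlinarith
  · have key : ∀ x, |x - w| ≤ 2 * a * (1 + |x|) →
        1 + |x| ≤ 4 / 3 * (1 + |w|) ∧ 1 + |w| ≤ 5 / 4 * (1 + |x|) := by
      intro x hx
      have h1 := abs_sub_abs_le_abs_sub x w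
      have h2 := abs_sub_abs_le_abs_sub w x
      rw [abs_sub_comm] at h2
      have h3 : 2 * a * (1 + |x|) ≤ 1 / 4 * (1 + |x|) := by
        have := abs_nonneg x
        nlinarith
      constructor <;> linarith
    refine (gaussianReal_le_of_pdf_le (w := w) (r := 3 * a * (1 + |w|))
      (B := 2 * (1 + 2 * C) * (√c)⁻¹ * (5 / 4) / (1 + |w|)) hv0'
      (measurableSet_le (by fun_prop) (by fun_prop)) ?_ ?_).trans ?_
    · intro x hx
      have hx1 : |x - w| ≤ 2 * a * (1 + |x|) := hx
      have := (key x hx1).1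
      have h4 : 2 * a * (1 + |x|) ≤ 3 * a * (1 + |w|) := by
        have := abs_nonneg w
        nlinarith
      have := abs_le.1 (hx1.trans h4)
      constructor <;> linarith
    · intro x hx
      have h5 := (key x hx).2
      have h6 := one_add_abs_mul_gaussianPDFReal_le hc hv hvC x
      have hw : 0 < 1 + |w| := by positivity
      rw [le_div_iff₀ hw]
      have h7 := gaussianPDFReal_nonneg 0 v x
      calc gaussianPDFReal 0 v x * (1 + |w|) ≤ gaussianPDFReal 0 v x * (5 / 4 * (1 + |x|)) := by
            gcongr
        _ = 5 / 4 * ((1 + |x|) * gaussianPDFReal 0 v x) := by ring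
        _ ≤ 5 / 4 * (2 * (1 + 2 * C) * (√c)⁻¹) := by gcongr
        _ = _ := by ring
    · rw [← ENNReal.ofReal_mul (by positivity)]
      apply ENNReal.ofReal_le_ofReal
      have hw : 0 < 1 + |w| := by positivity
      have : 2 * (1 + 2 * C) * (√c)⁻¹ * (5 / 4) / (1 + |w|) * (2 * (3 * a * (1 + |w|))) =
          15 * (1 + 2 * C) * (√c)⁻¹ * a := by
        field_simp; ring
      rw [this]
      nlinarith

lemma le_gaussianReal_abs_sub {v : ℝ≥0} {c C N : ℝ} (hc : 0 < c) (hv : c ≤ v) (hvC : v ≤ C) {w : ℝ}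
    (hw : |w| ≤ N) {r : ℝ} (hr : 0 < r) (hr1 : r ≤ 1) :
    ENNReal.ofReal ((√(2 * Real.pi * C))⁻¹ * Real.exp (-(N + 1) ^ 2 / (2 * c))) *
      ENNReal.ofReal r ≤ gaussianReal 0 v {x | |x - w| < r} := by
  have hv0' : v ≠ 0 := by
    rintro rfl
    simp at hv; linarith
  have hv0 : (0 : ℝ) < v := hc.trans_le hv
  have hC0 : 0 < C := hv0.trans_le hvC
  have hset : {x : ℝ | |x - w| < r} = Ioo (w - r) (w + r) := by
    ext x
    simp only [mem_ofPred_eq, mem_Ioo, abs_lt]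
    constructor <;> rintro ⟨h1, h2⟩ <;> constructor <;> linarith
  rw [hset, gaussianReal_apply 0 hv0']
  calc _ ≤ ENNReal.ofReal ((√(2 * Real.pi * C))⁻¹ * Real.exp (-(N + 1) ^ 2 / (2 * c))) *
        volume (Ioo (w - r) (w + r)) := by
        gcongr
        rw [Real.volume_Ioo]
        exact ENNReal.ofReal_le_ofReal (by linarith)
    _ = ∫⁻ _ in Ioo (w - r) (w + r),
        ENNReal.ofReal ((√(2 * Real.pi * C))⁻¹ * Real.exp (-(N + 1) ^ 2 / (2 * c))) := by simp
    _ ≤ _ := by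
        refine setLIntegral_mono (measurable_gaussianPDF 0 v) fun x hx => ?_
        apply ENNReal.ofReal_le_ofReal
        rw [gaussianPDFReal]
        have hx1 : |x| ≤ N + 1 := by
          have := abs_le.1 hw
          rw [abs_le]; constructor <;> linarith [hx.1, hx.2]
        have hx2 : x ^ 2 ≤ (N + 1) ^ 2 := by
          rw [← sq_abs x]
          exact pow_le_pow_left₀ (abs_nonneg x) hx1 2
        have hx3 : (x - 0) ^ 2 / (2 * (v : ℝ)) ≤ (N + 1) ^ 2 / (2 * c) := by
          rw [sub_zero]
          gcongr
        have h1 : -(N + 1) ^ 2 / (2 * c) ≤ -(x - 0) ^ 2 / (2 * (v : ℝ)) := by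
          rw [neg_div, neg_div]; linarith
        gcongr

/-- The anticoncentration estimate for a Gaussian variable in an interval of random length
independent of the variable. -/
lemma measure_abs_sub_le_add_le {Ω : Type*} [MeasurableSpace Ω] {P : Measure Ω}
    [IsProbabilityMeasure P] {X : Ω → ℝ} {S : Ω → ℝ≥0∞} (hX : Measurable X) (hS : Measurable S)
    (hXS : IndepFun X S P) {v : ℝ≥0} (hlaw : P.map X = gaussianReal 0 v) {c C : ℝ} (hc : 0 < c)
    (hv : c ≤ v) (hvC : v ≤ C) (w : ℝ) {a : ℝ} (ha : 0 ≤ a) :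
    P {ω | ENNReal.ofReal |X ω - w| ≤ ENNReal.ofReal (a * (1 + |X ω|)) + S ω} ≤
      ENNReal.ofReal ((8 + 15 * (1 + 2 * C) * (√c)⁻¹) * a) +
        ENNReal.ofReal (4 * (√c)⁻¹) * ∫⁻ ω, S ω ∂P := by
  -- According to which of the two lengths is larger, the event either concerns `X` alone or has
  -- width `2 S`; in the second case independence allows `S` to be frozen.
  have hsub : {ω | ENNReal.ofReal |X ω - w| ≤ ENNReal.ofReal (a * (1 + |X ω|)) + S ω} ⊆
      (X ⁻¹' {x | |x - w| ≤ 2 * a * (1 + |x|)}) ∪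
        ((fun ω => (X ω, S ω)) ⁻¹' {p : ℝ × ℝ≥0∞ | ENNReal.ofReal |p.1 - w| ≤ 2 * p.2}) := by
    intro ω hω
    simp only [mem_ofPred_eq] at hω
    rcases le_total (S ω) (ENNReal.ofReal (a * (1 + |X ω|))) with h | h
    · left
      have h1 : ENNReal.ofReal |X ω - w| ≤ ENNReal.ofReal (2 * a * (1 + |X ω|)) := by
        refine hω.trans ((add_le_add le_rfl h).trans ?_)
        rw [← ENNReal.ofReal_add (by positivity) (by positivity)]
        exact ENNReal.ofReal_le_ofReal (by linarith)
      exact (ENNReal.ofReal_le_ofReal_iff (by positivity)).1 h1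
    · right
      refine hω.trans ((add_le_add h le_rfl).trans ?_)
      rw [two_mul]
  refine (measure_mono hsub).trans ((measure_union_le _ _).trans (add_le_add ?_ ?_))
  · rw [← Measure.map_apply hX (measurableSet_le (by fun_prop) (by fun_prop)), hlaw]
    exact gaussianReal_abs_sub_le_mul hc hv hvC w ha
  · have hm : MeasurableSet {p : ℝ × ℝ≥0∞ | ENNReal.ofReal |p.1 - w| ≤ 2 * p.2} :=
      measurableSet_le (by fun_prop) (by fun_prop)
    rw [← Measure.map_apply (hX.prodMk hS) hm,
      (indepFun_iff_map_prod_eq_prod_map_map hX.aemeasurable hS.aemeasurable).1 hXS,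
      Measure.prod_apply_symm hm]
    have : ∀ s : ℝ≥0∞, P.map X ((fun x => (x, s)) ⁻¹' {p : ℝ × ℝ≥0∞ |
        ENNReal.ofReal |p.1 - w| ≤ 2 * p.2}) ≤ ENNReal.ofReal (4 * (√c)⁻¹) * s := by
      intro s
      rcases eq_or_ne s ∞ with rfl | hs
      · rw [ENNReal.mul_top (by simp; positivity)]
        exact le_top
      · lift s to ℝ≥0 using hs
        rw [hlaw]
        have : ((fun x => (x, (s : ℝ≥0∞))) ⁻¹' {p : ℝ × ℝ≥0∞ |
          ENNReal.ofReal |p.1 - w| ≤ 2 * p.2}) = {x : ℝ | |x - w| ≤ 2 * s} := by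
          ext x
          simp only [mem_preimage, mem_ofPred_eq]
          rw [ENNReal.ofReal_le_iff_le_toReal (by finiteness)]
          simp
        rw [this]
        refine (gaussianReal_abs_sub_le hc hv w _).trans ?_
        rw [← ENNReal.ofReal_mul (by positivity), ← ENNReal.ofReal_coe_nnreal,
          ← ENNReal.ofReal_mul (by positivity)]
        exact ENNReal.ofReal_le_ofReal (le_of_eq (by ring))
    calc _ ≤ ∫⁻ s, ENNReal.ofReal (4 * (√c)⁻¹) * s ∂(P.map S) := lintegral_mono this
      _ = _ := by
        rw [lintegral_const_mul _ measurable_id', lintegral_map measurable_id' hS]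

/-! ### Dyadic chaining -/

section Chaining

variable {ι : Type*} [Fintype ι] [DecidableEq ι]

/-- The dyadic point `k / 2ⁿ`. -/
def dyadic (n : ℕ) (k : ι → ℕ) : ι → ℝ := fun i => (k i : ℝ) / 2 ^ n

/-- The sum over all levels of the `ℓᵐ` norms of the increments of `f` between a dyadic point and
its parent. -/
def chainSum (m : ℕ) (f : (ι → ℝ) → ℝ) : ℝ≥0∞ :=
  ∑' n : ℕ, (∑ k : ι → Fin (2 ^ (n + 1)),
    ‖f (dyadic (n + 1) fun i => k i) - f (dyadic n fun i => (k i : ℕ) / 2)‖ₑ ^ m) ^ (1 / (m : ℝ))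

/-- The truncations `⌊2ⁿ u⌋ / 2ⁿ` start at `0`, converge to `u`, and each is the parent of the next,
since halving the index commutes with the floor. Telescoping leaves one increment per level, which
is at most the `ℓᵐ` norm over the whole level. -/
lemma enorm_sub_le_chainSum {m : ℕ} (hm : m ≠ 0) {f : (ι → ℝ) → ℝ} (hf : Continuous f) {u : ι → ℝ}
    (hu : ∀ i, u i ∈ Ico (0 : ℝ) 1) : ‖f u - f 0‖ₑ ≤ chainSum m f := by
  set k : ℕ → ι → ℕ := fun n i => ⌊u i * 2 ^ n⌋₊ with hk
  have hlt : ∀ n i, k n i < 2 ^ n := by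
    intro n i
    rw [hk, Nat.floor_lt (mul_nonneg (hu i).1 (by positivity))]
    push_cast
    calc u i * 2 ^ n < 1 * 2 ^ n := by gcongr; exact (hu i).2
      _ = _ := one_mul _
  have hpar : ∀ n i, k n i = k (n + 1) i / 2 := by
    intro n i
    simp only [hk]
    rw [← Nat.floor_div_natCast]
    congr 1
    push_cast
    rw [pow_succ]; field_simp
  have hlim : Tendsto (fun n => dyadic n (k n)) atTop (𝓝 u) := by
    rw [tendsto_pi_nhds]
    intro i
    have h1 : Tendsto (fun n : ℕ => u i - (1 / 2 : ℝ) ^ n) atTop (𝓝 (u i)) := by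
      have := (tendsto_pow_atTop_nhds_zero_of_lt_one (r := (1 / 2 : ℝ)) (by norm_num)
        (by norm_num)).const_sub (u i)
      simpa using this
    refine tendsto_of_tendsto_of_tendsto_of_le_of_le h1 tendsto_const_nhds ?_ ?_
    · intro n
      have := Nat.lt_floor_add_one (u i * 2 ^ n)
      simp only [dyadic, hk]
      rw [le_div_iff₀ (by positivity), sub_mul, ← mul_pow]
      norm_num
      linarith
    · intro n
      have := Nat.floor_le (mul_nonneg (hu i).1 (by positivity : (0 : ℝ) ≤ 2 ^ n))
      simp only [dyadic, hk]
      rwa [div_le_iff₀ (by positivity)]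
  -- The half-open cube matters here: a coordinate equal to `1` would start at `1` instead of `0`.
  have h0 : dyadic 0 (k 0) = (0 : ι → ℝ) := by
    ext i
    have := hlt 0 i
    simp only [pow_zero, Nat.lt_one_iff] at this
    simp [dyadic, this]
  have key := edist_le_tsum_of_edist_le_of_tendsto₀ (f := fun n => f (dyadic n (k n)))
    (fun n => (∑ k : ι → Fin (2 ^ (n + 1)),
      ‖f (dyadic (n + 1) fun i => k i) - f (dyadic n fun i => (k i : ℕ) / 2)‖ₑ ^ m) ^ (1 / (m : ℝ)))
    ?_ ((hf.tendsto u).comp hlim)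
  · rw [h0, edist_comm, edist_eq_enorm_sub] at key
    exact key
  · intro n
    have hm' : (m : ℝ) ≠ 0 := by exact_mod_cast hm
    rw [edist_comm, edist_eq_enorm_sub, one_div, ENNReal.le_rpow_inv_iff (by positivity),
      ENNReal.rpow_natCast]
    have := Finset.single_le_sum (f := fun k : ι → Fin (2 ^ (n + 1)) =>
      ‖f (dyadic (n + 1) fun i => k i) - f (dyadic n fun i => (k i : ℕ) / 2)‖ₑ ^ m)
      (fun _ _ => bot_le) (Finset.mem_univ (fun i => ⟨k (n + 1) i, hlt (n + 1) i⟩))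
    refine le_trans (le_of_eq ?_) this
    have hk' : k n = fun i => k (n + 1) i / 2 := funext (hpar n)
    simp only [Nat.succ_eq_add_one]
    rw [hk']

variable {Ω : Type*} [MeasurableSpace Ω] {P : Measure Ω} [IsProbabilityMeasure P]

lemma measurable_chainSum (m : ℕ) :
    Measurable (fun f : (ι → ℝ) → ℝ => chainSum m f) := by
  unfold chainSum
  refine Measurable.tsum fun n => Measurable.pow_const ?_ _
  refine Finset.measurable_sum _ fun k _ => Measurable.pow_const ?_ _
  have h : ∀ u : ι → ℝ, Measurable fun f : (ι → ℝ) → ℝ => f u := fun u => measurable_pi_apply u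
  exact ((h _).sub (h _)).enorm

/-- Jensen's inequality for the concave power `1/m` under a probability measure. -/
lemma lintegral_rpow_inv_le {m : ℕ} (hm : m ≠ 0) {h : Ω → ℝ≥0∞} (hh : Measurable h) :
    ∫⁻ ω, h ω ^ (1 / (m : ℝ)) ∂P ≤ (∫⁻ ω, h ω ∂P) ^ (1 / (m : ℝ)) := by
  have hm1 : (1 : ℝ) ≤ m := by exact_mod_cast Nat.one_le_iff_ne_zero.2 hm
  have := eLpNorm'_le_eLpNorm'_of_exponent_le (f := fun ω => h ω ^ (1 / (m : ℝ))) (p := 1)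
    (q := (m : ℝ)) one_pos hm1 P (hh.pow_const _).aestronglyMeasurable
  simp only [eLpNorm', enorm_eq_self, ENNReal.rpow_one, div_one] at this
  refine this.trans (le_of_eq ?_)
  congr 2
  ext ω
  rw [← ENNReal.rpow_mul, one_div_mul_cancel (by positivity), ENNReal.rpow_one]

/-- The `ℓᵐ` norm plays the role of a maximum over a level. Level `n + 1` has `2^{(n+1)|ι|}` points,
which costs only the factor `2^{(n+1)|ι|/m}` after the `m`-th root; for large `m` this is beaten by
the decay `ρ^{n+1}` of the increments. -/
lemma lintegral_chainSum_le {m : ℕ} (hm : m ≠ 0) {Y : (ι → ℝ) → Ω → ℝ} (hY : ∀ u, Measurable (Y u))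
    {B ρ : ℝ≥0∞}
    (hB : ∀ n : ℕ, ∀ u v : ι → ℝ, (∀ i, u i ∈ Icc (0 : ℝ) 1) → (∀ i, v i ∈ Icc (0 : ℝ) 1) →
      (∀ i, |u i - v i| ≤ (1 / 2) ^ n) → ∫⁻ ω, ‖Y u ω - Y v ω‖ₑ ^ m ∂P ≤ (B * ρ ^ n) ^ m) :
    ∫⁻ ω, chainSum m (fun u => Y u ω) ∂P ≤
      B * ∑' n : ℕ, (2 ^ ((Fintype.card ι : ℝ) / m) * ρ) ^ (n + 1) := by
  have hm' : (m : ℝ) ≠ 0 := by exact_mod_cast hm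
  have hmeas : ∀ u v, Measurable fun ω => ‖Y u ω - Y v ω‖ₑ ^ m := fun u v =>
    ((hY u).sub (hY v)).enorm.pow_const _
  unfold chainSum
  rw [lintegral_tsum fun n => (Measurable.pow_const
    (Finset.measurable_sum _ fun k _ => hmeas _ _) _).aemeasurable, ← ENNReal.tsum_mul_left]
  refine ENNReal.tsum_le_tsum fun n => ?_
  refine (lintegral_rpow_inv_le hm (Finset.measurable_sum _ fun k _ => hmeas _ _)).trans ?_
  rw [lintegral_finsetSum _ fun k _ => hmeas _ _]
  have hterm : ∀ k : ι → Fin (2 ^ (n + 1)), ∫⁻ ω, ‖Y (dyadic (n + 1) fun i => k i) ω -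
      Y (dyadic n fun i => (k i : ℕ) / 2) ω‖ₑ ^ m ∂P ≤ (B * ρ ^ (n + 1)) ^ m := by
    intro k
    refine hB (n + 1) _ _ ?_ ?_ ?_
    · intro i
      refine ⟨by simp only [dyadic]; positivity, ?_⟩
      simp only [dyadic]
      rw [div_le_one (by positivity)]
      exact_mod_cast (k i).2.le
    · intro i
      refine ⟨by simp only [dyadic]; positivity, ?_⟩
      simp only [dyadic]
      rw [div_le_one (by positivity)]
      have : (k i : ℕ) / 2 ≤ 2 ^ n := by
        have h := (k i).2
        have h' : 2 ^ (n + 1) = 2 * 2 ^ n := by ring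
        omega
      exact_mod_cast this
    · intro i
      simp only [dyadic]
      -- A dyadic point exceeds its parent by the last binary digit of its index, so by at most one
      -- step of the finer grid.
      have h1 : ((k i : ℕ) : ℝ) - 2 * (((k i : ℕ) / 2 : ℕ) : ℝ) = (((k i : ℕ) % 2 : ℕ) : ℝ) := by
        have h2 : ((2 * ((k i : ℕ) / 2) + (k i : ℕ) % 2 : ℕ) : ℝ) = ((k i : ℕ) : ℝ) := by
          rw [Nat.div_add_mod]
        push_cast at h2
        linarith
      have h3 : ((k i : ℕ) : ℝ) / 2 ^ (n + 1) - (((k i : ℕ) / 2 : ℕ) : ℝ) / 2 ^ n =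
          (((k i : ℕ) % 2 : ℕ) : ℝ) * (1 / 2) ^ (n + 1) := by
        rw [← h1, one_div, inv_pow, pow_succ (2 : ℝ) n]; field_simp
      rw [h3, abs_of_nonneg (by positivity)]
      have h4 : (((k i : ℕ) % 2 : ℕ) : ℝ) ≤ 1 := by
        exact_mod_cast Nat.le_of_lt_succ (Nat.mod_lt _ (by norm_num))
      exact mul_le_of_le_one_left (by positivity) h4
  calc _ ≤ (∑ _k : ι → Fin (2 ^ (n + 1)), (B * ρ ^ (n + 1)) ^ m) ^ (1 / (m : ℝ)) := by
        gcongr with k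
        exact hterm k
    _ = ((2 : ℝ≥0∞) ^ ((n + 1) * Fintype.card ι) * (B * ρ ^ (n + 1)) ^ m) ^ (1 / (m : ℝ)) := by
        simp [pow_mul]
    _ = ((2 : ℝ≥0∞) ^ ((n + 1) * Fintype.card ι)) ^ (1 / (m : ℝ)) * (B * ρ ^ (n + 1)) := by
        rw [ENNReal.mul_rpow_of_nonneg _ _ (by positivity)]
        congr 1
        rw [← ENNReal.rpow_natCast, ← ENNReal.rpow_mul, mul_one_div_cancel hm', ENNReal.rpow_one]
    _ = _ := by
        rw [mul_pow, ← ENNReal.rpow_natCast, ← ENNReal.rpow_mul, ← ENNReal.rpow_natCast (_ ^ _),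
          ← ENNReal.rpow_mul]
        have : (((n + 1) * Fintype.card ι : ℕ) : ℝ) * (1 / (m : ℝ)) =
            (Fintype.card ι : ℝ) / m * ((n + 1 : ℕ) : ℝ) := by
          push_cast; field_simp
        rw [this]
        ring

lemma lintegral_enorm_pow_of_map_eq_gaussianReal {X : Ω → ℝ} (hX : Measurable X) {v : ℝ≥0}
    (hlaw : P.map X = gaussianReal 0 v) (m : ℕ) :
    ∫⁻ ω, ‖X ω‖ₑ ^ m ∂P =
      ENNReal.ofReal (√v) ^ m * ∫⁻ x, ‖x‖ₑ ^ m ∂(gaussianReal 0 1) := by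
  rw [← lintegral_map (f := fun x : ℝ => ‖x‖ₑ ^ m) (by fun_prop) hX, hlaw]
  have h := gaussianReal_map_const_mul (μ := 0) (v := 1) (√v)
  have hv : NNReal.mk (√(v : ℝ) ^ 2) (sq_nonneg _) * 1 = v := by
    ext; simp
  rw [hv, mul_zero] at h
  rw [← h, lintegral_map (by fun_prop) (by fun_prop), ← lintegral_const_mul _ (by fun_prop)]
  congr 1
  ext x
  rw [enorm_mul, mul_pow, Real.enorm_of_nonneg (Real.sqrt_nonneg _)]

lemma lintegral_enorm_pow_gaussianReal_lt_top (m : ℕ) :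
    ∫⁻ x, ‖x‖ₑ ^ m ∂(gaussianReal 0 1) < ∞ := by
  rcases eq_or_ne m 0 with rfl | hm
  · simp
  have := (memLp_id_gaussianReal (μ := 0) (v := 1) m).eLpNorm_lt_top
  have h2 := (eLpNorm_lt_top_iff_lintegral_rpow_enorm_lt_top (p := (m : ℝ≥0∞))
    (by exact_mod_cast hm) (by simp)).1 (by simpa using this)
  simpa using h2

end Chaining

/-! ### Gaussian copies of a field and gauges -/

/-- Space-time points. -/
abbrev SpaceTime (d : ℕ) := ℝ × EuclideanSpace ℝ (Fin d)

/-- `V₁, …, V_D` are independent continuous centred Gaussian fields with covariance `Γ`. -/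
structure IsGaussianCopies {d D : ℕ} {Ω : Type*} [MeasurableSpace Ω] (P : Measure Ω)
    (Γ : SpaceTime d → SpaceTime d → ℝ) (V : Fin D → SpaceTime d → Ω → ℝ) : Prop where
  measurable : ∀ j p, Measurable (V j p)
  continuous : ∀ j ω, Continuous fun p => V j p ω
  gaussian : ∀ j, IsGaussianProcess (V j) P
  centred : ∀ j p, ∫ ω, V j p ω ∂P = 0
  covariance : ∀ j p p', ∫ ω, V j p ω * V j p' ω ∂P = Γ p p'
  indep : iIndepFun (fun j ω p => V j p ω) P

/-- A gauge `q` with lower scaling exponent `γ` and right inverse `qi`. -/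
structure IsGauge (q qi : ℝ → ℝ) (γ : ℝ) : Prop where
  exponent_pos : 0 < γ
  zero : q 0 = 0
  mono : MonotoneOn q (Ici 0)
  pos : ∀ τ, 0 < τ → 0 < q τ
  scaling : ∃ C, 0 < C ∧ ∀ τ, 0 ≤ τ → ∀ l, 0 < l → l ≤ 1 → q (l * τ) ≤ C * l ^ γ * q τ
  inverse : ∀ ρ, 0 < ρ → 0 < qi ρ ∧ q (qi ρ) = ρ

lemma IsGauge.nonneg {q qi : ℝ → ℝ} {γ : ℝ} (hq : IsGauge q qi γ) {τ : ℝ} (hτ : 0 ≤ τ) :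
    0 ≤ q τ := by
  rw [← hq.zero]
  exact hq.mono (mem_Ici.2 le_rfl) hτ hτ

/-- The gauge distance of two space-time points. -/
def gaugeDist {d : ℕ} (θ : ℝ) (q : ℝ → ℝ) (p p' : SpaceTime d) : ℝ :=
  |p.1 - p'.1| ^ θ + q ‖p.2 - p'.2‖

lemma gaugeDist_nonneg {d : ℕ} {θ γ : ℝ} {q qi : ℝ → ℝ} (hq : IsGauge q qi γ)
    (p p' : SpaceTime d) : 0 ≤ gaugeDist θ q p p' :=
  add_nonneg (by positivity) (hq.nonneg (norm_nonneg _))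

lemma gaugeDist_comm {d : ℕ} (θ : ℝ) (q : ℝ → ℝ) (p p' : SpaceTime d) :
    gaugeDist θ q p p' = gaugeDist θ q p' p := by
  simp only [gaugeDist, abs_sub_comm p.1, norm_sub_rev p.2]

/-- The covariance `Γ` and the mean `m` are controlled by the gauge distance. -/
structure IsControlled {d : ℕ} (θ : ℝ) (q : ℝ → ℝ) (c C : ℝ) (Γ : SpaceTime d → SpaceTime d → ℝ)
    (m : SpaceTime d → ℝ) : Prop where
  const_pos : 0 < c
  le_variance : ∀ p, c ≤ Γ p p
  variance_le : ∀ p, Γ p p ≤ C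
  increment_le : ∀ p p', Γ p p - 2 * Γ p p' + Γ p' p' ≤ (C * gaugeDist θ q p p') ^ 2
  mean_sub_le : ∀ p p', |m p - m p'| ≤ C * gaugeDist θ q p p'
  mean_le : ∀ p, |m p| ≤ C

lemma IsControlled.bound_pos {d : ℕ} {θ : ℝ} {q : ℝ → ℝ} {c C : ℝ}
    {Γ : SpaceTime d → SpaceTime d → ℝ} {m : SpaceTime d → ℝ} (h : IsControlled θ q c C Γ m) :
    0 < C :=
  h.const_pos.trans_le ((h.le_variance 0).trans (h.variance_le 0))

namespace IsGaussianCopies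

variable {d D : ℕ} {Ω : Type*} [MeasurableSpace Ω] {P : Measure Ω}
  {Γ : SpaceTime d → SpaceTime d → ℝ} {V : Fin D → SpaceTime d → Ω → ℝ}

lemma memLp (hV : IsGaussianCopies P Γ V) (j : Fin D) (p : SpaceTime d) : MemLp (V j p) 2 P :=
  ((hV.gaussian j).hasGaussianLaw_eval p).memLp_two

lemma integrable_mul (hV : IsGaussianCopies P Γ V) (j : Fin D) (p p' : SpaceTime d) :
    Integrable (fun ω => V j p ω * V j p' ω) P :=
  (hV.memLp j p).integrable_mul (hV.memLp j p')

lemma symm (hV : IsGaussianCopies P Γ V) (j : Fin D) (p p' : SpaceTime d) : Γ p p' = Γ p' p := by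
  rw [← hV.covariance j, ← hV.covariance j]
  simp_rw [mul_comm]

/-- The law of a linear combination of three values of the field. -/
lemma map_comb [IsProbabilityMeasure P] (hV : IsGaussianCopies P Γ V) (j : Fin D)
    (p₁ p₂ p₃ : SpaceTime d) (b₂ b₃ : ℝ) :
    P.map (fun ω => V j p₁ ω + b₂ * V j p₂ ω + b₃ * V j p₃ ω) =
      gaussianReal 0 (Γ p₁ p₁ + b₂ ^ 2 * Γ p₂ p₂ + b₃ ^ 2 * Γ p₃ p₃ + 2 * b₂ * Γ p₁ p₂ +
        2 * b₃ * Γ p₁ p₃ + 2 * b₂ * b₃ * Γ p₂ p₃).toNNReal := by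
  classical
  have hg : IsGaussianProcess
      (fun (_ : Unit) ω => V j p₁ ω + b₂ * V j p₂ ω + b₃ * V j p₃ ω) P := by
    have hG := hV.gaussian j
    refine hG.of_isGaussianProcess fun _ => ⟨{p₁, p₂, p₃},
      { toFun := fun x => x ⟨p₁, by simp⟩ + b₂ * x ⟨p₂, by simp⟩ + b₃ * x ⟨p₃, by simp⟩
        map_add' := fun x y => by simp; ring
        map_smul' := fun a x => by simp; ring }, fun ω => by simp⟩
  have hl := (hg.hasGaussianLaw_eval ())
  rw [hl.map_eq_gaussianReal]
  have hi : ∀ p, Integrable (V j p) P := fun p => (hV.memLp j p).integrable (by norm_num)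
  have hmean : ∫ ω, V j p₁ ω + b₂ * V j p₂ ω + b₃ * V j p₃ ω ∂P = 0 := by
    have h1 := hi p₁
    have h2 := hi p₂
    have h3 := hi p₃
    rw [integral_add (by fun_prop) (by fun_prop), integral_add (by fun_prop) (by fun_prop),
      integral_const_mul, integral_const_mul]
    simp [hV.centred]
  congr 1
  rw [variance_of_integral_eq_zero hl.aemeasurable hmean]
  congr 1
  have hm := fun p p' => hV.integrable_mul j p p'
  have : (fun ω => (V j p₁ ω + b₂ * V j p₂ ω + b₃ * V j p₃ ω) ^ 2) = fun ω =>
      V j p₁ ω * V j p₁ ω + b₂ ^ 2 * (V j p₂ ω * V j p₂ ω) + b₃ ^ 2 * (V j p₃ ω * V j p₃ ω) +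
      2 * b₂ * (V j p₁ ω * V j p₂ ω) + 2 * b₃ * (V j p₁ ω * V j p₃ ω) +
      2 * b₂ * b₃ * (V j p₂ ω * V j p₃ ω) := by
    ext ω; ring
  rw [this, integral_add (by fun_prop) (by fun_prop), integral_add (by fun_prop) (by fun_prop),
    integral_add (by fun_prop) (by fun_prop), integral_add (by fun_prop) (by fun_prop),
    integral_add (by fun_prop) (by fun_prop)]
  simp only [integral_const_mul, hV.covariance]

lemma map_eval [IsProbabilityMeasure P] (hV : IsGaussianCopies P Γ V) (j : Fin D)
    (p : SpaceTime d) :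
    P.map (V j p) = gaussianReal 0 (Γ p p).toNNReal := by
  simpa using hV.map_comb j p p p 0 0

/-- The value of the field at `p₀` is independent of the field of the residuals of the regression
on it. -/
lemma indepFun_residual [IsProbabilityMeasure P] (hV : IsGaussianCopies P Γ V) (j : Fin D)
    {p₀ : SpaceTime d}
    (h0 : Γ p₀ p₀ ≠ 0) {ι : Type*} (π : ι → SpaceTime d) :
    IndepFun (V j p₀) (fun ω u => V j (π u) ω - Γ (π u) p₀ / Γ p₀ p₀ * V j p₀ ω) P := by
  classical
  have hG : IsGaussianProcess (Sum.elim (fun (_ : Unit) => V j p₀)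
      (fun u ω => V j (π u) ω - Γ (π u) p₀ / Γ p₀ p₀ * V j p₀ ω)) P := by
    have hG := hV.gaussian j
    refine hG.of_isGaussianProcess fun s => ?_
    rcases s with s | u
    · exact ⟨{p₀}, ContinuousLinearMap.proj ⟨p₀, by simp⟩, fun ω => by simp⟩
    · exact ⟨{π u, p₀},
        { toFun := fun x => x ⟨π u, by simp⟩ - Γ (π u) p₀ / Γ p₀ p₀ * x ⟨p₀, by simp⟩
          map_add' := fun x y => by simp; ring
          map_smul' := fun a x => by simp; ring }, fun ω => by simp⟩
  have hi : ∀ p, Integrable (V j p) P := fun p => (hV.memLp j p).integrable (by norm_num)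
  have hind := hG.indepFun_of_covariance_eq_zero
    (fun _ => (hV.measurable j p₀).aemeasurable)
    (fun u => ((hV.measurable j _).sub ((hV.measurable j _).const_mul _)).aemeasurable) ?_
  · exact hind.comp (φ := fun x : Unit → ℝ => x ()) (ψ := id) (measurable_pi_apply ()) measurable_id
  -- Within a jointly Gaussian family independence only requires vanishing covariance, and the
  -- regression coefficient is chosen to achieve this.
  · intro _ u
    have hm : MemLp (fun ω => V j (π u) ω - Γ (π u) p₀ / Γ p₀ p₀ * V j p₀ ω) 2 P :=
      (hV.memLp j _).sub ((hV.memLp j _).const_mul _)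
    rw [covariance_eq_sub (hV.memLp j p₀) hm, hV.centred, zero_mul, sub_zero]
    have : (V j p₀ * fun ω => V j (π u) ω - Γ (π u) p₀ / Γ p₀ p₀ * V j p₀ ω) = fun ω =>
        V j (π u) ω * V j p₀ ω - Γ (π u) p₀ / Γ p₀ p₀ * (V j p₀ ω * V j p₀ ω) := by
      ext ω; simp; ring
    rw [this, integral_sub (hV.integrable_mul j _ _) ((hV.integrable_mul j _ _).const_mul _),
      integral_const_mul, hV.covariance, hV.covariance]
    field_simp
    ring

end IsGaussianCopies

/-! ### The probability of hitting a small ball from a small cell -/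

/-- The point of the cell with corner `p` and sides `a`, `b` with relative coordinates `u`. -/
def cellPoint {d : ℕ} (p : SpaceTime d) (a b : ℝ) (u : Fin (d + 1) → ℝ) : SpaceTime d :=
  (p.1 + a * u 0, WithLp.toLp 2 fun i => p.2 i + b * u i.succ)

lemma continuous_cellPoint {d : ℕ} (p : SpaceTime d) (a b : ℝ) : Continuous (cellPoint p a b) := by
  unfold cellPoint
  fun_prop

lemma cellPoint_zero {d : ℕ} (p : SpaceTime d) (a b : ℝ) : cellPoint p a b 0 = p := by
  ext <;> simp [cellPoint]

lemma norm_le_sum_abs {d : ℕ} (x : EuclideanSpace ℝ (Fin d)) : ‖x‖ ≤ ∑ i, |x i| := by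
  have hs : 0 ≤ ∑ i, |x i| := Finset.sum_nonneg fun _ _ => abs_nonneg _
  rw [EuclideanSpace.norm_eq, Real.sqrt_le_left hs]
  simp only [Real.norm_eq_abs]
  exact Finset.sum_sq_le_sq_sum_of_nonneg fun i _ => abs_nonneg _

/-- The sides are tuned so that each gauge has size `r` across a cell. A further factor `2⁻ⁿ` in the
coordinates gains `2^{-nθ}` in time and, by the lower scaling of `q`, `2^{-nγ}` in space. -/
lemma gaugeDist_cellPoint_le {d : ℕ} {θ γ : ℝ} {q qi : ℝ → ℝ} (hq : IsGauge q qi γ) {C : ℝ}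
    (hC : 0 < C)
    (hC' : ∀ τ, 0 ≤ τ → ∀ l, 0 < l → l ≤ 1 → q (l * τ) ≤ C * l ^ γ * q τ) (hθ : 0 < θ)
    (p : SpaceTime d) {r : ℝ} (hr : 0 < r) (n : ℕ) {u v : Fin (d + 1) → ℝ}
    (huv : ∀ i, |u i - v i| ≤ (1 / 2) ^ n) :
    gaugeDist θ q (cellPoint p (r ^ θ⁻¹) (qi r / d) u) (cellPoint p (r ^ θ⁻¹) (qi r / d) v) ≤
      (1 + C) * r * ((1 / 2) ^ (min θ γ)) ^ n := by
  obtain ⟨hb, hqb⟩ := hq.inverse r hr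
  have hn : (0 : ℝ) < (1 / 2) ^ n := by positivity
  have hn1 : ((1 : ℝ) / 2) ^ n ≤ 1 := pow_le_one₀ (by norm_num) (by norm_num)
  have hcomm : ∀ e : ℝ, min θ γ ≤ e → (((1 : ℝ) / 2) ^ n) ^ e ≤ ((1 / 2) ^ (min θ γ)) ^ n := by
    intro e he
    rw [← Real.rpow_natCast, ← Real.rpow_natCast, ← Real.rpow_mul (by norm_num),
      ← Real.rpow_mul (by norm_num)]
    apply Real.rpow_le_rpow_of_exponent_ge (by norm_num) (by norm_num)
    rw [mul_comm]
    gcongr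
  have h1 : |(cellPoint p (r ^ θ⁻¹) (qi r / d) u).1 - (cellPoint p (r ^ θ⁻¹) (qi r / d) v).1| ^ θ ≤
      r * ((1 / 2) ^ (min θ γ)) ^ n := by
    have : |(cellPoint p (r ^ θ⁻¹) (qi r / d) u).1 - (cellPoint p (r ^ θ⁻¹) (qi r / d) v).1| ≤
        r ^ θ⁻¹ * (1 / 2) ^ n := by
      simp only [cellPoint, add_sub_add_left_eq_sub, ← mul_sub, abs_mul]
      rw [abs_of_nonneg (by positivity)]
      gcongr
      exact huv 0
    calc _ ≤ (r ^ θ⁻¹ * (1 / 2) ^ n) ^ θ := by gcongr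
      _ = r * ((1 / 2) ^ n) ^ θ := by
        rw [Real.mul_rpow (by positivity) (by positivity), ← Real.rpow_mul hr.le,
          inv_mul_cancel₀ hθ.ne', Real.rpow_one]
      _ ≤ _ := by gcongr; exact hcomm θ (min_le_left _ _)
  have h2 : q ‖(cellPoint p (r ^ θ⁻¹) (qi r / d) u).2 - (cellPoint p (r ^ θ⁻¹) (qi r / d) v).2‖ ≤
      C * r * ((1 / 2) ^ (min θ γ)) ^ n := by
    have h3 : ‖(cellPoint p (r ^ θ⁻¹) (qi r / d) u).2 - (cellPoint p (r ^ θ⁻¹) (qi r / d) v).2‖ ≤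
        (1 / 2) ^ n * qi r := by
      refine (norm_le_sum_abs _).trans ?_
      have : ∀ i : Fin d, |((cellPoint p (r ^ θ⁻¹) (qi r / d) u).2 -
          (cellPoint p (r ^ θ⁻¹) (qi r / d) v).2) i| ≤ qi r / d * (1 / 2) ^ n := by
        intro i
        simp only [cellPoint, PiLp.sub_apply, add_sub_add_left_eq_sub, ← mul_sub, abs_mul]
        rw [abs_of_nonneg (by positivity)]
        gcongr
        exact huv i.succ
      refine (Finset.sum_le_sum fun i _ => this i).trans ?_
      simp only [Finset.sum_const, Finset.card_univ, Fintype.card_fin, nsmul_eq_mul]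
      -- The division by `d` compensates the passage from the Euclidean norm to the sum of `d`
      -- coordinates. For `d = 0` the sum is empty.
      rcases Nat.eq_zero_or_pos d with rfl | hd
      · simp; positivity
      · have : (0 : ℝ) < d := by exact_mod_cast hd
        apply le_of_eq; field_simp
    calc _ ≤ q ((1 / 2) ^ n * qi r) := hq.mono (norm_nonneg _) (by simp; positivity) h3
      _ ≤ C * ((1 / 2) ^ n) ^ γ * q (qi r) := hC' _ hb.le _ hn hn1
      _ = C * r * ((1 / 2) ^ n) ^ γ := by rw [hqb]; ring
      _ ≤ _ := by gcongr; exact hcomm γ (min_le_right _ _)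
  calc _ ≤ r * ((1 / 2) ^ (min θ γ)) ^ n + C * r * ((1 / 2) ^ (min θ γ)) ^ n := add_le_add h1 h2
    _ = _ := by ring

/-- Cauchy–Schwarz for `V(p)` and `V(p₁) - V(p₂)`, read off from the nonnegative second moment of
the residual of their regression. -/
lemma IsGaussianCopies.sq_cov_sub_le {d D : ℕ} {Ω : Type*} [MeasurableSpace Ω] {P : Measure Ω}
    [IsProbabilityMeasure P] {Γ : SpaceTime d → SpaceTime d → ℝ} {V : Fin D → SpaceTime d → Ω → ℝ}
    (hV : IsGaussianCopies P Γ V) (j : Fin D) {p : SpaceTime d} (hp : 0 < Γ p p)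
    (p₁ p₂ : SpaceTime d) :
    (Γ p₁ p - Γ p₂ p) ^ 2 ≤ Γ p p * (Γ p₁ p₁ - 2 * Γ p₁ p₂ + Γ p₂ p₂) := by
  set x := Γ p₁ p - Γ p₂ p with hx
  have hpos : 0 ≤ ∫ ω, (V j p₁ ω - V j p₂ ω - x / Γ p p * V j p ω) ^ 2 ∂P :=
    integral_nonneg fun _ => sq_nonneg _
  have hm := fun p p' => hV.integrable_mul j p p'
  have : (fun ω => (V j p₁ ω - V j p₂ ω - x / Γ p p * V j p ω) ^ 2) = fun ω =>
      V j p₁ ω * V j p₁ ω + V j p₂ ω * V j p₂ ω +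
      (x / Γ p p) ^ 2 * (V j p ω * V j p ω) +
      (-2) * (V j p₁ ω * V j p₂ ω) +
      (-2 * (x / Γ p p)) * (V j p₁ ω * V j p ω) +
      (2 * (x / Γ p p)) * (V j p₂ ω * V j p ω) := by
    ext ω; ring
  rw [this, integral_add (by fun_prop) (by fun_prop), integral_add (by fun_prop) (by fun_prop),
    integral_add (by fun_prop) (by fun_prop), integral_add (by fun_prop) (by fun_prop),
    integral_add (by fun_prop) (by fun_prop)] at hpos
  simp only [integral_const_mul, hV.covariance] at hpos
  have h5 : (x / Γ p p) ^ 2 * Γ p p + -2 * (x / Γ p p) * Γ p₁ p +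
      2 * (x / Γ p p) * Γ p₂ p = - (x ^ 2 / Γ p p) := by
    rw [hx]; field_simp; ring
  have h6 : x ^ 2 / Γ p p ≤ Γ p₁ p₁ - 2 * Γ p₁ p₂ + Γ p₂ p₂ := by linarith
  rw [div_le_iff₀ hp] at h6
  linarith

/-- The coefficient of the regression on `V(p)` is Lipschitz in the gauge distance: Cauchy–Schwarz
gives a factor `√Γ(p,p)`, the normalisation divides by `Γ(p,p)`, and the variance is at least `c`.
-/
lemma IsControlled.abs_cov_sub_le {d D : ℕ} {θ γ c C : ℝ} {q qi : ℝ → ℝ} (hq : IsGauge q qi γ)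
    {Ω : Type*} [MeasurableSpace Ω]
    {P : Measure Ω} [IsProbabilityMeasure P] {Γ : SpaceTime d → SpaceTime d → ℝ}
    {m : SpaceTime d → ℝ} (hΓ : IsControlled θ q c C Γ m)
    {V : Fin D → SpaceTime d → Ω → ℝ} (hV : IsGaussianCopies P Γ V) (j : Fin D)
    (p p₁ p₂ : SpaceTime d) :
    |Γ p₁ p / Γ p p - Γ p₂ p / Γ p p| ≤ C * gaugeDist θ q p₁ p₂ / √c := by
  have hp : 0 < Γ p p := hΓ.const_pos.trans_le (hΓ.le_variance p)
  have hs : 0 < √c := Real.sqrt_pos.2 hΓ.const_pos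
  have hg := gaugeDist_nonneg (θ := θ) hq p₁ p₂
  have hC := hΓ.bound_pos
  rw [← sub_div, abs_div, abs_of_pos hp, div_le_div_iff₀ hp hs]
  have h1 : |Γ p₁ p - Γ p₂ p| ≤ √(Γ p p) * (C * gaugeDist θ q p₁ p₂) := by
    refine abs_le_of_sq_le_sq ?_ (by positivity)
    rw [mul_pow, Real.sq_sqrt hp.le]
    exact (hV.sq_cov_sub_le j hp p₁ p₂).trans (by gcongr; exact hΓ.increment_le p₁ p₂)
  calc |Γ p₁ p - Γ p₂ p| * √c ≤ √(Γ p p) * (C * gaugeDist θ q p₁ p₂) * √(Γ p p) := by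
        gcongr
        exact hΓ.le_variance p
    _ = C * gaugeDist θ q p₁ p₂ * (√(Γ p p) * √(Γ p p)) := by ring
    _ = _ := by rw [Real.mul_self_sqrt hp.le]

/-- The chaining bound for the residuals of the regression on the value at `p`. -/
def residualChain {d : ℕ} {ι : Type*} [Fintype ι] [DecidableEq ι] (N : ℕ)
    (Γ : SpaceTime d → SpaceTime d → ℝ) (p : SpaceTime d) (π : (ι → ℝ) → SpaceTime d)
    (f : SpaceTime d → ℝ) : ℝ≥0∞ :=
  chainSum N fun u => f (π u) - Γ (π u) p / Γ p p * f p

lemma measurable_residualChain {d : ℕ} {ι : Type*} [Fintype ι] [DecidableEq ι] (N : ℕ)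
    (Γ : SpaceTime d → SpaceTime d → ℝ) (p : SpaceTime d) (π : (ι → ℝ) → SpaceTime d) :
    Measurable (residualChain N Γ p π) := by
  have heval : ∀ p' : SpaceTime d, Measurable fun f : SpaceTime d → ℝ => f p' :=
    fun p' => measurable_pi_apply p'
  exact (measurable_chainSum N).comp (measurable_pi_lambda (fun (f : SpaceTime d → ℝ) u =>
      f (π u) - Γ (π u) p / Γ p p * f p) fun u => (heval (π u)).sub ((heval p).const_mul _))

/-- Regression is an orthogonal projection, so residual increments have no more variance than the
increments of the field. The moments of order `N` of the Gaussian increments then feed the chaining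
bound. -/
lemma lintegral_residualChain_le {d D : ℕ} {θ γ c C : ℝ} {q qi : ℝ → ℝ} (hq : IsGauge q qi γ)
    {Ω : Type*} [MeasurableSpace Ω] {P : Measure Ω} [IsProbabilityMeasure P]
    {Γ : SpaceTime d → SpaceTime d → ℝ} {m : SpaceTime d → ℝ} (hΓ : IsControlled θ q c C Γ m)
    {V : Fin D → SpaceTime d → Ω → ℝ} (hV : IsGaussianCopies P Γ V) (j : Fin D) {N : ℕ}
    (hN : N ≠ 0) {ι : Type*} [Fintype ι] [DecidableEq ι] (p : SpaceTime d)
    (π : (ι → ℝ) → SpaceTime d) {B κ : ℝ} (hB : 0 ≤ B) (hκ : 0 ≤ κ)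
    (hdist : ∀ n u v, (∀ i, |u i - v i| ≤ (1 / 2) ^ n) →
      C * gaugeDist θ q (π u) (π v) ≤ B * κ ^ n) :
    ∫⁻ ω, residualChain N Γ p π (fun p' => V j p' ω) ∂P ≤ ENNReal.ofReal B *
      (∫⁻ x, ‖x‖ₑ ^ N ∂(gaussianReal 0 1)) ^ (1 / (N : ℝ)) *
      ∑' n : ℕ, (2 ^ ((Fintype.card ι : ℝ) / N) * ENNReal.ofReal κ) ^ (n + 1) := by
  have hN0 : (N : ℝ) ≠ 0 := by exact_mod_cast hN
  have hΓp : 0 < Γ p p := hΓ.const_pos.trans_le (hΓ.le_variance p)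
  have hres : ∀ u, Measurable fun ω => V j (π u) ω - Γ (π u) p / Γ p p * V j p ω := fun u =>
    (hV.measurable j _).sub ((hV.measurable j _).const_mul _)
  refine lintegral_chainSum_le (P := P) hN
    (Y := fun u ω => V j (π u) ω - Γ (π u) p / Γ p p * V j p ω) hres ?_
  intro n u v _ _ huv
  obtain ⟨k₁, hk₁⟩ : ∃ k, k = Γ (π u) p / Γ p p := ⟨_, rfl⟩
  obtain ⟨k₂, hk₂⟩ : ∃ k, k = Γ (π v) p / Γ p p := ⟨_, rfl⟩
  have hcomb := hV.map_comb j (π u) (π v) p (-1) (k₂ - k₁)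
  have he : (fun ω => V j (π u) ω + -1 * V j (π v) ω + (k₂ - k₁) * V j p ω) =
      fun ω => V j (π u) ω - Γ (π u) p / Γ p p * V j p ω -
        (V j (π v) ω - Γ (π v) p / Γ p p * V j p ω) := by
    ext ω; rw [hk₁, hk₂]; ring
  rw [he] at hcomb
  have hmeas : Measurable fun ω => V j (π u) ω - Γ (π u) p / Γ p p * V j p ω -
      (V j (π v) ω - Γ (π v) p / Γ p p * V j p ω) := (hres u).sub (hres v)
  rw [lintegral_enorm_pow_of_map_eq_gaussianReal hmeas hcomb]
  have hle : √((Γ (π u) (π u) + (-1) ^ 2 * Γ (π v) (π v) + (k₂ - k₁) ^ 2 * Γ p p +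
      2 * -1 * Γ (π u) (π v) + 2 * (k₂ - k₁) * Γ (π u) p +
      2 * -1 * (k₂ - k₁) * Γ (π v) p).toNNReal : ℝ) ≤ B * κ ^ n := by
    rw [Real.sqrt_le_left (by positivity), Real.coe_toNNReal']
    refine max_le ?_ (by positivity)
    have h2 := hΓ.increment_le (π u) (π v)
    have h3 : Γ (π u) (π u) - 2 * Γ (π u) (π v) + Γ (π v) (π v) ≤ (B * κ ^ n) ^ 2 :=
      h2.trans (pow_le_pow_left₀ (mul_nonneg hΓ.bound_pos.le (gaugeDist_nonneg hq _ _))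
        (hdist n u v huv) 2)
    -- Pythagoras: the terms involving `p` add up to minus the variance of the removed projection.
    have h4 : (k₂ - k₁) ^ 2 * Γ p p + 2 * (k₂ - k₁) * Γ (π u) p +
        2 * -1 * (k₂ - k₁) * Γ (π v) p = -((k₂ - k₁) ^ 2 * Γ p p) := by
      have e1 : Γ (π u) p = k₁ * Γ p p := by rw [hk₁]; field_simp
      have e2 : Γ (π v) p = k₂ * Γ p p := by rw [hk₂]; field_simp
      rw [e1, e2]; ring
    have h5 : 0 ≤ (k₂ - k₁) ^ 2 * Γ p p := by positivity
    linarith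
  calc _ ≤ ENNReal.ofReal (B * κ ^ n) ^ N * ∫⁻ x, ‖x‖ₑ ^ N ∂(gaussianReal 0 1) := by gcongr
    _ = _ := by
      rw [ENNReal.ofReal_mul hB, ENNReal.ofReal_pow hκ, mul_right_comm, mul_pow _
          (_ ^ (1 / (N : ℝ))),
        ← ENNReal.rpow_natCast (_ ^ (1 / (N : ℝ))), ← ENNReal.rpow_mul, one_div_mul_cancel hN0,
        ENNReal.rpow_one]

/-- If the field is close to `z` somewhere in the cell, its value at the corner is close to `z - m
p`. The discrepancy consists of the residual, the defect of the regression coefficient from `1`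
times `|f p|`, the variation of the mean, and the radius. All but the residual are deterministic
multiples of `1 + |f p|`. -/
lemma abs_sub_le_residualChain {d : ℕ} {ι : Type*} [Fintype ι] [DecidableEq ι] {N : ℕ} (hN : N ≠ 0)
    {Γ : SpaceTime d → SpaceTime d → ℝ} {p : SpaceTime d} (hp : Γ p p ≠ 0)
    {π : (ι → ℝ) → SpaceTime d} (hπ : Continuous π) (hπ0 : π 0 = p)
    (hk : Continuous fun u => Γ (π u) p / Γ p p) {m : SpaceTime d → ℝ} {f : SpaceTime d → ℝ}
    (hf : Continuous f) {u : ι → ℝ} (hu : ∀ i, u i ∈ Ico (0 : ℝ) 1) {z r a₁ a₂ : ℝ}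
    (h1 : |Γ (π u) p / Γ p p - 1| ≤ a₁) (h2 : |m (π u) - m p| ≤ a₂)
    (hlt : |m (π u) + f (π u) - z| < r) :
    ENNReal.ofReal |f p - (z - m p)| ≤
      ENNReal.ofReal ((a₁ + a₂ + r) * (1 + |f p|)) + residualChain N Γ p π f := by
  have hch : ‖f (π u) - Γ (π u) p / Γ p p * f p‖ₑ ≤ residualChain N Γ p π f := by
    have := enorm_sub_le_chainSum hN (f := fun u => f (π u) - Γ (π u) p / Γ p p * f p)
      ((hf.comp hπ).sub (hk.mul continuous_const)) hu
    simpa only [residualChain, hπ0, div_self hp, one_mul, sub_self, sub_zero] using this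
  obtain ⟨k, hk'⟩ : ∃ k, k = Γ (π u) p / Γ p p := ⟨_, rfl⟩
  rw [← hk'] at hch h1
  have ha₁ : 0 ≤ a₁ := (abs_nonneg _).trans h1
  have ha₂ : 0 ≤ a₂ := (abs_nonneg _).trans h2
  have hr : 0 ≤ r := (abs_nonneg _).trans hlt.le
  have h3 : |f p - (z - m p)| ≤ |f (π u) - k * f p| + (a₁ + a₂ + r) * (1 + |f p|) := by
    have e : f p - (z - m p) = -(f (π u) - k * f p) + -((k - 1) * f p) +
        (m (π u) + f (π u) - z) + -(m (π u) - m p) := by ring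
    rw [e]
    refine (abs_add_le _ _).trans ?_
    refine (add_le_add (abs_add_le _ _) le_rfl).trans ?_
    refine (add_le_add (add_le_add (abs_add_le _ _) le_rfl) le_rfl).trans ?_
    rw [abs_neg, abs_neg, abs_neg, abs_mul]
    have h4 : |k - 1| * |f p| ≤ a₁ * |f p| := by gcongr
    have h5 : 0 ≤ (a₂ + r) * |f p| := by positivity
    nlinarith
  calc _ ≤ ENNReal.ofReal (|f (π u) - k * f p| + (a₁ + a₂ + r) * (1 + |f p|)) :=
        ENNReal.ofReal_le_ofReal h3
    _ = ENNReal.ofReal ((a₁ + a₂ + r) * (1 + |f p|)) + ‖f (π u) - k * f p‖ₑ := by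
        rw [add_comm, ENNReal.ofReal_add (by positivity) (abs_nonneg _), Real.enorm_eq_ofReal_abs]
    _ ≤ _ := by gcongr

/-- The ratio of the geometric series is `2^{k/N - η}`, which is below one as soon as `N > k/η`. -/
lemma exists_chaining_exponent (k : ℕ) {η : ℝ} (hη : 0 < η) :
    ∃ N : ℕ, N ≠ 0 ∧
      ∑' n : ℕ, ((2 : ℝ≥0∞) ^ ((k : ℝ) / N) * ENNReal.ofReal ((1 / 2) ^ η)) ^ (n + 1) ≠ ∞ := by
  obtain ⟨N, hN⟩ := exists_nat_gt ((k : ℝ) / η)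
  have hN0 : (0 : ℝ) < N := lt_of_le_of_lt (by positivity) hN
  refine ⟨N, by rintro rfl; simp at hN0, ?_⟩
  have hs1 : (2 : ℝ≥0∞) ^ ((k : ℝ) / N) * ENNReal.ofReal ((1 / 2) ^ η) < 1 := by
    have h2 : (2 : ℝ≥0∞) = ENNReal.ofReal 2 := by simp
    rw [h2, ENNReal.ofReal_rpow_of_pos (by norm_num), ← ENNReal.ofReal_mul (by positivity),
      ← ENNReal.ofReal_one]
    apply (ENNReal.ofReal_lt_ofReal_iff (by norm_num)).2
    rw [one_div, Real.inv_rpow (by norm_num), ← Real.rpow_neg (by norm_num),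
      ← Real.rpow_add (by norm_num)]
    apply Real.rpow_lt_one_of_one_lt_of_neg (by norm_num)
    have : (k : ℝ) / N < η := by
      rw [div_lt_iff₀ hN0]
      rw [div_lt_iff₀ hη] at hN
      linarith
    linarith
  rw [ENNReal.tsum_geometric_add_one]
  refine ENNReal.mul_ne_top (hs1.trans ENNReal.one_lt_top).ne ?_
  rw [ENNReal.inv_ne_top]
  exact (tsub_pos_of_lt hs1).ne'

/-- No continuity of `Γ` is assumed. Along a cell it follows from the Lipschitz bound in the gauge
distance, because that distance decays geometrically over dyadic scales. -/
lemma continuous_regression_cellPoint {d D : ℕ} {θ γ c C : ℝ} {q qi : ℝ → ℝ} (hq : IsGauge q qi γ)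
    (hθ : 0 < θ) {Ω : Type*} [MeasurableSpace Ω] {P : Measure Ω} [IsProbabilityMeasure P]
    {Γ : SpaceTime d → SpaceTime d → ℝ} {m : SpaceTime d → ℝ} (hΓ : IsControlled θ q c C Γ m)
    {V : Fin D → SpaceTime d → Ω → ℝ} (hV : IsGaussianCopies P Γ V) (j : Fin D) (p : SpaceTime d)
    {r : ℝ} (hr : 0 < r) :
    Continuous fun u => Γ (cellPoint p (r ^ θ⁻¹) (qi r / d) u) p / Γ p p := by
  obtain ⟨C₁, hC₁, hscale⟩ := hq.scaling
  rw [continuous_iff_continuousAt]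
  intro u
  rw [Metric.continuousAt_iff]
  intro ε hε
  have hη0 : 0 < min θ γ := lt_min hθ hq.exponent_pos
  have h1 : ((1 : ℝ) / 2) ^ min θ γ < 1 := Real.rpow_lt_one (by norm_num) (by norm_num) hη0
  have h2 : Tendsto (fun n : ℕ => C * ((1 + C₁) * r * (((1 : ℝ) / 2) ^ min θ γ) ^ n) / √c) atTop
      (𝓝 (C * ((1 + C₁) * r * 0) / √c)) :=
    (((tendsto_pow_atTop_nhds_zero_of_lt_one (by positivity) h1).const_mul _).const_mul
        _).div_const _
  rw [mul_zero, mul_zero, zero_div] at h2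
  obtain ⟨n, hn⟩ := (h2.eventually (gt_mem_nhds hε)).exists
  refine ⟨(1 / 2) ^ n, by positivity, fun {v} hv => ?_⟩
  rw [Real.dist_eq]
  refine (hΓ.abs_cov_sub_le hq hV j p _ _).trans_lt (lt_of_le_of_lt ?_ hn)
  have hC := hΓ.bound_pos
  gcongr
  refine gaugeDist_cellPoint_le hq hC₁ hscale hθ p hr n fun i => ?_
  rw [← Real.dist_eq]
  exact (dist_le_pi_dist v u i).trans hv.le

/-- The event of coming near `z` in the cell is enlarged to a measurable condition `E` on a single
path, so that independence of the coordinates can be applied to it. In `E` the corner value lies in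
a window whose random length is independent of it and has mean `O(r)`; the bounded density gives
probability `O(r)`. The constant is fixed before the probability space, the cell and the target. -/
lemma exists_cell_bound {d : ℕ} {θ γ : ℝ} {q qi : ℝ → ℝ} (hq : IsGauge q qi γ) (hθ : 0 < θ)
    {c C : ℝ} {Γ : SpaceTime d → SpaceTime d → ℝ} {m : SpaceTime d → ℝ}
    (hΓ : IsControlled θ q c C Γ m) :
    ∃ C₀ : ℝ, 0 < C₀ ∧ ∀ {Ω : Type u} [MeasurableSpace Ω] (P : Measure Ω) [IsProbabilityMeasure P]
      {D : ℕ} (V : Fin D → SpaceTime d → Ω → ℝ), IsGaussianCopies P Γ V →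
      ∀ (p : SpaceTime d) (r : ℝ), 0 < r → ∀ z : ℝ, ∃ E : Set (SpaceTime d → ℝ), MeasurableSet E ∧
        (0 < D → ∀ f : SpaceTime d → ℝ, Continuous f →
          ∀ u : Fin (d + 1) → ℝ, (∀ i, u i ∈ Ico (0 : ℝ) 1) →
          |m (cellPoint p (r ^ θ⁻¹) (qi r / d) u) + f (cellPoint p (r ^ θ⁻¹) (qi r / d) u) - z| < r
          → f ∈ E) ∧
        ∀ j, P ((fun ω p => V j p ω) ⁻¹' E) ≤ ENNReal.ofReal (C₀ * r) := by
  obtain ⟨C₁, hC₁, hscale⟩ := hq.scaling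
  have hc := hΓ.const_pos
  have hC := hΓ.bound_pos
  have hη0 : 0 < min θ γ := lt_min hθ hq.exponent_pos
  obtain ⟨N, hN, hG⟩ := exists_chaining_exponent (Fintype.card (Fin (d + 1))) hη0
  obtain ⟨G₀, hG₀⟩ : ∃ G₀ : ℝ≥0∞, G₀ = ∑' n : ℕ, ((2 : ℝ≥0∞) ^
    ((Fintype.card (Fin (d + 1)) : ℝ) / N) * ENNReal.ofReal ((1 / 2) ^ min θ γ)) ^ (n + 1) :=
    ⟨_, rfl⟩
  rw [← hG₀] at hG
  obtain ⟨M, hM⟩ : ∃ M : ℝ≥0∞, M = (∫⁻ x, ‖x‖ₑ ^ N ∂(gaussianReal 0 1)) ^ (1 / (N : ℝ)) :=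
    ⟨_, rfl⟩
  have hMtop : M ≠ ∞ := by
    rw [hM]
    exact (ENNReal.rpow_lt_top_of_nonneg (by positivity)
      (lintegral_enorm_pow_gaussianReal_lt_top N).ne).ne
  obtain ⟨L, hL⟩ : ∃ L : ℝ, L = C * (1 + C₁) := ⟨_, rfl⟩
  have hL0 : 0 < L := by rw [hL]; positivity
  obtain ⟨a₀, ha₀⟩ : ∃ a₀ : ℝ, a₀ = L / √c + L + 1 := ⟨_, rfl⟩
  have ha₀0 : 0 < a₀ := by rw [ha₀]; positivity
  obtain ⟨K₁, hK₁⟩ : ∃ K₁ : ℝ, K₁ = 8 + 15 * (1 + 2 * C) * (√c)⁻¹ := ⟨_, rfl⟩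
  have hK₁0 : 0 < K₁ := by rw [hK₁]; positivity
  -- The first summand pays for the deterministic width `a₀ r`. The second is the density bound
  -- times the mean of the chaining sum: `L` bounds the increments, `M` is a Gaussian moment and
  -- `G₀` the geometric series.
  refine ⟨K₁ * a₀ + 4 * (√c)⁻¹ * (L * M.toReal * G₀.toReal), by positivity, ?_⟩
  intro Ω _ P _ D V hV p r hr z
  obtain ⟨π, hπ⟩ : ∃ π, π = cellPoint p (r ^ θ⁻¹) (qi r / d) := ⟨_, rfl⟩
  have hπ0 : π 0 = p := by rw [hπ, cellPoint_zero]
  have hπc : Continuous π := by rw [hπ]; exact continuous_cellPoint _ _ _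
  have hΓp : 0 < Γ p p := hc.trans_le (hΓ.le_variance p)
  have hdist : ∀ n u v, (∀ i, |u i - v i| ≤ (1 / 2) ^ n) →
      C * gaugeDist θ q (π u) (π v) ≤ L * r * ((1 / 2) ^ min θ γ) ^ n := by
    intro n u v huv
    rw [hπ]
    have := gaugeDist_cellPoint_le (u := u) (v := v) hq hC₁ hscale hθ p hr n huv
    calc _ ≤ C * ((1 + C₁) * r * ((1 / 2) ^ min θ γ) ^ n) := by gcongr
      _ = _ := by rw [hL]; ring
  have hSm := measurable_residualChain N Γ p π
  have hfp : Measurable fun f : SpaceTime d → ℝ => f p := measurable_pi_apply p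
  rw [← hπ]
  refine ⟨{f | ENNReal.ofReal |f p - (z - m p)| ≤
    ENNReal.ofReal (a₀ * r * (1 + |f p|)) + residualChain N Γ p π f}, ?_, ?_, ?_⟩
  · exact measurableSet_le ((hfp.sub_const _).abs.ennreal_ofReal)
      (((hfp.abs.const_add 1).const_mul _).ennreal_ofReal.add hSm)
  · intro hD f hf u hu hlt
    -- Level zero of the distance bound compares an arbitrary point of the cell with its corner.
    have hd : C * gaugeDist θ q (π u) p ≤ L * r := by
      have := hdist 0 u 0 (fun i => by
        have := hu i
        simp only [Pi.zero_apply, sub_zero, pow_zero]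
        rw [abs_of_nonneg this.1]; exact this.2.le)
      rwa [hπ0, pow_zero, mul_one] at this
    have hk : Continuous fun u => Γ (π u) p / Γ p p := by
      rw [hπ]; exact continuous_regression_cellPoint hq hθ hΓ hV ⟨0, hD⟩ p hr
    have h1 : |Γ (π u) p / Γ p p - 1| ≤ L * r / √c := by
      have := hΓ.abs_cov_sub_le hq hV ⟨0, hD⟩ p (π u) p
      rw [div_self hΓp.ne'] at this
      exact this.trans (by gcongr)
    have := abs_sub_le_residualChain hN hΓp.ne' hπc hπ0 hk hf hu h1
      ((hΓ.mean_sub_le _ _).trans hd) hlt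
    have e : L * r / √c + L * r + r = a₀ * r := by rw [ha₀]; ring
    rwa [e] at this
  · intro j
    have hXS : IndepFun (V j p) (fun ω => residualChain N Γ p π fun p' => V j p' ω) P :=
      (hV.indepFun_residual j hΓp.ne' π).comp measurable_id (measurable_chainSum N)
    have hSω : Measurable fun ω => residualChain N Γ p π fun p' => V j p' ω :=
      hSm.comp (measurable_pi_lambda _ fun p' => hV.measurable j p')
    have hcoe : ((Γ p p).toNNReal : ℝ) = Γ p p := Real.coe_toNNReal _ hΓp.le
    have hES := lintegral_residualChain_le hq hΓ hV j hN p π (B := L * r)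
      (κ := (1 / 2) ^ min θ γ) (by positivity) (by positivity) hdist
    rw [← hM, ← hG₀] at hES
    refine (measure_abs_sub_le_add_le (hV.measurable j p) hSω hXS (hV.map_eval j p) (C := C) hc
      (by rw [hcoe]; exact hΓ.le_variance p) (by rw [hcoe]; exact hΓ.variance_le p) (z - m p)
      (a := a₀ * r) (by positivity)).trans ?_
    have hLMG : ENNReal.ofReal (L * r) * M * G₀ = ENNReal.ofReal
        (L * r * M.toReal * G₀.toReal) := by
      rw [ENNReal.ofReal_mul (p := L * r * M.toReal) (by positivity),
        ENNReal.ofReal_mul (p := L * r) (by positivity),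
        ENNReal.ofReal_toReal hMtop, ENNReal.ofReal_toReal hG]
    calc _ ≤ ENNReal.ofReal (K₁ * (a₀ * r)) + ENNReal.ofReal (4 * (√c)⁻¹) *
          ENNReal.ofReal (L * r * M.toReal * G₀.toReal) := by
          rw [← hLMG, hK₁]; exact add_le_add le_rfl (mul_le_mul_right hES _)
      _ = _ := by
        rw [← ENNReal.ofReal_mul (by positivity), ← ENNReal.ofReal_add (by positivity)
          (by positivity)]
        congr 1
        ring

/-! ### Upper bounds for hitting probabilities -/

/-- The event that the field with mean `m` and fluctuations `V` hits `A` on `S`. -/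
def copyHitting {d D : ℕ} {Ω : Type*} (S : Set (SpaceTime d)) (m : SpaceTime d → ℝ)
    (V : Fin D → SpaceTime d → Ω → ℝ) (A : Set (EuclideanSpace ℝ (Fin D))) : Set Ω :=
  {ω | ∃ p ∈ S, WithLp.toLp 2 (fun j => m p + V j p ω) ∈ A}

lemma IsGaussianCopies.measure_forall_mem_le {d D : ℕ} {Ω : Type*} [MeasurableSpace Ω]
    {P : Measure Ω} {Γ : SpaceTime d → SpaceTime d → ℝ} {V : Fin D → SpaceTime d → Ω → ℝ}
    (hV : IsGaussianCopies P Γ V) {E : Fin D → Set (SpaceTime d → ℝ)}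
    (hE : ∀ j, MeasurableSet (E j)) :
    P {ω | ∀ j, (fun p => V j p ω) ∈ E j} = ∏ j, P ((fun ω p => V j p ω) ⁻¹' E j) := by
  have := hV.indep.measure_inter_preimage_eq_mul Finset.univ (sets := E) (fun j _ => hE j)
  rw [← this]
  congr 1
  ext ω
  simp

lemma exists_mem_cell {d : ℕ} {t₀ T M a b : ℝ} (ha : 0 < a) (hb : 0 < b) {p : SpaceTime d}
    (hp : p.1 ∈ Icc t₀ T) (hp' : p.2 ∈ cube d M) :
    ∃ (i : Fin (⌊(T - t₀) / a⌋₊ + 1)) (k : Fin d → Fin (⌊2 * M / b⌋₊ + 1))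
      (u : Fin (d + 1) → ℝ), (∀ i, u i ∈ Ico (0 : ℝ) 1) ∧
      cellPoint (t₀ + a * (i : ℕ), WithLp.toLp 2 fun l => -M + b * (k l : ℕ)) a b u = p := by
  have h1 : 0 ≤ (p.1 - t₀) / a := div_nonneg (by linarith [hp.1]) ha.le
  have h2 : ∀ l, 0 ≤ (p.2 l + M) / b := fun l => div_nonneg (by linarith [(hp' l).1]) hb.le
  refine ⟨⟨⌊(p.1 - t₀) / a⌋₊, ?_⟩, fun l => ⟨⌊(p.2 l + M) / b⌋₊, ?_⟩,
    Fin.cons ((p.1 - t₀) / a - ⌊(p.1 - t₀) / a⌋₊)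
      (fun l => (p.2 l + M) / b - ⌊(p.2 l + M) / b⌋₊), ?_, ?_⟩
  · refine Nat.lt_succ_of_le (Nat.floor_le_floor ?_)
    gcongr
    exact hp.2
  · refine Nat.lt_succ_of_le (Nat.floor_le_floor ?_)
    gcongr
    linarith [(hp' l).2]
  · intro i
    refine Fin.cases ?_ (fun l => ?_) i
    · simp only [Fin.cons_zero, mem_Ico]
      constructor
      · linarith [Nat.floor_le h1]
      · linarith [Nat.lt_floor_add_one ((p.1 - t₀) / a)]
    · simp only [Fin.cons_succ, mem_Ico]
      constructor
      · linarith [Nat.floor_le (h2 l)]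
      · linarith [Nat.lt_floor_add_one ((p.2 l + M) / b)]
  · ext l
    · simp only [cellPoint, Fin.cons_zero]
      field_simp
      ring
    · simp only [cellPoint, Fin.cons_succ]
      field_simp
      ring

/-- A count of cells: at most a multiple of `r^{-1/θ}` in time and of `qi(r)⁻¹` in each of the `d`
space directions, each cell contributing `O(r^D)` since a ball is contained in a product of `D`
intervals. -/
lemma exists_ball_bound {d D : ℕ} (hd : 0 < d) (hD : 0 < D) {θ γ : ℝ} {q qi : ℝ → ℝ}
    (hq : IsGauge q qi γ) (hθ : 0 < θ) {c C : ℝ} {Γ : SpaceTime d → SpaceTime d → ℝ}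
    {m : SpaceTime d → ℝ} (hΓ : IsControlled θ q c C Γ m) {t₀ T M : ℝ} (hT : t₀ < T) (hM : 0 < M) :
    ∃ C₀ ε₀ : ℝ, 0 < C₀ ∧ 0 < ε₀ ∧ ∀ {Ω : Type u} [MeasurableSpace Ω] (P : Measure Ω)
      [IsProbabilityMeasure P] (V : Fin D → SpaceTime d → Ω → ℝ), IsGaussianCopies P Γ V →
      ∀ r, 0 < r → r ≤ ε₀ → ∀ x,
        P (copyHitting (Icc t₀ T ×ˢ cube d M) m V (Metric.ball x r)) ≤
          ENNReal.ofReal (C₀ * (r ^ ((D : ℝ) - 1 / θ) * qi r ^ (-(d : ℝ)))) := by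
  obtain ⟨C₁, hC₁, hcell⟩ := exists_cell_bound.{u} hq hθ hΓ
  have hq1 := hq.pos 1 one_pos
  have hd' : (0 : ℝ) < d := by exact_mod_cast hd
  have hd1 : (1 : ℝ) ≤ d := by exact_mod_cast hd
  -- The threshold keeps both sides of a cell at most one, so that the extra cell produced by
  -- rounding is absorbed by a multiple of the inverse side.
  refine ⟨(T - t₀ + 1) * ((2 * M + 1) * d) ^ d * C₁ ^ D, min 1 (q 1 / 2), by
    have : 0 < T - t₀ := by linarith
    positivity, by positivity, ?_⟩
  intro Ω _ P _ V hV r hr hrε x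
  have hr1 : r ≤ 1 := hrε.trans (min_le_left _ _)
  have hrq : r < q 1 := lt_of_le_of_lt (hrε.trans (min_le_right _ _)) (by linarith)
  obtain ⟨hqi, hqqi⟩ := hq.inverse r hr
  have hqi1 : qi r ≤ 1 := by
    by_contra! h
    have := hq.mono (mem_Ici.2 zero_le_one) (mem_Ici.2 hqi.le) h.le
    linarith
  obtain ⟨a, ha⟩ : ∃ a, a = r ^ θ⁻¹ := ⟨_, rfl⟩
  obtain ⟨b, hb⟩ : ∃ b, b = qi r / d := ⟨_, rfl⟩
  have ha0 : 0 < a := by rw [ha]; positivity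
  have hb0 : 0 < b := by rw [hb]; positivity
  have ha1 : a ≤ 1 := by rw [ha]; exact Real.rpow_le_one hr.le hr1 (by positivity)
  have hb1 : b ≤ 1 := by rw [hb, div_le_one hd']; linarith
  choose E hEm hEsub hEle using fun p z => hcell P V hV p r hr z
  rw [← ha, ← hb] at hEsub
  obtain ⟨n₀, hn₀⟩ : ∃ n₀, n₀ = ⌊(T - t₀) / a⌋₊ + 1 := ⟨_, rfl⟩
  obtain ⟨n₁, hn₁⟩ : ∃ n₁, n₁ = ⌊2 * M / b⌋₊ + 1 := ⟨_, rfl⟩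
  have hn₀' : (n₀ : ℝ) ≤ (T - t₀ + 1) * r ^ (-(1 / θ)) := by
    have h1 : (n₀ : ℝ) ≤ (T - t₀) / a + 1 := by
      rw [hn₀]; push_cast
      gcongr
      exact Nat.floor_le (div_nonneg (by linarith) ha0.le)
    have h2 : r ^ (-(1 / θ)) = a⁻¹ := by rw [Real.rpow_neg hr.le, ha, one_div]
    rw [h2]
    refine h1.trans ?_
    rw [add_mul, div_eq_mul_inv]
    gcongr
    rw [one_mul]
    exact one_le_inv_iff₀.2 ⟨ha0, ha1⟩
  have hn₁' : (n₁ : ℝ) ≤ (2 * M + 1) * d * (qi r)⁻¹ := by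
    have h1 : (n₁ : ℝ) ≤ 2 * M / b + 1 := by
      rw [hn₁]; push_cast
      gcongr
      exact Nat.floor_le (by positivity)
    have h2 : d * (qi r)⁻¹ = b⁻¹ := by rw [hb, inv_div, div_eq_mul_inv]
    rw [mul_assoc, h2]
    refine h1.trans ?_
    rw [add_mul, div_eq_mul_inv]
    gcongr
    rw [one_mul]
    exact one_le_inv_iff₀.2 ⟨hb0, hb1⟩
  let corner : Fin n₀ × (Fin d → Fin n₁) → SpaceTime d := fun ik =>
    (t₀ + a * (ik.1 : ℕ), WithLp.toLp 2 fun l => -M + b * (ik.2 l : ℕ))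
  have hsub : copyHitting (Icc t₀ T ×ˢ cube d M) m V (Metric.ball x r) ⊆
      ⋃ ik, {ω | ∀ j, (fun p => V j p ω) ∈ E (corner ik) (x j)} := by
    rintro ω ⟨p, ⟨hp1, hp2⟩, hω⟩
    obtain ⟨i, k, u, hu, hup⟩ := exists_mem_cell ha0 hb0 hp1 hp2
    rw [mem_iUnion]
    subst hn₀ hn₁
    refine ⟨(i, k), fun j => ?_⟩
    refine hEsub (corner (i, k)) (x j) hD (fun p => V j p ω) (hV.continuous j ω) u hu ?_
    have : cellPoint (corner (i, k)) a b u = p := hup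
    rw [this]
    rw [mem_ball_iff_norm] at hω
    refine lt_of_le_of_lt ?_ hω
    have := PiLp.norm_apply_le (WithLp.toLp 2 (fun j => m p + V j p ω) - x) j
    simpa using this
  calc P (copyHitting (Icc t₀ T ×ˢ cube d M) m V (Metric.ball x r))
      ≤ ∑ ik, P {ω | ∀ j, (fun p => V j p ω) ∈ E (corner ik) (x j)} :=
        (measure_mono hsub).trans (measure_iUnion_fintype_le _ _)
    _ ≤ ∑ _ik : Fin n₀ × (Fin d → Fin n₁), ENNReal.ofReal (C₁ * r) ^ D := by
        refine Finset.sum_le_sum fun ik _ => ?_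
        rw [hV.measure_forall_mem_le fun j => hEm _ _]
        calc _ ≤ ∏ _j : Fin D, ENNReal.ofReal (C₁ * r) :=
              Finset.prod_le_prod' fun j _ => hEle _ _ j
          _ = _ := by simp
    _ = ENNReal.ofReal (n₀ * n₁ ^ d * (C₁ * r) ^ D) := by
        rw [ENNReal.ofReal_mul (p := n₀ * n₁ ^ d) (by positivity),
          ENNReal.ofReal_pow (p := C₁ * r) (by positivity),
          ENNReal.ofReal_mul (p := n₀) (by positivity), ENNReal.ofReal_pow (p := n₁)
              (by positivity)]
        simp
    _ ≤ _ := by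
        apply ENNReal.ofReal_le_ofReal
        have h3 : 0 < T - t₀ + 1 := by linarith
        calc (n₀ : ℝ) * n₁ ^ d * (C₁ * r) ^ D ≤ ((T - t₀ + 1) * r ^ (-(1 / θ))) *
              ((2 * M + 1) * d * (qi r)⁻¹) ^ d * (C₁ * r) ^ D := by gcongr
          _ = _ := by
            rw [sub_eq_add_neg (D : ℝ), Real.rpow_add hr, Real.rpow_natCast, Real.rpow_neg hqi.le,
              Real.rpow_natCast, mul_pow _ (qi r)⁻¹, mul_pow C₁, inv_pow]
            ring

/-- Countable subadditivity over a cover of `A` at the single scale `ε₀ / 2`; the Hausdorff measure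
is the supremum over all scales. -/
theorem exists_upper_bound {d D : ℕ} (hd : 0 < d) (hD : 0 < D) {θ γ : ℝ} {q qi : ℝ → ℝ}
    (hq : IsGauge q qi γ) (hθ : 0 < θ) {c C : ℝ} {Γ : SpaceTime d → SpaceTime d → ℝ}
    {m : SpaceTime d → ℝ} (hΓ : IsControlled θ q c C Γ m) {t₀ T M : ℝ} (hT : t₀ < T) (hM : 0 < M)
    {g : ℝ → ℝ} (hg : ∀ ρ, 0 < ρ → g ρ = ρ ^ ((D : ℝ) - 1 / θ) * qi ρ ^ (-(d : ℝ))) :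
    ∃ C₀ : ℝ, 0 < C₀ ∧ ∀ {Ω : Type u} [MeasurableSpace Ω] (P : Measure Ω)
      [IsProbabilityMeasure P] (V : Fin D → SpaceTime d → Ω → ℝ), IsGaussianCopies P Γ V →
      ∀ A, P (copyHitting (Icc t₀ T ×ˢ cube d M) m V A) ≤
        ENNReal.ofReal C₀ * hausdorffGauge g A := by
  obtain ⟨C₀, ε₀, hC₀, hε₀, hball⟩ := exists_ball_bound.{u} hd hD hq hθ hΓ hT hM
  refine ⟨C₀, hC₀, fun {Ω} _ P _ V hV A => ?_⟩
  have hC : ENNReal.ofReal C₀ ≠ 0 := by simpa using hC₀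
  rw [← ENNReal.div_le_iff' hC ENNReal.ofReal_ne_top]
  refine le_trans ?_ (le_iSup₂ (ε₀ / 2) (by positivity))
  refine le_iInf fun x => le_iInf fun r => le_iInf fun hr => le_iInf fun hA => ?_
  rw [ENNReal.div_le_iff' hC ENNReal.ofReal_ne_top, ← ENNReal.tsum_mul_left]
  have hsub : copyHitting (Icc t₀ T ×ˢ cube d M) m V A ⊆
      ⋃ i, copyHitting (Icc t₀ T ×ˢ cube d M) m V (Metric.ball (x i) (r i)) := by
    rintro ω ⟨p, hp, hω⟩
    obtain ⟨i, hi⟩ := mem_iUnion.1 (hA hω)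
    exact mem_iUnion.2 ⟨i, p, hp, hi⟩
  refine (measure_mono hsub).trans ((measure_iUnion_le _).trans (ENNReal.tsum_le_tsum fun i => ?_))
  -- Balls of radius zero are allowed in covers; they are empty, so no value of `g` at `0` is
  -- needed.
  rcases (hr i).1.eq_or_lt with h0 | h0
  · have : copyHitting (Icc t₀ T ×ˢ cube d M) m V (Metric.ball (x i) (r i)) = ∅ := by
      rw [← h0, Metric.ball_zero]
      simp [copyHitting]
    rw [this, measure_empty]
    exact bot_le
  -- Doubling the radius makes the bound equal to `C₀ g(2 rᵢ)`, the summand of the Hausdorff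
  -- measure, without any doubling property of `g`.
  · have h2 : 0 < 2 * r i := by positivity
    refine le_trans (measure_mono ?_) ((hball P V hV (2 * r i) h2
      (by linarith [(hr i).2]) (x i)).trans (le_of_eq ?_))
    · rintro ω ⟨p, hp, hω⟩
      exact ⟨p, hp, Metric.ball_subset_ball (by linarith) hω⟩
    · rw [hg _ h2, ENNReal.ofReal_mul hC₀.le]

/-! ### Two-point estimates -/

/-- The regression of a later value of the field on an earlier one leaves a variance of the order of
the square of the gauge distance. -/
def IsNondegenerate {d : ℕ} (θ : ℝ) (q : ℝ → ℝ) (c : ℝ) (S : Set (SpaceTime d))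
    (Γ : SpaceTime d → SpaceTime d → ℝ) : Prop :=
  ∀ p ∈ S, ∀ p' ∈ S, p.1 ≤ p'.1 → ∀ b : ℝ,
    (c * gaugeDist θ q p p') ^ 2 ≤ Γ p' p' - 2 * b * Γ p' p + b ^ 2 * Γ p p

lemma measure_mem_and_le_of_indepFun {Ω : Type*} [MeasurableSpace Ω] {P : Measure Ω}
    [IsProbabilityMeasure P] {X Y : Ω → ℝ} (hX : Measurable X) (hY : Measurable Y)
    (hXY : IndepFun X Y P) {s : Set ℝ} (hs : MeasurableSet s) {t : Set (ℝ × ℝ)}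
    (ht : MeasurableSet t) {B : ℝ≥0∞} (hB : ∀ x ∈ s, P.map Y {y | (x, y) ∈ t} ≤ B) :
    P {ω | X ω ∈ s ∧ (X ω, Y ω) ∈ t} ≤ P.map X s * B := by
  have hm : MeasurableSet ((s ×ˢ univ) ∩ t) := (hs.prod MeasurableSet.univ).inter ht
  have e : {ω | X ω ∈ s ∧ (X ω, Y ω) ∈ t} = (fun ω => (X ω, Y ω)) ⁻¹' ((s ×ˢ univ) ∩ t) := by
    ext ω; simp
  rw [e, ← Measure.map_apply (hX.prodMk hY) hm,
    (indepFun_iff_map_prod_eq_prod_map_map hX.aemeasurable hY.aemeasurable).1 hXY,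
    Measure.prod_apply hm]
  calc _ ≤ ∫⁻ x, s.indicator (fun _ => B) x ∂(P.map X) := by
        refine lintegral_mono fun x => ?_
        by_cases hx : x ∈ s
        · rw [indicator_of_mem hx]
          refine le_trans (measure_mono ?_) (hB x hx)
          intro y hy
          exact hy.2
        · rw [indicator_of_notMem hx]
          have : Prod.mk x ⁻¹' (s ×ˢ univ ∩ t) = ∅ := by
            ext y; simp [hx]
          rw [this, measure_empty]
    _ = _ := by rw [lintegral_indicator_const hs, mul_comm]

namespace IsGaussianCopies

variable {d D : ℕ} {Ω : Type*} [MeasurableSpace Ω] {P : Measure Ω}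
  {Γ : SpaceTime d → SpaceTime d → ℝ} {V : Fin D → SpaceTime d → Ω → ℝ}

/-- Condition on the value at `p`. What remains of the value at `p'` is an independent Gaussian with
the residual variance, whose window is shifted by the regression; `B` bounds its mass uniformly over
the shift. -/
lemma two_point_le_of_forall [IsProbabilityMeasure P] (hV : IsGaussianCopies P Γ V) (j : Fin D)
    {p p' : SpaceTime d} {c : ℝ} (hc : 0 < c) (hp : c ≤ Γ p p) (a b ε : ℝ) {B : ℝ≥0∞}
    (hB : ∀ x, |x - a| ≤ ε → gaussianReal 0 (Γ p' p' - (Γ p' p / Γ p p) ^ 2 * Γ p p).toNNReal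
      {y | |y - (b - Γ p' p / Γ p p * x)| ≤ ε} ≤ B) :
    P {ω | |V j p ω - a| ≤ ε ∧ |V j p' ω - b| ≤ ε} ≤
      ENNReal.ofReal (√c)⁻¹ * ENNReal.ofReal (2 * ε) * B := by
  have hp0 : 0 < Γ p p := hc.trans_le hp
  obtain ⟨k, hk⟩ : ∃ k, k = Γ p' p / Γ p p := ⟨_, rfl⟩
  have hY : Measurable fun ω => V j p' ω - k * V j p ω :=
    (hV.measurable j _).sub ((hV.measurable j _).const_mul _)
  have hind : IndepFun (V j p) (fun ω => V j p' ω - k * V j p ω) P := by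
    have := (hV.indepFun_residual j hp0.ne' (fun _ : Unit => p')).comp
      (φ := id) (ψ := fun f : Unit → ℝ => f ()) measurable_id
      (show Measurable fun f : Unit → ℝ => f () from measurable_pi_apply ())
    rw [hk]
    exact this
  have hlaw : P.map (fun ω => V j p' ω - k * V j p ω) =
      gaussianReal 0 (Γ p' p' - k ^ 2 * Γ p p).toNNReal := by
    have h := hV.map_comb j p' p p (-k) 0
    have e1 : (fun ω => V j p' ω + -k * V j p ω + 0 * V j p ω) =
        fun ω => V j p' ω - k * V j p ω := by ext ω; ring
    have e2 : Γ p' p' + (-k) ^ 2 * Γ p p + 0 ^ 2 * Γ p p + 2 * -k * Γ p' p + 2 * 0 * Γ p' p +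
        2 * -k * 0 * Γ p p = Γ p' p' - k ^ 2 * Γ p p := by
      have : Γ p' p = k * Γ p p := by rw [hk]; field_simp
      rw [this]; ring
    rw [e1, e2] at h
    exact h
  rw [← hk] at hB
  have hs : MeasurableSet {x : ℝ | |x - a| ≤ ε} := measurableSet_le (by fun_prop) (by fun_prop)
  have ht : MeasurableSet {xy : ℝ × ℝ | |xy.2 - (b - k * xy.1)| ≤ ε} :=
    measurableSet_le (by fun_prop) (by fun_prop)
  have h1 := measure_mem_and_le_of_indepFun (hV.measurable j p) hY hind hs ht (B := B)
    (fun x hx => by rw [hlaw]; exact hB x hx)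
  have e3 : {ω | |V j p ω - a| ≤ ε ∧ |V j p' ω - b| ≤ ε} =
      {ω | V j p ω ∈ {x : ℝ | |x - a| ≤ ε} ∧
        (V j p ω, V j p' ω - k * V j p ω) ∈ {xy : ℝ × ℝ | |xy.2 - (b - k * xy.1)| ≤ ε}} := by
    ext ω
    simp only [mem_ofPred_eq]
    have : V j p' ω - k * V j p ω - (b - k * V j p ω) = V j p' ω - b := by ring
    rw [this]
  rw [e3]
  refine h1.trans ?_
  gcongr
  rw [hV.map_eval]
  exact gaussianReal_abs_sub_le hc (by rw [Real.coe_toNNReal _ hp0.le]; exact hp) a ε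

end IsGaussianCopies

section TwoPoint

variable {d D : ℕ} {θ γ : ℝ} {q qi : ℝ → ℝ} {c C : ℝ} {Γ : SpaceTime d → SpaceTime d → ℝ}
  {m : SpaceTime d → ℝ} {S : Set (SpaceTime d)}

/-- The residual variance is the minimum over `b` of the variance of `V(p') - b V(p)`. Nondegeneracy
bounds it below, and `b = 1` shows that it is at most the variance of the increment. -/
lemma residual_variance_bounds (hΓ : IsControlled θ q c C Γ m)
    (hS : IsNondegenerate θ q c S Γ) {p p' : SpaceTime d} (hp : p ∈ S) (hp' : p' ∈ S)
    (hle : p.1 ≤ p'.1) (hsymm : Γ p p' = Γ p' p) :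
    (c * gaugeDist θ q p p') ^ 2 ≤ Γ p' p' - (Γ p' p / Γ p p) ^ 2 * Γ p p ∧
      Γ p' p' - (Γ p' p / Γ p p) ^ 2 * Γ p p ≤ (C * gaugeDist θ q p p') ^ 2 := by
  have hp0 : 0 < Γ p p := hΓ.const_pos.trans_le (hΓ.le_variance p)
  constructor
  · refine (hS p hp p' hp' hle (Γ p' p / Γ p p)).trans (le_of_eq ?_)
    field_simp; ring
  · refine le_trans ?_ (hΓ.increment_le p p')
    rw [hsymm]
    have : Γ p p - 2 * Γ p' p + Γ p' p' - (Γ p' p' - (Γ p' p / Γ p p) ^ 2 * Γ p p) =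
        (1 - Γ p' p / Γ p p) ^ 2 * Γ p p := by
      field_simp; ring
    have : 0 ≤ (1 - Γ p' p / Γ p p) ^ 2 * Γ p p := by positivity
    linarith

/-- The one-dimensional two-point estimates. -/
lemma two_point_le (hΓ : IsControlled θ q c C Γ m)
    (hS : IsNondegenerate θ q c S Γ) {Ω : Type*} [MeasurableSpace Ω] {P : Measure Ω}
    [IsProbabilityMeasure P] {V : Fin D → SpaceTime d → Ω → ℝ} (hV : IsGaussianCopies P Γ V)
    (j : Fin D) {p p' : SpaceTime d} (hp : p ∈ S) (hp' : p' ∈ S) (hle : p.1 ≤ p'.1)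
    (hpos : 0 < gaugeDist θ q p p') {a b ε : ℝ} (hε : 0 < ε) :
    P {ω | |V j p ω - a| ≤ ε ∧ |V j p' ω - b| ≤ ε} ≤
      ENNReal.ofReal ((4 * c⁻¹ + 2) * (√c)⁻¹ * ε ^ 2 / max (gaugeDist θ q p p') ε) := by
  have hc := hΓ.const_pos
  obtain ⟨g, hg⟩ : ∃ g, g = gaugeDist θ q p p' := ⟨_, rfl⟩
  rw [← hg] at hpos ⊢
  have hvar := (residual_variance_bounds hΓ hS hp hp' hle (hV.symm j p p')).1
  rw [← hg] at hvar
  have h0 : 0 < Γ p' p' - (Γ p' p / Γ p p) ^ 2 * Γ p p := lt_of_lt_of_le (by positivity) hvar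
  have hsq : √((c * g) ^ 2) = c * g := Real.sqrt_sq (by positivity)
  have key : ∀ x, |x - a| ≤ ε → gaussianReal 0 (Γ p' p' - (Γ p' p / Γ p p) ^ 2 * Γ p p).toNNReal
      {y | |y - (b - Γ p' p / Γ p p * x)| ≤ ε} ≤
        ENNReal.ofReal ((2 * c⁻¹ + 1) * ε / max g ε) := by
    intro x _
    -- At gauge distance below `ε` the second point carries no information and the trivial bound one
    -- has the right order.
    rcases le_total g ε with h | h
    · refine prob_le_one.trans ?_
      rw [max_eq_right h, mul_div_cancel_right₀ _ hε.ne', ← ENNReal.ofReal_one]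
      apply ENNReal.ofReal_le_ofReal
      have : 0 < c⁻¹ := by positivity
      linarith
    · refine (gaussianReal_abs_sub_le (c := (c * g) ^ 2) (by positivity)
        (by rw [Real.coe_toNNReal _ h0.le]; exact hvar) _ ε).trans ?_
      rw [hsq, ← ENNReal.ofReal_mul (by positivity), max_eq_left h]
      apply ENNReal.ofReal_le_ofReal
      rw [mul_inv, add_mul, add_div]
      have h1 : c⁻¹ * g⁻¹ * (2 * ε) = 2 * c⁻¹ * ε / g := by field_simp
      rw [h1]
      have : 0 ≤ 1 * ε / g := by positivity
      linarith
  refine (hV.two_point_le_of_forall j hc (hΓ.le_variance p) a b ε key).trans (le_of_eq ?_)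
  rw [← ENNReal.ofReal_mul (by positivity), ← ENNReal.ofReal_mul (by positivity)]
  congr 1
  ring

/-- If the targets are much further apart than `ε` and the gauge distance `g`, the residual has to
be of size at least `|b - a| / 2` although its standard deviation is `O(g)`; the tail gives the
extra power of `g / |b - a|`. In `hab` the term with `6 ε` pays for the windows and the other one
for the drift `|k - 1| |x|` of the regression. -/
lemma two_point_le_tail (hq : IsGauge q qi γ) (hΓ : IsControlled θ q c C Γ m)
    (hS : IsNondegenerate θ q c S Γ) {Ω : Type*} [MeasurableSpace Ω] {P : Measure Ω}
    [IsProbabilityMeasure P] {V : Fin D → SpaceTime d → Ω → ℝ} (hV : IsGaussianCopies P Γ V)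
    (j : Fin D) {p p' : SpaceTime d} (hp : p ∈ S) (hp' : p' ∈ S) (hle : p.1 ≤ p'.1)
    (hpos : 0 < gaugeDist θ q p p') {a b ε N : ℝ} (hε : 0 < ε) (hε1 : ε ≤ 1) (ha : |a| ≤ N)
    (hab : 6 * ε + 2 * (C / √c) * (N + 1) * gaugeDist θ q p p' ≤ |b - a|) (n : ℕ) :
    P {ω | |V j p ω - a| ≤ ε ∧ |V j p' ω - b| ≤ ε} ≤
      ENNReal.ofReal (4 * (√c)⁻¹ * c⁻¹ * n.factorial * (32 * C ^ 2) ^ n * ε ^ 2 /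
        gaugeDist θ q p p' * (gaugeDist θ q p p' / |b - a|) ^ (2 * n)) := by
  have hc := hΓ.const_pos
  have hC := hΓ.bound_pos
  have hreg := hΓ.abs_cov_sub_le hq hV j p p' p
  rw [gaugeDist_comm] at hreg
  have hp0 : 0 < Γ p p := hc.trans_le (hΓ.le_variance p)
  rw [div_self hp0.ne'] at hreg
  obtain ⟨g, hg⟩ : ∃ g, g = gaugeDist θ q p p' := ⟨_, rfl⟩
  have hvar := residual_variance_bounds hΓ hS hp hp' hle (hV.symm j p p')
  rw [← hg] at hpos hab hreg hvar ⊢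
  have h0 : 0 < Γ p' p' - (Γ p' p / Γ p p) ^ 2 * Γ p p := lt_of_lt_of_le (by positivity) hvar.1
  obtain ⟨k, hk⟩ : ∃ k, k = Γ p' p / Γ p p := ⟨_, rfl⟩
  have hsq : √((c * g) ^ 2) = c * g := Real.sqrt_sq (by positivity)
  have hN : 0 ≤ N := (abs_nonneg a).trans ha
  have hba : 0 < |b - a| := lt_of_lt_of_le (by positivity) hab
  have key : ∀ x, |x - a| ≤ ε → gaussianReal 0 (Γ p' p' - (Γ p' p / Γ p p) ^ 2 * Γ p p).toNNReal
      {y | |y - (b - Γ p' p / Γ p p * x)| ≤ ε} ≤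
        ENNReal.ofReal (2 * c⁻¹ * n.factorial * (32 * C ^ 2) ^ n * ε / g *
          (g / |b - a|) ^ (2 * n)) := by
    intro x hx
    have hw : |b - a| / 2 ≤ |b - k * x| := by
      have e : b - k * x = (b - a) - ((x - a) + (k - 1) * x) := by ring
      have h1 : |(x - a) + (k - 1) * x| ≤ ε + C * g / √c * (N + 1) := by
        refine (abs_add_le _ _).trans (add_le_add hx ?_)
        rw [abs_mul]
        have hx' : |x| ≤ N + 1 := by
          have := abs_sub_abs_le_abs_sub x a
          linarith
        have : |k - 1| ≤ C * g / √c := by rw [hk]; exact hreg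
        gcongr
      have h2 := abs_sub_abs_le_abs_sub (b - a) ((x - a) + (k - 1) * x)
      rw [← e] at h2
      have h3 : 2 * (C / √c) * (N + 1) * g = 2 * (C * g / √c * (N + 1)) := by ring
      linarith
    have hw2 : 2 * ε ≤ |b - k * x| := by
      have : 0 ≤ 2 * (C / √c) * (N + 1) * g := by positivity
      linarith
    rw [← hk] at hvar h0 ⊢
    refine (gaussianReal_abs_sub_le_tail (c := (c * g) ^ 2) (by positivity)
        (by rw [Real.coe_toNNReal _ h0.le]; exact hvar.1) n hε hw2).trans ?_
    rw [hsq, ← ENNReal.ofReal_mul (by positivity)]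
    apply ENNReal.ofReal_le_ofReal
    rw [Real.coe_toNNReal _ h0.le]
    have h4 : 8 * (Γ p' p' - k ^ 2 * Γ p p) / (b - k * x) ^ 2 ≤
        32 * C ^ 2 * (g / |b - a|) ^ 2 := by
      have h5 : (|b - a| / 2) ^ 2 ≤ (b - k * x) ^ 2 := by
        rw [← sq_abs (b - k * x)]
        exact pow_le_pow_left₀ (by positivity) hw 2
      calc _ ≤ 8 * (C * g) ^ 2 / (|b - a| / 2) ^ 2 := by
            gcongr
            exact hvar.2
        _ = _ := by field_simp; ring
    have h6 : 0 ≤ 8 * (Γ p' p' - k ^ 2 * Γ p p) / (b - k * x) ^ 2 := by positivity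
    calc (c * g)⁻¹ * (n.factorial * (8 * (Γ p' p' - k ^ 2 * Γ p p) / (b - k * x) ^ 2) ^ n) *
          (2 * ε) ≤ (c * g)⁻¹ * (n.factorial * (32 * C ^ 2 * (g / |b - a|) ^ 2) ^ n) * (2 * ε) := by
          gcongr
      _ = _ := by
        rw [mul_pow _ ((g / |b - a|) ^ 2), ← pow_mul, mul_inv]
        ring
  refine (hV.two_point_le_of_forall j hc (hΓ.le_variance p) a b ε key).trans (le_of_eq ?_)
  rw [← ENNReal.ofReal_mul (by positivity), ← ENNReal.ofReal_mul (by positivity)]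
  congr 1
  ring

/-- The joint small ball event of the field at `p` and `p'`. -/
def nearEvent {Ω : Type*} (m : SpaceTime d → ℝ) (V : Fin D → SpaceTime d → Ω → ℝ) (ε : ℝ)
    (p : SpaceTime d) (z : EuclideanSpace ℝ (Fin D)) : Set Ω :=
  {ω | ∀ j, |m p + V j p ω - z j| ≤ ε}

lemma measure_nearEvent_inter {Ω : Type*} [MeasurableSpace Ω] {P : Measure Ω}
    {V : Fin D → SpaceTime d → Ω → ℝ} (hV : IsGaussianCopies P Γ V)
    (ε : ℝ) (p p' : SpaceTime d) (z z' : EuclideanSpace ℝ (Fin D)) :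
    P (nearEvent m V ε p z ∩ nearEvent m V ε p' z') =
      ∏ j, P {ω | |V j p ω - (z j - m p)| ≤ ε ∧ |V j p' ω - (z' j - m p')| ≤ ε} := by
  have heval : ∀ p' : SpaceTime d, Measurable fun f : SpaceTime d → ℝ => f p' :=
    fun p' => measurable_pi_apply p'
  have := hV.measure_forall_mem_le (E := fun j =>
    {f | |f p - (z j - m p)| ≤ ε ∧ |f p' - (z' j - m p')| ≤ ε}) (fun j =>
      (measurableSet_le ((heval p).sub_const _).abs measurable_const).inter
        (measurableSet_le ((heval p').sub_const _).abs measurable_const))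
  refine Eq.trans (congrArg P ?_) this
  ext ω
  have e : ∀ (p : SpaceTime d) (z : EuclideanSpace ℝ (Fin D)) j,
      m p + V j p ω - z j = V j p ω - (z j - m p) := fun p z j => by ring
  simp only [nearEvent, mem_inter_iff, mem_ofPred_eq, e]
  exact ⟨fun h j => ⟨h.1 j, h.2 j⟩, fun h => ⟨fun j => (h j).1, fun j => (h j).2⟩⟩

/-- If `|z - z'|` is at most a multiple of `max(g, ε)`, with `g` the gauge distance, the product of
the `D` one-dimensional bounds `ε² / max(g, ε)` is enough. Otherwise some coordinate of `z - z'` is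
at least `|z - z'| / D`, and the tail estimate in that coordinate, taken with `n = D`, supplies a
factor `(g / |z - z'|)^{2D}`. This converts `g^{-D}` into `|z - z'|^{-D}`. -/
lemma exists_two_point_bound (hD : 0 < D) (hq : IsGauge q qi γ)
    (hΓ : IsControlled θ q c C Γ m) (hS : IsNondegenerate θ q c S Γ) {N : ℝ} (hN : 0 < N) :
    ∃ K : ℝ, 0 < K ∧ ∀ {Ω : Type u} [MeasurableSpace Ω] (P : Measure Ω)
      [IsProbabilityMeasure P] (V : Fin D → SpaceTime d → Ω → ℝ), IsGaussianCopies P Γ V →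
      ∀ p ∈ S, ∀ p' ∈ S, 0 < gaugeDist θ q p p' → ∀ ε, 0 < ε → ε ≤ 1 →
      ∀ z z' : EuclideanSpace ℝ (Fin D), ‖z‖ ≤ N → ‖z'‖ ≤ N →
      P (nearEvent m V ε p z ∩ nearEvent m V ε p' z') ≤
        ENNReal.ofReal (K * (ε ^ (2 * D) / max (gaugeDist θ q p p') ‖z - z'‖ ^ D)) := by
  have hc := hΓ.const_pos
  have hC := hΓ.bound_pos
  have hD' : (0 : ℝ) < D := by exact_mod_cast hD
  have hD1 : (1 : ℝ) ≤ D := by exact_mod_cast hD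
  obtain ⟨A, hA⟩ : ∃ A, A = (4 * c⁻¹ + 2) * (√c)⁻¹ := ⟨_, rfl⟩
  have hA0 : 0 < A := by rw [hA]; positivity
  obtain ⟨B, hB⟩ : ∃ B : ℝ, B = 4 * (√c)⁻¹ * c⁻¹ * D.factorial * (32 * C ^ 2) ^ D := ⟨_, rfl⟩
  have hB0 : 0 < B := by rw [hB]; positivity
  obtain ⟨R, hR⟩ : ∃ R : ℝ, R = 6 + 2 * (C / √c) * (N + C + 1) := ⟨_, rfl⟩
  have hR0 : 0 < R := by rw [hR]; positivity
  -- In the distant regime the three summands ensure, in turn, `g ≤ |z - z'|`, that the variation of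
  -- the mean uses up at most half of the gap in the chosen coordinate, and that the remaining gap
  -- exceeds the threshold of the tail estimate.
  obtain ⟨K₂, hK₂⟩ : ∃ K₂ : ℝ, K₂ = 1 + 2 * D * C + 4 * D * R := ⟨_, rfl⟩
  have hK₂0 : 0 < K₂ := by rw [hK₂]; positivity
  refine ⟨A ^ D * (1 + K₂) ^ D + B * A ^ (D - 1) * (2 * D) ^ (2 * D), by positivity, ?_⟩
  intro Ω _ P _ V hV
  -- Nondegeneracy is available only for the later point given the earlier one; the claim itself is
  -- symmetric.
  suffices H : ∀ p ∈ S, ∀ p' ∈ S, p.1 ≤ p'.1 → 0 < gaugeDist θ q p p' → ∀ ε, 0 < ε → ε ≤ 1 →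
      ∀ z z' : EuclideanSpace ℝ (Fin D), ‖z‖ ≤ N → ‖z'‖ ≤ N →
      P (nearEvent m V ε p z ∩ nearEvent m V ε p' z') ≤
        ENNReal.ofReal ((A ^ D * (1 + K₂) ^ D + B * A ^ (D - 1) * (2 * D) ^ (2 * D)) *
          (ε ^ (2 * D) / max (gaugeDist θ q p p') ‖z - z'‖ ^ D)) by
    intro p hp p' hp' hpos ε hε hε1 z z' hz hz'
    rcases le_total p.1 p'.1 with h | h
    · exact H p hp p' hp' h hpos ε hε hε1 z z' hz hz'
    · rw [inter_comm, gaugeDist_comm, norm_sub_rev]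
      exact H p' hp' p hp h (by rwa [gaugeDist_comm]) ε hε hε1 z' z hz' hz
  intro p hp p' hp' hle hpos ε hε hε1 z z' hz hz'
  rw [measure_nearEvent_inter hV]
  have hone := fun j => two_point_le hΓ hS hV j hp hp' hle hpos
    (a := z j - m p) (b := z' j - m p') hε
  have htail := fun j h1 h2 => two_point_le_tail hq hΓ hS hV j hp hp' hle hpos
    (a := z j - m p) (b := z' j - m p') hε hε1 (N := N + C) h1 h2 D
  have hmm := hΓ.mean_sub_le p p'
  obtain ⟨g, hg⟩ : ∃ g, g = gaugeDist θ q p p' := ⟨_, rfl⟩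
  rw [← hg] at hpos hone htail hmm ⊢
  rw [← hA] at hone
  rw [← hB] at htail
  have hmax : 0 < max g ‖z - z'‖ := lt_max_of_lt_left hpos
  rcases le_or_gt ‖z - z'‖ (K₂ * max g ε) with hcase | hcase
  · calc _ ≤ ∏ _j : Fin D, ENNReal.ofReal (A * ε ^ 2 / max g ε) :=
          Finset.prod_le_prod' fun j _ => hone j
      _ = ENNReal.ofReal ((A * ε ^ 2 / max g ε) ^ D) := by
          rw [ENNReal.ofReal_pow (by positivity)]; simp
      _ ≤ _ := by
          apply ENNReal.ofReal_le_ofReal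
          have h1 : max g ‖z - z'‖ ≤ (1 + K₂) * max g ε := by
            refine max_le ?_ ?_
            · have : g ≤ max g ε := le_max_left _ _
              nlinarith
            · have : 0 < max g ε := lt_max_iff.2 (Or.inl hpos)
              nlinarith
          have hmε : 0 < max g ε := lt_max_of_lt_left hpos
          have h2 : (A * ε ^ 2 / max g ε) ^ D ≤
              (A * (1 + K₂)) ^ D * (ε ^ (2 * D) / max g ‖z - z'‖ ^ D) := by
            rw [pow_mul, ← div_pow, ← mul_pow]
            gcongr
            rw [mul_div_assoc, mul_assoc]
            gcongr
            rw [div_le_iff₀ hmε, mul_comm, ← mul_assoc, mul_div_assoc', le_div_iff₀ hmax]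
            nlinarith [sq_nonneg ε]
          refine h2.trans ?_
          rw [mul_pow]
          gcongr
          have : 0 ≤ B * A ^ (D - 1) * (2 * (D : ℝ)) ^ (2 * D) := by positivity
          linarith
  · have hρ : 0 < ‖z - z'‖ := lt_of_le_of_lt (by positivity) hcase
    have hgε : g ≤ max g ε ∧ ε ≤ max g ε := ⟨le_max_left _ _, le_max_right _ _⟩
    obtain ⟨j₀, hj₀⟩ : ∃ j₀, ‖z - z'‖ / D ≤ |z j₀ - z' j₀| := by
      by_contra! h
      have h1 := norm_le_sum_abs (z - z')
      have h2 : ∑ i, |(z - z') i| < ∑ _i : Fin D, ‖z - z'‖ / D := by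
        refine Finset.sum_lt_sum_of_nonempty ?_ fun i _ => by simpa using h i
        exact Finset.univ_nonempty_iff.2 ⟨⟨0, hD⟩⟩
      simp only [Finset.sum_const, Finset.card_univ, Fintype.card_fin, nsmul_eq_mul] at h2
      rw [mul_div_cancel₀ _ hD'.ne'] at h2
      linarith
    have hC1 : 2 * D * C * g ≤ ‖z - z'‖ := by
      have : 2 * D * C * g ≤ K₂ * max g ε := by
        have h0 : 2 * D * C ≤ K₂ := by
          rw [hK₂]
          have : 0 ≤ 4 * D * R := by positivity
          linarith
        exact mul_le_mul h0 hgε.1 hpos.le hK₂0.le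
      linarith
    have hab : ‖z - z'‖ / (2 * D) ≤ |z' j₀ - m p' - (z j₀ - m p)| := by
      have e : z j₀ - z' j₀ = (m p - m p') - (z' j₀ - m p' - (z j₀ - m p)) := by ring
      have h1 : |z j₀ - z' j₀| ≤ |m p - m p'| + |z' j₀ - m p' - (z j₀ - m p)| := by
        rw [e]; exact abs_sub _ _
      have h2 : ‖z - z'‖ / D = 2 * (‖z - z'‖ / (2 * D)) := by field_simp
      have h3 : C * g ≤ ‖z - z'‖ / (2 * D) := by
        rw [le_div_iff₀ (by positivity)]; linarith
      linarith
    have hab' : 6 * ε + 2 * (C / √c) * (N + C + 1) * g ≤ |z' j₀ - m p' - (z j₀ - m p)| := by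
      refine le_trans ?_ hab
      rw [le_div_iff₀ (by positivity)]
      have h1 : 6 * ε + 2 * (C / √c) * (N + C + 1) * g ≤ R * max g ε := by
        rw [hR, add_mul]
        have : 0 ≤ 2 * (C / √c) * (N + C + 1) := by positivity
        gcongr
        · exact hgε.2
        · exact hgε.1
      have h2 : R * (2 * D) * max g ε ≤ K₂ * max g ε := by
        gcongr
        rw [hK₂]
        have h3 : 0 ≤ 2 * D * C := by positivity
        have h4 : 0 ≤ D * R := by positivity
        linarith
      have h5 : (6 * ε + 2 * (C / √c) * (N + C + 1) * g) * (2 * D) ≤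
          R * max g ε * (2 * D) := by gcongr
      linarith
    have hzj : |z j₀ - m p| ≤ N + C := by
      refine (abs_sub _ _).trans (add_le_add ?_ (hΓ.mean_le p))
      have := PiLp.norm_apply_le z j₀
      rw [Real.norm_eq_abs] at this
      exact this.trans hz
    have ht := htail j₀ hzj hab'
    have ht2 : P {ω | |V j₀ p ω - (z j₀ - m p)| ≤ ε ∧ |V j₀ p' ω - (z' j₀ - m p')| ≤ ε} ≤
        ENNReal.ofReal (B * ε ^ 2 / g * ((2 * D) * (g / ‖z - z'‖)) ^ (2 * D)) := by
      refine ht.trans (ENNReal.ofReal_le_ofReal ?_)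
      gcongr
      rw [div_le_iff₀ (lt_of_lt_of_le (by positivity) hab)]
      have : g = 2 * D * (g / ‖z - z'‖) * (‖z - z'‖ / (2 * D)) := by field_simp
      calc g = 2 * D * (g / ‖z - z'‖) * (‖z - z'‖ / (2 * D)) := this
        _ ≤ _ := by gcongr
    have hone' : ∀ j, P {ω | |V j p ω - (z j - m p)| ≤ ε ∧ |V j p' ω - (z' j - m p')| ≤ ε} ≤
        ENNReal.ofReal (A * ε ^ 2 / g) := fun j =>
      (hone j).trans (ENNReal.ofReal_le_ofReal (by gcongr; exact hgε.1))
    have hgz : g ≤ ‖z - z'‖ := by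
      have : 1 * max g ε ≤ K₂ * max g ε := by
        gcongr
        rw [hK₂]
        have h3 : 0 ≤ 2 * D * C := by positivity
        have h4 : 0 ≤ 4 * D * R := by positivity
        linarith
      linarith [hgε.1]
    rw [← Finset.mul_prod_erase _ _ (Finset.mem_univ j₀)]
    calc _ ≤ ENNReal.ofReal (B * ε ^ 2 / g * ((2 * D) * (g / ‖z - z'‖)) ^ (2 * D)) *
          ∏ _j ∈ Finset.univ.erase j₀, ENNReal.ofReal (A * ε ^ 2 / g) := by
          gcongr with j
          exact hone' j
      _ = ENNReal.ofReal (B * ε ^ 2 / g * ((2 * D) * (g / ‖z - z'‖)) ^ (2 * D) *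
          (A * ε ^ 2 / g) ^ (D - 1)) := by
          rw [Finset.prod_const, Finset.card_erase_of_mem (Finset.mem_univ _), Finset.card_univ,
            Fintype.card_fin, ← ENNReal.ofReal_pow (by positivity),
            ← ENNReal.ofReal_mul (by positivity)]
      _ ≤ _ := by
          apply ENNReal.ofReal_le_ofReal
          rw [max_eq_right hgz]
          have h1 : B * ε ^ 2 / g * ((2 * D) * (g / ‖z - z'‖)) ^ (2 * D) * (A * ε ^ 2 / g) ^
              (D - 1) =
              B * A ^ (D - 1) * (2 * D) ^ (2 * D) * ((ε ^ 2 / g) ^ D * (g / ‖z - z'‖) ^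
                  (2 * D)) := by
            have h2 : (ε ^ 2 / g) ^ D = ε ^ 2 / g * (ε ^ 2 / g) ^ (D - 1) :=
              (mul_pow_sub_one hD.ne' _).symm
            rw [h2, mul_pow, mul_div_assoc, mul_div_assoc A, mul_pow A]
            ring
          rw [h1]
          have h3 : (ε ^ 2 / g) ^ D * (g / ‖z - z'‖) ^ (2 * D) ≤
              ε ^ (2 * D) / ‖z - z'‖ ^ D := by
            -- Half of the gained power already suffices.
            have h4 : (g / ‖z - z'‖) ^ (2 * D) ≤ (g / ‖z - z'‖) ^ D := by
              apply pow_le_pow_of_le_one (by positivity) ((div_le_one hρ).2 hgz)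
              omega
            calc _ ≤ (ε ^ 2 / g) ^ D * (g / ‖z - z'‖) ^ D := by gcongr
              _ = _ := by
                rw [← mul_pow, pow_mul, ← div_pow]
                congr 1
                field_simp
          refine mul_le_mul ?_ h3 (by positivity) (by positivity)
          have : 0 ≤ A ^ D * (1 + K₂) ^ D := by positivity
          linarith

lemma exists_one_point_bound (hΓ : IsControlled θ q c C Γ m) {N : ℝ} :
    ∃ k : ℝ, 0 < k ∧ ∀ {Ω : Type u} [MeasurableSpace Ω] (P : Measure Ω)
      [IsProbabilityMeasure P] (V : Fin D → SpaceTime d → Ω → ℝ), IsGaussianCopies P Γ V →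
      ∀ p, ∀ ε, 0 < ε → ε ≤ 1 → ∀ z : EuclideanSpace ℝ (Fin D), ‖z‖ ≤ N →
      ENNReal.ofReal (k * ε ^ D) ≤ P (nearEvent m V ε p z) := by
  have hc := hΓ.const_pos
  have hC := hΓ.bound_pos
  obtain ⟨k, hk⟩ : ∃ k, k = (√(2 * Real.pi * C))⁻¹ * Real.exp (-(N + C + 1) ^ 2 / (2 * c)) :=
    ⟨_, rfl⟩
  have hk0 : 0 < k := by rw [hk]; positivity
  refine ⟨k ^ D, by positivity, ?_⟩
  intro Ω _ P _ V hV p ε hε hε1 z hz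
  rw [← inter_self (nearEvent m V ε p z), measure_nearEvent_inter hV]
  have hp0 : 0 < Γ p p := hc.trans_le (hΓ.le_variance p)
  calc ENNReal.ofReal (k ^ D * ε ^ D) = ∏ _j : Fin D, (ENNReal.ofReal k * ENNReal.ofReal ε) := by
        rw [← mul_pow, ENNReal.ofReal_pow (by positivity), ENNReal.ofReal_mul hk0.le]; simp
    _ ≤ _ := by
        refine Finset.prod_le_prod' fun j _ => ?_
        have hzj : |z j - m p| ≤ N + C := by
          refine (abs_sub _ _).trans (add_le_add ?_ (hΓ.mean_le p))
          have := PiLp.norm_apply_le z j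
          rw [Real.norm_eq_abs] at this
          exact this.trans hz
        have h := le_gaussianReal_abs_sub (v := (Γ p p).toNNReal) (C := C) hc
          (by rw [Real.coe_toNNReal _ hp0.le]; exact hΓ.le_variance p)
          (by rw [Real.coe_toNNReal _ hp0.le]; exact hΓ.variance_le p) hzj hε hε1
        rw [← hk, ← hV.map_eval j p, Measure.map_apply (hV.measurable j p)
          (measurableSet_lt (by fun_prop) (by fun_prop))] at h
        refine h.trans (measure_mono fun ω hω => ?_)
        have : |V j p ω - (z j - m p)| < ε := hω
        exact ⟨this.le, this.le⟩

end TwoPoint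

/-! ### Scaling of gauge integrals -/

lemma isGauge_rpow {θ : ℝ} (hθ : 0 < θ) : IsGauge (fun τ => τ ^ θ) (fun ρ => ρ ^ θ⁻¹) θ where
  exponent_pos := hθ
  zero := Real.zero_rpow hθ.ne'
  mono := fun _ ha _ _ hab => Real.rpow_le_rpow ha hab hθ.le
  pos := fun _ h => Real.rpow_pos_of_pos h _
  scaling := ⟨1, one_pos, fun τ hτ l hl _ => by rw [one_mul, Real.mul_rpow hl.le hτ]⟩
  inverse := fun ρ hρ => ⟨Real.rpow_pos_of_pos hρ _, by
    rw [← Real.rpow_mul hρ.le, inv_mul_cancel₀ hθ.ne', Real.rpow_one]⟩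

/-- Rescale by `b = qi(ρ)`, the radius at which `q` reaches `ρ`. The lower scaling of `q` gives
`max(q|y|, ρ) ≥ k ρ (1 + |y|/b)^γ`, and `(1 + |y|)^{-γe}` is integrable because `γ e` exceeds the
dimension. The Jacobian of the rescaling is the factor `qi(ρ)^{dim}`. -/
lemma exists_lintegral_max_rpow_le {F : Type*} [NormedAddCommGroup F] [NormedSpace ℝ F]
    [FiniteDimensional ℝ F] [MeasurableSpace F] [BorelSpace F] (ν : Measure F)
    [ν.IsAddHaarMeasure] {q qi : ℝ → ℝ} {γ e : ℝ} (hq : IsGauge q qi γ)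
    (he : Module.finrank ℝ F / γ < e) :
    ∃ K : ℝ, 0 < K ∧ ∀ ρ, 0 < ρ → ∫⁻ y, ENNReal.ofReal (max (q ‖y‖) ρ ^ (-e)) ∂ν ≤
      ENNReal.ofReal (K * (ρ ^ (-e) * qi ρ ^ Module.finrank ℝ F)) := by
  obtain ⟨C, hC, hscale⟩ := hq.scaling
  have hγ := hq.exponent_pos
  have he0 : 0 ≤ e := le_trans (by positivity) he.le
  have hfin : ∫⁻ y : F, ENNReal.ofReal ((1 + ‖y‖) ^ (-(γ * e))) ∂ν < ∞ := by
    apply finite_integral_one_add_norm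
    rw [div_lt_iff₀ hγ] at he
    linarith
  obtain ⟨I, hI⟩ : ∃ I : ℝ≥0∞, I = ∫⁻ y : F, ENNReal.ofReal ((1 + ‖y‖) ^ (-(γ * e))) ∂ν :=
    ⟨_, rfl⟩
  rw [← hI] at hfin
  obtain ⟨k, hk⟩ : ∃ k : ℝ, k = (max 1 C)⁻¹ * 2 ^ (-γ) := ⟨_, rfl⟩
  have hk0 : 0 < k := by rw [hk]; positivity
  refine ⟨k ^ (-e) * (I.toReal + 1), by positivity, fun ρ hρ => ?_⟩
  obtain ⟨hb, hqb⟩ := hq.inverse ρ hρ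
  obtain ⟨b, hb'⟩ : ∃ b, b = qi ρ := ⟨_, rfl⟩
  rw [← hb'] at hb hqb ⊢
  have hpt : ∀ y : F, max (q ‖y‖) ρ ^ (-e) ≤
      k ^ (-e) * ρ ^ (-e) * (1 + ‖b⁻¹ • y‖) ^ (-(γ * e)) := by
    intro y
    have h1 : k * ρ * (1 + ‖b⁻¹ • y‖) ^ γ ≤ max (q ‖y‖) ρ := by
      rw [norm_smul, norm_inv, Real.norm_of_nonneg hb.le]
      have h2γ : (2 : ℝ) ^ (-γ) * 2 ^ γ = 1 := by
        rw [← Real.rpow_add (by norm_num)]; simp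
      rcases le_or_gt ‖y‖ b with h | h
      · have h2 : b⁻¹ * ‖y‖ ≤ 1 := by
          rw [inv_mul_le_iff₀ hb]; linarith
        calc k * ρ * (1 + b⁻¹ * ‖y‖) ^ γ ≤ 1 * 2 ^ (-γ) * ρ * (1 + 1) ^ γ := by
              rw [hk]
              gcongr
              exact inv_le_one_of_one_le₀ (le_max_left _ _)
          _ = ρ * (2 ^ (-γ) * 2 ^ γ) := by norm_num; ring
          _ = ρ := by rw [h2γ, mul_one]
          _ ≤ _ := le_max_right _ _
      · have hy : 0 < ‖y‖ := hb.trans h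
        have h2 : 1 ≤ b⁻¹ * ‖y‖ := by
          rw [le_inv_mul_iff₀ hb]; linarith
        -- Scaling down from `|y|` to `b`, where `q` equals `ρ`, yields a lower bound for `q|y|`.
        have h3 := hscale ‖y‖ hy.le (b / ‖y‖) (by positivity) ((div_le_one hy).2 h.le)
        rw [div_mul_cancel₀ _ hy.ne', hqb] at h3
        have h4 : (b / ‖y‖) ^ γ * (b⁻¹ * ‖y‖) ^ γ = 1 := by
          rw [← Real.mul_rpow (by positivity) (by positivity)]
          have : b / ‖y‖ * (b⁻¹ * ‖y‖) = 1 := by field_simp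
          rw [this, Real.one_rpow]
        have hqy : 0 ≤ q ‖y‖ := hq.nonneg hy.le
        calc k * ρ * (1 + b⁻¹ * ‖y‖) ^ γ ≤ C⁻¹ * 2 ^ (-γ) * ρ * (2 * (b⁻¹ * ‖y‖)) ^ γ := by
              rw [hk]
              gcongr
              · exact le_max_right _ _
              · linarith
          _ ≤ C⁻¹ * 2 ^ (-γ) * (C * (b / ‖y‖) ^ γ * q ‖y‖) * (2 * (b⁻¹ * ‖y‖)) ^ γ := by gcongr
          _ = (C⁻¹ * C) * (2 ^ (-γ) * 2 ^ γ) * ((b / ‖y‖) ^ γ * (b⁻¹ * ‖y‖) ^ γ) * q ‖y‖ := by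
              rw [Real.mul_rpow (x := 2) (by norm_num) (by positivity)]; ring
          _ = q ‖y‖ := by rw [h2γ, h4, inv_mul_cancel₀ hC.ne']; ring
          _ ≤ _ := le_max_left _ _
    have h5 : 0 < k * ρ * (1 + ‖b⁻¹ • y‖) ^ γ := by positivity
    calc _ ≤ (k * ρ * (1 + ‖b⁻¹ • y‖) ^ γ) ^ (-e) :=
          Real.rpow_le_rpow_of_nonpos h5 h1 (by linarith)
      _ = _ := by
          rw [Real.mul_rpow (by positivity) (by positivity), Real.mul_rpow hk0.le hρ.le,
            ← Real.rpow_mul (by positivity)]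
          congr 2
          ring
  calc _ ≤ ∫⁻ y : F, ENNReal.ofReal (k ^ (-e) * ρ ^ (-e)) *
        ENNReal.ofReal ((1 + ‖b⁻¹ • y‖) ^ (-(γ * e))) ∂ν := by
        refine lintegral_mono fun y => ?_
        rw [← ENNReal.ofReal_mul (by positivity)]
        exact ENNReal.ofReal_le_ofReal (hpt y)
    _ = ENNReal.ofReal (k ^ (-e) * ρ ^ (-e)) * (ENNReal.ofReal (b ^ Module.finrank ℝ F) * I) := by
        rw [lintegral_const_mul _ (by fun_prop), hI]
        congr 1
        have hmap := Measure.map_addHaar_smul ν (r := b⁻¹) (by positivity)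
        have h := lintegral_map (μ := ν) (f := fun y : F =>
          ENNReal.ofReal ((1 + ‖y‖) ^ (-(γ * e)))) (g := fun y => b⁻¹ • y)
          (by fun_prop) (by fun_prop)
        rw [← h, hmap, lintegral_smul_measure]
        congr 2
        rw [inv_pow, inv_inv, abs_of_nonneg (by positivity)]
    _ ≤ _ := by
        rw [← ENNReal.ofReal_toReal hfin.ne, ← ENNReal.ofReal_mul (by positivity),
          ← ENNReal.ofReal_mul (by positivity)]
        apply ENNReal.ofReal_le_ofReal
        have : 0 ≤ k ^ (-e) * ρ ^ (-e) * b ^ Module.finrank ℝ F := by positivity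
        rw [ENNReal.toReal_ofReal (by positivity)]
        nlinarith

/-- Write `D = e₁ + e₂` and bound the gauge distance below by its time part in the power `e₁` and by
its space part in the power `e₂`. The integral becomes a product of two integrals of a single gauge,
of orders `ρ^{-e₁} ρ^{1/θ}` and `ρ^{-e₂} qi(ρ)^d`. -/
lemma exists_lintegral_gaugeDist_le {d D : ℕ} {θ γ : ℝ} {q qi : ℝ → ℝ} (hq : IsGauge q qi γ)
    (hθ : 0 < θ) (hD : 1 / θ + d / γ < D) (hqm : Measurable fun τ => q |τ|) :
    ∃ K : ℝ, 0 < K ∧ ∀ ρ, 0 < ρ → ∀ p : SpaceTime d,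
      ∫⁻ p', ENNReal.ofReal ((max (gaugeDist θ q p p') ρ ^ D)⁻¹) ≤
        ENNReal.ofReal (K * (ρ ^ ((D : ℝ) - 1 / θ) * qi ρ ^ (-(d : ℝ)))⁻¹) := by
  -- The strict inequality on `D` leaves room for `e₁ > 1/θ` and `D - e₁ > d/γ` at once.
  obtain ⟨e₁, he₁, he₁'⟩ := exists_between (lt_sub_iff_add_lt.2 hD)
  obtain ⟨e₂, he₂⟩ : ∃ e₂, e₂ = D - e₁ := ⟨_, rfl⟩
  have hγ := hq.exponent_pos
  have he₁0 : 0 < e₁ := lt_trans (by positivity) he₁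
  have he₂' : d / γ < e₂ := by rw [he₂]; linarith
  have he₂0 : 0 ≤ e₂ := le_trans (by positivity) he₂'.le
  obtain ⟨K₁, hK₁, h₁⟩ := exists_lintegral_max_rpow_le (volume : Measure ℝ) (isGauge_rpow hθ)
    (e := e₁) (by simpa using he₁)
  obtain ⟨K₂, hK₂, h₂⟩ := exists_lintegral_max_rpow_le
    (volume : Measure (EuclideanSpace ℝ (Fin d))) hq (e := e₂) (by simpa using he₂')
  refine ⟨K₁ * K₂, by positivity, fun ρ hρ p => ?_⟩
  have hqn : Measurable fun y : EuclideanSpace ℝ (Fin d) => q ‖y‖ := by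
    have := hqm.comp (measurable_norm (α := EuclideanSpace ℝ (Fin d)))
    simpa [Function.comp_def] using this
  have hpt : ∀ p' : SpaceTime d, (max (gaugeDist θ q p p') ρ ^ D)⁻¹ ≤
      max (‖p'.1 - p.1‖ ^ θ) ρ ^ (-e₁) * max (q ‖p'.2 - p.2‖) ρ ^ (-e₂) := by
    intro p'
    have hm : 0 < max (gaugeDist θ q p p') ρ := lt_max_of_lt_right hρ
    have hq0 := hq.nonneg (norm_nonneg (p'.2 - p.2))
    have hg : gaugeDist θ q p p' = ‖p'.1 - p.1‖ ^ θ + q ‖p'.2 - p.2‖ := by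
      rw [gaugeDist_comm, gaugeDist, Real.norm_eq_abs]
    have e : (max (gaugeDist θ q p p') ρ ^ D)⁻¹ =
        max (gaugeDist θ q p p') ρ ^ (-e₁) * max (gaugeDist θ q p p') ρ ^ (-e₂) := by
      rw [← Real.rpow_add hm, he₂, ← Real.rpow_natCast, ← Real.rpow_neg hm.le]
      congr 1
      ring
    rw [e]
    gcongr ?_ * ?_
    · apply Real.rpow_le_rpow_of_nonpos (lt_max_of_lt_right hρ) _ (by linarith)
      gcongr
      rw [hg]; linarith
    · apply Real.rpow_le_rpow_of_nonpos (lt_max_of_lt_right hρ) _ (by linarith)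
      gcongr
      rw [hg]
      have : 0 ≤ ‖p'.1 - p.1‖ ^ θ := by positivity
      linarith
  have hi := hq.inverse ρ hρ
  calc _ ≤ ∫⁻ p' : SpaceTime d, ENNReal.ofReal (max (‖p'.1 - p.1‖ ^ θ) ρ ^ (-e₁)) *
        ENNReal.ofReal (max (q ‖p'.2 - p.2‖) ρ ^ (-e₂)) := by
        refine lintegral_mono fun p' => ?_
        rw [← ENNReal.ofReal_mul (by positivity)]
        exact ENNReal.ofReal_le_ofReal (hpt p')
    _ = (∫⁻ t : ℝ, ENNReal.ofReal (max (‖t - p.1‖ ^ θ) ρ ^ (-e₁))) *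
        ∫⁻ x : EuclideanSpace ℝ (Fin d), ENNReal.ofReal (max (q ‖x - p.2‖) ρ ^ (-e₂)) := by
        rw [Measure.volume_eq_prod]
        refine lintegral_prod_mul (f := fun t : ℝ => ENNReal.ofReal (max (‖t - p.1‖ ^ θ) ρ ^ (-e₁)))
          (g := fun x : EuclideanSpace ℝ (Fin d) =>
            ENNReal.ofReal (max (q ‖x - p.2‖) ρ ^ (-e₂))) ?_ ?_
        · fun_prop
        · have := hqn.comp (measurable_id.sub_const p.2)
          exact (((this.max measurable_const).pow_const _).ennreal_ofReal).aemeasurable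
    _ = (∫⁻ t : ℝ, ENNReal.ofReal (max (‖t‖ ^ θ) ρ ^ (-e₁))) *
        ∫⁻ x : EuclideanSpace ℝ (Fin d), ENNReal.ofReal (max (q ‖x‖) ρ ^ (-e₂)) := by
        rw [lintegral_sub_right_eq_self (fun t : ℝ => ENNReal.ofReal (max (‖t‖ ^ θ) ρ ^ (-e₁))),
          lintegral_sub_right_eq_self (fun x : EuclideanSpace ℝ (Fin d) =>
            ENNReal.ofReal (max (q ‖x‖) ρ ^ (-e₂)))]
    _ ≤ _ := (mul_le_mul' (h₁ ρ hρ) (h₂ ρ hρ))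
    _ = _ := by
        rw [← ENNReal.ofReal_mul (by have := hi.1; positivity)]
        congr 1
        simp only [Module.finrank_self, pow_one, finrank_euclideanSpace, Fintype.card_fin]
        rw [mul_inv, ← Real.rpow_neg hρ.le, ← Real.rpow_neg hi.1.le, neg_neg, Real.rpow_natCast]
        have : ρ ^ (-((D : ℝ) - 1 / θ)) = ρ ^ (-e₁) * ρ ^ (-e₂) * ρ ^ θ⁻¹ := by
          rw [← Real.rpow_add hρ, ← Real.rpow_add hρ, he₂]
          congr 1
          rw [one_div]; ring
        rw [this]
        ring

/-! ### Lower bounds for hitting probabilities -/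

/-- The second moment method. -/
lemma sq_lintegral_measure_le {X Ω : Type*} [MeasurableSpace X] [MeasurableSpace Ω] {l : Measure X}
    [SFinite l] {P : Measure Ω} [SFinite P] {G : Set (X × Ω)} (hG : MeasurableSet G) :
    (∫⁻ x, P (Prod.mk x ⁻¹' G) ∂l) ^ 2 ≤
      (∫⁻ x, ∫⁻ x', P (Prod.mk x ⁻¹' G ∩ Prod.mk x' ⁻¹' G) ∂l ∂l) *
        P {ω | l ((fun x => (x, ω)) ⁻¹' G) ≠ 0} := by
  set J : Ω → ℝ≥0∞ := fun ω => l ((fun x => (x, ω)) ⁻¹' G) with hJ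
  have hJm : Measurable J := measurable_measure_prodMk_right hG
  have h1 : ∫⁻ x, P (Prod.mk x ⁻¹' G) ∂l = ∫⁻ ω, J ω ∂P := by
    rw [← Measure.prod_apply hG, Measure.prod_apply_symm hG]
  have hs : MeasurableSet {ω | J ω ≠ 0} := hJm (measurableSet_singleton 0).compl
  -- Inserting the indicator of `J ≠ 0` brings the probability of that event into Cauchy–Schwarz.
  have h2 : ∫⁻ ω, J ω ∂P = ∫⁻ ω, (J * {ω | J ω ≠ 0}.indicator (1 : Ω → ℝ≥0∞)) ω ∂P := by
    refine lintegral_congr fun ω => ?_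
    by_cases h : J ω = 0
    · simp [h]
    · rw [Pi.mul_apply, indicator_of_mem h]; simp
  have h3 : ∫⁻ ω, J ω ^ 2 ∂P =
      ∫⁻ x, ∫⁻ x', P (Prod.mk x ⁻¹' G ∩ Prod.mk x' ⁻¹' G) ∂l ∂l := by
    have hGi : Measurable (G.indicator (1 : X × Ω → ℝ≥0∞)) := measurable_one.indicator hG
    have hsec : ∀ ω, J ω = ∫⁻ x, G.indicator (1 : X × Ω → ℝ≥0∞) (x, ω) ∂l := by
      intro ω
      have hm : MeasurableSet ((fun x => (x, ω)) ⁻¹' G) := hG.preimage (by fun_prop)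
      show l ((fun x => (x, ω)) ⁻¹' G) = _
      rw [← lintegral_indicator_one hm]
      rfl
    have hsq : ∀ ω, J ω ^ 2 = ∫⁻ x, ∫⁻ x', G.indicator (1 : X × Ω → ℝ≥0∞) (x, ω) *
        G.indicator (1 : X × Ω → ℝ≥0∞) (x', ω) ∂l ∂l := by
      intro ω
      rw [sq, hsec ω]
      have hx : Measurable fun x => G.indicator (1 : X × Ω → ℝ≥0∞) (x, ω) :=
        hGi.comp (by fun_prop)
      simp_rw [lintegral_const_mul _ hx]
      rw [lintegral_mul_const _ hx]
    simp_rw [hsq]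
    rw [lintegral_lintegral_swap]
    · refine lintegral_congr fun x => ?_
      rw [lintegral_lintegral_swap]
      · refine lintegral_congr fun x' => ?_
        have hm : MeasurableSet (Prod.mk x ⁻¹' G ∩ Prod.mk x' ⁻¹' G) :=
          (hG.preimage (by fun_prop)).inter (hG.preimage (by fun_prop))
        rw [← lintegral_indicator_one hm]
        refine lintegral_congr fun ω => ?_
        by_cases h : (x, ω) ∈ G <;> by_cases h' : (x', ω) ∈ G <;> simp [h, h', indicator]
      · refine Measurable.aemeasurable ?_
        have e1 : Measurable fun a : Ω × X => G.indicator (1 : X × Ω → ℝ≥0∞) (x, a.1) :=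
          hGi.comp (by fun_prop)
        have e2 : Measurable fun a : Ω × X => G.indicator (1 : X × Ω → ℝ≥0∞) (a.2, a.1) :=
          hGi.comp (by fun_prop)
        exact e1.mul e2
    · refine Measurable.aemeasurable ?_
      have e1 : Measurable fun a : (Ω × X) × X => G.indicator (1 : X × Ω → ℝ≥0∞) (a.1.2, a.1.1) :=
        hGi.comp (by fun_prop)
      have e2 : Measurable fun a : (Ω × X) × X => G.indicator (1 : X × Ω → ℝ≥0∞) (a.2, a.1.1) :=
        hGi.comp (by fun_prop)
      exact (e1.mul e2).lintegral_prod_right'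
  have h4 := ENNReal.lintegral_mul_le_Lp_mul_Lq P Real.HolderConjugate.two_two hJm.aemeasurable
    ((measurable_one.indicator hs).aemeasurable (μ := P))
  have h5 : ∫⁻ ω, ({ω | J ω ≠ 0}.indicator (1 : Ω → ℝ≥0∞) ω) ^ (2 : ℝ) ∂P = P {ω | J ω ≠ 0} := by
    rw [← lintegral_indicator_one hs]
    refine lintegral_congr fun ω => ?_
    by_cases h : J ω = 0
    · simp [h]
    · rw [indicator_of_mem h]; simp
  rw [← h2, h5] at h4
  rw [h1, ← h3]
  calc _ ≤ ((∫⁻ ω, J ω ^ (2 : ℝ) ∂P) ^ (1 / (2 : ℝ)) * P {ω | J ω ≠ 0} ^ (1 / (2 : ℝ))) ^ 2 := by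
        gcongr
    _ = _ := by
        rw [← ENNReal.mul_rpow_of_nonneg _ _ (by norm_num), ← ENNReal.rpow_natCast,
          ← ENNReal.rpow_mul]
        norm_num
        rfl

lemma isCompact_cube (d : ℕ) (M : ℝ) : IsCompact (cube d M) := by
  refine Metric.isCompact_of_isClosed_isBounded ?_ ?_
  · have : cube d M = ⋂ i, (fun x : EuclideanSpace ℝ (Fin d) => x i) ⁻¹' Icc (-M) M := by
      ext x; simp [cube]
    rw [this]
    exact isClosed_iInter fun i => isClosed_Icc.preimage (by fun_prop)
  · refine (Metric.isBounded_closedBall (x := 0) (r := d * M)).subset fun x hx => ?_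
    rw [mem_closedBall_zero_iff]
    refine (norm_le_sum_abs x).trans ?_
    calc ∑ i, |x i| ≤ ∑ _i : Fin d, M := Finset.sum_le_sum fun i _ => abs_le.2 (hx i)
      _ = _ := by simp

lemma volume_cube_pos (d : ℕ) {M : ℝ} (hM : 0 < M) :
    0 < (volume : Measure (EuclideanSpace ℝ (Fin d))) (cube d M) := by
  refine lt_of_lt_of_le (Metric.measure_ball_pos volume 0 hM) (measure_mono fun x hx => ?_)
  intro i
  have := PiLp.norm_apply_le x i
  rw [mem_ball_zero_iff] at hx
  rw [Real.norm_eq_abs] at this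
  exact abs_le.1 (this.trans hx.le)

lemma measurableSet_nearEvent {d D : ℕ} {Ω : Type*} [MeasurableSpace Ω]
    {m : SpaceTime d → ℝ} (hm : Continuous m) {V : Fin D → SpaceTime d → Ω → ℝ}
    (hVm : ∀ j p, Measurable (V j p)) (hVc : ∀ j ω, Continuous fun p => V j p ω) (ε : ℝ) :
    MeasurableSet {x : (SpaceTime d × EuclideanSpace ℝ (Fin D)) × Ω |
      x.2 ∈ nearEvent m V ε x.1.1 x.1.2} := by
  have hV : ∀ j, Measurable fun x : (SpaceTime d × EuclideanSpace ℝ (Fin D)) × Ω =>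
      V j x.1.1 x.2 := fun j =>
    (measurable_uncurry_of_continuous_of_measurable (hVc j) (hVm j)).comp
      (f := fun x : (SpaceTime d × EuclideanSpace ℝ (Fin D)) × Ω => (x.1.1, x.2)) (by fun_prop)
  have hm' : Measurable fun x : (SpaceTime d × EuclideanSpace ℝ (Fin D)) × Ω => m x.1.1 :=
    hm.measurable.comp (by fun_prop)
  have : {x : (SpaceTime d × EuclideanSpace ℝ (Fin D)) × Ω |
      x.2 ∈ nearEvent m V ε x.1.1 x.1.2} =
      ⋂ j, {x | |m x.1.1 + V j x.1.1 x.2 - x.1.2 j| ≤ ε} := by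
    ext x; simp [nearEvent]
  rw [this]
  refine MeasurableSet.iInter fun j => measurableSet_le ?_ measurable_const
  exact ((hm'.add (hV j)).sub (by fun_prop)).abs

/-- If `U` comes arbitrarily close to a compact set on a compact set, it hits it. -/
lemma mem_copyHitting_of_forall {d D : ℕ} {Ω : Type*} {S : Set (SpaceTime d)} (hS : IsCompact S)
    {m : SpaceTime d → ℝ} (hm : Continuous m) {V : Fin D → SpaceTime d → Ω → ℝ}
    {ω : Ω} (hVc : ∀ j, Continuous fun p => V j p ω) {K : Set (EuclideanSpace ℝ (Fin D))}
    (hK : IsCompact K)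
    (h : ∀ n : ℕ, ∃ p ∈ S, ∃ z ∈ K, ω ∈ nearEvent m V (1 / ((n : ℝ) + 1)) p z) :
    ω ∈ copyHitting S m V K := by
  have hc : Continuous fun x : SpaceTime d × EuclideanSpace ℝ (Fin D) =>
      ∑ j, |m x.1 + V j x.1 ω - x.2 j| := by
    refine continuous_finsetSum _ fun j _ => ?_
    have := (hVc j).comp (continuous_fst (X := SpaceTime d) (Y := EuclideanSpace ℝ (Fin D)))
    exact (((hm.comp continuous_fst).add this).sub (by fun_prop)).abs
  obtain ⟨p₀, hp₀, z₀, hz₀, -⟩ := h 0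
  obtain ⟨⟨p, z⟩, ⟨hp, hz⟩, hmin⟩ := (hS.prod hK).exists_isMinOn ⟨(p₀, z₀), hp₀, hz₀⟩
    hc.continuousOn
  have hle : ∑ j, |m p + V j p ω - z j| ≤ 0 := by
    have hlim : Tendsto (fun n : ℕ => (D : ℝ) * (1 / ((n : ℝ) + 1))) atTop (𝓝 (D * 0)) :=
      tendsto_one_div_add_atTop_nhds_zero_nat.const_mul _
    rw [mul_zero] at hlim
    refine ge_of_tendsto' hlim fun n => ?_
    obtain ⟨p', hp', z', hz', hn⟩ := h n
    have h1 : ∑ j, |m p + V j p ω - z j| ≤ ∑ j, |m p' + V j p' ω - z' j| :=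
      hmin (show (p', z') ∈ S ×ˢ K from ⟨hp', hz'⟩)
    refine h1.trans ((Finset.sum_le_sum fun j _ => hn j).trans ?_)
    simp
  have hz' : z = WithLp.toLp 2 (fun j => m p + V j p ω) := by
    ext j
    have h0 := (Finset.sum_eq_zero_iff_of_nonneg (fun j _ => abs_nonneg _)).1
      (le_antisymm hle (Finset.sum_nonneg fun j _ => abs_nonneg _)) j (Finset.mem_univ j)
    have := abs_eq_zero.1 h0
    simp only
    linarith
  exact ⟨p, hp, hz' ▸ hz⟩


/-! ### The second moment of the occupation of a small neighbourhood. -/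

section SecondMoment

variable {d D : ℕ} {θ γ : ℝ} {q qi : ℝ → ℝ} {K₁ K₂ ε v : ℝ} {S : Set (SpaceTime d)}
  {Ω : Type*} [MeasurableSpace Ω] {P : Measure Ω}
  {m : SpaceTime d → ℝ} {V : Fin D → SpaceTime d → Ω → ℝ} {g : ℝ → ℝ}

lemma gaugeDist_pos (hq : IsGauge q qi γ) {p p' : SpaceTime d} (hpp' : p' ≠ p) :
    0 < gaugeDist θ q p p' := by
  rcases eq_or_ne p.1 p'.1 with h | h
  · have h2 : p.2 ≠ p'.2 := fun h2 => hpp' (Prod.ext h.symm h2.symm)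
    have := hq.pos _ (norm_pos_iff.2 (sub_ne_zero.2 h2))
    have h0 : 0 ≤ |p.1 - p'.1| ^ θ := by positivity
    unfold gaugeDist
    linarith
  · have h0 : 0 < |p.1 - p'.1| ^ θ := Real.rpow_pos_of_pos (abs_pos.2 (sub_ne_zero.2 h)) _
    have := hq.nonneg (norm_nonneg (p.2 - p'.2))
    unfold gaugeDist
    linarith

/-- Two degenerate cases are harmless: the two-point bound is missing only on the null set `p' = p`,
and for `z = z'` the kernel is infinite because `g 0 = 0`. -/
lemma setLIntegral_nearEvent_inter_le (hq : IsGauge q qi γ) (hSm : MeasurableSet S)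
    (hK₁ : 0 < K₁) (hK₂ : 0 < K₂) (hε : 0 < ε) (hg0 : g 0 = 0)
    (hg : ∀ ρ, 0 < ρ → g ρ = ρ ^ ((D : ℝ) - 1 / θ) * qi ρ ^ (-(d : ℝ)))
    {p : SpaceTime d} {z z' : EuclideanSpace ℝ (Fin D)}
    (h2pt : ∀ p' ∈ S, 0 < gaugeDist θ q p p' →
      P (nearEvent m V ε p z ∩ nearEvent m V ε p' z') ≤
        ENNReal.ofReal (K₁ * (ε ^ (2 * D) / max (gaugeDist θ q p p') ‖z - z'‖ ^ D)))
    (hint : ∀ ρ, 0 < ρ → ∫⁻ p', ENNReal.ofReal ((max (gaugeDist θ q p p') ρ ^ D)⁻¹) ≤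
        ENNReal.ofReal (K₂ * (ρ ^ ((D : ℝ) - 1 / θ) * qi ρ ^ (-(d : ℝ)))⁻¹)) :
    ∫⁻ p' in S, P (nearEvent m V ε p z ∩ nearEvent m V ε p' z') ≤
      ENNReal.ofReal (K₁ * K₂ * ε ^ (2 * D)) * invKernel g (z - z') := by
  rcases eq_or_ne z z' with rfl | hne
  · rw [invKernel, sub_self, norm_zero, hg0, ENNReal.ofReal_zero, ENNReal.inv_zero,
      ENNReal.mul_top (by simp; positivity)]
    exact le_top
  · have hρ : 0 < ‖z - z'‖ := norm_pos_iff.2 (sub_ne_zero.2 hne)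
    have hqi := (hq.inverse _ hρ).1
    have hgpos : 0 < g ‖z - z'‖ := by
      rw [hg _ hρ]
      positivity
    calc _ ≤ ∫⁻ p' in S, ENNReal.ofReal (K₁ * ε ^ (2 * D)) *
          ENNReal.ofReal ((max (gaugeDist θ q p p') ‖z - z'‖ ^ D)⁻¹) := by
          refine lintegral_mono_ae ?_
          have hne : ∀ᵐ p' ∂(volume.restrict S), p' ≠ p := by
            refine ae_restrict_of_ae ?_
            rw [Measure.volume_eq_prod]
            exact Measure.ae_ne _ p
          filter_upwards [ae_restrict_mem hSm, hne] with p' hp' hpp'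
          rw [← ENNReal.ofReal_mul (by positivity)]
          refine (h2pt p' hp' (gaugeDist_pos hq hpp')).trans (le_of_eq ?_)
          congr 1
          ring
      _ ≤ ENNReal.ofReal (K₁ * ε ^ (2 * D)) * ENNReal.ofReal (K₂ *
          (‖z - z'‖ ^ ((D : ℝ) - 1 / θ) * qi ‖z - z'‖ ^ (-(d : ℝ)))⁻¹) := by
          rw [lintegral_const_mul' _ _ ENNReal.ofReal_ne_top]
          gcongr
          exact (setLIntegral_le_lintegral _ _).trans (hint _ hρ)
      _ = _ := by
          rw [invKernel, ← ENNReal.ofReal_inv_of_pos hgpos,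
            ← ENNReal.ofReal_mul (by positivity), ← ENNReal.ofReal_mul (by positivity),
            hg _ hρ]
          congr 1
          ring

lemma measurable_invKernel (hgm : Measurable fun τ => g |τ|) :
    Measurable (invKernel g : EuclideanSpace ℝ (Fin D) → ℝ≥0∞) := by
  have := hgm.comp (measurable_norm (α := EuclideanSpace ℝ (Fin D)))
  simp only [Function.comp_def, abs_norm] at this
  exact this.ennreal_ofReal.inv

lemma measurable_measure_nearEvent_inter [IsProbabilityMeasure P] (hm : Continuous m)
    (hVm : ∀ j p, Measurable (V j p)) (hVc : ∀ j ω, Continuous fun p => V j p ω) (ε : ℝ) :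
    Measurable fun y : (SpaceTime d × EuclideanSpace ℝ (Fin D)) ×
      (SpaceTime d × EuclideanSpace ℝ (Fin D)) =>
        P (nearEvent m V ε y.1.1 y.1.2 ∩ nearEvent m V ε y.2.1 y.2.2) := by
  have hGm := measurableSet_nearEvent hm hVm hVc ε
  have h1 := (hGm.preimage (f := fun w : ((SpaceTime d × EuclideanSpace ℝ (Fin D)) ×
      (SpaceTime d × EuclideanSpace ℝ (Fin D))) × Ω => (w.1.1, w.2)) (by fun_prop)).inter
    (hGm.preimage (f := fun w : ((SpaceTime d × EuclideanSpace ℝ (Fin D)) ×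
      (SpaceTime d × EuclideanSpace ℝ (Fin D))) × Ω => (w.1.2, w.2)) (by fun_prop))
  exact measurable_measure_prodMk_left h1

lemma lintegral_prod_le_of_forall {X Y : Type*} [MeasurableSpace X] [MeasurableSpace Y]
    {μ : Measure X} [SFinite μ] {ν : Measure Y} [SFinite ν] {s : Set Y} (hs : MeasurableSet s)
    {f : X × Y → ℝ≥0∞} (hf : Measurable f) {h : Y → ℝ≥0∞}
    (hfh : ∀ y ∈ s, ∫⁻ x, f (x, y) ∂μ ≤ h y) :
    ∫⁻ w, f w ∂(μ.prod (ν.restrict s)) ≤ ∫⁻ y, h y ∂ν := by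
  rw [lintegral_prod_symm _ hf.aemeasurable]
  refine le_trans (lintegral_mono_ae ?_) (lintegral_mono' Measure.restrict_le_self le_rfl)
  filter_upwards [ae_restrict_mem hs] with y hy using hfh y hy

lemma lintegral_prod_lintegral_prod_le {X Y : Type*} [MeasurableSpace X] [MeasurableSpace Y]
    {μ : Measure X} [SFinite μ] {ν : Measure Y} [SFinite ν] {s : Set X} {t : Set Y}
    (hs : MeasurableSet s) (ht : MeasurableSet t)
    {f : (X × Y) × (X × Y) → ℝ≥0∞} (hf : Measurable f) {h : Y × Y → ℝ≥0∞} (hh : Measurable h)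
    (hfh : ∀ x ∈ s, ∀ y ∈ t, ∀ y' ∈ t, ∫⁻ x' in s, f ((x, y), (x', y')) ∂μ ≤ h (y, y')) :
    ∫⁻ w, ∫⁻ w', f (w, w') ∂((μ.restrict s).prod (ν.restrict t))
      ∂((μ.restrict s).prod (ν.restrict t)) ≤ μ s * ∫⁻ y, ∫⁻ y', h (y, y') ∂ν ∂ν := by
  have h1 : ∀ᵐ w ∂((μ.restrict s).prod (ν.restrict t)), w.1 ∈ s ∧ w.2 ∈ t := by
    rw [Measure.prod_restrict]
    filter_upwards [ae_restrict_mem (hs.prod ht)] with x hx using hx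
  have hm2 : Measurable fun y => ∫⁻ y', h (y, y') ∂ν := hh.lintegral_prod_right'
  calc _ ≤ ∫⁻ w, ∫⁻ y', h (w.2, y') ∂ν ∂((μ.restrict s).prod (ν.restrict t)) := by
        refine lintegral_mono_ae ?_
        filter_upwards [h1] with w hw
        exact lintegral_prod_le_of_forall ht (hf.comp (by fun_prop)) fun y' hy' =>
          hfh w.1 hw.1 w.2 hw.2 y' hy'
    _ ≤ _ := by
        have hm3 : Measurable fun w : X × Y => ∫⁻ y', h (w.2, y') ∂ν := hm2.comp measurable_snd
        rw [lintegral_prod _ hm3.aemeasurable]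
        simp only [lintegral_const, Measure.restrict_apply_univ]
        rw [mul_comm]
        gcongr
        exact Measure.restrict_le_self

lemma lintegral_nearEvent_inter_le [IsProbabilityMeasure P] (hm : Continuous m)
    (hVm : ∀ j p, Measurable (V j p)) (hVc : ∀ j ω, Continuous fun p => V j p ω)
    (hSm : MeasurableSet S) {ν : Measure (EuclideanSpace ℝ (Fin D))} [IsProbabilityMeasure ν]
    {K : Set (EuclideanSpace ℝ (Fin D))} (hKm : MeasurableSet K)
    (hvS : (volume : Measure (SpaceTime d)) S = ENNReal.ofReal v) (hgm : Measurable fun τ => g |τ|)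
    {B : ℝ} (hinner : ∀ p ∈ S, ∀ z ∈ K, ∀ z' ∈ K,
      ∫⁻ p' in S, P (nearEvent m V ε p z ∩ nearEvent m V ε p' z') ≤
        ENNReal.ofReal B * invKernel g (z - z')) :
    ∫⁻ x, ∫⁻ x', P (nearEvent m V ε x.1 x.2 ∩ nearEvent m V ε x'.1 x'.2)
      ∂((volume.restrict S).prod (ν.restrict K)) ∂((volume.restrict S).prod (ν.restrict K)) ≤
      ENNReal.ofReal B * (ENNReal.ofReal v * energy (invKernel g) ν) := by
  have hh : Measurable fun y : EuclideanSpace ℝ (Fin D) × EuclideanSpace ℝ (Fin D) =>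
      ENNReal.ofReal B * invKernel g (y.1 - y.2) :=
    ((measurable_invKernel hgm).comp (measurable_fst.sub measurable_snd)).const_mul _
  refine (lintegral_prod_lintegral_prod_le hSm hKm
    (measurable_measure_nearEvent_inter hm hVm hVc ε) hh hinner).trans (le_of_eq ?_)
  rw [hvS, energy]
  simp_rw [lintegral_const_mul' _ _ ENNReal.ofReal_ne_top]
  ring

lemma le_lintegral_nearEvent {k : ℝ} (hk : 0 < k) (hε : 0 < ε) (hv : 0 < v)
    (hSm : MeasurableSet S) {ν : Measure (EuclideanSpace ℝ (Fin D))} [IsProbabilityMeasure ν]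
    {K : Set (EuclideanSpace ℝ (Fin D))} (hKm : MeasurableSet K) (hK : (2 : ℝ≥0∞)⁻¹ ≤ ν K)
    (hvS : (volume : Measure (SpaceTime d)) S = ENNReal.ofReal v)
    (h1pt : ∀ p, ∀ z ∈ K, ENNReal.ofReal (k * ε ^ D) ≤ P (nearEvent m V ε p z)) :
    ENNReal.ofReal (k * ε ^ D * v / 2) ≤
      ∫⁻ x, P (nearEvent m V ε x.1 x.2) ∂((volume.restrict S).prod (ν.restrict K)) := by
  have hlS : ∀ᵐ x ∂((volume.restrict S).prod (ν.restrict K)), x.1 ∈ S ∧ x.2 ∈ K := by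
    rw [Measure.prod_restrict]
    filter_upwards [ae_restrict_mem (hSm.prod hKm)] with x hx using hx
  calc ENNReal.ofReal (k * ε ^ D * v / 2) = ENNReal.ofReal (k * ε ^ D) *
        (ENNReal.ofReal v * 2⁻¹) := by
        rw [← ENNReal.ofReal_ofNat 2, ← ENNReal.ofReal_inv_of_pos (by norm_num),
          ← ENNReal.ofReal_mul hv.le, ← ENNReal.ofReal_mul (by positivity)]
        congr 1
        ring
    _ ≤ ENNReal.ofReal (k * ε ^ D) * ((volume.restrict S).prod (ν.restrict K)) univ := by
        rw [← univ_prod_univ, Measure.prod_prod, Measure.restrict_apply_univ, hvS,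
          Measure.restrict_apply_univ]
        gcongr
    _ = ∫⁻ _x, ENNReal.ofReal (k * ε ^ D) ∂((volume.restrict S).prod (ν.restrict K)) := by
        rw [lintegral_const]
    _ ≤ _ := by
        refine lintegral_mono_ae ?_
        filter_upwards [hlS] with x hx
        exact h1pt x.1 x.2 hx.2

/-- The square of the first moment and the second moment are both of order `ε^{2D}`, so the bound on
the probability does not depend on `ε`. -/
lemma second_moment_quotient_le {k : ℝ} (hk : 0 < k) (hε : 0 < ε) (hv : 0 < v) (hK₁ : 0 < K₁)
    (hK₂ : 0 < K₂) {a b e p : ℝ≥0∞} (ha : ENNReal.ofReal (k * ε ^ D * v / 2) ≤ a)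
    (hb : b ≤ ENNReal.ofReal (K₁ * K₂ * ε ^ (2 * D)) * (ENNReal.ofReal v * e))
    (hab : a ^ 2 ≤ b * p) :
    ENNReal.ofReal (k ^ 2 * v / (4 * (K₁ * K₂))) / e ≤ p := by
  have hfin : ENNReal.ofReal (k * ε ^ D * v / 2) ^ 2 ≤
      ENNReal.ofReal (K₁ * K₂ * ε ^ (2 * D) * v) * (e * p) := by
    refine (pow_le_pow_left' ha 2).trans (hab.trans ?_)
    rw [ENNReal.ofReal_mul (p := K₁ * K₂ * ε ^ (2 * D)) (by positivity), mul_assoc,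
      ← mul_assoc _ e p,
      ← mul_assoc]
    gcongr
  apply ENNReal.div_le_of_le_mul
  have hX : ENNReal.ofReal (K₁ * K₂ * ε ^ (2 * D) * v) ≠ 0 := by simp; positivity
  have hfin' : ENNReal.ofReal (k * ε ^ D * v / 2) ^ 2 / ENNReal.ofReal (K₁ * K₂ * ε ^ (2 * D) * v)
      ≤ e * p := ENNReal.div_le_of_le_mul' hfin
  rw [mul_comm e p] at hfin'
  refine le_trans (le_of_eq ?_) hfin'
  rw [← ENNReal.ofReal_pow (by positivity), ← ENNReal.ofReal_div_of_pos (by positivity)]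
  congr 1
  field_simp
  ring

/-- The events decrease with `ε`, so the uniform lower bound survives on their intersection. There
the field comes arbitrarily close to the compact set, hence it hits it. -/
lemma le_measure_copyHitting_of_forall [IsProbabilityMeasure P] (hm : Continuous m)
    (hVm : ∀ j p, Measurable (V j p)) (hVc : ∀ j ω, Continuous fun p => V j p ω)
    (hS : IsCompact S) {K : Set (EuclideanSpace ℝ (Fin D))} (hK : IsCompact K)
    {l : Measure (SpaceTime d × EuclideanSpace ℝ (Fin D))} [SFinite l]
    (hl : ∀ᵐ x ∂l, x.1 ∈ S ∧ x.2 ∈ K) {a : ℝ≥0∞}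
    (h : ∀ ε, 0 < ε → ε ≤ 1 → a ≤ P {ω | l {x | ω ∈ nearEvent m V ε x.1 x.2} ≠ 0}) :
    a ≤ P (copyHitting S m V K) := by
  obtain ⟨Z, hZ⟩ : ∃ Z : ℕ → Set Ω, Z = fun n : ℕ =>
    {ω | l {x | ω ∈ nearEvent m V (1 / ((n : ℝ) + 1)) x.1 x.2} ≠ 0} := ⟨_, rfl⟩
  have hZm : ∀ n, MeasurableSet (Z n) := fun n => by
    have := measurable_measure_prodMk_right (μ := l)
      (measurableSet_nearEvent hm hVm hVc (1 / ((n : ℝ) + 1))) (measurableSet_singleton 0).compl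
    rw [hZ]
    exact this
  have hanti : Antitone Z := by
    intro n n' hnn' ω hω
    rw [hZ] at hω ⊢
    have hle : 1 / ((n' : ℝ) + 1) ≤ 1 / ((n : ℝ) + 1) := by gcongr
    intro h0
    exact hω (measure_mono_null (fun x hx j => (hx j).trans hle) h0)
  have hlim := tendsto_measure_iInter_atTop (μ := P) (fun n => (hZm n).nullMeasurableSet) hanti
    ⟨0, measure_ne_top _ _⟩
  have ha : a ≤ P (⋂ n, Z n) := by
    refine ge_of_tendsto' hlim fun n => ?_
    rw [hZ]
    refine h _ (by positivity) ?_
    rw [div_le_one (by positivity)]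
    linarith [(Nat.cast_nonneg n : (0 : ℝ) ≤ n)]
  refine ha.trans (measure_mono fun ω hω => ?_)
  refine mem_copyHitting_of_forall hS hm (fun j => hVc j ω) hK fun n => ?_
  have h1 : l {x | ω ∈ nearEvent m V (1 / ((n : ℝ) + 1)) x.1 x.2} ≠ 0 := by
    have := mem_iInter.1 hω n
    rw [hZ] at this
    exact this
  obtain ⟨x, hx, hxS⟩ := (frequently_ae_mem_iff.2 h1).and_eventually hl |>.exists
  exact ⟨x.1, hxS.1, x.2, hxS.2, hx⟩

end SecondMoment

/-- For each admissible `ν` the second moment method yields a constant divided by the energy of `ν`,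
and the supremum over `ν` is the capacity. The constant comes from the one-point bound, the
two-point bound and the volume of the cylinder only. -/
theorem exists_lower_bound {d D : ℕ} (hD : 0 < D) {θ γ : ℝ} {q qi : ℝ → ℝ}
    (hq : IsGauge q qi γ) (hqm : Measurable fun τ => q |τ|) (hθ : 0 < θ)
    (hDQ : 1 / θ + d / γ < D) {c C : ℝ} {Γ : SpaceTime d → SpaceTime d → ℝ}
    {m : SpaceTime d → ℝ} (hΓ : IsControlled θ q c C Γ m) (hm : Continuous m)
    {t₀ T M : ℝ} (hT : t₀ < T) (hM : 0 < M)
    (hS : IsNondegenerate θ q c (Icc t₀ T ×ˢ cube d M) Γ) {g : ℝ → ℝ}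
    (hgm : Measurable fun τ => g |τ|) (hg0 : g 0 = 0)
    (hg : ∀ ρ, 0 < ρ → g ρ = ρ ^ ((D : ℝ) - 1 / θ) * qi ρ ^ (-(d : ℝ))) {N : ℝ} (hN : 0 < N) :
    ∃ c₀ : ℝ, 0 < c₀ ∧ ∀ {Ω : Type u} [MeasurableSpace Ω] (P : Measure Ω)
      [IsProbabilityMeasure P] (V : Fin D → SpaceTime d → Ω → ℝ), IsGaussianCopies P Γ V →
      ∀ A : Set (EuclideanSpace ℝ (Fin D)), MeasurableSet A → A ⊆ Metric.ball 0 N →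
        ENNReal.ofReal c₀ * capacity (invKernel g) A ≤
          P (copyHitting (Icc t₀ T ×ˢ cube d M) m V A) := by
  obtain ⟨K₁, hK₁, h2pt⟩ := exists_two_point_bound.{u} hD hq hΓ hS hN
  obtain ⟨k, hk, h1pt⟩ := exists_one_point_bound.{u} (D := D) hΓ (N := N)
  obtain ⟨K₂, hK₂, hint⟩ := exists_lintegral_gaugeDist_le hq hθ hDQ hqm
  obtain ⟨S, hSdef⟩ : ∃ S : Set (SpaceTime d), S = Icc t₀ T ×ˢ cube d M := ⟨_, rfl⟩
  have hSc : IsCompact S := hSdef ▸ isCompact_Icc.prod (isCompact_cube d M)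
  have hvS0 : (volume : Measure (SpaceTime d)) S ≠ 0 := by
    rw [hSdef, Measure.volume_eq_prod, Measure.prod_prod]
    refine mul_ne_zero ?_ (volume_cube_pos d hM).ne'
    simpa using hT
  have hvS : (volume : Measure (SpaceTime d)) S ≠ ∞ := hSc.measure_lt_top.ne
  rw [← hSdef] at h2pt ⊢
  obtain ⟨v, hv⟩ : ∃ v, v = ((volume : Measure (SpaceTime d)) S).toReal := ⟨_, rfl⟩
  have hv0 : 0 < v := by rw [hv]; exact ENNReal.toReal_pos hvS0 hvS
  have hvS' : (volume : Measure (SpaceTime d)) S = ENNReal.ofReal v := by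
    rw [hv, ENNReal.ofReal_toReal hvS]
  refine ⟨k ^ 2 * v / (4 * (K₁ * K₂)), by positivity, ?_⟩
  intro Ω _ P _ V hV A hA hAN
  unfold capacity
  -- The inverse of an infimum of energies is a supremum of inverses, so it suffices to treat a
  -- single `ν`.
  rw [ENNReal.inv_iInf, ENNReal.mul_iSup]
  refine iSup_le fun ν => ?_
  rw [ENNReal.inv_iInf, ENNReal.mul_iSup]
  refine iSup_le fun hν => ?_
  rw [ENNReal.inv_iInf, ENNReal.mul_iSup]
  refine iSup_le fun hνA => ?_
  rw [← div_eq_mul_inv]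
  have hνA1 : ν A = 1 := by
    have := prob_add_prob_compl (μ := ν) hA
    rwa [hνA, add_zero] at this
  -- Compactness is needed to pass from near hits to hits. Keeping half of the mass costs a constant
  -- in the first moment, while the energy of the whole `ν` still bounds the second.
  obtain ⟨K, hKA, hKc, hK⟩ := hA.exists_lt_isCompact_of_ne_top (μ := ν) (by rw [hνA1]; simp)
    (show (2 : ℝ≥0∞)⁻¹ < ν A by rw [hνA1]; exact ENNReal.one_half_lt_one)
  have hKm := hKc.measurableSet
  have hSm := hSc.measurableSet
  have hzN : ∀ z ∈ K, ‖z‖ ≤ N := fun z hz => (mem_ball_zero_iff.1 (hAN (hKA hz))).le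
  have hlS : ∀ᵐ x ∂((volume.restrict S).prod (ν.restrict K)), x.1 ∈ S ∧ x.2 ∈ K := by
    rw [Measure.prod_restrict]
    filter_upwards [ae_restrict_mem (hSm.prod hKm)] with x hx using hx
  have main := le_measure_copyHitting_of_forall hm hV.measurable hV.continuous hSc hKc hlS
    (a := ENNReal.ofReal (k ^ 2 * v / (4 * (K₁ * K₂))) / energy (invKernel g) ν) (P := P)
    (fun ε hε hε1 => second_moment_quotient_le hk hε hv0 hK₁ hK₂
      (le_lintegral_nearEvent hk hε hv0 hSm hKm hK.le hvS' fun p z hz =>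
        h1pt P V hV p ε hε hε1 z (hzN z hz))
      (lintegral_nearEvent_inter_le hm hV.measurable hV.continuous hSm hKm hvS' hgm
        fun p hp z hz z' hz' => setLIntegral_nearEvent_inter_le hq hSm hK₁ hK₂ hε hg0 hg
          (fun p' hp' hpos => h2pt P V hV p hp p' hp' hpos ε hε hε1 z z' (hzN z hz) (hzN z' hz'))
          (fun ρ hρ => hint ρ hρ p))
      (sq_lintegral_measure_le (measurableSet_nearEvent hm hV.measurable hV.continuous ε)))
  refine main.trans (measure_mono fun ω hω => ?_)
  obtain ⟨p, hp, hpK⟩ := hω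
  exact ⟨p, hp, hKA hpK⟩

/-! ### Limits in `L²` -/

section LTwo

variable {Ω : Type*} [MeasurableSpace Ω] {P : Measure Ω}

lemma tendsto_integral_mul_of_eLpNorm {X Y : ℕ → Ω → ℝ} {X' Y' : Ω → ℝ}
    (hX : ∀ n, MemLp (X n) 2 P) (hX' : MemLp X' 2 P) (hY : ∀ n, MemLp (Y n) 2 P)
    (hY' : MemLp Y' 2 P) (hXl : Tendsto (fun n => eLpNorm (fun ω => X n ω - X' ω) 2 P) atTop (𝓝 0))
    (hYl : Tendsto (fun n => eLpNorm (fun ω => Y n ω - Y' ω) 2 P) atTop (𝓝 0)) :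
    Tendsto (fun n => ∫ ω, X n ω * Y n ω ∂P) atTop (𝓝 (∫ ω, X' ω * Y' ω ∂P)) := by
  have h1 : Tendsto (fun n => (hX n).toLp (X n)) atTop (𝓝 (hX'.toLp X')) :=
    (Lp.tendsto_Lp_iff_tendsto_eLpNorm'' X hX X' hX').2 hXl
  have h2 : Tendsto (fun n => (hY n).toLp (Y n)) atTop (𝓝 (hY'.toLp Y')) :=
    (Lp.tendsto_Lp_iff_tendsto_eLpNorm'' Y hY Y' hY').2 hYl
  have key : ∀ {f g : Ω → ℝ} (hf : MemLp f 2 P) (hg : MemLp g 2 P),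
      inner ℝ (hf.toLp f) (hg.toLp g) = ∫ ω, f ω * g ω ∂P := by
    intro f g hf hg
    rw [L2.inner_def]
    refine integral_congr_ae ?_
    filter_upwards [hf.coeFn_toLp, hg.coeFn_toLp] with ω h1 h2
    rw [h1, h2]
    simp [mul_comm]
  have h3 := h1.inner (𝕜 := ℝ) h2
  simp_rw [key] at h3
  exact h3

lemma tendsto_integral_of_eLpNorm [IsFiniteMeasure P] {X : ℕ → Ω → ℝ} {X' : Ω → ℝ}
    (hX : ∀ n, MemLp (X n) 2 P) (hX' : MemLp X' 2 P)
    (hXl : Tendsto (fun n => eLpNorm (fun ω => X n ω - X' ω) 2 P) atTop (𝓝 0)) :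
    Tendsto (fun n => ∫ ω, X n ω ∂P) atTop (𝓝 (∫ ω, X' ω ∂P)) := by
  have := tendsto_integral_mul_of_eLpNorm hX hX' (fun _ => memLp_const (1 : ℝ)) (memLp_const 1) hXl
    (by simp)
  simpa using this

lemma tendsto_eLpNorm_sum_mul {ι : Type*} [Fintype ι] {Y : ℕ → Ω → ι → ℝ} {X : Ω → ι → ℝ}
    (hY : ∀ n i, MemLp (fun ω => Y n ω i) 2 P) (hX : ∀ i, MemLp (fun ω => X ω i) 2 P)
    (hl : ∀ i, Tendsto (fun n => eLpNorm (fun ω => Y n ω i - X ω i) 2 P) atTop (𝓝 0))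
    (b : ι → ℝ) :
    Tendsto (fun n => eLpNorm (fun ω => ∑ i, b i * Y n ω i - ∑ i, b i * X ω i) 2 P)
      atTop (𝓝 0) := by
  have hle : ∀ n, eLpNorm (fun ω => ∑ i, b i * Y n ω i - ∑ i, b i * X ω i) 2 P ≤
      ∑ i, ENNReal.ofReal ‖b i‖ * eLpNorm (fun ω => Y n ω i - X ω i) 2 P := by
    intro n
    have e : (fun ω => ∑ i, b i * Y n ω i - ∑ i, b i * X ω i) =
        ∑ i, b i • fun ω => Y n ω i - X ω i := by
      ext ω
      simp [Finset.sum_apply, ← Finset.sum_sub_distrib, mul_sub]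
    rw [e]
    refine (eLpNorm_sum_le (fun i _ => ?_) (by norm_num)).trans (le_of_eq ?_)
    · exact (((hY n i).sub (hX i)).const_smul (b i)).1
    · refine Finset.sum_congr rfl fun i _ => ?_
      rw [eLpNorm_const_smul, ← ofReal_norm]
  refine tendsto_of_tendsto_of_tendsto_of_le_of_le tendsto_const_nhds ?_
    (fun n => bot_le) hle
  have : Tendsto (fun n => ∑ i, ENNReal.ofReal ‖b i‖ * eLpNorm (fun ω => Y n ω i - X ω i) 2 P)
      atTop (𝓝 (∑ i, ENNReal.ofReal ‖b i‖ * 0)) :=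
    tendsto_finsetSum _ fun i _ =>
      ENNReal.Tendsto.const_mul (hl i) (Or.inr ENNReal.ofReal_ne_top)
  simpa using this

/-- Gaussianity is tested on linear forms. Convergence in `L²` gives convergence of their means and
variances, and along an almost surely convergent subsequence dominated convergence gives convergence
of the characteristic functions. -/
lemma hasGaussianLaw_of_tendsto_eLpNorm [IsProbabilityMeasure P] {ι : Type*} [Fintype ι]
    {Y : ℕ → Ω → ι → ℝ} {X : Ω → ι → ℝ} (hY : ∀ n, HasGaussianLaw (Y n) P)
    (hX : ∀ i, MemLp (fun ω => X ω i) 2 P)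
    (hl : ∀ i, Tendsto (fun n => eLpNorm (fun ω => Y n ω i - X ω i) 2 P) atTop (𝓝 0)) :
    HasGaussianLaw X P := by
  classical
  have hY2 : ∀ n i, MemLp (fun ω => Y n ω i) 2 P := fun n i => ((hY n).eval i).memLp_two
  have hXm : AEMeasurable X P := aemeasurable_pi_iff.2 fun i => (hX i).1.aemeasurable
  rw [hasGaussianLaw_iff_charFunDual_map_eq hXm]
  intro L
  have hL : ∀ v : ι → ℝ, L v = ∑ i, L (Pi.single i 1) * v i := by
    intro v
    conv_lhs => rw [← Finset.univ_sum_single v, map_sum]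
    refine Finset.sum_congr rfl fun i _ => ?_
    have : Pi.single i (v i) = v i • Pi.single (M := fun _ => ℝ) i (1 : ℝ) := by
      rw [← Pi.single_smul]; simp
    rw [this, map_smul, smul_eq_mul, mul_comm]
  have hlim := tendsto_eLpNorm_sum_mul hY2 hX hl fun i => L (Pi.single i 1)
  have hlim : Tendsto (fun n => eLpNorm (fun ω => L (Y n ω) - L (X ω)) 2 P) atTop (𝓝 0) := by
    refine Tendsto.congr (fun n => ?_) hlim
    congr 1
    ext ω
    rw [hL (Y n ω), hL (X ω)]
  have hx2 : MemLp (fun ω => L (X ω)) 2 P := by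
    have e : (fun ω => L (X ω)) = fun ω => ∑ i, L (Pi.single i 1) * X ω i :=
      funext fun ω => hL (X ω)
    rw [e]
    exact memLp_finsetSum _ fun i _ => (hX i).const_mul _
  have hy2 : ∀ n, MemLp (fun ω => L (Y n ω)) 2 P := fun n => ((hY n).map_fun L).memLp_two
  have hmeas := tendstoInMeasure_of_tendsto_eLpNorm (by norm_num) (fun n => (hy2 n).1) hx2.1 hlim
  obtain ⟨ns, hns, hae⟩ := hmeas.exists_seq_tendsto_ae
  have hmean := (tendsto_integral_of_eLpNorm hy2 hx2 hlim).comp hns.tendsto_atTop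
  have hsq := (tendsto_integral_mul_of_eLpNorm hy2 hx2 hy2 hx2 hlim hlim).comp hns.tendsto_atTop
  have hvar : Tendsto (fun k => Var[fun ω => L (Y (ns k) ω); P]) atTop
      (𝓝 Var[fun ω => L (X ω); P]) := by
    have e : ∀ {f : Ω → ℝ}, MemLp f 2 P → Var[f; P] = ∫ ω, f ω * f ω ∂P - (∫ ω, f ω ∂P) ^ 2 := by
      intro f hf
      rw [variance_eq_sub hf]
      simp [sq]
    rw [e hx2]
    simp_rw [fun k => e (hy2 (ns k))]
    exact hsq.sub (hmean.pow 2)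
  have hchar : Tendsto (fun k => ∫ ω, Complex.exp (L (Y (ns k) ω) * Complex.I) ∂P) atTop
      (𝓝 (∫ ω, Complex.exp (L (X ω) * Complex.I) ∂P)) := by
    refine tendsto_integral_of_dominated_convergence (fun _ => 1) (fun k => ?_)
      (integrable_const _) (fun k => ?_) ?_
    · have := (hy2 (ns k)).1
      exact Complex.continuous_exp.comp_aestronglyMeasurable
        ((Complex.continuous_ofReal.comp_aestronglyMeasurable this).mul_const _)
    · filter_upwards with ω
      rw [Complex.norm_exp_ofReal_mul_I]
    · filter_upwards [hae] with ω hω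
      exact (Complex.continuous_exp.tendsto _).comp
        (((Complex.continuous_ofReal.tendsto _).comp hω).mul_const _)
  have e1 : charFunDual (P.map X) L = ∫ ω, Complex.exp (L (X ω) * Complex.I) ∂P := by
    rw [charFunDual_apply, integral_map hXm (by fun_prop)]
  have e2 : ∀ n, charFunDual (P.map (Y n)) L = ∫ ω, Complex.exp (L (Y n ω) * Complex.I) ∂P := by
    intro n
    rw [charFunDual_apply, integral_map (hY n).aemeasurable (by fun_prop)]
  rw [e1]
  refine tendsto_nhds_unique hchar ?_
  simp_rw [← e2, fun n => (hY n).charFunDual_map_eq_fun L]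
  refine (Complex.continuous_exp.tendsto _).comp (Tendsto.sub ?_ ?_)
  · have := ((Complex.continuous_ofReal.tendsto _).comp hmean).mul_const Complex.I
    simp only [Function.comp_def] at this ⊢
    exact this
  · exact ((Complex.continuous_ofReal.tendsto _).comp hvar).div_const _

end LTwo

/-! ### Wiener integrals -/

namespace Elementary

variable {d : ℕ} {T : ℝ} (φ : Elementary d T) {Ω : Type u} [MeasurableSpace Ω] {P : Measure Ω}
  {W : ℝ → Set (EuclideanSpace ℝ (Fin d)) → Ω → ℝ}

/-- The right end of a summand of an elementary integrand as an index of the noise. -/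
def rightIndex (i : Fin φ.n) : NoiseIndex d T :=
  ⟨(φ.right i, φ.base i), ⟨(φ.left_nonneg i).trans (φ.left_le_right i), φ.right_le i⟩,
    φ.measurable_base i, φ.bounded_base i⟩

/-- The left end of a summand of an elementary integrand as an index of the noise. -/
def leftIndex (i : Fin φ.n) : NoiseIndex d T :=
  ⟨(φ.left i, φ.base i), ⟨φ.left_nonneg i, (φ.left_le_right i).trans (φ.right_le i)⟩,
    φ.measurable_base i, φ.bounded_base i⟩

lemma integral_eq (W : ℝ → Set (EuclideanSpace ℝ (Fin d)) → Ω → ℝ) (ω : Ω) :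
    φ.integral W ω = ∑ i, φ.coef i * (onIndex T W (φ.rightIndex i) ω -
      onIndex T W (φ.leftIndex i) ω) := rfl

lemma isGaussianProcess_integral {ι : Type*} (hW : IsGaussianProcess (onIndex T W) P)
    (φ : ι → Elementary d T) : IsGaussianProcess (fun i ω => (φ i).integral W ω) P := by
  classical
  refine hW.of_isGaussianProcess fun i => ?_
  let I : Finset (NoiseIndex d T) :=
    Finset.univ.image (φ i).rightIndex ∪ Finset.univ.image (φ i).leftIndex
  have hr : ∀ k, (φ i).rightIndex k ∈ I := fun k => by simp [I]
  have hl : ∀ k, (φ i).leftIndex k ∈ I := fun k => by simp [I]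
  refine ⟨I, ∑ k, (φ i).coef k • (ContinuousLinearMap.proj (R := ℝ) (φ := fun _ : I => ℝ)
    ⟨_, hr k⟩ - ContinuousLinearMap.proj (R := ℝ) (φ := fun _ : I => ℝ) ⟨_, hl k⟩), fun ω => ?_⟩
  simp [integral_eq, Finset.restrict]

lemma memLp_integral (hW : IsGaussianProcess (onIndex T W) P) : MemLp (φ.integral W) 2 P :=
  ((isGaussianProcess_integral hW fun _ : Unit => φ).hasGaussianLaw_eval ()).memLp_two

lemma integral_integral_eq_zero {H : ℝ} {Λ : Measure (EuclideanSpace ℝ (Fin d))}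
    (hW : IsNoise P H T Λ W) : ∫ ω, φ.integral W ω ∂P = 0 := by
  simp_rw [integral_eq]
  have hi : ∀ p, Integrable (onIndex T W p) P := fun p =>
    (hW.gaussian.hasGaussianLaw_eval p).integrable
  have hi' : ∀ i ∈ Finset.univ, Integrable (fun ω => φ.coef i * (onIndex T W (φ.rightIndex i) ω -
      onIndex T W (φ.leftIndex i) ω)) P := fun i _ => ((hi _).sub (hi _)).const_mul _
  rw [integral_finsetSum _ hi']
  refine Finset.sum_eq_zero fun i _ => ?_
  rw [integral_const_mul, integral_sub (hi _) (hi _), hW.centred, hW.centred]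
  simp

end Elementary

section WienerIntegral

variable {d : ℕ} {H T : ℝ} {Λ : Measure (EuclideanSpace ℝ (Fin d))} {Ω : Type u}
  [MeasurableSpace Ω] {P : Measure Ω} {W : ℝ → Set (EuclideanSpace ℝ (Fin d)) → Ω → ℝ}

lemma isGaussianProcess_of_isWienerIntegral [IsProbabilityMeasure P] (hW : IsNoise P H T Λ W)
    {ι : Type*} {g : ι → ℝ → EuclideanSpace ℝ (Fin d) → ℝ} {X : ι → Ω → ℝ}
    (hX : ∀ i, IsWienerIntegral P H T Λ W (g i) (X i)) : IsGaussianProcess X P where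
  hasGaussianLaw I := by
    choose hX2 φ _ hφ using hX
    refine hasGaussianLaw_of_tendsto_eLpNorm (Y := fun n ω (i : I) => (φ i n).integral W ω)
      (fun n => ?_) (fun i => hX2 i) (fun i => hφ i)
    exact (Elementary.isGaussianProcess_integral hW.gaussian fun i => φ i n).hasGaussianLaw I

lemma IsWienerIntegral.integral_eq_zero [IsProbabilityMeasure P] (hW : IsNoise P H T Λ W)
    {g : ℝ → EuclideanSpace ℝ (Fin d) → ℝ} {X : Ω → ℝ} (hX : IsWienerIntegral P H T Λ W g X) :
    ∫ ω, X ω ∂P = 0 := by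
  obtain ⟨hX2, φ, -, hφ⟩ := hX
  have h := tendsto_integral_of_eLpNorm (fun n => (φ n).memLp_integral hW.gaussian) hX2 hφ
  simp_rw [fun n => (φ n).integral_integral_eq_zero hW] at h
  exact tendsto_nhds_unique h tendsto_const_nhds

/-- A subsequence of the elementary integrals converges almost surely, so their upper limit
represents `X` as a measurable functional of the noise. In this form independence of the noises
passes to the components of the solution. -/
lemma IsWienerIntegral.exists_measurable [IsProbabilityMeasure P] (hW : IsNoise P H T Λ W)
    {g : ℝ → EuclideanSpace ℝ (Fin d) → ℝ} {X : Ω → ℝ} (hX : IsWienerIntegral P H T Λ W g X) :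
    ∃ F : (NoiseIndex d T → ℝ) → ℝ, Measurable F ∧
      X =ᵐ[P] fun ω => F fun p => onIndex T W p ω := by
  obtain ⟨hX2, φ, -, hφ⟩ := hX
  have hmeas := tendstoInMeasure_of_tendsto_eLpNorm (by norm_num)
    (fun n => ((φ n).memLp_integral hW.gaussian).1) hX2.1 hφ
  obtain ⟨ns, -, hae⟩ := hmeas.exists_seq_tendsto_ae
  have heval : ∀ p, Measurable fun f : NoiseIndex d T → ℝ => f p := fun p => measurable_pi_apply p
  refine ⟨fun f => limsup (fun k => ∑ i, (φ (ns k)).coef i *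
    (f ((φ (ns k)).rightIndex i) - f ((φ (ns k)).leftIndex i))) atTop, ?_, ?_⟩
  · refine Measurable.limsup fun k => Finset.measurable_sum _ fun i _ => ?_
    exact ((heval _).sub (heval _)).const_mul _
  · filter_upwards [hae] with ω hω
    exact hω.limsup_eq.symm

end WienerIntegral

/-! ### Continuous versions -/

/-- Discard one measurable null set, off which all paths are continuous and agree with measurable
versions at the points of a countable dense set. Every other value is a limit of such values, hence
measurable, and on the discarded set the field is put equal to zero. -/
lemma exists_continuous_version {Ω : Type*} [MeasurableSpace Ω] {P : Measure Ω} {E : Type*}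
    [MetricSpace E] [SecondCountableTopology E] [Nonempty E] {ι : Type*} [Countable ι]
    {Y : ι → E → Ω → ℝ}
    (hY : ∀ j p, AEMeasurable (Y j p) P) (hc : ∀ᵐ ω ∂P, ∀ j, Continuous fun p => Y j p ω) :
    ∃ V : ι → E → Ω → ℝ, (∀ j p, Measurable (V j p)) ∧ (∀ j ω, Continuous fun p => V j p ω) ∧
      ∀ᵐ ω ∂P, ∀ j p, V j p ω = Y j p ω := by
  classical
  have hd : ∀ᵐ ω ∂P, ∀ (n : ℕ) j,
      Y j (TopologicalSpace.denseSeq E n) ω = (hY j (TopologicalSpace.denseSeq E n)).mk _ ω := by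
    rw [ae_all_iff]
    intro n
    rw [ae_all_iff]
    intro j
    exact (hY j _).ae_eq_mk
  obtain ⟨s, hs, hsm, hs0⟩ := exists_measurable_superset_of_null (hc.and hd)
  have hsc : ∀ ω ∉ s, (∀ j, Continuous fun p => Y j p ω) ∧ ∀ (n : ℕ) j,
      Y j (TopologicalSpace.denseSeq E n) ω = (hY j (TopologicalSpace.denseSeq E n)).mk _ ω :=
    fun ω hω => by
      by_contra h
      exact hω (hs h)
  refine ⟨fun j p ω => sᶜ.indicator (fun ω => Y j p ω) ω, fun j p => ?_, fun j ω => ?_, ?_⟩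
  · have hp : p ∈ closure (range (TopologicalSpace.denseSeq E)) :=
      TopologicalSpace.denseRange_denseSeq E p
    obtain ⟨x, hx, hxp⟩ := mem_closure_iff_seq_limit.1 hp
    choose n hn using hx
    refine measurable_of_tendsto_metrizable (f := fun k => sᶜ.indicator
      ((hY j (TopologicalSpace.denseSeq E (n k))).mk _))
      (fun k => (hY j _).measurable_mk.indicator hsm.compl) ?_
    rw [tendsto_pi_nhds]
    intro ω
    by_cases hω : ω ∈ s
    · simp [hω]
    · simp only [indicator_of_mem (show ω ∈ sᶜ from hω)]
      simp_rw [← (hsc ω hω).2, hn]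
      exact (((hsc ω hω).1 j).tendsto p).comp hxp
  · by_cases hω : ω ∈ s
    · simpa [hω] using continuous_const
    · simpa [hω] using (hsc ω hω).1 j
  · filter_upwards [compl_mem_ae_iff.2 hs0] with ω hω j p
    rw [indicator_of_mem hω]

/-- The nearest point projection onto `[t₀, T] × [-M, M]^d`. -/
def clampPoint {d : ℕ} (t₀ T M : ℝ) (p : SpaceTime d) : SpaceTime d :=
  (max t₀ (min T p.1), WithLp.toLp 2 fun i => max (-M) (min M (p.2 i)))

section Clamp

variable {d : ℕ} {t₀ T M : ℝ}

lemma clampPoint_mem (hT : t₀ ≤ T) (hM : 0 ≤ M) (p : SpaceTime d) :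
    clampPoint t₀ T M p ∈ Icc t₀ T ×ˢ cube d M :=
  ⟨⟨le_max_left _ _, max_le hT (min_le_left _ _)⟩,
    fun _ => ⟨le_max_left _ _, max_le (by linarith) (min_le_left _ _)⟩⟩

lemma clampPoint_of_mem {p : SpaceTime d} (hp : p ∈ Icc t₀ T ×ˢ cube d M) :
    clampPoint t₀ T M p = p := by
  obtain ⟨⟨h1, h2⟩, h3⟩ := hp
  refine Prod.ext ?_ ?_
  · simp [clampPoint, h1, h2]
  · ext i
    have := h3 i
    simp [clampPoint, this.1, this.2]

lemma continuous_clampPoint : Continuous (clampPoint t₀ T M : SpaceTime d → SpaceTime d) := by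
  unfold clampPoint
  fun_prop

lemma abs_clamp_sub_clamp_le (a b x y : ℝ) :
    |max a (min b x) - max a (min b y)| ≤ |x - y| := by
  have h1 := abs_max_sub_max_le_max a (min b x) a (min b y)
  have h2 := abs_min_sub_min_le_max b x b y
  simp only [sub_self, abs_zero, abs_nonneg, max_eq_right] at h1 h2
  exact h1.trans h2

lemma abs_clampPoint_fst_sub_le (p p' : SpaceTime d) :
    |(clampPoint t₀ T M p).1 - (clampPoint t₀ T M p').1| ≤ |p.1 - p'.1| :=
  abs_clamp_sub_clamp_le _ _ _ _

lemma norm_clampPoint_snd_sub_le (p p' : SpaceTime d) :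
    ‖(clampPoint t₀ T M p).2 - (clampPoint t₀ T M p').2‖ ≤ ‖p.2 - p'.2‖ := by
  rw [EuclideanSpace.norm_eq, EuclideanSpace.norm_eq]
  gcongr with i
  exact abs_clamp_sub_clamp_le (-M) M (p.2 i) (p'.2 i)

end Clamp

/-- The random field solution has, after subtraction of the mean and extension by the values at the
nearest points of the cylinder, a version made of Gaussian copies. -/
theorem exists_isGaussianCopies {d D : ℕ} {H T t₀ M : ℝ} (ht₀ : 0 < t₀) (hT : t₀ ≤ T) (hM : 0 ≤ M)
    {Λ : Measure (EuclideanSpace ℝ (Fin d))} {v₀ : EuclideanSpace ℝ (Fin d) → ℝ}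
    {Γ : SpaceTime d → SpaceTime d → ℝ} {Ω : Type u} [MeasurableSpace Ω] {P : Measure Ω}
    [IsProbabilityMeasure P] {W : Fin D → ℝ → Set (EuclideanSpace ℝ (Fin d)) → Ω → ℝ}
    {U : ℝ → EuclideanSpace ℝ (Fin d) → Ω → EuclideanSpace ℝ (Fin D)}
    (hU : IsSolution P H T Λ v₀ W U) (hc : HasContinuousPaths P t₀ T M U)
    (hm : Continuous fun p : SpaceTime d =>
      initialPart v₀ (clampPoint t₀ T M p).1 (clampPoint t₀ T M p).2)
    (hcov : ∀ (j : Fin D) (p p' : SpaceTime d) (X Y : Ω → ℝ), p.1 ∈ Ioc 0 T → p'.1 ∈ Ioc 0 T →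
      IsWienerIntegral P H T Λ (W j) (fun r z => heatKernel (p.1 - r) (p.2 - z)) X →
      IsWienerIntegral P H T Λ (W j) (fun r z => heatKernel (p'.1 - r) (p'.2 - z)) Y →
      ∫ ω, X ω * Y ω ∂P = Γ p p') :
    ∃ V : Fin D → SpaceTime d → Ω → ℝ,
      IsGaussianCopies P (fun p p' => Γ (clampPoint t₀ T M p) (clampPoint t₀ T M p')) V ∧
      ∀ A, P (hitting t₀ T M U A) = P (copyHitting (Icc t₀ T ×ˢ cube d M)
        (fun p => initialPart v₀ (clampPoint t₀ T M p).1 (clampPoint t₀ T M p).2) V A) := by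
  obtain ⟨κ, hκ⟩ : ∃ κ : SpaceTime d → SpaceTime d, κ = clampPoint t₀ T M := ⟨_, rfl⟩
  have hκm : ∀ p, κ p ∈ Icc t₀ T ×ˢ cube d M := fun p => hκ ▸ clampPoint_mem hT hM p
  have hκt : ∀ p, (κ p).1 ∈ Ioc 0 T := fun p =>
    ⟨ht₀.trans_le (hκm p).1.1, (hκm p).1.2⟩
  have hκc : Continuous κ := hκ ▸ continuous_clampPoint
  rw [← hκ] at hm ⊢
  obtain ⟨Y, hY⟩ : ∃ Y : Fin D → SpaceTime d → Ω → ℝ, Y = fun j p ω =>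
    U (κ p).1 (κ p).2 ω j - initialPart v₀ (κ p).1 (κ p).2 := ⟨_, rfl⟩
  have hYW : ∀ j p, IsWienerIntegral P H T Λ (W j)
      (fun r z => heatKernel ((κ p).1 - r) ((κ p).2 - z)) (Y j p) := fun j p => by
    rw [hY]; exact hU.mild _ (hκt p) _ j
  have hYc : ∀ᵐ ω ∂P, ∀ j, Continuous fun p => Y j p ω := by
    filter_upwards [hc] with ω hω j
    have h1 : Continuous fun p => U (κ p).1 (κ p).2 ω := hω.comp_continuous hκc hκm
    have h2 : Continuous fun p => U (κ p).1 (κ p).2 ω j :=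
      (PiLp.continuous_apply 2 (fun _ : Fin D => ℝ) j).comp h1
    rw [hY]
    exact h2.sub hm
  obtain ⟨V, hVm, hVc, hVY⟩ := exists_continuous_version
    (fun j p => ((hYW j p).1.1).aemeasurable) hYc
  have hVYp : ∀ j p, Y j p =ᵐ[P] V j p := fun j p => by
    filter_upwards [hVY] with ω hω using (hω j p).symm
  refine ⟨V, ⟨hVm, hVc, fun j => ?_, fun j p => ?_, fun j p p' => ?_, ?_⟩, fun A => ?_⟩
  · exact (isGaussianProcess_of_isWienerIntegral (hU.noise j) (hYW j)).congr (hVYp j)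
  · rw [← integral_congr_ae (hVYp j p)]
    exact (hYW j p).integral_eq_zero (hU.noise j)
  · rw [← hcov j _ _ _ _ (hκt p) (hκt p') (hYW j p) (hYW j p')]
    exact integral_congr_ae ((hVYp j p).symm.mul (hVYp j p').symm)
  -- Each component is, at every point, a functional of its own noise. Independence of the
  -- path-valued variables then needs equality only almost surely for each fixed point.
  · choose F hF hFY using fun j p => (hYW j p).exists_measurable (hU.noise j)
    have h1 := hU.indep.comp (fun j f p => F j p f) fun j => measurable_pi_iff.2 fun p => hF j p
    exact h1.process_congr fun j p => (hFY j p).symm.trans (hVYp j p)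
  · refine measure_congr ?_
    filter_upwards [hVY] with ω hω
    have e : ∀ p ∈ Icc t₀ T ×ˢ cube d M, U p.1 p.2 ω =
        WithLp.toLp 2 fun j => initialPart v₀ (κ p).1 (κ p).2 + V j p ω := by
      intro p hp
      ext j
      have h1 : κ p = p := by rw [hκ]; exact clampPoint_of_mem hp
      have h2 := hω j p
      rw [hY] at h2
      simp only [h1] at h2 ⊢
      rw [h2]
      ring
    refine propext ⟨?_, ?_⟩
    · rintro ⟨t, ht, x, hx, h⟩
      refine ⟨(t, x), ⟨ht, hx⟩, ?_⟩
      rw [← e (t, x) ⟨ht, hx⟩]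
      exact h
    · rintro ⟨p, hp, h⟩
      rw [← e p hp] at h
      exact ⟨p.1, hp.1, p.2, hp.2, h⟩

/-! ### The time kernel -/

lemma lintegral_eq_ofReal_mul_lintegral_comp_mul {f : ℝ → ℝ≥0∞} (hf : Measurable f) {c : ℝ}
    (hc : 0 < c) : ∫⁻ x, f x = ENNReal.ofReal c * ∫⁻ x, f (c * x) := by
  conv_lhs => rw [← Real.smul_map_volume_mul_left hc.ne']
  rw [lintegral_smul_measure, lintegral_map hf (by fun_prop), abs_of_pos hc, smul_eq_mul]

/-- The kernel `(r - u)₊ ^ (H - 3/2)`. -/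
def volterra (H r u : ℝ) : ℝ≥0∞ :=
  if u < r then ENNReal.ofReal ((r - u) ^ (H - 3 / 2)) else 0

lemma measurable_volterra (H : ℝ) : Measurable fun p : ℝ × ℝ => volterra H p.1 p.2 := by
  unfold volterra
  refine Measurable.ite (measurableSet_lt (by fun_prop) (by fun_prop)) ?_ measurable_const
  fun_prop

/-- The substitution `u = s - (r - s) x` for `s < r` leaves `(r - s)^{2a+1} ∫₀^∞ (1 + x)^a x^a dx`
with `a = H - 3/2`. Here `2a + 1 = 2H - 2`, and the integral converges because `-1 < a` and `2a <
-1`. Writing the time kernel as such a product makes it positive definite and separates the two time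
variables. -/
lemma exists_volterra_const {H : ℝ} (hH : 1 / 2 < H) (hH1 : H < 1) :
    ∃ B : ℝ, 0 < B ∧ ∀ r s, r ≠ s →
      ∫⁻ u, volterra H r u * volterra H s u = ENNReal.ofReal (B * |r - s| ^ (2 * H - 2)) := by
  obtain ⟨a, ha⟩ : ∃ a, a = H - 3 / 2 := ⟨_, rfl⟩
  obtain ⟨g, hg⟩ : ∃ g : ℝ → ℝ≥0∞, g = fun x => (Ioi 0).indicator
    (fun x => ENNReal.ofReal ((1 + x) ^ a * x ^ a)) x := ⟨_, rfl⟩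
  have hgm : Measurable g := by
    rw [hg]
    exact Measurable.indicator (by fun_prop) measurableSet_Ioi
  have hfin : ∫⁻ x, g x < ∞ := by
    have h1 : ∫⁻ x in Ioc (0 : ℝ) 1, g x < ∞ := by
      have hi : IntegrableOn (fun x : ℝ => x ^ a) (Ioc 0 1) := by
        rw [← intervalIntegrable_iff_integrableOn_Ioc_of_le zero_le_one]
        exact intervalIntegral.intervalIntegrable_rpow' (by linarith)
      refine lt_of_le_of_lt (setLIntegral_mono (by fun_prop) fun x hx => ?_) hi.lintegral_lt_top
      rw [hg]
      simp only [indicator_of_mem (show x ∈ Ioi (0 : ℝ) from hx.1)]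
      apply ENNReal.ofReal_le_ofReal
      have hx0 : 0 ≤ x ^ a := Real.rpow_nonneg hx.1.le _
      have : (1 + x) ^ a ≤ 1 := Real.rpow_le_one_of_one_le_of_nonpos (by linarith [hx.1])
        (by linarith)
      nlinarith
    have h2 : ∫⁻ x in Ioi (1 : ℝ), g x < ∞ := by
      have hi : IntegrableOn (fun x : ℝ => x ^ (2 * a)) (Ioi 1) :=
        integrableOn_Ioi_rpow_of_lt (by linarith) one_pos
      refine lt_of_le_of_lt (setLIntegral_mono (by fun_prop) fun x hx => ?_) hi.lintegral_lt_top
      have hx0 : 0 < x := one_pos.trans hx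
      rw [hg]
      simp only [indicator_of_mem (show x ∈ Ioi (0 : ℝ) from hx0)]
      apply ENNReal.ofReal_le_ofReal
      have h3 : (1 + x) ^ a ≤ x ^ a := Real.rpow_le_rpow_of_nonpos hx0 (by linarith) (by linarith)
      rw [two_mul, Real.rpow_add hx0]
      exact mul_le_mul_of_nonneg_right h3 (by positivity)
    have h3 : ∫⁻ x, g x = ∫⁻ x in Ioi 0, g x := by
      rw [← lintegral_indicator measurableSet_Ioi]
      refine lintegral_congr fun x => ?_
      by_cases hx : x ∈ Ioi (0 : ℝ) <;> simp [hg, hx]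
    rw [h3, ← Ioc_union_Ioi_eq_Ioi (zero_le_one' ℝ)]
    exact (lintegral_union_le _ _ _).trans_lt (ENNReal.add_lt_top.2 ⟨h1, h2⟩)
  have hpos : 0 < ∫⁻ x, g x := by
    rw [lintegral_pos_iff_support hgm]
    refine lt_of_lt_of_le (b := volume (Ioi (0 : ℝ))) (by simp) (measure_mono fun x hx => ?_)
    have hx0 : (0 : ℝ) < x := hx
    simp only [hg, Function.mem_support, indicator_of_mem hx, ne_eq, ENNReal.ofReal_eq_zero, not_le]
    positivity
  have main : ∀ r s, s < r → ∫⁻ u, volterra H r u * volterra H s u =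
      ENNReal.ofReal ((∫⁻ x, g x).toReal * |r - s| ^ (2 * H - 2)) := by
    intro r s hrs
    have hc : 0 < r - s := sub_pos.2 hrs
    have hm : Measurable fun u => volterra H r u * volterra H s u :=
      ((measurable_volterra H).comp (f := fun u => (r, u)) (by fun_prop)).mul
        ((measurable_volterra H).comp (f := fun u => (s, u)) (by fun_prop))
    have hm' : Measurable fun x => volterra H r (s - x) * volterra H s (s - x) :=
      hm.comp (f := fun x => s - x) (by fun_prop)
    -- Reflect at the smaller time `s` and scale by the gap `r - s`.
    rw [← lintegral_sub_left_eq_self _ s, lintegral_eq_ofReal_mul_lintegral_comp_mul hm' hc]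
    have hpt : ∀ x, volterra H r (s - (r - s) * x) * volterra H s (s - (r - s) * x) =
        ENNReal.ofReal ((r - s) ^ (2 * a)) * g x := by
      intro x
      by_cases hx : 0 < x
      · have h1 : s - (r - s) * x < s := by nlinarith
        have h2 : s - (r - s) * x < r := by linarith
        rw [volterra, volterra, if_pos h1, if_pos h2, hg]
        simp only [indicator_of_mem (show x ∈ Ioi (0 : ℝ) from hx), ← ha]
        rw [← ENNReal.ofReal_mul (by apply Real.rpow_nonneg; linarith),
          ← ENNReal.ofReal_mul (by positivity)]
        congr 1
        have e1 : r - (s - (r - s) * x) = (r - s) * (1 + x) := by ring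
        have e2 : s - (s - (r - s) * x) = (r - s) * x := by ring
        rw [e1, e2, Real.mul_rpow hc.le (by linarith), Real.mul_rpow hc.le hx.le, two_mul,
          Real.rpow_add hc]
        ring
      · have h1 : ¬ s - (r - s) * x < s := by
          push Not at hx ⊢
          nlinarith
        rw [volterra, volterra, if_neg h1, mul_zero, hg]
        simp [indicator_of_notMem (show x ∉ Ioi (0 : ℝ) from hx)]
    simp_rw [hpt]
    rw [lintegral_const_mul _ hgm, ← mul_assoc, ← ENNReal.ofReal_mul hc.le, mul_comm,
      ENNReal.ofReal_mul ENNReal.toReal_nonneg, ENNReal.ofReal_toReal hfin.ne, abs_of_pos hc]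
    congr 2
    have : (r - s) * (r - s) ^ (2 * a) = (r - s) ^ (1 : ℝ) * (r - s) ^ (2 * a) := by simp
    rw [this, ← Real.rpow_add hc, ha]
    congr 1
    ring
  refine ⟨(∫⁻ x, g x).toReal, ENNReal.toReal_pos hpos.ne' hfin.ne, fun r s hrs => ?_⟩
  rcases lt_or_gt_of_ne hrs with h | h
  · rw [abs_sub_comm, ← main s r h]
    simp_rw [mul_comm]
  · exact main r s h

/-- The odd extension of `x ↦ x ^ p`. -/
def oddPow (p x : ℝ) : ℝ := max x 0 ^ p - max (-x) 0 ^ p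

lemma oddPow_neg (p x : ℝ) : oddPow p (-x) = -oddPow p x := by
  simp [oddPow]

lemma oddPow_of_nonneg {p x : ℝ} (hp : 0 < p) (hx : 0 ≤ x) : oddPow p x = x ^ p := by
  simp [oddPow, hx, Real.zero_rpow hp.ne']

lemma continuous_oddPow {p : ℝ} (hp : 0 < p) : Continuous (oddPow p) := by
  unfold oddPow
  exact ((continuous_id.max continuous_const).rpow_const fun _ => Or.inr hp.le).sub
    ((continuous_neg.max continuous_const).rpow_const fun _ => Or.inr hp.le)

lemma monotone_oddPow {p : ℝ} (hp : 0 < p) : Monotone (oddPow p) := by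
  intro x y hxy
  have h1 : max x 0 ^ p ≤ max y 0 ^ p :=
    Real.rpow_le_rpow (le_max_right _ _) (max_le_max_right _ hxy) hp.le
  have h2 : max (-y) 0 ^ p ≤ max (-x) 0 ^ p :=
    Real.rpow_le_rpow (le_max_right _ _) (max_le_max_right _ (neg_le_neg hxy)) hp.le
  unfold oddPow
  linarith

lemma intervalIntegrable_abs_rpow {q : ℝ} (hq : -1 < q) (a b : ℝ) :
    IntervalIntegrable (fun x => |x| ^ q) volume a b := by
  have hpos : ∀ b, 0 ≤ b → IntervalIntegrable (fun x => |x| ^ q) volume 0 b := by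
    intro b hb
    refine (intervalIntegral.intervalIntegrable_rpow' hq (a := 0) (b := b)).congr fun x hx => ?_
    rw [uIoc_of_le hb] at hx
    simp [abs_of_pos hx.1]
  have h0 : ∀ b, IntervalIntegrable (fun x => |x| ^ q) volume 0 b := by
    intro b
    rcases le_total 0 b with h | h
    · exact hpos b h
    · rw [IntervalIntegrable.iff_comp_neg (by finiteness), neg_zero]
      simpa using hpos (-b) (by linarith)
  exact (h0 a).symm.trans (h0 b)

lemma integral_abs_rpow {q : ℝ} (hq : -1 < q) (a b : ℝ) :
    ∫ x in a..b, |x| ^ q = (oddPow (q + 1) b - oddPow (q + 1) a) / (q + 1) := by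
  have hq1 : 0 < q + 1 := by linarith
  have hpos : ∀ b, 0 ≤ b → ∫ x in 0..b, |x| ^ q = oddPow (q + 1) b / (q + 1) := by
    intro b hb
    have : ∫ x in 0..b, |x| ^ q = ∫ x in 0..b, x ^ q := by
      refine intervalIntegral.integral_congr fun x hx => ?_
      rw [uIcc_of_le hb] at hx
      simp [abs_of_nonneg hx.1]
    rw [this, integral_rpow (Or.inl hq), oddPow_of_nonneg hq1 hb, Real.zero_rpow hq1.ne', sub_zero]
  have h0 : ∀ b, ∫ x in 0..b, |x| ^ q = oddPow (q + 1) b / (q + 1) := by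
    intro b
    rcases le_total 0 b with h | h
    · exact hpos b h
    · have h1 := hpos (-b) (by linarith)
      have h2 := intervalIntegral.integral_comp_neg (a := 0) (b := b) fun x : ℝ => |x| ^ q
      simp only [abs_neg, neg_zero] at h2
      rw [intervalIntegral.integral_symm 0 (-b), h1, oddPow_neg] at h2
      rw [h2]
      ring
  have hi := fun a b => intervalIntegrable_abs_rpow hq a b
  rw [← intervalIntegral.integral_interval_sub_left (hi 0 b) (hi 0 a), h0, h0]
  ring

lemma integral_oddPow {p : ℝ} (hp : 0 < p) (a b : ℝ) :
    ∫ x in a..b, oddPow p x = (|b| ^ (p + 1) - |a| ^ (p + 1)) / (p + 1) := by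
  have hp1 : 0 < p + 1 := by linarith
  have hpos : ∀ b, 0 ≤ b → ∫ x in 0..b, oddPow p x = |b| ^ (p + 1) / (p + 1) := by
    intro b hb
    have : ∫ x in 0..b, oddPow p x = ∫ x in 0..b, x ^ p := by
      refine intervalIntegral.integral_congr fun x hx => ?_
      rw [uIcc_of_le hb] at hx
      exact oddPow_of_nonneg hp hx.1
    rw [this, integral_rpow (Or.inl (by linarith)), abs_of_nonneg hb, Real.zero_rpow hp1.ne',
      sub_zero]
  have h0 : ∀ b, ∫ x in 0..b, oddPow p x = |b| ^ (p + 1) / (p + 1) := by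
    intro b
    rcases le_total 0 b with h | h
    · exact hpos b h
    · have h1 := hpos (-b) (by linarith)
      have h2 := intervalIntegral.integral_comp_neg (a := 0) (b := b) (oddPow p)
      simp only [oddPow_neg, neg_zero, intervalIntegral.integral_neg] at h2
      rw [intervalIntegral.integral_symm 0 (-b), h1, abs_neg] at h2
      linarith
  have hi := fun a b => (continuous_oddPow hp).intervalIntegrable (μ := volume) a b
  rw [← intervalIntegral.integral_interval_sub_left (hi 0 b) (hi 0 a), h0, h0]
  ring

/-- The measure `H (2H - 1) |r - s|^{2H - 2} dr ds` on `(0, T]²`. -/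
def timeMeasure (H T : ℝ) : Measure (ℝ × ℝ) :=
  ((volume.restrict (Ioc 0 T)).prod (volume.restrict (Ioc 0 T))).withDensity
    fun p => ENNReal.ofReal (H * (2 * H - 1) * |p.1 - p.2| ^ (2 * H - 2))

/-- Two antiderivatives turn `H (2H - 1) |r - s|^{2H-2}` into the second difference of the
fractional covariance over the rectangle. The sign is recorded as well, since otherwise
`ENNReal.ofReal` would lose the value. -/
lemma timeMeasure_prod {H T : ℝ} (hH : 1 / 2 < H) {a b c e : ℝ} (ha : 0 ≤ a) (hab : a ≤ b)
    (hb : b ≤ T) (hc : 0 ≤ c) (hce : c ≤ e) (he : e ≤ T) :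
    timeMeasure H T (Ioc a b ×ˢ Ioc c e) =
      ENNReal.ofReal (fbmCov H b e - fbmCov H a e - fbmCov H b c + fbmCov H a c) ∧
    0 ≤ fbmCov H b e - fbmCov H a e - fbmCov H b c + fbmCov H a c := by
  have hp : 0 < 2 * H - 1 := by linarith
  have hin : ∀ r, ∫⁻ s in Ioc c e, ENNReal.ofReal (H * (2 * H - 1) * |r - s| ^ (2 * H - 2)) =
      ENNReal.ofReal (H * (oddPow (2 * H - 1) (e - r) - oddPow (2 * H - 1) (c - r))) := by
    intro r
    have hi := (intervalIntegrable_abs_rpow (q := 2 * H - 2) (by linarith)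
      (c - r) (e - r)).comp_sub_right r
    simp only [sub_add_cancel] at hi
    have hi2 := hi.const_mul (H * (2 * H - 1))
    rw [← ofReal_integral_eq_lintegral_ofReal]
    · congr 1
      rw [← intervalIntegral.integral_of_le hce, intervalIntegral.integral_const_mul]
      have := intervalIntegral.integral_comp_sub_right (a := c) (b := e)
        (fun x : ℝ => |x| ^ (2 * H - 2)) r
      simp_rw [abs_sub_comm r]
      rw [this, integral_abs_rpow (by linarith), show 2 * H - 2 + 1 = 2 * H - 1 by ring]
      obtain ⟨w, hw⟩ : ∃ w, w = 2 * H - 1 := ⟨_, rfl⟩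
      rw [← hw] at hp ⊢
      field_simp
    · simp_rw [abs_sub_comm r]
      exact (intervalIntegrable_iff_integrableOn_Ioc_of_le hce).1 hi2
    · exact ae_of_all _ fun s => by have : 0 < H := by linarith
                                    positivity
  have hcont : ∀ e, Continuous fun r => oddPow (2 * H - 1) (e - r) := fun e =>
    (continuous_oddPow hp).comp (by fun_prop)
  have hint : ∀ e, ∫ r in a..b, oddPow (2 * H - 1) (e - r) =
      (|a - e| ^ (2 * H) - |b - e| ^ (2 * H)) / (2 * H) := by
    intro e
    rw [intervalIntegral.integral_comp_sub_left (fun x => oddPow (2 * H - 1) x) e,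
      integral_oddPow hp, show 2 * H - 1 + 1 = 2 * H by ring, abs_sub_comm e, abs_sub_comm e]
  have hval : ∫ r in Ioc a b, H * (oddPow (2 * H - 1) (e - r) - oddPow (2 * H - 1) (c - r)) =
      fbmCov H b e - fbmCov H a e - fbmCov H b c + fbmCov H a c := by
    rw [← intervalIntegral.integral_of_le hab, intervalIntegral.integral_const_mul,
      intervalIntegral.integral_sub ((hcont e).intervalIntegrable _ _)
        ((hcont c).intervalIntegrable _ _), hint, hint]
    unfold fbmCov
    field_simp
    ring
  have hnn : ∀ r, 0 ≤ H * (oddPow (2 * H - 1) (e - r) - oddPow (2 * H - 1) (c - r)) := by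
    intro r
    have := monotone_oddPow hp (show c - r ≤ e - r by linarith)
    have hH0 : 0 ≤ H := by linarith
    exact mul_nonneg hH0 (sub_nonneg.2 this)
  rw [← hval]
  refine ⟨?_, integral_nonneg hnn⟩
  rw [timeMeasure, withDensity_apply _ (measurableSet_Ioc.prod measurableSet_Ioc),
    Measure.prod_restrict, Measure.restrict_restrict (measurableSet_Ioc.prod measurableSet_Ioc),
    prod_inter_prod, ← Measure.prod_restrict]
  have hsub : ∀ {a b}, 0 ≤ a → b ≤ T → Ioc a b ∩ Ioc 0 T = Ioc a b := fun ha hb =>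
    inter_eq_left.2 (Ioc_subset_Ioc ha hb)
  rw [hsub ha hb, hsub hc he, lintegral_prod _ (by fun_prop)]
  simp only [hin]
  rw [← ofReal_integral_eq_lintegral_ofReal]
  · exact (((hcont e).sub (hcont c)).const_smul H).integrableOn_Ioc
  · exact ae_of_all _ hnn

/-! ### The spatial covariance -/

section Spatial

variable {d : ℕ}

lemma isLocallyFiniteMeasure_of_hasTemperateGrowth
    {Λ : Measure (EuclideanSpace ℝ (Fin d))} (h : Λ.HasTemperateGrowth) :
    (∀ R : ℝ, Λ (Metric.ball 0 R) < ∞) ∧ IsLocallyFiniteMeasure Λ := by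
  obtain ⟨n, hn⟩ := h.exists_integrable
  have key : ∀ R : ℝ, Λ (Metric.ball 0 R) < ∞ := by
    intro R
    have hpos : 0 < (1 + max R 0) ^ (-(n : ℝ)) := by positivity
    refine lt_of_le_of_lt (measure_mono fun x hx => ?_) (hn.measure_norm_ge_lt_top hpos)
    rw [mem_ball_zero_iff] at hx
    have : (1 + max R 0) ^ (-(n : ℝ)) ≤ (1 + ‖x‖) ^ (-(n : ℝ)) :=
      Real.rpow_le_rpow_of_nonpos (by positivity)
        (by linarith [le_max_left R 0]) (by simp)
    exact this.trans (le_abs_self _)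
  refine ⟨key, ⟨fun x => ⟨Metric.ball 0 (‖x‖ + 1), ?_, key _⟩⟩⟩
  exact Metric.isOpen_ball.mem_nhds (by simp)

/-- The pairs `(v, w)` with `w + v ∈ A` and `w ∈ B`. -/
def shiftSet (A B : Set (EuclideanSpace ℝ (Fin d))) :
    Set (EuclideanSpace ℝ (Fin d) × EuclideanSpace ℝ (Fin d)) :=
  {y | y.2 ∈ B ∧ y.2 + y.1 ∈ A}

lemma measurableSet_shiftSet {A B : Set (EuclideanSpace ℝ (Fin d))} (hA : MeasurableSet A)
    (hB : MeasurableSet B) : MeasurableSet (shiftSet A B) :=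
  (hB.preimage measurable_snd).inter
    (hA.preimage (f := fun y : EuclideanSpace ℝ (Fin d) × EuclideanSpace ℝ (Fin d) => y.2 + y.1)
      (by fun_prop))

variable {Λ : Measure (EuclideanSpace ℝ (Fin d))} {H T : ℝ} {Ω : Type u} [MeasurableSpace Ω]
  {P : Measure Ω} {W : ℝ → Set (EuclideanSpace ℝ (Fin d)) → Ω → ℝ}

/-- Positive definiteness of the spatial covariance is read off from the noise: the second moment of
`∑ (aᵢ - bᵢ) W(T, Aᵢ)` is nonnegative, and covariances at time `T` are `T^{2H}` times the spatial
ones. Symmetry comes from the same identity. -/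
lemma two_mul_sum_spatialCov_le (hT : 0 < T) (hH : 0 < H) (hW : IsNoise P H T Λ W)
    {ι : Type*} (s : Finset ι) (A : ι → Set (EuclideanSpace ℝ (Fin d)))
    (hA : ∀ i, MeasurableSet (A i)) (hA' : ∀ i, Bornology.IsBounded (A i)) (a b : ι → ℝ) :
    2 * ∑ i ∈ s, ∑ j ∈ s, a i * b j * spatialCov Λ (A i) (A j) ≤
      ∑ i ∈ s, ∑ j ∈ s, a i * a j * spatialCov Λ (A i) (A j) +
        ∑ i ∈ s, ∑ j ∈ s, b i * b j * spatialCov Λ (A i) (A j) := by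
  obtain ⟨p, hp⟩ : ∃ p : ι → NoiseIndex d T, ∀ i, p i = ⟨(T, A i), ⟨hT.le, le_rfl⟩, hA i, hA' i⟩ :=
    ⟨_, fun i => rfl⟩
  have hcov : ∀ i j, ∫ ω, onIndex T W (p i) ω * onIndex T W (p j) ω ∂P =
      T ^ (2 * H) * spatialCov Λ (A i) (A j) := by
    intro i j
    rw [hW.covariance, hp, hp, fbmCov]
    simp only [sub_self, abs_zero]
    rw [Real.zero_rpow (by positivity)]
    ring
  have hi : ∀ i j, Integrable (fun ω => onIndex T W (p i) ω * onIndex T W (p j) ω) P := fun i j =>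
    (hW.gaussian.hasGaussianLaw_eval (p i)).memLp_two.integrable_mul
      (hW.gaussian.hasGaussianLaw_eval (p j)).memLp_two
  have hsymm : ∀ i j, T ^ (2 * H) * spatialCov Λ (A i) (A j) =
      T ^ (2 * H) * spatialCov Λ (A j) (A i) := by
    intro i j
    rw [← hcov, ← hcov]
    simp_rw [mul_comm]
  have h0 : 0 ≤ ∑ i ∈ s, ∑ j ∈ s, (a i - b i) * (a j - b j) *
      (T ^ (2 * H) * spatialCov Λ (A i) (A j)) := by
    have : ∑ i ∈ s, ∑ j ∈ s, (a i - b i) * (a j - b j) *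
        (T ^ (2 * H) * spatialCov Λ (A i) (A j)) =
        ∫ ω, (∑ i ∈ s, (a i - b i) * onIndex T W (p i) ω) ^ 2 ∂P := by
      simp_rw [sq, Finset.sum_mul_sum, ← hcov]
      rw [integral_finsetSum]
      · refine Finset.sum_congr rfl fun i _ => ?_
        rw [integral_finsetSum]
        · refine Finset.sum_congr rfl fun j _ => ?_
          rw [← integral_const_mul]
          refine integral_congr_ae (ae_of_all _ fun ω => ?_)
          ring
        · intro j _
          refine ((hi i j).const_mul ((a i - b i) * (a j - b j))).congr (ae_of_all _ fun ω => ?_)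
          ring
      · intro i _
        refine integrable_finsetSum _ fun j _ => ?_
        refine ((hi i j).const_mul ((a i - b i) * (a j - b j))).congr (ae_of_all _ fun ω => ?_)
        ring
    rw [this]
    exact integral_nonneg fun ω => sq_nonneg _
  have hTH : 0 < T ^ (2 * H) := by positivity
  have hs : ∀ i j, spatialCov Λ (A i) (A j) = spatialCov Λ (A j) (A i) := fun i j =>
    mul_left_cancel₀ hTH.ne' (hsymm i j)
  have hab : ∑ i ∈ s, ∑ j ∈ s, b i * a j * spatialCov Λ (A i) (A j) =
      ∑ i ∈ s, ∑ j ∈ s, a i * b j * spatialCov Λ (A i) (A j) := by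
    rw [Finset.sum_comm]
    refine Finset.sum_congr rfl fun i _ => Finset.sum_congr rfl fun j _ => ?_
    rw [hs]; ring
  have hexp : ∑ i ∈ s, ∑ j ∈ s, (a i - b i) * (a j - b j) *
      (T ^ (2 * H) * spatialCov Λ (A i) (A j)) = T ^ (2 * H) *
      (∑ i ∈ s, ∑ j ∈ s, a i * a j * spatialCov Λ (A i) (A j) +
        ∑ i ∈ s, ∑ j ∈ s, b i * b j * spatialCov Λ (A i) (A j) -
        ∑ i ∈ s, ∑ j ∈ s, a i * b j * spatialCov Λ (A i) (A j) -
        ∑ i ∈ s, ∑ j ∈ s, b i * a j * spatialCov Λ (A i) (A j)) := by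
    simp only [← Finset.sum_add_distrib, ← Finset.sum_sub_distrib, Finset.mul_sum]
    refine Finset.sum_congr rfl fun i _ => Finset.sum_congr rfl fun j _ => ?_
    ring
  rw [hexp, hab] at h0
  have := nonneg_of_mul_nonneg_right h0 hTH
  linarith

variable [SFinite Λ]

lemma measure_shiftSet (hΛ : ∀ R : ℝ, Λ (Metric.ball 0 R) < ∞)
    {A B : Set (EuclideanSpace ℝ (Fin d))} (hA : MeasurableSet A) (hB : MeasurableSet B)
    (hA' : Bornology.IsBounded A) (hB' : Bornology.IsBounded B) :
    (Λ.prod volume) (shiftSet A B) = ENNReal.ofReal (spatialCov Λ A B) ∧ 0 ≤ spatialCov Λ A B := by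
  have hZ := measurableSet_shiftSet hA hB
  refine ⟨?_, integral_nonneg fun _ => measureReal_nonneg⟩
  obtain ⟨R, hR⟩ := hA'.subset_ball 0
  obtain ⟨R', hR'⟩ := hB'.subset_ball 0
  have hfin : (Λ.prod volume) (shiftSet A B) < ∞ := by
    refine lt_of_le_of_lt (measure_mono (t := Metric.ball 0 (R + R') ×ˢ Metric.ball 0 R') ?_) ?_
    · rintro ⟨v, w⟩ ⟨h1, h2⟩
      have h3 := mem_ball_zero_iff.1 (hR' h1)
      have h4 := mem_ball_zero_iff.1 (hR h2)
      refine ⟨?_, hR' h1⟩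
      rw [mem_ball_zero_iff]
      have : v = w + v - w := by abel
      simp only at h3 h4 ⊢
      rw [this]
      exact (norm_sub_le _ _).trans_lt (by linarith)
    · rw [Measure.prod_prod]
      exact ENNReal.mul_lt_top (hΛ _) measure_ball_lt_top
  rw [spatialCov]
  simp only [measureReal_def]
  have hm : Measurable fun v => (volume : Measure (EuclideanSpace ℝ (Fin d)))
      {w | w ∈ B ∧ w + v ∈ A} := measurable_measure_prodMk_left hZ
  have heq : (Λ.prod volume) (shiftSet A B) =
      ∫⁻ v, (volume : Measure (EuclideanSpace ℝ (Fin d))) {w | w ∈ B ∧ w + v ∈ A} ∂Λ :=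
    Measure.prod_apply hZ
  rw [integral_toReal hm.aemeasurable, ← heq, ENNReal.ofReal_toReal hfin.ne]
  refine ae_of_all _ fun v => ?_
  exact lt_of_le_of_lt (measure_mono (t := Metric.ball 0 R') fun w hw => hR' hw.1)
    measure_ball_lt_top

/-- The form `∫ Λ(dv) ∫ f(w + v) g(w) dw`. -/
def spatialForm (Λ : Measure (EuclideanSpace ℝ (Fin d)))
    (f g : EuclideanSpace ℝ (Fin d) → ℝ≥0∞) : ℝ≥0∞ :=
  ∫⁻ y, f (y.2 + y.1) * g y.2 ∂(Λ.prod volume)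

lemma spatialForm_sum {ι : Type*} (s : Finset ι) (A : ι → Set (EuclideanSpace ℝ (Fin d)))
    (hA : ∀ i, MeasurableSet (A i)) (a b : ι → ℝ≥0∞) :
    spatialForm Λ (fun z => ∑ i ∈ s, a i * (A i).indicator 1 z)
      (fun z => ∑ i ∈ s, b i * (A i).indicator 1 z) =
      ∑ i ∈ s, ∑ j ∈ s, a i * b j * (Λ.prod volume) (shiftSet (A i) (A j)) := by
  have hm : ∀ i j, Measurable ((shiftSet (A i) (A j)).indicator
      (1 : EuclideanSpace ℝ (Fin d) × EuclideanSpace ℝ (Fin d) → ℝ≥0∞)) := fun i j =>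
    measurable_one.indicator (measurableSet_shiftSet (hA i) (hA j))
  unfold spatialForm
  have hpt : ∀ y : EuclideanSpace ℝ (Fin d) × EuclideanSpace ℝ (Fin d),
      (∑ i ∈ s, a i * (A i).indicator 1 (y.2 + y.1)) * ∑ j ∈ s, b j * (A j).indicator 1 y.2 =
      ∑ i ∈ s, ∑ j ∈ s, a i * b j * (shiftSet (A i) (A j)).indicator
        (1 : EuclideanSpace ℝ (Fin d) × EuclideanSpace ℝ (Fin d) → ℝ≥0∞) y := by
    intro y
    rw [Finset.sum_mul_sum]
    refine Finset.sum_congr rfl fun i _ => Finset.sum_congr rfl fun j _ => ?_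
    by_cases h1 : y.2 ∈ A j <;> by_cases h2 : y.2 + y.1 ∈ A i <;>
      simp [shiftSet, indicator, h1, h2]
  simp_rw [hpt]
  rw [lintegral_finsetSum _ fun i _ => Finset.measurable_sum _ fun j _ => (hm i j).const_mul _]
  refine Finset.sum_congr rfl fun i _ => ?_
  rw [lintegral_finsetSum _ fun j _ => (hm i j).const_mul _]
  refine Finset.sum_congr rfl fun j _ => ?_
  rw [lintegral_const_mul _ (hm i j), lintegral_indicator_one
    (measurableSet_shiftSet (hA i) (hA j))]

/-- Approximate both functions from below by simple functions cut off to balls, where the inequality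
is the one for finite sums, and pass to the limit by monotone convergence. -/
lemma two_mul_spatialForm_le (hT : 0 < T) (hH : 0 < H) (hW : IsNoise P H T Λ W)
    (hΛ : ∀ R : ℝ, Λ (Metric.ball 0 R) < ∞)
    {f g : EuclideanSpace ℝ (Fin d) → ℝ≥0∞} (hf : Measurable f) (hg : Measurable g) :
    2 * spatialForm Λ f g ≤ spatialForm Λ f f + spatialForm Λ g g := by
  obtain ⟨F, hF⟩ : ∃ F : (EuclideanSpace ℝ (Fin d) → ℝ≥0∞) → ℕ → EuclideanSpace ℝ (Fin d) → ℝ≥0∞,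
    F = fun f (n : ℕ) z => (Metric.ball 0 (n : ℝ)).indicator (SimpleFunc.eapprox f n) z := ⟨_, rfl⟩
  have hFm : ∀ f n, Measurable (F f n) := fun f n => by
    rw [hF]
    exact (SimpleFunc.measurable _).indicator measurableSet_ball
  have hmono : ∀ f, Monotone (F f) := by
    intro f n m hnm z
    rw [hF]
    have hb : Metric.ball (0 : EuclideanSpace ℝ (Fin d)) (n : ℝ) ⊆ Metric.ball 0 (m : ℝ) :=
      Metric.ball_subset_ball (by exact_mod_cast hnm)
    exact (indicator_le_indicator_of_subset hb (fun _ => bot_le) z).trans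
      (indicator_le_indicator (SimpleFunc.monotone_eapprox f hnm z))
  have hsup : ∀ {f : EuclideanSpace ℝ (Fin d) → ℝ≥0∞}, Measurable f → ∀ z, ⨆ n, F f n z = f z := by
    intro f hf z
    refine le_antisymm (iSup_le fun n => ?_) ?_
    · rw [hF]
      refine (indicator_le_self _ _ z).trans ?_
      rw [← SimpleFunc.iSup_eapprox_apply hf z]
      exact le_iSup (fun n => SimpleFunc.eapprox f n z) n
    · rw [← SimpleFunc.iSup_eapprox_apply hf z]
      refine iSup_le fun n => ?_
      obtain ⟨k, hk⟩ := exists_nat_gt ‖z‖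
      refine le_trans ?_ (le_iSup _ (max n k))
      rw [hF]
      have hz : z ∈ Metric.ball (0 : EuclideanSpace ℝ (Fin d)) ((max n k : ℕ) : ℝ) := by
        rw [mem_ball_zero_iff]
        exact hk.trans_le (by exact_mod_cast le_max_right n k)
      simp only [indicator_of_mem hz]
      exact SimpleFunc.monotone_eapprox f (le_max_left n k) z
  have hle : ∀ {f : EuclideanSpace ℝ (Fin d) → ℝ≥0∞}, Measurable f → ∀ n z, F f n z ≤ f z := by
    intro f hf n z
    rw [← hsup hf z]
    exact le_iSup (fun n => F f n z) n
  have hn : ∀ n, 2 * spatialForm Λ (F f n) (F g n) ≤ spatialForm Λ f f + spatialForm Λ g g := by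
    intro n
    -- The fibres of the pair give one partition on which both approximations are constant.
    -- Intersecting with a ball makes its pieces admissible for the noise and their covariances
    -- finite.
    obtain ⟨p, hp⟩ : ∃ p, p = (SimpleFunc.eapprox f n).pair (SimpleFunc.eapprox g n) := ⟨_, rfl⟩
    obtain ⟨A, hA⟩ : ∃ A : ℝ≥0∞ × ℝ≥0∞ → Set (EuclideanSpace ℝ (Fin d)),
      A = fun y => p ⁻¹' {y} ∩ Metric.ball 0 (n : ℝ) := ⟨_, rfl⟩
    have hAm : ∀ y, MeasurableSet (A y) := fun y => by
      rw [hA]; exact (p.measurableSet_fiber y).inter measurableSet_ball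
    have hAb : ∀ y, Bornology.IsBounded (A y) := fun y => by
      rw [hA]; exact Metric.isBounded_ball.subset inter_subset_right
    have hsum : ∀ (φ : ℝ≥0∞ × ℝ≥0∞ → ℝ≥0∞) z, (Metric.ball 0 (n : ℝ)).indicator (φ ∘ p) z =
        ∑ y ∈ p.range, φ y * (A y).indicator 1 z := by
      intro φ z
      by_cases hz : z ∈ Metric.ball (0 : EuclideanSpace ℝ (Fin d)) (n : ℝ)
      · rw [indicator_of_mem hz, Finset.sum_eq_single (p z)]
        · have : z ∈ A (p z) := by rw [hA]; exact ⟨rfl, hz⟩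
          simp [this]
        · intro y _ hy
          have : z ∉ A y := by rw [hA]; exact fun h => hy h.1.symm
          simp [this]
        · intro h
          exact absurd (p.mem_range_self z) h
      · rw [indicator_of_notMem hz]
        symm
        refine Finset.sum_eq_zero fun y _ => ?_
        have : z ∉ A y := by rw [hA]; exact fun h => hz h.2
        simp [this]
    have hFf : F f n = fun z => ∑ y ∈ p.range, y.1 * (A y).indicator 1 z := by
      ext z
      rw [← hsum Prod.fst z, hF, hp]
      rfl
    have hFg : F g n = fun z => ∑ y ∈ p.range, y.2 * (A y).indicator 1 z := by
      ext z
      rw [← hsum Prod.snd z, hF, hp]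
      rfl
    have hfin : ∀ y ∈ p.range, y.1 ≠ ∞ ∧ y.2 ≠ ∞ := by
      intro y hy
      obtain ⟨z, rfl⟩ := SimpleFunc.mem_range.1 hy
      rw [hp]
      exact ⟨(SimpleFunc.eapprox_lt_top f n z).ne, (SimpleFunc.eapprox_lt_top g n z).ne⟩
    have hreal : ∀ φ ψ : ℝ≥0∞ × ℝ≥0∞ → ℝ≥0∞, (∀ y ∈ p.range, φ y ≠ ∞) →
        (∀ y ∈ p.range, ψ y ≠ ∞) →
        ∑ i ∈ p.range, ∑ j ∈ p.range, φ i * ψ j * (Λ.prod volume) (shiftSet (A i) (A j)) =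
        ENNReal.ofReal (∑ i ∈ p.range, ∑ j ∈ p.range, (φ i).toReal * (ψ j).toReal *
          spatialCov Λ (A i) (A j)) := by
      intro φ ψ hφ hψ
      have h0 := fun i j => (measure_shiftSet hΛ (hAm i) (hAm j) (hAb i) (hAb j)).2
      rw [ENNReal.ofReal_sum_of_nonneg fun i _ => Finset.sum_nonneg fun j _ =>
        mul_nonneg (by positivity) (h0 i j)]
      refine Finset.sum_congr rfl fun i hi => ?_
      rw [ENNReal.ofReal_sum_of_nonneg fun j _ => mul_nonneg (by positivity) (h0 i j)]
      refine Finset.sum_congr rfl fun j hj => ?_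
      rw [ENNReal.ofReal_mul (by positivity), ENNReal.ofReal_mul (by positivity),
        ENNReal.ofReal_toReal (hφ i hi), ENNReal.ofReal_toReal (hψ j hj),
        (measure_shiftSet hΛ (hAm i) (hAm j) (hAb i) (hAb j)).1]
    have h1 := fun y hy => (hfin y hy).1
    have h2 := fun y hy => (hfin y hy).2
    have hnn : ∀ a : ℝ≥0∞ × ℝ≥0∞ → ℝ, (∀ y, 0 ≤ a y) →
        0 ≤ ∑ i ∈ p.range, ∑ j ∈ p.range, a i * a j * spatialCov Λ (A i) (A j) := fun a ha =>
      Finset.sum_nonneg fun i _ => Finset.sum_nonneg fun j _ =>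
        mul_nonneg (mul_nonneg (ha i) (ha j))
          (measure_shiftSet hΛ (hAm i) (hAm j) (hAb i) (hAb j)).2
    have htwo : ∀ x : ℝ, (2 : ℝ≥0∞) * ENNReal.ofReal x = ENNReal.ofReal (2 * x) := fun x => by
      rw [ENNReal.ofReal_mul (by norm_num), ENNReal.ofReal_ofNat]
    calc 2 * spatialForm Λ (F f n) (F g n) ≤
          spatialForm Λ (F f n) (F f n) + spatialForm Λ (F g n) (F g n) := by
          rw [hFf, hFg, spatialForm_sum _ _ hAm, spatialForm_sum _ _ hAm, spatialForm_sum _ _ hAm,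
            hreal _ _ h1 h2, hreal _ _ h1 h1, hreal _ _ h2 h2,
            ← ENNReal.ofReal_add (hnn _ fun _ => ENNReal.toReal_nonneg)
              (hnn _ fun _ => ENNReal.toReal_nonneg), htwo]
          exact ENNReal.ofReal_le_ofReal (two_mul_sum_spatialCov_le hT hH hW _ _ hAm hAb _ _)
      _ ≤ _ := by
          unfold spatialForm
          gcongr <;> exact hle (by assumption) _ _
  have hlim : spatialForm Λ f g ≤ ⨆ n, spatialForm Λ (F f n) (F g n) := by
    unfold spatialForm
    rw [← lintegral_iSup]
    · refine lintegral_mono fun y => ?_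
      rw [← hsup hf, ← hsup hg, ENNReal.iSup_mul]
      refine iSup_le fun n => ?_
      rw [ENNReal.mul_iSup]
      refine iSup_le fun m => ?_
      refine le_trans ?_ (le_iSup _ (max n m))
      exact mul_le_mul' (hmono f (le_max_left n m) _) (hmono g (le_max_right n m) _)
    · intro n
      exact ((hFm f n).comp (by fun_prop)).mul ((hFm g n).comp measurable_snd)
    · intro n m hnm y
      exact mul_le_mul' (hmono f hnm _) (hmono g hnm _)
  calc _ ≤ 2 * ⨆ n, spatialForm Λ (F f n) (F g n) := by gcongr
    _ ≤ _ := by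
        rw [ENNReal.mul_iSup]
        exact iSup_le hn

end Spatial

/-! ### The covariance form of the noise -/

/-- The measure behind the covariance of the noise. -/
def noiseMeasure {d : ℕ} (H T : ℝ) (Λ : Measure (EuclideanSpace ℝ (Fin d))) :
    Measure ((ℝ × ℝ) × (EuclideanSpace ℝ (Fin d) × EuclideanSpace ℝ (Fin d))) :=
  (timeMeasure H T).prod (Λ.prod volume)

/-- The covariance form of the noise on nonnegative functions. -/
def noiseForm {d : ℕ} (H T : ℝ) (Λ : Measure (EuclideanSpace ℝ (Fin d)))
    (f g : ℝ × EuclideanSpace ℝ (Fin d) → ℝ≥0∞) : ℝ≥0∞ :=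
  ∫⁻ x, f (x.1.1, x.2.2 + x.2.1) * g (x.1.2, x.2.2) ∂(noiseMeasure H T Λ)

instance sFinite_timeMeasure (H T : ℝ) : SFinite (timeMeasure H T) := by
  unfold timeMeasure; infer_instance

lemma ae_ne_prod : ∀ᵐ p ∂((volume : Measure ℝ).prod (volume : Measure ℝ)), p.1 ≠ p.2 := by
  have hm : MeasurableSet {p : ℝ × ℝ | p.1 = p.2} :=
    measurableSet_eq_fun measurable_fst measurable_snd
  have : ((volume : Measure ℝ).prod (volume : Measure ℝ)) {p : ℝ × ℝ | p.1 = p.2} = 0 := by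
    rw [Measure.measure_prod_null hm]
    refine ae_of_all _ fun x => ?_
    have : Prod.mk x ⁻¹' {p : ℝ × ℝ | p.1 = p.2} = {x} := by
      ext y; simp [eq_comm]
    simp [this]
  rw [ae_iff]
  simpa using this

/-- The Volterra representation may be substituted for the density because it fails only on the
diagonal, which is a null set. -/
lemma exists_lintegral_timeMeasure_eq {H : ℝ} (hH : 1 / 2 < H) (hH1 : H < 1) :
    ∃ κ : ℝ, 0 < κ ∧ ∀ (T : ℝ) (h : ℝ × ℝ → ℝ≥0∞), Measurable h →
      ∫⁻ p, h p ∂(timeMeasure H T) = ENNReal.ofReal κ * ∫⁻ u, ∫⁻ p, h p *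
        (volterra H p.1 u * volterra H p.2 u)
          ∂((volume.restrict (Ioc 0 T)).prod (volume.restrict (Ioc 0 T))) := by
  obtain ⟨B, hB, hBeq⟩ := exists_volterra_const hH hH1
  have hH2 : 0 < H * (2 * H - 1) := mul_pos (by linarith) (by linarith)
  refine ⟨H * (2 * H - 1) / B, by positivity, fun T h hh => ?_⟩
  have hv1 : Measurable fun x : (ℝ × ℝ) × ℝ => volterra H x.1.1 x.2 :=
    (measurable_volterra H).comp (f := fun x : (ℝ × ℝ) × ℝ => (x.1.1, x.2)) (by fun_prop)
  have hv2 : Measurable fun x : (ℝ × ℝ) × ℝ => volterra H x.1.2 x.2 :=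
    (measurable_volterra H).comp (f := fun x : (ℝ × ℝ) × ℝ => (x.1.2, x.2)) (by fun_prop)
  have hm : Measurable fun x : (ℝ × ℝ) × ℝ =>
      h x.1 * (volterra H x.1.1 x.2 * volterra H x.1.2 x.2) :=
    (hh.comp measurable_fst).mul (hv1.mul hv2)
  have hae : ∀ᵐ p ∂((volume.restrict (Ioc 0 T)).prod (volume.restrict (Ioc 0 T))),
      (p : ℝ × ℝ).1 ≠ p.2 := by
    rw [Measure.prod_restrict]
    exact ae_restrict_of_ae ae_ne_prod
  rw [timeMeasure, lintegral_withDensity_eq_lintegral_mul _ (by fun_prop) hh,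
    lintegral_lintegral_swap (f := fun u p => h p * (volterra H p.1 u * volterra H p.2 u))
      (hm.comp measurable_swap).aemeasurable, ← lintegral_const_mul _ hm.lintegral_prod_right']
  refine lintegral_congr_ae ?_
  filter_upwards [hae] with p hp
  have hvm : Measurable fun u => volterra H p.1 u * volterra H p.2 u :=
    (hv1.mul hv2).comp (f := fun u => (p, u)) (by fun_prop)
  rw [lintegral_const_mul _ hvm, hBeq _ _ hp, Pi.mul_apply, mul_comm (h p), ← mul_assoc,
    ← ENNReal.ofReal_mul (by positivity)]
  congr 2
  field_simp

/-- For an integrand that is a product in the two times, the double time integral splits for each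
fixed `u` into a product of two single ones. This is used once with spatial variables and once with
frequencies in the place of `Y`. -/
lemma exists_lintegral_timeMeasure_prod_eq {H : ℝ} (hH : 1 / 2 < H) (hH1 : H < 1) :
    ∃ κ : ℝ, 0 < κ ∧ ∀ (T : ℝ) {Y : Type} [MeasurableSpace Y] (ν : Measure Y) [SFinite ν]
      (F G : ℝ × Y → ℝ≥0∞), Measurable F → Measurable G →
      ∫⁻ x, F (x.1.1, x.2) * G (x.1.2, x.2) ∂((timeMeasure H T).prod ν) =
        ENNReal.ofReal κ * ∫⁻ u, ∫⁻ y, (∫⁻ r in Ioc 0 T, F (r, y) * volterra H r u) *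
          (∫⁻ s in Ioc 0 T, G (s, y) * volterra H s u) ∂ν := by
  obtain ⟨κ, hκ, hκeq⟩ := exists_lintegral_timeMeasure_eq hH hH1
  refine ⟨κ, hκ, fun T Y _ ν _ F G hF hG => ?_⟩
  have hvr : ∀ u, Measurable fun r => volterra H r u := fun u =>
    (measurable_volterra H).comp (f := fun r => (r, u)) (by fun_prop)
  have hFv : ∀ {F : ℝ × Y → ℝ≥0∞}, Measurable F → Measurable fun x : Y × ℝ =>
      ∫⁻ r in Ioc 0 T, F (r, x.1) * volterra H r x.2 := by
    intro F hF
    have : Measurable fun y : (Y × ℝ) × ℝ => F (y.2, y.1.1) * volterra H y.2 y.1.2 :=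
      (hF.comp (by fun_prop)).mul ((measurable_volterra H).comp
        (f := fun y : (Y × ℝ) × ℝ => (y.2, y.1.2)) (by fun_prop))
    exact this.lintegral_prod_right'
  have hm : Measurable fun x : (ℝ × ℝ) × Y => F (x.1.1, x.2) * G (x.1.2, x.2) :=
    (hF.comp (by fun_prop)).mul (hG.comp (by fun_prop))
  have hFG : Measurable fun x : Y × ℝ => (∫⁻ r in Ioc 0 T, F (r, x.1) * volterra H r x.2) *
      ∫⁻ s in Ioc 0 T, G (s, x.1) * volterra H s x.2 := (hFv hF).mul (hFv hG)
  rw [lintegral_prod_symm _ hm.aemeasurable,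
    lintegral_lintegral_swap (f := fun u y => (∫⁻ r in Ioc 0 T, F (r, y) * volterra H r u) *
    ∫⁻ s in Ioc 0 T, G (s, y) * volterra H s u) (hFG.comp measurable_swap).aemeasurable,
    ← lintegral_const_mul _ hFG.lintegral_prod_right']
  refine lintegral_congr fun y => ?_
  have hy : Measurable fun p : ℝ × ℝ => F (p.1, y) * G (p.2, y) :=
    (hF.comp (by fun_prop)).mul (hG.comp (by fun_prop))
  rw [hκeq T _ hy]
  congr 1
  refine lintegral_congr fun u => ?_
  have e1 : Measurable fun r => F (r, y) * volterra H r u := (hF.comp (by fun_prop)).mul (hvr u)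
  have e2 : Measurable fun s => G (s, y) * volterra H s u := (hG.comp (by fun_prop)).mul (hvr u)
  rw [← lintegral_prod_mul e1.aemeasurable e2.aemeasurable]
  refine lintegral_congr fun p => ?_
  ring

section NoiseForm

variable {d : ℕ} {H T : ℝ} {Λ : Measure (EuclideanSpace ℝ (Fin d))} [SFinite Λ]

lemma measurable_noiseForm_integrand {f g : ℝ × EuclideanSpace ℝ (Fin d) → ℝ≥0∞}
    (hf : Measurable f) (hg : Measurable g) :
    Measurable fun x : (ℝ × ℝ) × (EuclideanSpace ℝ (Fin d) × EuclideanSpace ℝ (Fin d)) =>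
      f (x.1.1, x.2.2 + x.2.1) * g (x.1.2, x.2.2) :=
  (hf.comp (by fun_prop)).mul (hg.comp (by fun_prop))

/-- The smoothing of an integrand in time by the Volterra kernel. -/
def volterraInt (H T : ℝ) (f : ℝ × EuclideanSpace ℝ (Fin d) → ℝ≥0∞) (u : ℝ)
    (z : EuclideanSpace ℝ (Fin d)) : ℝ≥0∞ :=
  ∫⁻ r in Ioc 0 T, f (r, z) * volterra H r u

lemma measurable_volterraInt {f : ℝ × EuclideanSpace ℝ (Fin d) → ℝ≥0∞} (hf : Measurable f) :
    Measurable fun x : ℝ × EuclideanSpace ℝ (Fin d) => volterraInt H T f x.1 x.2 := by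
  have : Measurable fun y : (ℝ × EuclideanSpace ℝ (Fin d)) × ℝ =>
      f (y.2, y.1.2) * volterra H y.2 y.1.1 :=
    (hf.comp (by fun_prop)).mul ((measurable_volterra H).comp
      (f := fun y : (ℝ × EuclideanSpace ℝ (Fin d)) × ℝ => (y.2, y.1.1)) (by fun_prop))
  exact this.lintegral_prod_right'

lemma exists_noiseForm_eq (hH : 1 / 2 < H) (hH1 : H < 1) :
    ∃ κ : ℝ, 0 < κ ∧ ∀ (T : ℝ) (f g : ℝ × EuclideanSpace ℝ (Fin d) → ℝ≥0∞), Measurable f →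
      Measurable g → noiseForm H T Λ f g =
        ENNReal.ofReal κ * ∫⁻ u, spatialForm Λ (volterraInt H T f u) (volterraInt H T g u) := by
  obtain ⟨κ, hκ, hκeq⟩ := exists_lintegral_timeMeasure_prod_eq hH hH1
  refine ⟨κ, hκ, fun T f g hf hg => ?_⟩
  have hF : Measurable fun x : ℝ × (EuclideanSpace ℝ (Fin d) × EuclideanSpace ℝ (Fin d)) =>
      f (x.1, x.2.2 + x.2.1) := hf.comp (by fun_prop)
  have hG : Measurable fun x : ℝ × (EuclideanSpace ℝ (Fin d) × EuclideanSpace ℝ (Fin d)) =>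
      g (x.1, x.2.2) := hg.comp (by fun_prop)
  exact hκeq T (Λ.prod volume) _ _ hF hG

/-- The form is a superposition over `u` of spatial forms applied to the Volterra transforms, and
each of these satisfies the inequality. -/
lemma two_mul_noiseForm_le (hT : 0 < T) (hH : 1 / 2 < H) (hH1 : H < 1) {Ω : Type u}
    [MeasurableSpace Ω] {P : Measure Ω} {W : ℝ → Set (EuclideanSpace ℝ (Fin d)) → Ω → ℝ}
    (hW : IsNoise P H T Λ W) (hΛ : ∀ R : ℝ, Λ (Metric.ball 0 R) < ∞)
    {f g : ℝ × EuclideanSpace ℝ (Fin d) → ℝ≥0∞} (hf : Measurable f) (hg : Measurable g) :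
    2 * noiseForm H T Λ f g ≤ noiseForm H T Λ f f + noiseForm H T Λ g g := by
  obtain ⟨κ, hκ, hκeq⟩ := exists_noiseForm_eq (Λ := Λ) hH hH1
  have hm : ∀ {f}, Measurable f → ∀ u, Measurable (volterraInt (d := d) H T f u) := fun hf u =>
    (measurable_volterraInt hf).comp (f := fun z => (u, z)) (by fun_prop)
  have hSm : ∀ {f g}, Measurable f → Measurable g → Measurable fun u =>
      spatialForm Λ (volterraInt H T f u) (volterraInt H T g u) := by
    intro f g hf hg
    have hFG : Measurable fun x : ℝ × (EuclideanSpace ℝ (Fin d) × EuclideanSpace ℝ (Fin d)) =>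
        volterraInt H T f x.1 (x.2.2 + x.2.1) * volterraInt H T g x.1 x.2.2 :=
      ((measurable_volterraInt hf).comp
        (f := fun x : ℝ × (EuclideanSpace ℝ (Fin d) × EuclideanSpace ℝ (Fin d)) =>
        (x.1, x.2.2 + x.2.1)) (by fun_prop)).mul
        ((measurable_volterraInt hg).comp
          (f := fun x : ℝ × (EuclideanSpace ℝ (Fin d) × EuclideanSpace ℝ (Fin d)) =>
          (x.1, x.2.2)) (by fun_prop))
    exact hFG.lintegral_prod_right'
  rw [hκeq T f g hf hg, hκeq T f f hf hf, hκeq T g g hg hg, ← mul_add,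
    ← lintegral_add_left (hSm hf hf), mul_left_comm, ← lintegral_const_mul _ (hSm hf hg)]
  gcongr with u
  exact two_mul_spatialForm_le hT (by linarith) hW hΛ (hm hf u) (hm hg u)

lemma noiseForm_mono {f f' g g' : ℝ × EuclideanSpace ℝ (Fin d) → ℝ≥0∞} (hf : ∀ x, f x ≤ f' x)
    (hg : ∀ x, g x ≤ g' x) : noiseForm H T Λ f g ≤ noiseForm H T Λ f' g' :=
  lintegral_mono fun _ => mul_le_mul' (hf _) (hg _)

lemma noiseForm_add_self_le {f g : ℝ × EuclideanSpace ℝ (Fin d) → ℝ≥0∞} (hf : Measurable f)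
    (hg : Measurable g) : noiseForm H T Λ (fun x => f x + g x) (fun x => f x + g x) ≤
      noiseForm H T Λ f f + noiseForm H T Λ f g + noiseForm H T Λ g f + noiseForm H T Λ g g := by
  have h1 : Measurable fun x : (ℝ × ℝ) × (EuclideanSpace ℝ (Fin d) × EuclideanSpace ℝ (Fin d)) =>
      f (x.1.1, x.2.2 + x.2.1) * f (x.1.2, x.2.2) + f (x.1.1, x.2.2 + x.2.1) * g (x.1.2, x.2.2) :=
    (measurable_noiseForm_integrand hf hf).add (measurable_noiseForm_integrand hf hg)
  unfold noiseForm
  rw [← lintegral_add_left (measurable_noiseForm_integrand hf hf),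
    add_assoc, ← lintegral_add_left (measurable_noiseForm_integrand hg hf),
    ← lintegral_add_left h1]
  refine lintegral_mono fun x => le_of_eq ?_
  ring

lemma noiseForm_const_mul {f g : ℝ × EuclideanSpace ℝ (Fin d) → ℝ≥0∞} (hf : Measurable f)
    (hg : Measurable g) (a b : ℝ≥0∞) : noiseForm H T Λ (fun x => a * f x) (fun x => b * g x) =
      a * b * noiseForm H T Λ f g := by
  unfold noiseForm
  rw [← lintegral_const_mul _ (measurable_noiseForm_integrand hf hg)]
  refine lintegral_congr fun x => ?_
  ring

/-- A weak form of the Cauchy–Schwarz inequality. -/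
lemma tendsto_noiseForm_of_tendsto (hT : 0 < T) (hH : 1 / 2 < H) (hH1 : H < 1) {Ω : Type u}
    [MeasurableSpace Ω] {P : Measure Ω} {W : ℝ → Set (EuclideanSpace ℝ (Fin d)) → Ω → ℝ}
    (hW : IsNoise P H T Λ W) (hΛ : ∀ R : ℝ, Λ (Metric.ball 0 R) < ∞)
    {δ : ℕ → ℝ × EuclideanSpace ℝ (Fin d) → ℝ≥0∞} {g : ℝ × EuclideanSpace ℝ (Fin d) → ℝ≥0∞}
    (hδ : ∀ n, Measurable (δ n)) (hg : Measurable g)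
    (hlim : Tendsto (fun n => noiseForm H T Λ (δ n) (δ n)) atTop (𝓝 0))
    (hfin : noiseForm H T Λ g g ≠ ∞) :
    Tendsto (fun n => noiseForm H T Λ (δ n) g) atTop (𝓝 0) ∧
      Tendsto (fun n => noiseForm H T Λ g (δ n)) atTop (𝓝 0) := by
  have key : ∀ N : ℕ → ℝ≥0∞, (∀ (k : ℕ) n, 2 * (k * N n) ≤
      (k : ℝ≥0∞) ^ 2 * noiseForm H T Λ (δ n) (δ n) + noiseForm H T Λ g g) →
      Tendsto N atTop (𝓝 0) := by
    intro N hN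
    rw [ENNReal.tendsto_nhds_zero]
    intro ε hε
    rcases eq_or_ne ε ∞ with rfl | hε'
    · simp
    -- The inequality `2ab ≤ a² + b²` is applied to `k δₙ` and `g`. The number `k` makes the form of
    -- `g` smaller than `k ε`; afterwards `n` is so large that `k²` times the form of `δₙ` is at
    -- most `k ε`.
    obtain ⟨k, hk0, hk⟩ := ENNReal.exists_nat_pos_mul_gt hε.ne' hfin
    have hk0' : (k : ℝ≥0∞) ≠ 0 := by exact_mod_cast hk0.ne'
    have hkt : (k : ℝ≥0∞) ≠ ∞ := ENNReal.natCast_ne_top k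
    have hpos : 0 < ε / k := ENNReal.div_pos hε.ne' hkt
    filter_upwards [(ENNReal.tendsto_nhds_zero.1 hlim) _ hpos] with n hn
    have h1 : 2 * (k * N n) ≤ 2 * (k * ε) := by
      refine (hN k n).trans ?_
      calc _ ≤ (k : ℝ≥0∞) ^ 2 * (ε / k) + k * ε := by gcongr
        _ = 2 * (k * ε) := by
          rw [sq, mul_assoc, ENNReal.mul_div_cancel hk0' hkt, two_mul]
    have h2 := (ENNReal.mul_le_mul_iff_right (by norm_num) (by norm_num)).1 h1
    exact (ENNReal.mul_le_mul_iff_right hk0' hkt).1 h2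
  refine ⟨key _ fun k n => ?_, key _ fun k n => ?_⟩
  · have h := two_mul_noiseForm_le hT hH hH1 hW hΛ ((hδ n).const_mul (k : ℝ≥0∞)) (hg.const_mul 1)
    rw [noiseForm_const_mul (hδ n) hg, noiseForm_const_mul (hδ n) (hδ n),
      noiseForm_const_mul hg hg] at h
    simpa [sq] using h
  · have h := two_mul_noiseForm_le hT hH hH1 hW hΛ (hg.const_mul 1) ((hδ n).const_mul (k : ℝ≥0∞))
    rw [noiseForm_const_mul hg (hδ n), noiseForm_const_mul (hδ n) (hδ n),
      noiseForm_const_mul hg hg, add_comm] at h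
    simpa [sq] using h

end NoiseForm

/-! ### The isometry -/

section Isometry

variable {d : ℕ} {H T : ℝ} {Λ : Measure (EuclideanSpace ℝ (Fin d))} [SFinite Λ]

/-- The product `f(r, w + v) g(s, w)`. -/
def noiseProd (f g : ℝ × EuclideanSpace ℝ (Fin d) → ℝ)
    (x : (ℝ × ℝ) × (EuclideanSpace ℝ (Fin d) × EuclideanSpace ℝ (Fin d))) : ℝ :=
  f (x.1.1, x.2.2 + x.2.1) * g (x.1.2, x.2.2)

lemma measurable_noiseProd {f g : ℝ × EuclideanSpace ℝ (Fin d) → ℝ}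
    (hf : Measurable f) (hg : Measurable g) : Measurable (noiseProd f g) :=
  (hf.comp (by fun_prop)).mul (hg.comp (by fun_prop))

lemma lintegral_enorm_noiseProd (f g : ℝ × EuclideanSpace ℝ (Fin d) → ℝ) :
    ∫⁻ x, ‖noiseProd f g x‖ₑ ∂(noiseMeasure H T Λ) =
      noiseForm H T Λ (fun x => ‖f x‖ₑ) (fun x => ‖g x‖ₑ) := by
  simp only [noiseProd, enorm_mul, noiseForm]

lemma noiseNormSq_eq (hH : 1 / 2 < H) {h : ℝ × EuclideanSpace ℝ (Fin d) → ℝ} (hh : Measurable h) :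
    noiseNormSq H T Λ (fun r z => h (r, z)) =
      noiseForm H T Λ (fun x => ‖h x‖ₑ) (fun x => ‖h x‖ₑ) := by
  have hH2 : 0 ≤ H * (2 * H - 1) := mul_nonneg (by linarith) (by linarith)
  have hm := measurable_noiseForm_integrand hh.enorm hh.enorm
  have hm2 := hm.lintegral_prod_right' (ν := Λ.prod volume)
  rw [noiseForm, noiseMeasure, lintegral_prod _ hm.aemeasurable, timeMeasure,
    lintegral_withDensity_eq_lintegral_mul _ (by fun_prop) hm2]
  have hm3 : Measurable fun p : ℝ × ℝ => ENNReal.ofReal (H * (2 * H - 1) *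
      |p.1 - p.2| ^ (2 * H - 2)) := by fun_prop
  rw [lintegral_prod _ (hm3.mul hm2).aemeasurable, noiseNormSq]
  rw [← lintegral_const_mul' _ _ ENNReal.ofReal_ne_top]
  refine lintegral_congr fun r => ?_
  rw [← lintegral_const_mul' _ _ ENNReal.ofReal_ne_top]
  refine lintegral_congr fun s => ?_
  simp only [Pi.mul_apply]
  rw [ENNReal.ofReal_mul hH2, mul_assoc]
  congr 2
  exact (lintegral_prod _ (hm.comp (f := fun y => ((r, s), y)) (by fun_prop)).aemeasurable).symm

lemma Elementary.measurable_toFun (φ : Elementary d T) :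
    Measurable fun x : ℝ × EuclideanSpace ℝ (Fin d) => φ.toFun x.1 x.2 := by
  unfold Elementary.toFun
  refine Finset.measurable_sum _ fun i _ => ?_
  exact (((measurable_one.indicator measurableSet_Ioc).comp measurable_fst).const_mul _).mul
    ((measurable_one.indicator (φ.measurable_base i)).comp measurable_snd)

/-- The set on which a product of summands of two elementary integrands lives. -/
def Elementary.box (φ ψ : Elementary d T) (i : Fin φ.n) (j : Fin ψ.n) :
    Set ((ℝ × ℝ) × (EuclideanSpace ℝ (Fin d) × EuclideanSpace ℝ (Fin d))) :=
  (Ioc (φ.left i) (φ.right i) ×ˢ Ioc (ψ.left j) (ψ.right j)) ×ˢ shiftSet (φ.base i) (ψ.base j)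

lemma Elementary.noiseProd_eq (φ ψ : Elementary d T)
    (x : (ℝ × ℝ) × (EuclideanSpace ℝ (Fin d) × EuclideanSpace ℝ (Fin d))) :
    noiseProd (fun x => φ.toFun x.1 x.2) (fun x => ψ.toFun x.1 x.2) x =
      ∑ i, ∑ j, φ.coef i * ψ.coef j * (φ.box ψ i j).indicator 1 x := by
  simp only [noiseProd, Elementary.toFun]
  rw [Finset.sum_mul_sum]
  refine Finset.sum_congr rfl fun i _ => Finset.sum_congr rfl fun j _ => ?_
  by_cases h1 : x.1.1 ∈ Ioc (φ.left i) (φ.right i) <;>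
  by_cases h2 : x.1.2 ∈ Ioc (ψ.left j) (ψ.right j) <;>
  by_cases h3 : x.2.2 + x.2.1 ∈ φ.base i <;>
  by_cases h4 : x.2.2 ∈ ψ.base j <;>
  simp only [Elementary.box, shiftSet, indicator, mem_prod, mem_ofPred_eq, h1, h2, h3, h4,
      Pi.one_apply, and_self,
    and_true, and_false, if_true, if_false, mul_one, mul_zero, zero_mul]


lemma Elementary.measurableSet_box (φ ψ : Elementary d T) (i : Fin φ.n) (j : Fin ψ.n) :
    MeasurableSet (φ.box ψ i j) :=
  (measurableSet_Ioc.prod measurableSet_Ioc).prod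
    (measurableSet_shiftSet (φ.measurable_base i) (ψ.measurable_base j))

lemma Elementary.measure_box (hH : 1 / 2 < H) (hΛ : ∀ R : ℝ, Λ (Metric.ball 0 R) < ∞)
    (φ ψ : Elementary d T) (i : Fin φ.n) (j : Fin ψ.n) :
    noiseMeasure H T Λ (φ.box ψ i j) < ∞ ∧ (noiseMeasure H T Λ).real (φ.box ψ i j) =
      (fbmCov H (φ.right i) (ψ.right j) - fbmCov H (φ.left i) (ψ.right j) -
        fbmCov H (φ.right i) (ψ.left j) + fbmCov H (φ.left i) (ψ.left j)) *
        spatialCov Λ (φ.base i) (ψ.base j) := by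
  have h1 := timeMeasure_prod hH (φ.left_nonneg i) (φ.left_le_right i) (φ.right_le i)
    (ψ.left_nonneg j) (ψ.left_le_right j) (ψ.right_le j)
  have h2 := measure_shiftSet hΛ (φ.measurable_base i) (ψ.measurable_base j) (φ.bounded_base i)
    (ψ.bounded_base j)
  rw [measureReal_def, noiseMeasure, Elementary.box, Measure.prod_prod, h1.1, h2.1]
  refine ⟨ENNReal.mul_lt_top ENNReal.ofReal_lt_top ENNReal.ofReal_lt_top, ?_⟩
  rw [← ENNReal.ofReal_mul h1.2, ENNReal.toReal_ofReal (mul_nonneg h1.2 h2.2)]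

lemma Elementary.integrable_noiseProd (hH : 1 / 2 < H) (hΛ : ∀ R : ℝ, Λ (Metric.ball 0 R) < ∞)
    (φ ψ : Elementary d T) : Integrable
      (noiseProd (fun x => φ.toFun x.1 x.2) (fun x => ψ.toFun x.1 x.2)) (noiseMeasure H T Λ) := by
  have e : noiseProd (fun x => φ.toFun x.1 x.2) (fun x => ψ.toFun x.1 x.2) = fun x =>
      ∑ i, ∑ j, φ.coef i * ψ.coef j * (φ.box ψ i j).indicator 1 x :=
    funext (φ.noiseProd_eq ψ)
  rw [e]
  refine integrable_finsetSum _ fun i _ => integrable_finsetSum _ fun j _ => Integrable.const_mul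
      ?_ _
  exact (integrable_indicator_iff (φ.measurableSet_box ψ i j)).2
    (integrableOn_const (φ.measure_box hH hΛ ψ i j).1.ne)

/-- Both sides are bilinear in the summands. For one pair, the covariance of two increments of the
noise is the second difference of the time covariance times the spatial covariance, which is the
measure of the corresponding box. -/
lemma Elementary.integral_noiseProd (hH : 1 / 2 < H) (hΛ : ∀ R : ℝ, Λ (Metric.ball 0 R) < ∞)
    {Ω : Type u} [MeasurableSpace Ω] {P : Measure Ω}
    {W : ℝ → Set (EuclideanSpace ℝ (Fin d)) → Ω → ℝ} (hW : IsNoise P H T Λ W)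
    (φ ψ : Elementary d T) :
    ∫ x, noiseProd (fun x => φ.toFun x.1 x.2) (fun x => ψ.toFun x.1 x.2) x
      ∂(noiseMeasure H T Λ) = ∫ ω, φ.integral W ω * ψ.integral W ω ∂P := by
  have hint : ∀ i j, Integrable ((φ.box ψ i j).indicator (1 : _ × _ → ℝ))
      (noiseMeasure H T Λ) := fun i j =>
    (integrable_indicator_iff (φ.measurableSet_box ψ i j)).2
      (integrableOn_const (φ.measure_box hH hΛ ψ i j).1.ne)
  have hWi : ∀ p q, Integrable (fun ω => onIndex T W p ω * onIndex T W q ω) P := fun p q =>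
    (hW.gaussian.hasGaussianLaw_eval p).memLp_two.integrable_mul
      (hW.gaussian.hasGaussianLaw_eval q).memLp_two
  have hinc : ∀ i j, Integrable (fun ω => (onIndex T W (φ.rightIndex i) ω -
      onIndex T W (φ.leftIndex i) ω) * (onIndex T W (ψ.rightIndex j) ω -
      onIndex T W (ψ.leftIndex j) ω)) P ∧
      ∫ ω, (onIndex T W (φ.rightIndex i) ω - onIndex T W (φ.leftIndex i) ω) *
        (onIndex T W (ψ.rightIndex j) ω - onIndex T W (ψ.leftIndex j) ω) ∂P =
        (noiseMeasure H T Λ).real (φ.box ψ i j) := by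
    intro i j
    have e : (fun ω => (onIndex T W (φ.rightIndex i) ω -
      onIndex T W (φ.leftIndex i) ω) * (onIndex T W (ψ.rightIndex j) ω -
      onIndex T W (ψ.leftIndex j) ω)) = fun ω =>
        (onIndex T W (φ.rightIndex i) ω * onIndex T W (ψ.rightIndex j) ω -
        onIndex T W (φ.leftIndex i) ω * onIndex T W (ψ.rightIndex j) ω) -
        (onIndex T W (φ.rightIndex i) ω * onIndex T W (ψ.leftIndex j) ω -
        onIndex T W (φ.leftIndex i) ω * onIndex T W (ψ.leftIndex j) ω) := by
      ext ω; ring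
    rw [e]
    have hd : ∀ p q p' q', Integrable (fun ω => onIndex T W p ω * onIndex T W q ω -
        onIndex T W p' ω * onIndex T W q' ω) P := fun p q p' q' => (hWi p q).sub (hWi p' q')
    refine ⟨(hd _ _ _ _).sub (hd _ _ _ _), ?_⟩
    rw [integral_sub (hd _ _ _ _) (hd _ _ _ _),
      integral_sub (hWi _ _) (hWi _ _), integral_sub (hWi _ _) (hWi _ _), hW.covariance,
      hW.covariance, hW.covariance, hW.covariance, (φ.measure_box hH hΛ ψ i j).2]
    simp only [rightIndex, leftIndex]
    ring
  have hR : ∀ ω, φ.integral W ω * ψ.integral W ω = ∑ i, ∑ j, φ.coef i * ψ.coef j *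
      ((onIndex T W (φ.rightIndex i) ω - onIndex T W (φ.leftIndex i) ω) *
        (onIndex T W (ψ.rightIndex j) ω - onIndex T W (ψ.leftIndex j) ω)) := by
    intro ω
    rw [integral_eq, integral_eq, Finset.sum_mul_sum]
    refine Finset.sum_congr rfl fun i _ => Finset.sum_congr rfl fun j _ => ?_
    ring
  simp_rw [hR, φ.noiseProd_eq ψ]
  rw [integral_finsetSum _ fun i _ => integrable_finsetSum _ fun j _ => (hint i j).const_mul _,
    integral_finsetSum _ fun i _ => integrable_finsetSum _ fun j _ => (hinc i j).1.const_mul _]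
  refine Finset.sum_congr rfl fun i _ => ?_
  rw [integral_finsetSum _ fun j _ => (hint i j).const_mul _,
    integral_finsetSum _ fun j _ => (hinc i j).1.const_mul _]
  refine Finset.sum_congr rfl fun j _ => ?_
  rw [integral_const_mul, integral_const_mul, (hinc i j).2,
    integral_indicator_one (φ.measurableSet_box ψ i j)]

/-- The covariance of two Wiener integrals. -/
theorem IsWienerIntegral.integral_mul (hT : 0 < T) (hH : 1 / 2 < H) (hH1 : H < 1)
    (hΛ : ∀ R : ℝ, Λ (Metric.ball 0 R) < ∞) {Ω : Type u} [MeasurableSpace Ω] {P : Measure Ω}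
    {W : ℝ → Set (EuclideanSpace ℝ (Fin d)) → Ω → ℝ} (hW : IsNoise P H T Λ W)
    {g h : ℝ → EuclideanSpace ℝ (Fin d) → ℝ}
    (hg : Measurable fun x : ℝ × EuclideanSpace ℝ (Fin d) => g x.1 x.2)
    (hh : Measurable fun x : ℝ × EuclideanSpace ℝ (Fin d) => h x.1 x.2)
    {X Y : Ω → ℝ} (hX : IsWienerIntegral P H T Λ W g X) (hY : IsWienerIntegral P H T Λ W h Y) :
    ∫ ω, X ω * Y ω ∂P =
      ∫ x, noiseProd (fun x => g x.1 x.2) (fun x => h x.1 x.2) x ∂(noiseMeasure H T Λ) ∧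
    Integrable (noiseProd (fun x => g x.1 x.2) (fun x => h x.1 x.2)) (noiseMeasure H T Λ) := by
  obtain ⟨hX2, φ, hφg, hφX⟩ := hX
  obtain ⟨hY2, ψ, hψh, hψY⟩ := hY
  obtain ⟨δ, hδ⟩ : ∃ δ : ℕ → ℝ × EuclideanSpace ℝ (Fin d) → ℝ,
    δ = fun n x => (φ n).toFun x.1 x.2 - g x.1 x.2 := ⟨_, rfl⟩
  obtain ⟨ε, hε⟩ : ∃ ε : ℕ → ℝ × EuclideanSpace ℝ (Fin d) → ℝ,
    ε = fun n x => (ψ n).toFun x.1 x.2 - h x.1 x.2 := ⟨_, rfl⟩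
  have hδm : ∀ n, Measurable (δ n) := fun n => by rw [hδ]; exact (φ n).measurable_toFun.sub hg
  have hεm : ∀ n, Measurable (ε n) := fun n => by rw [hε]; exact (ψ n).measurable_toFun.sub hh
  have hδ0 : Tendsto (fun n => noiseForm H T Λ (fun x => ‖δ n x‖ₑ) (fun x => ‖δ n x‖ₑ)) atTop
      (𝓝 0) := by
    refine hφg.congr fun n => ?_
    rw [← noiseNormSq_eq hH (hδm n), hδ]
  have hε0 : Tendsto (fun n => noiseForm H T Λ (fun x => ‖ε n x‖ₑ) (fun x => ‖ε n x‖ₑ)) atTop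
      (𝓝 0) := by
    refine hψh.congr fun n => ?_
    rw [← noiseNormSq_eq hH (hεm n), hε]
  -- An approximable integrand has finite norm: `|g|` is at most the error plus an elementary
  -- integrand, and the mixed terms are controlled by the weak Cauchy–Schwarz inequality.
  have hfin : ∀ {g : ℝ → EuclideanSpace ℝ (Fin d) → ℝ},
      Measurable (fun x : ℝ × EuclideanSpace ℝ (Fin d) => g x.1 x.2) →
      ∀ (φ : ℕ → Elementary d T) (δ : ℕ → ℝ × EuclideanSpace ℝ (Fin d) → ℝ),
      (δ = fun n x => (φ n).toFun x.1 x.2 - g x.1 x.2) → (∀ n, Measurable (δ n)) →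
      Tendsto (fun n => noiseForm H T Λ (fun x => ‖δ n x‖ₑ) (fun x => ‖δ n x‖ₑ)) atTop (𝓝 0) →
      noiseForm H T Λ (fun x => ‖g x.1 x.2‖ₑ) (fun x => ‖g x.1 x.2‖ₑ) ≠ ∞ := by
    intro g hg φ δ hδ hδm hδ0
    obtain ⟨n, hn⟩ := ((ENNReal.tendsto_nhds_zero.1 hδ0) 1 one_pos).exists
    have h1 : noiseForm H T Λ (fun x => ‖(φ n).toFun x.1 x.2‖ₑ)
        (fun x => ‖(φ n).toFun x.1 x.2‖ₑ) ≠ ∞ := by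
      rw [← lintegral_enorm_noiseProd]
      exact ((φ n).integrable_noiseProd hH hΛ (φ n)).2.ne
    have h2 : noiseForm H T Λ (fun x => ‖δ n x‖ₑ) (fun x => ‖δ n x‖ₑ) ≠ ∞ :=
      (hn.trans_lt ENNReal.one_lt_top).ne
    have hfm := (φ n).measurable_toFun.enorm
    have hdm := (hδm n).enorm
    have h3 := two_mul_noiseForm_le hT hH hH1 hW hΛ hdm hfm
    have h4 := two_mul_noiseForm_le hT hH hH1 hW hΛ hfm hdm
    have h5 : ∀ {a b c : ℝ≥0∞}, 2 * a ≤ b + c → b ≠ ∞ → c ≠ ∞ → a ≠ ∞ := by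
      rintro a b c habc hb hc rfl
      rw [ENNReal.mul_top (by norm_num), top_le_iff, ENNReal.add_eq_top] at habc
      exact habc.elim hb hc
    refine ne_top_of_le_ne_top ?_ ((noiseForm_mono (fun x => ?_) (fun x => ?_)).trans
      (noiseForm_add_self_le hdm hfm))
    · exact ENNReal.add_ne_top.2 ⟨ENNReal.add_ne_top.2 ⟨ENNReal.add_ne_top.2
        ⟨h2, h5 h3 h2 h1⟩, h5 h4 h1 h2⟩, h1⟩
    all_goals
      rw [add_comm]
      have : g x.1 x.2 = (φ n).toFun x.1 x.2 - δ n x := by rw [hδ]; ring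
      rw [this]
      exact enorm_sub_le
  have hgfin := hfin hg φ δ hδ hδm hδ0
  have hhfin := hfin hh ψ ε hε hεm hε0
  have hge := hg.enorm
  have hhe := hh.enorm
  have hgh : Integrable (noiseProd (fun x => g x.1 x.2) (fun x => h x.1 x.2))
      (noiseMeasure H T Λ) := by
    refine ⟨(measurable_noiseProd hg hh).aestronglyMeasurable, ?_⟩
    have h3 := two_mul_noiseForm_le hT hH hH1 hW hΛ hge hhe
    rw [hasFiniteIntegral_iff_enorm, lintegral_enorm_noiseProd]
    rw [lt_top_iff_ne_top]
    intro htop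
    rw [htop, ENNReal.mul_top (by norm_num), top_le_iff, ENNReal.add_eq_top] at h3
    exact h3.elim hgfin hhfin
  refine ⟨?_, hgh⟩
  have hlim1 := tendsto_integral_mul_of_eLpNorm (fun n => (φ n).memLp_integral hW.gaussian) hX2
    (fun n => (ψ n).memLp_integral hW.gaussian) hY2 hφX hψY
  refine tendsto_nhds_unique hlim1 ?_
  simp_rw [← fun n => Elementary.integral_noiseProd hH hΛ hW (φ n) (ψ n)]
  refine tendsto_integral_of_L1 _ hgh.aestronglyMeasurable (Eventually.of_forall fun n =>
    (φ n).integrable_noiseProd hH hΛ (ψ n)) ?_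
  have hδε : Tendsto (fun n => noiseForm H T Λ (fun x => ‖δ n x‖ₑ) (fun x => ‖ε n x‖ₑ)) atTop
      (𝓝 0) := by
    refine tendsto_of_tendsto_of_tendsto_of_le_of_le tendsto_const_nhds ?_ (fun n => bot_le)
      fun n => (le_mul_of_one_le_left bot_le one_le_two).trans
        (two_mul_noiseForm_le hT hH hH1 hW hΛ (hδm n).enorm (hεm n).enorm)
    simpa using hδ0.add hε0
  have hδh := (tendsto_noiseForm_of_tendsto hT hH hH1 hW hΛ (fun n => (hδm n).enorm) hhe hδ0
    hhfin).1
  have hgε := (tendsto_noiseForm_of_tendsto hT hH hH1 hW hΛ (fun n => (hεm n).enorm) hge hε0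
    hgfin).2
  refine tendsto_of_tendsto_of_tendsto_of_le_of_le tendsto_const_nhds
    (by simpa using (hδε.add hδh).add hgε) (fun n => bot_le) fun n => ?_
  have hm1 : Measurable fun x => ‖noiseProd (δ n) (ε n) x‖ₑ +
      ‖noiseProd (δ n) (fun x => h x.1 x.2) x‖ₑ :=
    (measurable_noiseProd (hδm n) (hεm n)).enorm.add (measurable_noiseProd (hδm n) hh).enorm
  rw [← lintegral_enorm_noiseProd, ← lintegral_enorm_noiseProd, ← lintegral_enorm_noiseProd,
    ← lintegral_add_left (measurable_noiseProd (hδm n) (hεm n)).enorm, ← lintegral_add_left hm1]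
  refine lintegral_mono fun x => ?_
  -- The difference of the products is `δ ε + δ h + g ε`, and the form of the absolute values of
  -- each term tends to zero. The integrals therefore converge in `L¹`.
  have e : noiseProd (fun x => (φ n).toFun x.1 x.2) (fun x => (ψ n).toFun x.1 x.2) x -
      noiseProd (fun x => g x.1 x.2) (fun x => h x.1 x.2) x =
      noiseProd (δ n) (ε n) x + noiseProd (δ n) (fun x => h x.1 x.2) x +
        noiseProd (fun x => g x.1 x.2) (ε n) x := by
    rw [hδ, hε]
    simp only [noiseProd]
    ring
  rw [e]
  exact (enorm_add_le _ _).trans (add_le_add_left (enorm_add_le _ _) _)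

end Isometry

/-! ### The heat kernel and its Fourier transform -/

section HeatKernel

variable {d : ℕ}

lemma one_add_pow_mul_exp_neg_le {b : ℝ} (hb : 0 < b) (m : ℕ) {s : ℝ} (hs : 0 ≤ s) :
    (1 + s) ^ m * Real.exp (-(b * s ^ 2)) ≤ m.factorial * Real.exp (1 + 1 / (4 * b)) := by
  have h1 := Real.pow_div_factorial_le_exp (1 + s) (by positivity) m
  rw [div_le_iff₀ (by positivity)] at h1
  have h2 : 1 + s + -(b * s ^ 2) ≤ 1 + 1 / (4 * b) := by
    have h3 : 0 ≤ (2 * b * s - 1) ^ 2 / (4 * b) := by positivity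
    have h4 : (2 * b * s - 1) ^ 2 / (4 * b) = b * s ^ 2 - s + 1 / (4 * b) := by field_simp; ring
    linarith
  calc (1 + s) ^ m * Real.exp (-(b * s ^ 2))
      ≤ Real.exp (1 + s) * m.factorial * Real.exp (-(b * s ^ 2)) := by gcongr
    _ = m.factorial * Real.exp (1 + s + -(b * s ^ 2)) := by rw [Real.exp_add (1 + s)]; ring
    _ ≤ _ := by gcongr

/-- The Gaussian `x ↦ exp (-b |x|²)` as a Schwartz function. -/
def gaussianSchwartz (d : ℕ) (b : ℝ) (hb : 0 < b) : SchwartzMap (EuclideanSpace ℝ (Fin d)) ℝ where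
  toFun x := Real.exp (-(b * ‖x‖ ^ 2))
  smooth' := Real.contDiff_exp.comp (contDiff_const.mul (contDiff_norm_sq ℝ)).neg
  decay' := by
    intro k n
    have ht : (fun x : EuclideanSpace ℝ (Fin d) => -(b * ‖x‖ ^ 2)).HasTemperateGrowth :=
      ((Function.HasTemperateGrowth.const b).mul (Function.hasTemperateGrowth_norm_sq _)).neg
    obtain ⟨l, C, hC, hCl⟩ := ht.norm_iteratedFDeriv_le_uniform n
    refine ⟨n.factorial * (C + 1) ^ n * ((k + l * n).factorial * Real.exp (1 + 1 / (4 * b))),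
      fun x => ?_⟩
    -- All derivatives of the outer function equal the Gaussian itself and those of the inner one
    -- grow polynomially, so the bound for derivatives of a composition gives a polynomial times the
    -- Gaussian.
    have h1 : ∀ i, i ≤ n → ‖iteratedFDeriv ℝ i Real.exp (-(b * ‖x‖ ^ 2))‖ ≤
        Real.exp (-(b * ‖x‖ ^ 2)) := fun i _ => by
      rw [norm_iteratedFDeriv_eq_norm_iteratedDeriv, iteratedDeriv_eq_iterate, Real.iter_deriv_exp,
        Real.norm_of_nonneg (Real.exp_pos _).le]
    have h2 : ∀ i, 1 ≤ i → i ≤ n → ‖iteratedFDeriv ℝ i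
        (fun x : EuclideanSpace ℝ (Fin d) => -(b * ‖x‖ ^ 2)) x‖ ≤
        ((C + 1) * (1 + ‖x‖) ^ l) ^ i := fun i hi hin => by
      refine (hCl i hin x).trans (le_trans ?_ (le_self_pow₀ ?_ (by omega)))
      · gcongr; linarith
      · exact one_le_mul_of_one_le_of_one_le (by linarith)
          (one_le_pow₀ (by linarith [norm_nonneg x]))
    have h3 := norm_iteratedFDeriv_comp_le (Real.contDiff_exp (n := (⊤ : ℕ∞))) ht.1
      (mod_cast le_top) x h1 h2
    have h4 : ‖x‖ ^ k ≤ (1 + ‖x‖) ^ k := by gcongr; linarith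
    calc ‖x‖ ^ k * ‖iteratedFDeriv ℝ n (fun x : EuclideanSpace ℝ (Fin d) =>
          Real.exp (-(b * ‖x‖ ^ 2))) x‖
        ≤ (1 + ‖x‖) ^ k * (n.factorial * Real.exp (-(b * ‖x‖ ^ 2)) *
          ((C + 1) * (1 + ‖x‖) ^ l) ^ n) := mul_le_mul h4 h3 (norm_nonneg _) (by positivity)
      _ = n.factorial * (C + 1) ^ n * ((1 + ‖x‖) ^ (k + l * n) * Real.exp (-(b * ‖x‖ ^ 2))) := by
        rw [pow_add, pow_mul, mul_pow]; ring
      _ ≤ _ := by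
        exact mul_le_mul_of_nonneg_left (one_add_pow_mul_exp_neg_le hb _ (norm_nonneg x))
          (by positivity)

@[simp] lemma gaussianSchwartz_apply (b : ℝ) (hb : 0 < b) (x : EuclideanSpace ℝ (Fin d)) :
    gaussianSchwartz d b hb x = Real.exp (-(b * ‖x‖ ^ 2)) := rfl

lemma heatKernel_nonneg (τ : ℝ) (x : EuclideanSpace ℝ (Fin d)) : 0 ≤ heatKernel τ x := by
  unfold heatKernel
  split_ifs with h
  · positivity
  · exact le_rfl

lemma heatKernel_of_pos {τ : ℝ} (hτ : 0 < τ) (x : EuclideanSpace ℝ (Fin d)) :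
    heatKernel τ x = (4 * Real.pi * τ) ^ (-(d : ℝ) / 2) *
      Real.exp (-((4 * τ)⁻¹ * ‖x‖ ^ 2)) := by
  rw [heatKernel, if_pos hτ]
  congr 2
  rw [neg_div, div_eq_inv_mul]

lemma measurable_heatKernel :
    Measurable fun y : ℝ × EuclideanSpace ℝ (Fin d) => heatKernel y.1 y.2 := by
  unfold heatKernel
  refine Measurable.ite (measurableSet_lt measurable_const measurable_fst) ?_ measurable_const
  fun_prop

/-- The heat kernel at a fixed time, centred at `z`, as a Schwartz function. -/
def heatSchwartz {τ : ℝ} (hτ : 0 < τ) (z : EuclideanSpace ℝ (Fin d)) :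
    SchwartzMap (EuclideanSpace ℝ (Fin d)) ℂ :=
  SchwartzMap.postcompCLM (𝕜 := ℝ) Complex.ofRealCLM
    ((4 * Real.pi * τ) ^ (-(d : ℝ) / 2) •
      SchwartzMap.compSubConstCLM ℝ z (gaussianSchwartz d (4 * τ)⁻¹ (by positivity)))

lemma heatSchwartz_apply {τ : ℝ} (hτ : 0 < τ) (z x : EuclideanSpace ℝ (Fin d)) :
    heatSchwartz hτ z x = (heatKernel τ (z - x) : ℝ) := by
  rw [heatKernel_of_pos hτ, norm_sub_rev]
  simp [heatSchwartz]

lemma fourier_heatKernel {τ : ℝ} (hτ : 0 < τ) (z ξ : EuclideanSpace ℝ (Fin d)) :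
    ∫ x, Complex.exp (Complex.I * ((inner ℝ x ξ : ℝ) : ℂ)) * (heatKernel τ (z - x) : ℝ) =
      Complex.exp (Complex.I * ((inner ℝ z ξ : ℝ) : ℂ)) * (Real.exp (-(τ * ‖ξ‖ ^ 2)) : ℝ) := by
  rw [← integral_sub_left_eq_self _ volume z]
  have hb : 0 < (((4 * τ)⁻¹ : ℝ) : ℂ).re := by rw [Complex.ofReal_re]; positivity
  have h1 : ∀ y : EuclideanSpace ℝ (Fin d),
      Complex.exp (Complex.I * ((inner ℝ (z - y) ξ : ℝ) : ℂ)) *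
        (heatKernel τ (z - (z - y)) : ℝ) =
      (Complex.exp (Complex.I * ((inner ℝ z ξ : ℝ) : ℂ)) *
        (((4 * Real.pi * τ) ^ (-(d : ℝ) / 2) : ℝ) : ℂ)) *
        Complex.exp (-(((4 * τ)⁻¹ : ℝ) : ℂ) * ‖y‖ ^ 2 + (-Complex.I) *
            ((inner ℝ ξ y : ℝ) : ℂ)) := by
    intro y
    rw [heatKernel_of_pos hτ, sub_sub_cancel, inner_sub_left, real_inner_comm ξ y]
    push_cast
    rw [mul_sub, sub_eq_add_neg, Complex.exp_add, Complex.exp_add]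
    ring_nf
  simp_rw [h1]
  rw [integral_const_mul, GaussianFourier.integral_cexp_neg_mul_sq_norm_add hb, mul_assoc]
  congr 1
  have h2 : (Real.pi : ℂ) / (((4 * τ)⁻¹ : ℝ) : ℂ) = ((4 * Real.pi * τ : ℝ) : ℂ) := by
    push_cast; field_simp
  rw [h2, finrank_euclideanSpace_fin, ← Complex.ofReal_natCast,
    show ((d : ℝ) : ℂ) / 2 = (((d : ℝ) / 2 : ℝ) : ℂ) by push_cast; ring,
    ← Complex.ofReal_cpow (by positivity), ← mul_assoc, ← Complex.ofReal_mul,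
    ← Real.rpow_add (by positivity), neg_div, neg_add_cancel, Real.rpow_zero, Complex.ofReal_one,
    one_mul, Complex.ofReal_exp]
  congr 1
  push_cast
  rw [neg_sq, Complex.I_sq]
  have : (τ : ℂ) ≠ 0 := by exact_mod_cast hτ.ne'
  field_simp

/-- The cosine changes sign, so a single value is not a spectral integral of a nonnegative function.
Adding the value at `z = 0` replaces `cos` by `1 + cos ≥ 0` and keeps all manipulations in `[0, ∞]`,
where Tonelli needs no integrability. -/
lemma lintegral_heatKernel_add {Λ μ : Measure (EuclideanSpace ℝ (Fin d))}
    (hΛ : IsSpectralMeasure Λ μ) {τ : ℝ} (hτ : 0 < τ) (z : EuclideanSpace ℝ (Fin d)) :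
    ∫⁻ v, ENNReal.ofReal (heatKernel τ (z - v)) ∂Λ +
      ∫⁻ v, ENNReal.ofReal (heatKernel τ (0 - v)) ∂Λ =
    ENNReal.ofReal ((2 * Real.pi) ^ d)⁻¹ *
      ∫⁻ ξ, ENNReal.ofReal ((1 + Real.cos (inner ℝ z ξ)) * Real.exp (-(τ * ‖ξ‖ ^ 2))) ∂μ := by
  have : Λ.HasTemperateGrowth := hΛ.temperate
  have : μ.HasTemperateGrowth := hΛ.temperate_spectral
  have hint : ∀ z, Integrable (fun v => heatKernel τ (z - v)) Λ := fun z => by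
    have h := (heatSchwartz hτ z).integrable (μ := Λ)
    have h2 := h.re
    simpa [heatSchwartz_apply] using h2
  have hg : Integrable (fun ξ => Real.exp (-(τ * ‖ξ‖ ^ 2))) μ :=
    (gaussianSchwartz d τ hτ).integrable
  have hcos : ∀ z : EuclideanSpace ℝ (Fin d),
      Integrable (fun ξ => Real.cos (inner ℝ z ξ) * Real.exp (-(τ * ‖ξ‖ ^ 2))) μ := fun z =>
    hg.bdd_mul (c := 1) (by fun_prop) (ae_of_all _ fun ξ => by
      simpa using Real.abs_cos_le_one _)
  have key : ∀ z, ∫ v, heatKernel τ (z - v) ∂Λ = ((2 * Real.pi) ^ d)⁻¹ *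
      ∫ ξ, Real.cos (inner ℝ z ξ) * Real.exp (-(τ * ‖ξ‖ ^ 2)) ∂μ := by
    intro z
    have h := hΛ.fourier (heatSchwartz hτ z)
    simp_rw [heatSchwartz_apply, fourier_heatKernel hτ] at h
    have h2 := congrArg Complex.re h
    rw [integral_complex_ofReal, Complex.ofReal_re, ← Complex.ofReal_inv,
      Complex.re_ofReal_mul] at h2
    rw [h2]
    congr 1
    have hci : Integrable (fun ξ => Complex.exp (Complex.I * ((inner ℝ z ξ : ℝ) : ℂ)) *
        (Real.exp (-(τ * ‖ξ‖ ^ 2)) : ℝ)) μ :=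
      hg.ofReal.bdd_mul (c := 1) (by fun_prop) (ae_of_all _ fun ξ => by
        rw [mul_comm, Complex.norm_exp_ofReal_mul_I])
    have h3 := integral_re hci
    simp only [RCLike.re_to_complex] at h3
    rw [← h3]
    refine integral_congr_ae (ae_of_all _ fun ξ => ?_)
    simp only
    rw [Complex.re_mul_ofReal, mul_comm Complex.I, Complex.exp_ofReal_mul_I_re]
  rw [← ofReal_integral_eq_lintegral_ofReal (hint z) (ae_of_all _ fun v => heatKernel_nonneg _ _),
    ← ofReal_integral_eq_lintegral_ofReal (hint 0) (ae_of_all _ fun v => heatKernel_nonneg _ _),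
    ← ENNReal.ofReal_add (integral_nonneg fun v => heatKernel_nonneg _ _)
      (integral_nonneg fun v => heatKernel_nonneg _ _), key z, key 0]
  have h1 : ∀ ξ : EuclideanSpace ℝ (Fin d),
      (1 + Real.cos (inner ℝ z ξ)) * Real.exp (-(τ * ‖ξ‖ ^ 2)) =
      Real.cos (inner ℝ z ξ) * Real.exp (-(τ * ‖ξ‖ ^ 2)) +
      Real.cos (inner ℝ 0 ξ) * Real.exp (-(τ * ‖ξ‖ ^ 2)) := fun ξ => by
    rw [inner_zero_left, Real.cos_zero]; ring
  have hsum : Integrable (fun ξ => (1 + Real.cos (inner ℝ z ξ)) * Real.exp (-(τ * ‖ξ‖ ^ 2))) μ := by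
    simp_rw [h1]
    exact (hcos z).add (hcos 0)
  rw [← ofReal_integral_eq_lintegral_ofReal hsum (ae_of_all _ fun ξ => mul_nonneg
    (by linarith [Real.neg_one_le_cos (inner ℝ z ξ)]) (Real.exp_pos _).le),
    ← ENNReal.ofReal_mul (by positivity)]
  congr 1
  rw [← mul_add, ← integral_add (hcos z) (hcos 0)]
  simp_rw [h1]

/-- The semigroup property of the heat kernel. -/
lemma lintegral_heatKernel_mul {τ₁ τ₂ : ℝ} (h₁ : 0 < τ₁) (h₂ : 0 < τ₂)
    (a b : EuclideanSpace ℝ (Fin d)) :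
    ∫⁻ w, ENNReal.ofReal (heatKernel τ₁ (a - w)) * ENNReal.ofReal (heatKernel τ₂ (b - w)) =
      ENNReal.ofReal (heatKernel (τ₁ + τ₂) (a - b)) := by
  have h12 : 0 < τ₁ + τ₂ := by positivity
  obtain ⟨k, hk⟩ : ∃ k, k = (τ₁ + τ₂) / (4 * τ₁ * τ₂) := ⟨_, rfl⟩
  have hk0 : 0 < k := by rw [hk]; positivity
  obtain ⟨c, hc⟩ : ∃ c, c = (τ₁ / (τ₁ + τ₂)) • (b - a) := ⟨_, rfl⟩
  have hsq : ∀ w : EuclideanSpace ℝ (Fin d),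
      (4 * τ₁)⁻¹ * ‖w‖ ^ 2 + (4 * τ₂)⁻¹ * ‖(b - a) + w‖ ^ 2 =
      (4 * (τ₁ + τ₂))⁻¹ * ‖a - b‖ ^ 2 + k * ‖w + c‖ ^ 2 := by
    intro w
    rw [norm_sub_rev a b, norm_add_sq_real (b - a) w, norm_add_sq_real w c, hc, norm_smul,
      inner_smul_right, Real.norm_of_nonneg (by positivity), real_inner_comm, hk]
    field_simp
    ring
  rw [← lintegral_sub_left_eq_self _ a]
  obtain ⟨A, hA⟩ : ∃ A, A = (4 * Real.pi * τ₁) ^ (-(d : ℝ) / 2) *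
    (4 * Real.pi * τ₂) ^ (-(d : ℝ) / 2) * Real.exp (-((4 * (τ₁ + τ₂))⁻¹ * ‖a - b‖ ^ 2)) := ⟨_, rfl⟩
  have hA0 : 0 ≤ A := by rw [hA]; positivity
  have h1 : ∀ w : EuclideanSpace ℝ (Fin d), ENNReal.ofReal (heatKernel τ₁ (a - (a - w))) *
      ENNReal.ofReal (heatKernel τ₂ (b - (a - w))) =
      ENNReal.ofReal (A * Real.exp (-k * ‖w + c‖ ^ 2)) := by
    intro w
    rw [← ENNReal.ofReal_mul (heatKernel_nonneg _ _)]
    congr 1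
    rw [sub_sub_cancel, show b - (a - w) = (b - a) + w by abel, heatKernel_of_pos h₁,
      heatKernel_of_pos h₂, hA]
    calc _ = (4 * Real.pi * τ₁) ^ (-(d : ℝ) / 2) * (4 * Real.pi * τ₂) ^ (-(d : ℝ) / 2) *
          Real.exp (-((4 * τ₁)⁻¹ * ‖w‖ ^ 2 + (4 * τ₂)⁻¹ * ‖(b - a) + w‖ ^ 2)) := by
          rw [neg_add, Real.exp_add]; ring
      _ = _ := by rw [hsq, neg_add, Real.exp_add]; ring_nf
  simp_rw [h1]
  rw [lintegral_add_right_eq_self (fun w : EuclideanSpace ℝ (Fin d) =>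
    ENNReal.ofReal (A * Real.exp (-k * ‖w‖ ^ 2))) c]
  have hint : Integrable (fun w : EuclideanSpace ℝ (Fin d) => Real.exp (-k * ‖w‖ ^ 2)) := by
    refine ((gaussianSchwartz d k hk0).integrable (μ := volume)).congr (ae_of_all _ fun w => ?_)
    simp only [gaussianSchwartz_apply, neg_mul]
  rw [← ofReal_integral_eq_lintegral_ofReal (hint.const_mul A)
    (ae_of_all _ fun w => mul_nonneg hA0 (Real.exp_pos _).le), integral_const_mul,
    GaussianFourier.integral_rexp_neg_mul_sq_norm hk0, finrank_euclideanSpace_fin]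
  congr 1
  rw [heatKernel_of_pos h12, hA, hk]
  have e1 : (Real.pi / ((τ₁ + τ₂) / (4 * τ₁ * τ₂))) = (4 * Real.pi * τ₁) * (4 * Real.pi * τ₂) *
      (4 * Real.pi * (τ₁ + τ₂))⁻¹ := by
    field_simp
  have e2 : ∀ x : ℝ, 0 < x → x ^ (-(d : ℝ) / 2) * x ^ ((d : ℝ) / 2) = 1 := fun x hx => by
    rw [← Real.rpow_add hx, neg_div, neg_add_cancel, Real.rpow_zero]
  have e3 : ∀ x y z : ℝ, 0 < x → 0 < y → 0 < z → x ^ (-(d : ℝ) / 2) * y ^ (-(d : ℝ) / 2) *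
      (x * y * z⁻¹) ^ ((d : ℝ) / 2) = z ^ (-(d : ℝ) / 2) := fun x y z hx hy hz => by
    rw [Real.mul_rpow (by positivity) (by positivity), Real.mul_rpow hx.le hy.le,
      Real.inv_rpow hz.le, ← Real.rpow_neg hz.le, ← neg_div]
    calc _ = (x ^ (-(d : ℝ) / 2) * x ^ ((d : ℝ) / 2)) * (y ^ (-(d : ℝ) / 2) * y ^ ((d : ℝ) / 2)) *
          z ^ (-(d : ℝ) / 2) := by ring
      _ = _ := by rw [e2 x hx, e2 y hy]; ring
  rw [e1, ← e3 (4 * Real.pi * τ₁) (4 * Real.pi * τ₂) (4 * Real.pi * (τ₁ + τ₂)) (by positivity)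
    (by positivity) (by positivity)]
  ring

end HeatKernel

/-! ### The covariance of the solution -/

section Covariance

variable {d : ℕ} {H T : ℝ}

/-- The amplitude at frequency `ξ` with `|ξ|² = λ`: the Volterra transform of the heat semigroup. -/
def heatAmp (H t l u : ℝ) : ℝ≥0∞ :=
  ∫⁻ r in Ioo 0 t, ENNReal.ofReal (Real.exp (-((t - r) * l))) * volterra H r u

lemma measurable_heatAmp (H t : ℝ) : Measurable fun q : ℝ × ℝ => heatAmp H t q.1 q.2 := by
  have : Measurable fun y : (ℝ × ℝ) × ℝ =>
      ENNReal.ofReal (Real.exp (-((t - y.2) * y.1.1))) * volterra H y.2 y.1.2 :=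
    Measurable.mul (by fun_prop) ((measurable_volterra H).comp
      (f := fun y : (ℝ × ℝ) × ℝ => (y.2, y.1.2)) (by fun_prop))
  exact this.lintegral_prod_right'

lemma measurable_heatAmp_norm (H t : ℝ) :
    Measurable fun q : EuclideanSpace ℝ (Fin d) × ℝ => heatAmp H t (‖q.1‖ ^ 2) q.2 :=
  (measurable_heatAmp H t).comp (f := fun q : EuclideanSpace ℝ (Fin d) × ℝ => (‖q.1‖ ^ 2, q.2))
    (by fun_prop)

/-- The heat kernel as an integrand for the noise. -/
def heatIntegrand (t : ℝ) (x : EuclideanSpace ℝ (Fin d)) (y : ℝ × EuclideanSpace ℝ (Fin d)) : ℝ :=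
  heatKernel (t - y.1) (x - y.2)

lemma measurable_heatIntegrand (t : ℝ) (x : EuclideanSpace ℝ (Fin d)) :
    Measurable (heatIntegrand t x) :=
  measurable_heatKernel.comp (f := fun y : ℝ × EuclideanSpace ℝ (Fin d) => (t - y.1, x - y.2))
    (by fun_prop)

/-- The smoothed covariance of the noise. -/
def heatSmooth (Λ : Measure (EuclideanSpace ℝ (Fin d))) (t s : ℝ) (z : EuclideanSpace ℝ (Fin d))
    (p : ℝ × ℝ) : ℝ≥0∞ :=
  if p.1 < t ∧ p.2 < s then
    ∫⁻ v, ENNReal.ofReal (heatKernel (t - p.1 + (s - p.2)) (z - v)) ∂Λ else 0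

lemma measurable_heatSmooth (Λ : Measure (EuclideanSpace ℝ (Fin d))) [SFinite Λ] (t s : ℝ)
    (z : EuclideanSpace ℝ (Fin d)) : Measurable (heatSmooth Λ t s z) := by
  refine Measurable.ite ((measurableSet_lt measurable_fst measurable_const).inter
    (measurableSet_lt measurable_snd measurable_const)) ?_ measurable_const
  have : Measurable fun y : (ℝ × ℝ) × EuclideanSpace ℝ (Fin d) =>
      heatKernel (t - y.1.1 + (s - y.1.2)) (z - y.2) :=
    measurable_heatKernel.comp (f := fun y : (ℝ × ℝ) × EuclideanSpace ℝ (Fin d) =>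
      (t - y.1.1 + (s - y.1.2), z - y.2)) (by fun_prop)
  exact this.ennreal_ofReal.lintegral_prod_right'

lemma noiseForm_heatIntegrand (Λ : Measure (EuclideanSpace ℝ (Fin d))) [SFinite Λ] (t s : ℝ)
    (x y : EuclideanSpace ℝ (Fin d)) :
    noiseForm H T Λ (fun w => ENNReal.ofReal (heatIntegrand t x w))
      (fun w => ENNReal.ofReal (heatIntegrand s y w)) =
      ∫⁻ p, heatSmooth Λ t s (x - y) p ∂(timeMeasure H T) := by
  have hm := measurable_noiseForm_integrand (measurable_heatIntegrand t x).ennreal_ofReal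
    (measurable_heatIntegrand s y).ennreal_ofReal
  rw [noiseForm, noiseMeasure, lintegral_prod _ hm.aemeasurable]
  refine lintegral_congr fun p => ?_
  refine (lintegral_prod _ (hm.comp (f := fun y => (p, y)) (by fun_prop)).aemeasurable).trans ?_
  simp only [Function.comp_apply, heatIntegrand]
  unfold heatSmooth
  split_ifs with h
  · refine lintegral_congr fun v => ?_
    rw [show x - y - v = (x - v) - y by abel,
      ← lintegral_heatKernel_mul (sub_pos.2 h.1) (sub_pos.2 h.2)]
    refine lintegral_congr fun w => ?_
    rw [show x - (w + v) = x - v - w by abel]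
  · have h0 : ∀ v w : EuclideanSpace ℝ (Fin d),
        ENNReal.ofReal (heatKernel (t - p.1) (x - (w + v))) *
          ENNReal.ofReal (heatKernel (s - p.2) (y - w)) = 0 := by
      intro v w
      rw [not_and_or] at h
      rcases h with h | h
      · rw [heatKernel, if_neg (by linarith), ENNReal.ofReal_zero, zero_mul]
      · rw [heatKernel, heatKernel, if_neg (c := 0 < s - p.2) (by linarith), ENNReal.ofReal_zero,
          mul_zero]
    simp [h0]

lemma setLIntegral_Ioc_ite {t : ℝ} (ht : t ≤ T) (f : ℝ → ℝ≥0∞) :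
    ∫⁻ r in Ioc 0 T, (if r < t then f r else 0) = ∫⁻ r in Ioo 0 t, f r := by
  rw [← lintegral_indicator measurableSet_Ioc, ← lintegral_indicator measurableSet_Ioo]
  refine lintegral_congr fun r => ?_
  simp only [indicator, mem_Ioc, mem_Ioo]
  split_ifs with h1 h2 h3 h4 h5 <;> first | rfl | (exfalso; grind)

/-- Integrating out the second space variable merges the two heat kernels by the semigroup property;
the `Λ`-integral of the result passes to frequencies. There the exponential is a product of
functions of the two times, so the Volterra representation splits it into two amplitudes. -/
lemma exists_noiseForm_heat_eq {Λ μ : Measure (EuclideanSpace ℝ (Fin d))} [SFinite Λ] [SFinite μ]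
    (hH : 1 / 2 < H) (hH1 : H < 1) (hΛ : IsSpectralMeasure Λ μ) :
    ∃ κ : ℝ, 0 < κ ∧ ∀ T t s, t ≤ T → s ≤ T → ∀ x y : EuclideanSpace ℝ (Fin d),
      noiseForm H T Λ (fun w => ENNReal.ofReal (heatIntegrand t x w))
        (fun w => ENNReal.ofReal (heatIntegrand s y w)) +
      noiseForm H T Λ (fun w => ENNReal.ofReal (heatIntegrand t x w))
        (fun w => ENNReal.ofReal (heatIntegrand s x w)) =
      ENNReal.ofReal κ * ∫⁻ q, ENNReal.ofReal (1 + Real.cos (inner ℝ (x - y) q.1)) *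
        (heatAmp H t (‖q.1‖ ^ 2) q.2 * heatAmp H s (‖q.1‖ ^ 2) q.2) ∂(μ.prod volume) := by
  obtain ⟨κ, hκ, hκeq⟩ := exists_lintegral_timeMeasure_prod_eq hH hH1
  refine ⟨((2 * Real.pi) ^ d)⁻¹ * κ, by positivity, fun T t s ht hs x y => ?_⟩
  have hc : ∀ a, 0 ≤ 1 + Real.cos a := fun a => by linarith [Real.neg_one_le_cos a]
  obtain ⟨F, hF⟩ : ∃ F : ℝ → ℝ × EuclideanSpace ℝ (Fin d) → ℝ≥0∞, F = fun t y =>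
    if y.1 < t then ENNReal.ofReal (Real.exp (-((t - y.1) * ‖y.2‖ ^ 2))) else 0 := ⟨_, rfl⟩
  have hFm : ∀ t, Measurable (F t) := fun t => by
    rw [hF]
    refine Measurable.ite (measurableSet_lt measurable_fst measurable_const) ?_ measurable_const
    fun_prop
  obtain ⟨cz, hcz⟩ : ∃ cz : EuclideanSpace ℝ (Fin d) → ℝ≥0∞,
    cz = fun ξ => ENNReal.ofReal (1 + Real.cos (inner ℝ (x - y) ξ)) := ⟨_, rfl⟩
  have hczm : Measurable cz := by rw [hcz]; fun_prop
  have hFt : Measurable fun y : ℝ × EuclideanSpace ℝ (Fin d) => cz y.2 * F t y :=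
    (hczm.comp measurable_snd).mul (hFm t)
  have h1 := hκeq T μ _ _ hFt (hFm s)
  have hprod : Measurable fun x : (ℝ × ℝ) × EuclideanSpace ℝ (Fin d) =>
      cz x.2 * F t (x.1.1, x.2) * F s (x.1.2, x.2) :=
    (hFt.comp (f := fun x : (ℝ × ℝ) × EuclideanSpace ℝ (Fin d) => (x.1.1, x.2))
      (by fun_prop)).mul ((hFm s).comp (by fun_prop))
  rw [noiseForm_heatIntegrand, noiseForm_heatIntegrand, sub_self,
    ← lintegral_add_left (measurable_heatSmooth Λ t s (x - y)), ENNReal.ofReal_mul (by positivity),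
    mul_assoc]
  have h2 : ∀ p, heatSmooth Λ t s (x - y) p + heatSmooth Λ t s 0 p =
      ENNReal.ofReal ((2 * Real.pi) ^ d)⁻¹ *
        ∫⁻ ξ, cz ξ * F t (p.1, ξ) * F s (p.2, ξ) ∂μ := by
    intro p
    unfold heatSmooth
    split_ifs with h
    · rw [lintegral_heatKernel_add hΛ (by linarith [h.1, h.2])]
      congr 1
      refine lintegral_congr fun ξ => ?_
      simp only [hF, hcz, h.1, h.2, if_true]
      rw [mul_assoc, ← ENNReal.ofReal_mul (Real.exp_pos _).le, ← ENNReal.ofReal_mul (hc _),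
        ← Real.exp_add]
      congr 3
      ring
    · have h0 : ∀ ξ, cz ξ * F t (p.1, ξ) * F s (p.2, ξ) = 0 := by
        intro ξ
        rw [not_and_or] at h
        rcases h with h | h
        · simp [hF, h]
        · simp [hF, h]
      simp [h0]
  simp_rw [h2]
  rw [lintegral_const_mul _ hprod.lintegral_prod_right']
  congr 1
  rw [← lintegral_prod _ hprod.aemeasurable, h1]
  congr 1
  have h3 : Measurable fun q : EuclideanSpace ℝ (Fin d) × ℝ =>
      ENNReal.ofReal (1 + Real.cos (inner ℝ (x - y) q.1)) *
        (heatAmp H t (‖q.1‖ ^ 2) q.2 * heatAmp H s (‖q.1‖ ^ 2) q.2) :=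
    Measurable.mul (by fun_prop) ((measurable_heatAmp_norm H t).mul (measurable_heatAmp_norm H s))
  rw [lintegral_prod_symm _ h3.aemeasurable]
  refine lintegral_congr fun u => lintegral_congr fun ξ => ?_
  have h4 : ∀ t, t ≤ T → ∫⁻ r in Ioc 0 T, F t (r, ξ) * volterra H r u =
      heatAmp H t (‖ξ‖ ^ 2) u := by
    intro t ht
    rw [heatAmp, ← setLIntegral_Ioc_ite ht]
    refine lintegral_congr fun r => ?_
    simp only [hF, ite_mul, zero_mul]
  have h5 : ∫⁻ r in Ioc 0 T, cz (r, ξ).2 * F t (r, ξ) * volterra H r u =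
      cz ξ * heatAmp H t (‖ξ‖ ^ 2) u := by
    rw [← h4 t ht, ← lintegral_const_mul' _ _ (by rw [hcz]; exact ENNReal.ofReal_ne_top)]
    simp_rw [mul_assoc]
  rw [h5, h4 s hs, hcz, mul_assoc]

/-- The covariance of the solution in its spectral form. -/
def heatCov (κ H : ℝ) (μ : Measure (EuclideanSpace ℝ (Fin d)))
    (p p' : ℝ × EuclideanSpace ℝ (Fin d)) : ℝ :=
  κ * ∫ q, Real.cos (inner ℝ (p.2 - p'.2) q.1) *
    ((heatAmp H p.1 (‖q.1‖ ^ 2) q.2).toReal * (heatAmp H p'.1 (‖q.1‖ ^ 2) q.2).toReal)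
      ∂(μ.prod volume)

/-- The amplitude at time `t` as a real function. -/
def realAmp (H t : ℝ) (q : EuclideanSpace ℝ (Fin d) × ℝ) : ℝ :=
  (heatAmp H t (‖q.1‖ ^ 2) q.2).toReal

lemma measurable_realAmp (H t : ℝ) : Measurable (realAmp (d := d) H t) :=
  (measurable_heatAmp_norm H t).ennreal_toReal

lemma realAmp_nonneg (H t : ℝ) (q : EuclideanSpace ℝ (Fin d) × ℝ) : 0 ≤ realAmp H t q :=
  ENNReal.toReal_nonneg

/-- An amplitude with finite square integral is infinite only on a null set, so passing to real
values loses nothing. -/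
lemma ae_ofReal_realAmp {μ : Measure (EuclideanSpace ℝ (Fin d))} [SFinite μ] {t : ℝ}
    (h : ∫⁻ q, heatAmp H t (‖q.1‖ ^ 2) q.2 ^ 2 ∂(μ.prod volume) < ∞) :
    ∀ᵐ q ∂(μ.prod volume), ENNReal.ofReal (realAmp H t q) = heatAmp H t (‖q.1‖ ^ 2) q.2 := by
  filter_upwards [ae_lt_top ((measurable_heatAmp_norm H t).pow_const 2) h.ne] with q hq
  refine ENNReal.ofReal_toReal fun htop => ?_
  rw [htop] at hq
  simp at hq

lemma memLp_realAmp {μ : Measure (EuclideanSpace ℝ (Fin d))} [SFinite μ] {t : ℝ}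
    (h : ∫⁻ q, heatAmp H t (‖q.1‖ ^ 2) q.2 ^ 2 ∂(μ.prod volume) < ∞) :
    MemLp (realAmp H t) 2 (μ.prod volume) := by
  refine (memLp_two_iff_integrable_sq (measurable_realAmp H t).aestronglyMeasurable).2
    ⟨((measurable_realAmp H t).pow_const 2).aestronglyMeasurable, ?_⟩
  rw [hasFiniteIntegral_iff_ofReal (ae_of_all _ fun q => sq_nonneg _)]
  refine lt_of_le_of_lt (lintegral_mono fun q => ?_) h
  rw [ENNReal.ofReal_pow (realAmp_nonneg H t q)]
  gcongr
  exact ENNReal.ofReal_toReal_le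

lemma integrable_cos_mul_realAmp {μ : Measure (EuclideanSpace ℝ (Fin d))} [SFinite μ] {t s : ℝ}
    (ht : MemLp (realAmp H t) 2 (μ.prod volume)) (hs : MemLp (realAmp H s) 2 (μ.prod volume))
    (z : EuclideanSpace ℝ (Fin d)) :
    Integrable (fun q => Real.cos (inner ℝ z q.1) * (realAmp H t q * realAmp H s q))
      (μ.prod volume) :=
  (ht.integrable_mul hs).bdd_mul (c := 1) (by fun_prop)
    (ae_of_all _ fun q => by simpa using Real.abs_cos_le_one _)

/-- The isometry reduces the covariance to the form of the two heat kernels. The identity with `1 +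
cos` is used for the given displacement and for displacement zero; all quantities are finite, so the
second, halved, can be subtracted from the first, and `cos` remains. -/
lemma exists_integral_mul_eq_heatCov {Λ μ : Measure (EuclideanSpace ℝ (Fin d))} [SFinite Λ]
    [SFinite μ] (hH : 1 / 2 < H) (hH1 : H < 1) (hT : 0 < T) (hΛ : IsSpectralMeasure Λ μ)
    (hamp : ∀ t ∈ Ioc 0 T, ∫⁻ q, heatAmp H t (‖q.1‖ ^ 2) q.2 ^ 2 ∂(μ.prod volume) < ∞) :
    ∃ κ : ℝ, 0 < κ ∧ ∀ {Ω : Type u} [MeasurableSpace Ω] (P : Measure Ω)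
      (W : ℝ → Set (EuclideanSpace ℝ (Fin d)) → Ω → ℝ), IsNoise P H T Λ W →
      ∀ (p p' : ℝ × EuclideanSpace ℝ (Fin d)) (X Y : Ω → ℝ), p.1 ∈ Ioc 0 T → p'.1 ∈ Ioc 0 T →
      IsWienerIntegral P H T Λ W (fun r z => heatKernel (p.1 - r) (p.2 - z)) X →
      IsWienerIntegral P H T Λ W (fun r z => heatKernel (p'.1 - r) (p'.2 - z)) Y →
      ∫ ω, X ω * Y ω ∂P = heatCov κ H μ p p' := by
  obtain ⟨κ, hκ, hκeq⟩ := exists_noiseForm_heat_eq hH hH1 hΛ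
  refine ⟨κ, hκ, fun {Ω} _ P W hW p p' X Y hp hp' hX hY => ?_⟩
  obtain ⟨h1, h2⟩ := IsWienerIntegral.integral_mul hT hH hH1
    (isLocallyFiniteMeasure_of_hasTemperateGrowth hΛ.temperate).1 hW
    (measurable_heatIntegrand p.1 p.2) (measurable_heatIntegrand p'.1 p'.2) hX hY
  have hnn : ∀ x, 0 ≤ noiseProd (heatIntegrand p.1 p.2) (heatIntegrand p'.1 p'.2) x := fun x =>
    mul_nonneg (heatKernel_nonneg _ _) (heatKernel_nonneg _ _)
  have hN : ∀ y : EuclideanSpace ℝ (Fin d), ∫⁻ x, ENNReal.ofReal (noiseProd (heatIntegrand p.1 p.2)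
      (heatIntegrand p'.1 y) x) ∂(noiseMeasure H T Λ) =
      noiseForm H T Λ (fun w => ENNReal.ofReal (heatIntegrand p.1 p.2 w))
        (fun w => ENNReal.ofReal (heatIntegrand p'.1 y w)) := fun y =>
    lintegral_congr fun x => ENNReal.ofReal_mul (heatKernel_nonneg _ _)
  have hat := ae_ofReal_realAmp (hamp p.1 hp)
  have has := ae_ofReal_realAmp (hamp p'.1 hp')
  have hmt := memLp_realAmp (hamp p.1 hp)
  have hms := memLp_realAmp (hamp p'.1 hp')
  have hR : ∀ z : EuclideanSpace ℝ (Fin d),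
      ∫⁻ q, ENNReal.ofReal (1 + Real.cos (inner ℝ z q.1)) *
        (heatAmp H p.1 (‖q.1‖ ^ 2) q.2 * heatAmp H p'.1 (‖q.1‖ ^ 2) q.2) ∂(μ.prod volume) =
      ENNReal.ofReal (∫ q, Real.cos (inner ℝ z q.1) * (realAmp H p.1 q * realAmp H p'.1 q)
        ∂(μ.prod volume) + ∫ q, realAmp H p.1 q * realAmp H p'.1 q ∂(μ.prod volume)) := by
    intro z
    have hi := integrable_cos_mul_realAmp hmt hms z
    have hi2 : Integrable (fun q => realAmp H p.1 q * realAmp H p'.1 q) (μ.prod volume) :=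
      hmt.integrable_mul hms
    have hi3 : Integrable (fun q => Real.cos (inner ℝ z q.1) *
        (realAmp H p.1 q * realAmp H p'.1 q) +
      realAmp H p.1 q * realAmp H p'.1 q) (μ.prod volume) := hi.add hi2
    have hc : ∀ q : EuclideanSpace ℝ (Fin d) × ℝ, 0 ≤ 1 + Real.cos (inner ℝ z q.1) := fun q => by
      linarith [Real.neg_one_le_cos (inner ℝ z q.1)]
    have he : ∀ q : EuclideanSpace ℝ (Fin d) × ℝ,
        Real.cos (inner ℝ z q.1) * (realAmp H p.1 q * realAmp H p'.1 q) +
        realAmp H p.1 q * realAmp H p'.1 q =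
        (1 + Real.cos (inner ℝ z q.1)) * (realAmp H p.1 q * realAmp H p'.1 q) := fun q => by ring
    rw [← integral_add hi hi2, ofReal_integral_eq_lintegral_ofReal hi3 (ae_of_all _ fun q => by
      exact (mul_nonneg (hc q) (mul_nonneg (realAmp_nonneg _ _ _) (realAmp_nonneg _ _ _))).trans_eq
          (he q).symm)]
    refine lintegral_congr_ae ?_
    filter_upwards [hat, has] with q hq hq'
    rw [he, ENNReal.ofReal_mul (hc q), ENNReal.ofReal_mul (realAmp_nonneg _ _ _), hq, hq']
  have e1 := hκeq T p.1 p'.1 hp.2 hp'.2 p.2 p'.2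
  -- With equal space points the left side is twice the quantity to be subtracted.
  have e2 := hκeq T p.1 p'.1 hp.2 hp'.2 p.2 p.2
  rw [hR, ← ENNReal.ofReal_mul hκ.le] at e1 e2
  simp only [sub_self, inner_zero_left, Real.cos_zero, one_mul] at e2
  have hfin1 : noiseForm H T Λ (fun w => ENNReal.ofReal (heatIntegrand p.1 p.2 w))
      (fun w => ENNReal.ofReal (heatIntegrand p'.1 p'.2 w)) ≠ ∞ :=
    ne_top_of_le_ne_top ENNReal.ofReal_ne_top (le_self_add.trans_eq e1)
  have hfin2 : noiseForm H T Λ (fun w => ENNReal.ofReal (heatIntegrand p.1 p.2 w))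
      (fun w => ENNReal.ofReal (heatIntegrand p'.1 p.2 w)) ≠ ∞ :=
    ne_top_of_le_ne_top ENNReal.ofReal_ne_top (le_self_add.trans_eq e2)
  have hA : 0 ≤ ∫ q, realAmp H p.1 q * realAmp H p'.1 q ∂(μ.prod volume) :=
    integral_nonneg fun q => mul_nonneg (realAmp_nonneg _ _ _) (realAmp_nonneg _ _ _)
  have hB : 0 ≤ ∫ q, Real.cos (inner ℝ (p.2 - p'.2) q.1) * (realAmp H p.1 q * realAmp H p'.1 q)
        ∂(μ.prod volume) + ∫ q, realAmp H p.1 q * realAmp H p'.1 q ∂(μ.prod volume) := by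
    have hi2 : Integrable (fun q => realAmp H p.1 q * realAmp H p'.1 q) (μ.prod volume) :=
      hmt.integrable_mul hms
    rw [← integral_add (integrable_cos_mul_realAmp hmt hms _) hi2]
    refine integral_nonneg fun q => ?_
    have : 0 ≤ (1 + Real.cos (inner ℝ (p.2 - p'.2) q.1)) * (realAmp H p.1 q * realAmp H p'.1 q) :=
      mul_nonneg (by linarith [Real.neg_one_le_cos (inner ℝ (p.2 - p'.2) q.1)])
        (mul_nonneg (realAmp_nonneg _ _ _) (realAmp_nonneg _ _ _))
    simp only [Pi.zero_apply]
    linarith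
  have e1' := congrArg ENNReal.toReal e1
  have e2' := congrArg ENNReal.toReal e2
  rw [ENNReal.toReal_add hfin1 hfin2, ENNReal.toReal_ofReal (mul_nonneg hκ.le hB)] at e1'
  rw [ENNReal.toReal_add hfin2 hfin2,
    ENNReal.toReal_ofReal (mul_nonneg hκ.le (add_nonneg hA hA))] at e2'
  have h3 : ∫ ω, X ω * Y ω ∂P =
      (noiseForm H T Λ (fun w => ENNReal.ofReal (heatIntegrand p.1 p.2 w))
      (fun w => ENNReal.ofReal (heatIntegrand p'.1 p'.2 w))).toReal := by
    rw [← hN, ← integral_eq_lintegral_of_nonneg_ae (ae_of_all _ hnn) h2.1]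
    exact h1
  rw [h3]
  have h4 : heatCov κ H μ p p' = κ * ∫ q, Real.cos (inner ℝ (p.2 - p'.2) q.1) *
    (realAmp H p.1 q * realAmp H p'.1 q) ∂(μ.prod volume) := rfl
  rw [h4]
  linarith

end Covariance

/-! ### Radial integrals -/

section Radial

variable {d : ℕ}

/-- Polar coordinates. The value of `C` is part of the conclusion so that the constants obtained for
different `f` can be identified. -/
lemma lintegral_fun_norm (hd : 0 < d) {f : ℝ → ℝ≥0∞} (hf : Measurable f) :
    ∃ C : ℝ≥0∞, C ≠ 0 ∧ C ≠ ∞ ∧ C = (volume : Measure (EuclideanSpace ℝ (Fin d))).toSphere univ ∧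
    ∫⁻ x : EuclideanSpace ℝ (Fin d), f ‖x‖ =
      C * ∫⁻ y in Ioi (0 : ℝ), ENNReal.ofReal (y ^ (d - 1)) * f y := by
  have : Nonempty (Fin d) := ⟨⟨0, hd⟩⟩
  have hC : (volume : Measure (EuclideanSpace ℝ (Fin d))).toSphere univ ≠ ∞ := measure_ne_top _ _
  refine ⟨_, ?_, hC, rfl, ?_⟩
  · rw [Ne, Measure.measure_univ_eq_zero]
    exact Measure.toSphere_ne_zero _
  calc ∫⁻ x : EuclideanSpace ℝ (Fin d), f ‖x‖
      = ∫⁻ x : ({(0)}ᶜ : Set (EuclideanSpace ℝ (Fin d))), f ‖x.1‖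
          ∂((volume : Measure (EuclideanSpace ℝ (Fin d))).comap (↑)) := by
        rw [lintegral_subtype_comap (measurableSet_singleton _).compl fun x => f ‖x‖,
          restrict_compl_singleton]
    _ = ∫⁻ x, f x.2 ∂((volume : Measure (EuclideanSpace ℝ (Fin d))).toSphere.prod
          (.volumeIoiPow (d - 1))) := by
        have h := Measure.measurePreserving_homeomorphUnitSphereProd
          (volume : Measure (EuclideanSpace ℝ (Fin d)))
        rw [finrank_euclideanSpace_fin] at h
        simpa using h.lintegral_comp_emb (Homeomorph.measurableEmbedding _)
          (f ∘ Subtype.val ∘ Prod.snd)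
    _ = _ := by
        have hf2 : Measurable fun x : Ioi (0 : ℝ) => f x := hf.comp measurable_subtype_coe
        have hf3 : Measurable fun x : Metric.sphere (0 : EuclideanSpace ℝ (Fin d)) 1 × Ioi
            (0 : ℝ) =>
            f x.2 := hf2.comp measurable_snd
        rw [lintegral_prod _ hf3.aemeasurable]
        dsimp only
        rw [lintegral_const, mul_comm]
        congr 1
        rw [Measure.volumeIoiPow, lintegral_withDensity_eq_lintegral_mul _ (by fun_prop) hf2,
          ← lintegral_subtype_comap measurableSet_Ioi]
        rfl

/-- Polar coordinates for the Riesz kernel. -/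
lemma exists_lintegral_norm_rpow_eq (hd : 0 < d) (α : ℝ) :
    ∃ C : ℝ, 0 < C ∧ ∀ f : ℝ → ℝ≥0∞, Measurable f →
      ∫⁻ ξ : EuclideanSpace ℝ (Fin d), f ‖ξ‖ * ENNReal.ofReal (‖ξ‖ ^ (-α)) =
        ENNReal.ofReal C * ∫⁻ y in Ioi (0 : ℝ), f y * ENNReal.ofReal (y ^ ((d : ℝ) - α - 1)) := by
  -- The zero function only serves to name the constant before `f` is given.
  obtain ⟨C, hC0, hC, hCe, -⟩ := lintegral_fun_norm hd (f := 0) measurable_const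
  refine ⟨C.toReal, ENNReal.toReal_pos hC0 hC, fun f hf => ?_⟩
  obtain ⟨C', -, -, hCe', h⟩ := lintegral_fun_norm hd
    (f := fun y => f y * ENNReal.ofReal (y ^ (-α))) (hf.mul (by fun_prop))
  rw [h, ENNReal.ofReal_toReal hC, hCe', hCe]
  congr 1
  refine setLIntegral_congr_fun measurableSet_Ioi fun y hy => ?_
  have hy0 : (0 : ℝ) < y := hy
  rw [mul_left_comm, ← ENNReal.ofReal_mul (by positivity), ← Real.rpow_natCast,
    ← Real.rpow_add hy0, Nat.cast_sub hd]
  congr 3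
  push_cast
  ring

/-- A quadratic factor in a radial integral. -/
lemma lintegral_norm_mul_inner_sq {f : ℝ → ℝ≥0∞} (hf : Measurable f)
    (z : EuclideanSpace ℝ (Fin d)) :
    (d : ℝ≥0∞) * ∫⁻ ξ : EuclideanSpace ℝ (Fin d), f ‖ξ‖ * ENNReal.ofReal (inner ℝ z ξ ^ 2) =
      ENNReal.ofReal (‖z‖ ^ 2) *
        ∫⁻ ξ : EuclideanSpace ℝ (Fin d), f ‖ξ‖ * ENNReal.ofReal (‖ξ‖ ^ 2) := by
  -- By rotation invariance only the length of the vector matters: a reflection exchanges two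
  -- vectors of equal length. So `z` may be turned into each coordinate direction, and the sum over
  -- the directions restores `‖ξ‖²`.
  have hrot : ∀ v w : EuclideanSpace ℝ (Fin d), ‖v‖ = ‖w‖ →
      ∫⁻ ξ : EuclideanSpace ℝ (Fin d), f ‖ξ‖ * ENNReal.ofReal (inner ℝ v ξ ^ 2) =
      ∫⁻ ξ : EuclideanSpace ℝ (Fin d), f ‖ξ‖ * ENNReal.ofReal (inner ℝ w ξ ^ 2) := by
    intro v w hvw
    obtain ⟨R, hR⟩ : ∃ R : EuclideanSpace ℝ (Fin d) ≃ₗᵢ[ℝ] EuclideanSpace ℝ (Fin d), R v = w :=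
      ⟨_, Submodule.reflection_sub hvw⟩
    rw [← R.measurePreserving.lintegral_comp_emb R.toHomeomorph.measurableEmbedding
      (fun ξ => f ‖ξ‖ * ENNReal.ofReal (inner ℝ w ξ ^ 2))]
    refine lintegral_congr fun ξ => ?_
    rw [R.norm_map, ← hR, R.inner_map_map]
  have h1 : ∀ i : Fin d,
      ∫⁻ ξ : EuclideanSpace ℝ (Fin d), f ‖ξ‖ * ENNReal.ofReal (inner ℝ z ξ ^ 2) =
      ∫⁻ ξ : EuclideanSpace ℝ (Fin d), ENNReal.ofReal (‖z‖ ^ 2) *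
        (f ‖ξ‖ * ENNReal.ofReal (ξ i ^ 2)) := by
    intro i
    rw [hrot z (EuclideanSpace.single i ‖z‖) (by simp)]
    refine lintegral_congr fun ξ => ?_
    rw [EuclideanSpace.inner_single_left, mul_pow, ENNReal.ofReal_mul (by simp)]
    simp only [conj_trivial]
    ring
  have h2 : (d : ℝ≥0∞) * ∫⁻ ξ : EuclideanSpace ℝ (Fin d), f ‖ξ‖ * ENNReal.ofReal (inner ℝ z ξ ^ 2) =
      ∑ i : Fin d, ∫⁻ ξ : EuclideanSpace ℝ (Fin d), ENNReal.ofReal (‖z‖ ^ 2) *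
        (f ‖ξ‖ * ENNReal.ofReal (ξ i ^ 2)) := by
    rw [← Finset.sum_congr rfl fun i _ => h1 i]
    simp
  have hm : ∀ i : Fin d, Measurable fun ξ : EuclideanSpace ℝ (Fin d) =>
      ENNReal.ofReal (‖z‖ ^ 2) * (f ‖ξ‖ * ENNReal.ofReal (ξ i ^ 2)) := fun i =>
    ((hf.comp measurable_norm).mul (by fun_prop)).const_mul _
  rw [h2, ← lintegral_finsetSum _ fun i _ => hm i,
    ← lintegral_const_mul' _ _ ENNReal.ofReal_ne_top]
  refine lintegral_congr fun ξ => ?_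
  rw [← Finset.mul_sum, ← Finset.mul_sum, ← ENNReal.ofReal_sum_of_nonneg fun i _ => sq_nonneg _]
  congr 3
  rw [EuclideanSpace.norm_sq_eq]
  simp

/-- Integrals of radial functions with respect to a spectral measure comparable to `|ξ|^{-α} dξ`. -/
lemma IsComparableRiesz.exists_radial {α : ℝ} {μ : Measure (EuclideanSpace ℝ (Fin d))}
    (hμ : IsComparableRiesz α μ) (hd : 0 < d) :
    ∃ c C : ℝ, 0 < c ∧ 0 < C ∧ ∀ f : ℝ → ℝ≥0∞, Measurable f →
      ENNReal.ofReal c * ∫⁻ y in Ioi (0 : ℝ), f y * ENNReal.ofReal (y ^ ((d : ℝ) - α - 1)) ≤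
        ∫⁻ ξ, f ‖ξ‖ ∂μ ∧
      ∫⁻ ξ, f ‖ξ‖ ∂μ ≤
        ENNReal.ofReal C * ∫⁻ y in Ioi (0 : ℝ), f y * ENNReal.ofReal (y ^ ((d : ℝ) - α - 1)) := by
  obtain ⟨c₁, c₂, hc₁, hc₂, h⟩ := hμ
  obtain ⟨K, hK, hKf⟩ := exists_lintegral_norm_rpow_eq hd α
  refine ⟨c₁ * K, c₂ * K, by positivity, by positivity, fun f hf => ?_⟩
  have := h (fun ξ => f ‖ξ‖) (hf.comp measurable_norm)
  rwa [hKf f hf, ← mul_assoc, ← mul_assoc, ← ENNReal.ofReal_mul hc₁.le,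
    ← ENNReal.ofReal_mul hc₂.le] at this

lemma IsComparableRiesz.exists_inner_sq {α : ℝ} {μ : Measure (EuclideanSpace ℝ (Fin d))}
    (hμ : IsComparableRiesz α μ) (hd : 0 < d) :
    ∃ c : ℝ, 0 < c ∧ ∀ f : ℝ → ℝ≥0∞, Measurable f → ∀ z,
      ENNReal.ofReal (c * ‖z‖ ^ 2) *
        ∫⁻ y in Ioi (0 : ℝ), f y * ENNReal.ofReal (y ^ ((d : ℝ) - α + 1)) ≤
      ∫⁻ ξ, f ‖ξ‖ * ENNReal.ofReal (inner ℝ z ξ ^ 2) ∂μ := by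
  obtain ⟨c₁, c₂, hc₁, hc₂, h⟩ := hμ
  obtain ⟨K, hK, hKf⟩ := exists_lintegral_norm_rpow_eq hd α
  have hd' : (0 : ℝ) < d := Nat.cast_pos.2 hd
  refine ⟨c₁ * K / d, by positivity, fun f hf z => ?_⟩
  have hfm : Measurable fun ξ : EuclideanSpace ℝ (Fin d) => f ‖ξ‖ := hf.comp measurable_norm
  have hm : Measurable fun ξ : EuclideanSpace ℝ (Fin d) =>
      f ‖ξ‖ * ENNReal.ofReal (inner ℝ z ξ ^ 2) := hfm.mul (by fun_prop)
  refine le_trans (le_of_eq ?_) (h _ hm).1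
  have h1 := lintegral_norm_mul_inner_sq (f := fun y => f y * ENNReal.ofReal (y ^ (-α)))
    (hf.mul (by fun_prop)) z
  have h2 := hKf (fun y => f y * ENNReal.ofReal (y ^ 2)) (hf.mul (by fun_prop))
  have e1 : ∀ ξ : EuclideanSpace ℝ (Fin d), f ‖ξ‖ * ENNReal.ofReal (‖ξ‖ ^ (-α)) *
      ENNReal.ofReal (‖ξ‖ ^ 2) = f ‖ξ‖ * ENNReal.ofReal (‖ξ‖ ^ 2) * ENNReal.ofReal (‖ξ‖ ^ (-α)) :=
    fun ξ => by ring
  have e2 : ∀ ξ : EuclideanSpace ℝ (Fin d), f ‖ξ‖ * ENNReal.ofReal (‖ξ‖ ^ (-α)) *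
      ENNReal.ofReal (inner ℝ z ξ ^ 2) =
      f ‖ξ‖ * ENNReal.ofReal (inner ℝ z ξ ^ 2) * ENNReal.ofReal (‖ξ‖ ^ (-α)) :=
    fun ξ => by ring
  have e3 : ∫⁻ y in Ioi (0 : ℝ), f y * ENNReal.ofReal (y ^ 2) *
      ENNReal.ofReal (y ^ ((d : ℝ) - α - 1)) =
      ∫⁻ y in Ioi (0 : ℝ), f y * ENNReal.ofReal (y ^ ((d : ℝ) - α + 1)) := by
    refine setLIntegral_congr_fun measurableSet_Ioi fun y hy => ?_
    have hy0 : (0 : ℝ) < y := hy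
    rw [mul_assoc, ← ENNReal.ofReal_mul (by positivity), ← Real.rpow_natCast,
      ← Real.rpow_add hy0]
    congr 3
    push_cast
    ring
  simp_rw [e1, e2] at h1
  rw [h2, e3] at h1
  have h3 : ENNReal.ofReal (c₁ * K / d * ‖z‖ ^ 2) =
      ENNReal.ofReal c₁ * ((d : ℝ≥0∞)⁻¹ * (ENNReal.ofReal (‖z‖ ^ 2) * ENNReal.ofReal K)) := by
    rw [← ENNReal.ofReal_natCast, ← ENNReal.ofReal_inv_of_pos hd',
      ← ENNReal.ofReal_mul (by positivity), ← ENNReal.ofReal_mul (by positivity),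
      ← ENNReal.ofReal_mul (by positivity)]
    congr 1
    ring
  rw [h3, mul_assoc, mul_assoc, mul_assoc, ← h1, ← mul_assoc (d : ℝ≥0∞)⁻¹,
    ENNReal.inv_mul_cancel (by simpa using hd.ne') (ENNReal.natCast_ne_top d), one_mul]

end Radial

/-! ### Estimates of the amplitudes -/

section Amplitude

variable {H : ℝ}

lemma lintegral_Ioo_rpow {b h : ℝ} (hb : -1 < b) (hh : 0 ≤ h) :
    ∫⁻ x in Ioo 0 h, ENNReal.ofReal (x ^ b) = ENNReal.ofReal (h ^ (b + 1) / (b + 1)) := by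
  have hi : IntegrableOn (fun x : ℝ => x ^ b) (Ioc 0 h) := by
    rw [← intervalIntegrable_iff_integrableOn_Ioc_of_le hh]
    exact intervalIntegral.intervalIntegrable_rpow' hb
  rw [restrict_Ioo_eq_restrict_Ioc, ← ofReal_integral_eq_lintegral_ofReal hi
    ((ae_restrict_iff' measurableSet_Ioc).2 (ae_of_all _ fun x hx => Real.rpow_nonneg hx.1.le _)),
    ← intervalIntegral.integral_of_le hh, integral_rpow (Or.inl hb), Real.zero_rpow (by linarith),
    sub_zero]

/-- For `h ≤ 1/l` drop the exponential; for `h ≥ 1/l` extend the range to the half-line and use the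
Gamma integral. -/
lemma exists_lintegral_rpow_mul_exp_le {a : ℝ} (ha : 0 < a) :
    ∃ C : ℝ, 0 < C ∧ ∀ h l : ℝ, 0 ≤ h → 0 < l →
      ∫⁻ x in Ioo 0 h, ENNReal.ofReal (x ^ (a - 1) * Real.exp (-(l * x))) ≤
        ENNReal.ofReal (C * min h (1 / l) ^ a) := by
  refine ⟨max (1 / a) (Real.Gamma a), lt_max_of_lt_left (by positivity), fun h l hh hl => ?_⟩
  have hG := Real.Gamma_pos_of_pos ha
  rcases le_total h (1 / l) with hle | hle
  · rw [min_eq_left hle]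
    calc ∫⁻ x in Ioo 0 h, ENNReal.ofReal (x ^ (a - 1) * Real.exp (-(l * x)))
        ≤ ∫⁻ x in Ioo 0 h, ENNReal.ofReal (x ^ (a - 1)) := by
          refine setLIntegral_mono (by fun_prop) fun x hx => ENNReal.ofReal_le_ofReal ?_
          refine mul_le_of_le_one_right (Real.rpow_nonneg hx.1.le _) (Real.exp_le_one_iff.2 ?_)
          have := mul_pos hl hx.1
          linarith
      _ = ENNReal.ofReal (h ^ a / a) := by
          rw [lintegral_Ioo_rpow (by linarith) hh, sub_add_cancel]
      _ ≤ _ := by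
          refine ENNReal.ofReal_le_ofReal ?_
          rw [div_eq_inv_mul, ← one_div]
          gcongr
          exact le_max_left _ _
  · rw [min_eq_right hle]
    calc ∫⁻ x in Ioo 0 h, ENNReal.ofReal (x ^ (a - 1) * Real.exp (-(l * x)))
        ≤ ∫⁻ x in Ioi 0, ENNReal.ofReal (x ^ (a - 1) * Real.exp (-(l * x))) :=
          lintegral_mono_set Ioo_subset_Ioi_self
      _ = ENNReal.ofReal ((1 / l) ^ a * Real.Gamma a) := by
          have hi := integrableOn_rpow_mul_exp_neg_mul_rpow (s := a - 1) (by linarith) one_pos hl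
          simp only [Real.rpow_one, neg_mul] at hi
          rw [← ofReal_integral_eq_lintegral_ofReal hi ((ae_restrict_iff' measurableSet_Ioi).2
            (ae_of_all _ fun x hx => mul_nonneg (Real.rpow_nonneg (le_of_lt hx) _)
              (Real.exp_pos _).le)), Real.integral_rpow_mul_exp_neg_mul_Ioi ha hl]
      _ ≤ _ := by
          refine ENNReal.ofReal_le_ofReal ?_
          rw [mul_comm]
          gcongr
          exact le_max_right _ _

lemma setLIntegral_Ioo_comp_sub_right (s t u : ℝ) (f : ℝ → ℝ≥0∞) :
    ∫⁻ r in Ioo s t, f (r - u) = ∫⁻ x in Ioo (s - u) (t - u), f x := by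
  rw [← lintegral_indicator measurableSet_Ioo, ← lintegral_indicator measurableSet_Ioo,
    ← lintegral_sub_right_eq_self ((Ioo (s - u) (t - u)).indicator f) u]
  refine lintegral_congr fun r => ?_
  simp only [indicator, mem_Ioo, sub_lt_sub_iff_right]

lemma setLIntegral_Ioo_comp_sub_left (s t : ℝ) (f : ℝ → ℝ≥0∞) :
    ∫⁻ r in Ioo s t, f (t - r) = ∫⁻ x in Ioo 0 (t - s), f x := by
  rw [← lintegral_indicator measurableSet_Ioo, ← lintegral_indicator measurableSet_Ioo,
    ← lintegral_sub_left_eq_self ((Ioo 0 (t - s)).indicator f) t]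
  refine lintegral_congr fun r => ?_
  simp only [indicator, mem_Ioo, sub_pos, sub_lt_sub_iff_left, and_comm]

/-- The part of the amplitude due to the noise after time `s`. -/
def heatAmpFrom (H s t l u : ℝ) : ℝ≥0∞ :=
  ∫⁻ r in Ioo s t, ENNReal.ofReal (Real.exp (-((t - r) * l))) * volterra H r u

lemma measurable_volterra_left (H u : ℝ) : Measurable fun r => volterra H r u :=
  (measurable_volterra H).comp (f := fun r : ℝ => (r, u)) (by fun_prop)

/-- The contribution of the times before `s` is the amplitude at `s`, damped by the heat semigroup
over the elapsed time. -/
lemma heatAmp_eq_add {s t : ℝ} (hs : 0 < s) (hst : s ≤ t) (l u : ℝ) :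
    heatAmp H t l u = ENNReal.ofReal (Real.exp (-((t - s) * l))) * heatAmp H s l u +
      heatAmpFrom H s t l u := by
  rcases hst.eq_or_lt with rfl | hst
  · simp [heatAmpFrom]
  · rw [heatAmp, heatAmp, heatAmpFrom, ← Ioo_union_Ico_eq_Ioo hs hst.le,
      lintegral_union measurableSet_Ico (by
        rw [Set.disjoint_left]; exact fun x hx hx' => absurd hx.2 (not_lt.2 hx'.1)),
      restrict_Ioo_eq_restrict_Ico, ← lintegral_const_mul' _ _ ENNReal.ofReal_ne_top]
    congr 1
    · rw [← restrict_Ioo_eq_restrict_Ico]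
      refine lintegral_congr fun r => ?_
      rw [← mul_assoc, ← ENNReal.ofReal_mul (Real.exp_pos _).le, ← Real.exp_add]
      congr 3
      ring
    · rw [← restrict_Ioo_eq_restrict_Ico (a := s)]

/-- Causality: the amplitude at time `s` does not see `u ≥ s`. The innovation of a later value is
found on precisely this range of `u`. -/
lemma heatAmp_eq_zero {s l u : ℝ} (hu : s ≤ u) : heatAmp H s l u = 0 := by
  rw [heatAmp, setLIntegral_eq_zero measurableSet_Ioo]
  intro r hr
  have : volterra H r u = 0 := by rw [volterra, if_neg (by linarith [hr.2])]
  simp [this]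

/-- Reading the Volterra representation backwards turns the square integral into a double integral
of two exponentials against `|r - r'|^{2H-2}`. It is dominated by products of one-dimensional
integrals in the distance to `t` and in `|r - r'|`; these are of orders `m` and `m^{2H-1}` with `m =
min (t - s) (1 / l)`. -/
lemma exists_lintegral_heatAmpFrom_le (hH : 1 / 2 < H) (hH1 : H < 1) :
    ∃ C : ℝ, 0 < C ∧ ∀ s t l : ℝ, 0 ≤ s → s ≤ t → 0 < l →
      ∫⁻ u, heatAmpFrom H s t l u ^ 2 ≤
        ENNReal.ofReal (C * min (t - s) (1 / l) ^ (2 * H)) := by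
  obtain ⟨κ, hκ, hκeq⟩ := exists_lintegral_timeMeasure_eq hH hH1
  obtain ⟨C₁, hC₁, h₁⟩ := exists_lintegral_rpow_mul_exp_le one_pos
  obtain ⟨C₂, hC₂, h₂⟩ := exists_lintegral_rpow_mul_exp_le (a := 2 * H - 1) (by linarith)
  obtain ⟨c, hc⟩ : ∃ c, c = H * (2 * H - 1) := ⟨_, rfl⟩
  have hc0 : 0 < c := by rw [hc]; exact mul_pos (by linarith) (by linarith)
  refine ⟨κ⁻¹ * (2 * c * (C₂ * C₁)), by positivity, fun s t l hs hst hl => ?_⟩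
  obtain ⟨m, hm⟩ : ∃ m, m = min (t - s) (1 / l) := ⟨_, rfl⟩
  have hm0 : 0 ≤ m := by rw [hm]; exact le_min (by linarith) (by positivity)
  obtain ⟨F, hF⟩ : ∃ F : ℝ → ℝ≥0∞, F = (Ioo s t).indicator
    fun r => ENNReal.ofReal (Real.exp (-((t - r) * l))) := ⟨_, rfl⟩
  have hFm : Measurable F := by rw [hF]; exact Measurable.indicator (by fun_prop) measurableSet_Ioo
  obtain ⟨φ, hφ⟩ : ∃ φ : ℝ → ℝ≥0∞, φ = (Ioo 0 (t - s)).indicator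
    fun x => ENNReal.ofReal (x ^ ((1 : ℝ) - 1) * Real.exp (-(l * x))) := ⟨_, rfl⟩
  have hφm : Measurable φ := by rw [hφ]; exact Measurable.indicator (by fun_prop) measurableSet_Ioo
  obtain ⟨ψ, hψ⟩ : ∃ ψ : ℝ → ℝ≥0∞, ψ = (Ioo 0 (t - s)).indicator
    fun x => ENNReal.ofReal (x ^ (2 * H - 1 - 1) * Real.exp (-(l * x))) := ⟨_, rfl⟩
  have hψm : Measurable ψ := by rw [hψ]; exact Measurable.indicator (by fun_prop) measurableSet_Ioo
  have hΦ : ∫⁻ x, φ x ≤ ENNReal.ofReal (C₁ * m) := by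
    rw [hφ, lintegral_indicator measurableSet_Ioo, hm]
    simpa using h₁ (t - s) l (by linarith) hl
  have hΨ : ∫⁻ x, ψ x ≤ ENNReal.ofReal (C₂ * m ^ (2 * H - 1)) := by
    rw [hψ, lintegral_indicator measurableSet_Ioo, hm]
    exact h₂ (t - s) l (by linarith) hl
  have hamp : ∀ u, ∫⁻ r in Ioc 0 t, F r * volterra H r u = heatAmpFrom H s t l u := by
    intro u
    rw [heatAmpFrom, ← lintegral_indicator measurableSet_Ioc, ← lintegral_indicator
      measurableSet_Ioo]
    refine lintegral_congr fun r => ?_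
    by_cases hr : r ∈ Ioo s t
    · rw [indicator_of_mem hr, indicator_of_mem (show r ∈ Ioc 0 t from
        ⟨hs.trans_lt hr.1, hr.2.le⟩), hF,
        indicator_of_mem hr]
    · rw [indicator_of_notMem hr, hF, indicator_apply, indicator_of_notMem hr, zero_mul, ite_self]
  have hq := hκeq t (fun p => F p.1 * F p.2) ((hFm.comp measurable_fst).mul
    (hFm.comp measurable_snd))
  have hsq : ∀ u, ∫⁻ p, F p.1 * F p.2 * (volterra H p.1 u * volterra H p.2 u)
      ∂((volume.restrict (Ioc 0 t)).prod (volume.restrict (Ioc 0 t))) =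
      heatAmpFrom H s t l u ^ 2 := by
    intro u
    have hFv : Measurable fun r => F r * volterra H r u := hFm.mul (measurable_volterra_left H u)
    rw [sq, ← hamp u, ← lintegral_prod_mul hFv.aemeasurable hFv.aemeasurable]
    refine lintegral_congr fun p => ?_
    ring
  simp_rw [hsq] at hq
  have hpt : ∀ p : ℝ × ℝ, ENNReal.ofReal (H * (2 * H - 1) * |p.1 - p.2| ^ (2 * H - 2)) *
      (F p.1 * F p.2) ≤ ENNReal.ofReal c *
        (φ (t - p.1) * ψ (p.1 - p.2) + φ (t - p.2) * ψ (p.2 - p.1)) := by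
    have key : ∀ r r' : ℝ, r' < r → ENNReal.ofReal (H * (2 * H - 1) * |r - r'| ^ (2 * H - 2)) *
        (F r * F r') ≤ ENNReal.ofReal c * (φ (t - r) * ψ (r - r')) := by
      intro r r' hlt
      by_cases hr : r ∈ Ioo s t
      · by_cases hr' : r' ∈ Ioo s t
        · have m1 : t - r ∈ Ioo 0 (t - s) := ⟨by linarith [hr.2], by linarith [hr.1]⟩
          have m2 : r - r' ∈ Ioo 0 (t - s) := ⟨by linarith, by linarith [hr.2, hr'.1]⟩
          have hp : 0 ≤ (r - r') ^ (2 * H - 2) := Real.rpow_nonneg (by linarith) _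
          rw [hF, hφ, hψ, indicator_of_mem hr, indicator_of_mem hr', indicator_of_mem m1,
            indicator_of_mem m2, ← hc, abs_of_pos (by linarith : 0 < r - r'), sub_self,
            Real.rpow_zero, one_mul, ← ENNReal.ofReal_mul (Real.exp_pos _).le,
            ← ENNReal.ofReal_mul (Real.exp_pos _).le, ← ENNReal.ofReal_mul (by positivity),
            ← ENNReal.ofReal_mul hc0.le]
          refine ENNReal.ofReal_le_ofReal ?_
          -- Since `t - r' = (t - r) + (r - r')`, one superfluous factor `exp(-l (t - r)) ≤ 1` is
          -- dropped.
          have e1 : Real.exp (-((t - r) * l)) * Real.exp (-((t - r') * l)) ≤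
              Real.exp (-(l * (t - r))) * Real.exp (-(l * (r - r'))) := by
            rw [← Real.exp_add, ← Real.exp_add]
            refine Real.exp_le_exp.2 ?_
            nlinarith [mul_pos hl m1.1]
          rw [show 2 * H - 1 - 1 = 2 * H - 2 by ring]
          calc c * (r - r') ^ (2 * H - 2) *
                (Real.exp (-((t - r) * l)) * Real.exp (-((t - r') * l)))
              ≤ c * (r - r') ^ (2 * H - 2) *
                (Real.exp (-(l * (t - r))) * Real.exp (-(l * (r - r')))) := by gcongr
            _ = _ := by ring
        · rw [hF, indicator_of_notMem hr', mul_zero, mul_zero]; exact bot_le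
      · rw [hF, indicator_of_notMem hr, zero_mul, mul_zero]; exact bot_le
    rintro ⟨r, r'⟩
    simp only
    rcases lt_trichotomy r r' with h | h | h
    · rw [abs_sub_comm, mul_comm (F r)]
      exact (key r' r h).trans (mul_le_mul_right le_add_self _)
    -- On the diagonal the density takes the conventional value `0 ^ (2H - 2) = 0`.
    · rw [h, sub_self, abs_zero, Real.zero_rpow (by linarith), mul_zero, ENNReal.ofReal_zero,
        zero_mul]
      exact bot_le
    · exact (key r r' h).trans (mul_le_mul_right le_self_add _)
  have hm1 : Measurable fun p : ℝ × ℝ => φ (t - p.1) * ψ (p.1 - p.2) :=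
    (hφm.comp (by fun_prop)).mul (hψm.comp (by fun_prop))
  have hm2 : Measurable fun p : ℝ × ℝ => φ (t - p.2) * ψ (p.2 - p.1) :=
    (hφm.comp (by fun_prop)).mul (hψm.comp (by fun_prop))
  have hI : ∫⁻ r, ∫⁻ r', φ (t - r) * ψ (r - r') = (∫⁻ x, ψ x) * ∫⁻ x, φ x := by
    have : ∀ r, ∫⁻ r', φ (t - r) * ψ (r - r') = (∫⁻ x, ψ x) * φ (t - r) := by
      intro r
      have hψr : Measurable fun r' => ψ (r - r') := hψm.comp (by fun_prop)
      rw [lintegral_const_mul _ hψr, lintegral_sub_left_eq_self ψ r, mul_comm]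
    simp_rw [this]
    have hφt : Measurable fun r => φ (t - r) := hφm.comp (by fun_prop)
    rw [lintegral_const_mul _ hφt, lintegral_sub_left_eq_self φ t]
  have hJ : ∫⁻ p, F p.1 * F p.2 ∂(timeMeasure H t) ≤
      ENNReal.ofReal c * ((∫⁻ x, ψ x) * (∫⁻ x, φ x) + (∫⁻ x, ψ x) * ∫⁻ x, φ x) := by
    have hFF : Measurable fun p : ℝ × ℝ => F p.1 * F p.2 :=
      (hFm.comp measurable_fst).mul (hFm.comp measurable_snd)
    rw [timeMeasure, lintegral_withDensity_eq_lintegral_mul _ (by fun_prop) hFF,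
      Measure.prod_restrict]
    refine (setLIntegral_le_lintegral _ _).trans ((lintegral_mono hpt).trans_eq ?_)
    rw [lintegral_const_mul' _ _ ENNReal.ofReal_ne_top, lintegral_add_left hm1,
      lintegral_prod _ hm1.aemeasurable, lintegral_prod_symm _ hm2.aemeasurable]
    simp only
    rw [hI]
  have hfin : ENNReal.ofReal κ * ∫⁻ u, heatAmpFrom H s t l u ^ 2 ≤
      ENNReal.ofReal κ * ENNReal.ofReal (κ⁻¹ * (2 * c * (C₂ * C₁)) * m ^ (2 * H)) := by
    rw [← hq, ← ENNReal.ofReal_mul hκ.le]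
    refine hJ.trans ?_
    have e : (∫⁻ x, ψ x) * ∫⁻ x, φ x ≤ ENNReal.ofReal (C₂ * m ^ (2 * H - 1) * (C₁ * m)) := by
      rw [ENNReal.ofReal_mul (by positivity)]
      exact mul_le_mul' hΨ hΦ
    refine (mul_le_mul_right (add_le_add e e) _).trans ?_
    rw [← ENNReal.ofReal_add (by positivity) (by positivity), ← ENNReal.ofReal_mul hc0.le]
    refine ENNReal.ofReal_le_ofReal (le_of_eq ?_)
    have e2 : m ^ (2 * H) = m ^ (2 * H - 1) * m := by
      rw [← Real.rpow_add_one' hm0 (by linarith), sub_add_cancel]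
    rw [e2]
    field_simp
    ring
  rw [← hm]
  exact (ENNReal.mul_le_mul_iff_right (by simpa using hκ) ENNReal.ofReal_ne_top).1 hfin

/-- For `u` within `m = min (t - s) (1 / l)` of `t` the exponential is at least `e⁻¹` on `(u, t)`,
so the amplitude is at least a multiple of `(t - u)^{H-1/2}`. Squaring and integrating over these
`u` gives `m^{2H}`. -/
lemma exists_le_lintegral_heatAmp (hH : 1 / 2 < H) :
    ∃ c : ℝ, 0 < c ∧ ∀ s t l : ℝ, 0 ≤ s → s < t → 0 < l →
      ENNReal.ofReal (c * min (t - s) (1 / l) ^ (2 * H)) ≤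
        ∫⁻ u in Ioo s t, heatAmp H t l u ^ 2 := by
  have ha : 0 < H - 1 / 2 := by linarith
  refine ⟨(Real.exp (-1) / (H - 1 / 2)) ^ 2 / (2 * H), by positivity, fun s t l hs hst hl => ?_⟩
  obtain ⟨m, hm⟩ : ∃ m, m = min (t - s) (1 / l) := ⟨_, rfl⟩
  have hm0 : 0 < m := by rw [hm]; exact lt_min (by linarith) (by positivity)
  have hms : m ≤ t - s := by rw [hm]; exact min_le_left _ _
  have hml : m * l ≤ 1 := by
    have : m ≤ 1 / l := by rw [hm]; exact min_le_right _ _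
    rwa [le_div_iff₀ hl] at this
  have hlow : ∀ u ∈ Ioo (t - m) t, ENNReal.ofReal ((Real.exp (-1) / (H - 1 / 2)) ^ 2) *
      ENNReal.ofReal ((t - u) ^ (2 * H - 1)) ≤ heatAmp H t l u ^ 2 := by
    intro u hu
    have htu : 0 < t - u := by linarith [hu.2]
    have h1 : ENNReal.ofReal (Real.exp (-1) / (H - 1 / 2) * (t - u) ^ (H - 1 / 2)) ≤
        heatAmp H t l u := by
      calc ENNReal.ofReal (Real.exp (-1) / (H - 1 / 2) * (t - u) ^ (H - 1 / 2))
          = ENNReal.ofReal (Real.exp (-1)) * ∫⁻ r in Ioo u t, ENNReal.ofReal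
              ((r - u) ^ (H - 3 / 2)) := by
            rw [setLIntegral_Ioo_comp_sub_right u t u fun x => ENNReal.ofReal (x ^ (H - 3 / 2)),
              sub_self, lintegral_Ioo_rpow (by linarith) htu.le,
              ← ENNReal.ofReal_mul (Real.exp_pos _).le, show H - 3 / 2 + 1 = H - 1 / 2 by ring]
            congr 1
            ring
        _ = ∫⁻ r in Ioo u t, ENNReal.ofReal (Real.exp (-1)) *
              ENNReal.ofReal ((r - u) ^ (H - 3 / 2)) :=
            (lintegral_const_mul' _ _ ENNReal.ofReal_ne_top).symm
        _ ≤ ∫⁻ r in Ioo u t, ENNReal.ofReal (Real.exp (-((t - r) * l))) * volterra H r u := by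
            refine setLIntegral_mono' measurableSet_Ioo fun r hr => ?_
            rw [volterra, if_pos hr.1]
            gcongr
            have : (t - r) * l ≤ m * l := by
              gcongr
              linarith [hr.1, hu.1]
            linarith
        _ ≤ heatAmp H t l u := lintegral_mono_set (Ioo_subset_Ioo_left (by linarith [hu.1]))
    calc _ = ENNReal.ofReal (Real.exp (-1) / (H - 1 / 2) * (t - u) ^ (H - 1 / 2)) ^ 2 := by
          rw [← ENNReal.ofReal_pow (by positivity), ← ENNReal.ofReal_mul (by positivity), mul_pow,
            ← Real.rpow_mul_natCast htu.le]
          congr 3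
          push_cast
          ring
      _ ≤ _ := by gcongr
  calc ENNReal.ofReal ((Real.exp (-1) / (H - 1 / 2)) ^ 2 / (2 * H) * min (t - s) (1 / l) ^ (2 * H))
      = ENNReal.ofReal ((Real.exp (-1) / (H - 1 / 2)) ^ 2) *
          ∫⁻ u in Ioo (t - m) t, ENNReal.ofReal ((t - u) ^ (2 * H - 1)) := by
        rw [setLIntegral_Ioo_comp_sub_left (t - m) t fun x => ENNReal.ofReal (x ^ (2 * H - 1)),
          sub_sub_cancel, lintegral_Ioo_rpow (by linarith) hm0.le,
          ← ENNReal.ofReal_mul (by positivity), ← hm, sub_add_cancel]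
        congr 1
        ring
    _ = ∫⁻ u in Ioo (t - m) t, ENNReal.ofReal ((Real.exp (-1) / (H - 1 / 2)) ^ 2) *
          ENNReal.ofReal ((t - u) ^ (2 * H - 1)) :=
        (lintegral_const_mul' _ _ ENNReal.ofReal_ne_top).symm
    _ ≤ ∫⁻ u in Ioo (t - m) t, heatAmp H t l u ^ 2 := setLIntegral_mono' measurableSet_Ioo hlow
    _ ≤ _ := lintegral_mono_set (Ioo_subset_Ioo_left (by linarith))

/-- Here `A - B = E - (1 - e) B` is a difference of nonnegative numbers, so the cross term has the
favourable sign. For infinite values either the right side is infinite, or both real values are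
zero. -/
lemma ofReal_sq_toReal_sub_le {A B E : ℝ≥0∞} {e : ℝ} (he0 : 0 ≤ e) (he1 : e ≤ 1)
    (h : A = ENNReal.ofReal e * B + E) :
    ENNReal.ofReal ((A.toReal - B.toReal) ^ 2) ≤ E ^ 2 + ENNReal.ofReal ((1 - e) ^ 2) * B ^ 2 := by
  by_cases hE : E = ∞
  · simp [hE]
  by_cases hB : B = ∞
  · rcases he0.eq_or_lt with rfl | he
    · simp [hB]
    · rw [hB, ENNReal.mul_top (by simpa using he), top_add] at h
      simp [h, hB]
  lift B to ℝ≥0 using hB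
  lift E to ℝ≥0 using hE
  have hA : A.toReal = e * B + E := by
    rw [h, ENNReal.toReal_add (ENNReal.mul_ne_top ENNReal.ofReal_ne_top ENNReal.coe_ne_top)
      ENNReal.coe_ne_top, ENNReal.toReal_mul, ENNReal.toReal_ofReal he0]
    simp
  rw [hA, ENNReal.coe_toReal, ← ENNReal.ofReal_coe_nnreal, ← ENNReal.ofReal_coe_nnreal,
    ← ENNReal.ofReal_pow B.coe_nonneg, ← ENNReal.ofReal_pow E.coe_nonneg,
    ← ENNReal.ofReal_mul (sq_nonneg _), ← ENNReal.ofReal_add (by positivity) (by positivity)]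
  refine ENNReal.ofReal_le_ofReal ?_
  have h1 : 0 ≤ (E : ℝ) * ((1 - e) * B) :=
    mul_nonneg E.coe_nonneg (mul_nonneg (by linarith) B.coe_nonneg)
  nlinarith

/-- By `1 - exp(-x) ≤ min(x, 1)`; a base in `[0, 1]` allows the exponent `2` to be lowered to `2H`.
-/
lemma sq_one_sub_exp_mul_rpow_le {H h s l : ℝ} (hH : 1 / 2 < H) (hH1 : H < 1) (hh : 0 ≤ h)
    (hs : 0 < s) (hl : 0 < l) :
    (1 - Real.exp (-(h * l))) ^ 2 * min s (1 / l) ^ (2 * H) ≤ min h (1 / l) ^ (2 * H) := by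
  have hx : 0 ≤ h * l := by positivity
  have h1 : 0 ≤ 1 - Real.exp (-(h * l)) := by
    have : Real.exp (-(h * l)) ≤ 1 := Real.exp_le_one_iff.2 (by linarith)
    linarith
  have h2 : min s (1 / l) ^ (2 * H) ≤ (1 / l) ^ (2 * H) :=
    Real.rpow_le_rpow (le_min hs.le (by positivity)) (min_le_right _ _) (by linarith)
  have h3 : (1 - Real.exp (-(h * l))) ^ 2 ≤ min (h * l) 1 ^ (2 * H) := by
    have h4 : 1 - Real.exp (-(h * l)) ≤ min (h * l) 1 :=
      le_min (by linarith [Real.add_one_le_exp (-(h * l))]) (by linarith [Real.exp_pos (-(h * l))])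
    have h5 : 0 ≤ min (h * l) 1 := le_min hx one_pos.le
    calc (1 - Real.exp (-(h * l))) ^ 2 ≤ min (h * l) 1 ^ 2 := by gcongr
      _ = min (h * l) 1 ^ (2 : ℝ) := (Real.rpow_two _).symm
      _ ≤ _ := by
        rcases h5.eq_or_lt with h0 | h0
        · rw [← h0, Real.zero_rpow (by norm_num), Real.zero_rpow (by linarith)]
        · exact Real.rpow_le_rpow_of_exponent_ge h0 (min_le_right _ _) (by linarith)
  calc _ ≤ min (h * l) 1 ^ (2 * H) * (1 / l) ^ (2 * H) := by gcongr
    _ = (min (h * l) 1 * (1 / l)) ^ (2 * H) := by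
      rw [Real.mul_rpow (le_min hx one_pos.le) (by positivity)]
    _ = _ := by
      rw [min_mul_of_nonneg _ _ (by positivity)]
      congr 2
      · field_simp
      · ring

/-- The difference comes from the times after `s` and from the additional damping of the
contribution before `s`. Both are of the order of `min (t - s) (1 / l) ^ (2H)`. -/
lemma exists_lintegral_heatAmp_sub_le (hH : 1 / 2 < H) (hH1 : H < 1) :
    ∃ C : ℝ, 0 < C ∧ ∀ s t l : ℝ, 0 < s → s ≤ t → 0 < l →
      ∫⁻ u, ENNReal.ofReal (((heatAmp H t l u).toReal - (heatAmp H s l u).toReal) ^ 2) ≤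
        ENNReal.ofReal (C * min (t - s) (1 / l) ^ (2 * H)) := by
  obtain ⟨C, hC, h⟩ := exists_lintegral_heatAmpFrom_le hH hH1
  refine ⟨2 * C, by positivity, fun s t l hs hst hl => ?_⟩
  have hx : 0 ≤ (t - s) * l := mul_nonneg (by linarith) hl.le
  have he1 : Real.exp (-((t - s) * l)) ≤ 1 := Real.exp_le_one_iff.2 (by linarith)
  have hm : Measurable fun u => heatAmp H s l u :=
    (measurable_heatAmp H s).comp (f := fun u : ℝ => (l, u)) (by fun_prop)
  have hm2 : Measurable fun u => ENNReal.ofReal ((1 - Real.exp (-((t - s) * l))) ^ 2) *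
      heatAmp H s l u ^ 2 := (hm.pow_const 2).const_mul _
  calc _ ≤ ∫⁻ u, (heatAmpFrom H s t l u ^ 2 +
        ENNReal.ofReal ((1 - Real.exp (-((t - s) * l))) ^ 2) * heatAmp H s l u ^ 2) :=
        lintegral_mono fun u => ofReal_sq_toReal_sub_le (Real.exp_pos _).le he1
          (heatAmp_eq_add hs hst l u)
    _ = (∫⁻ u, heatAmpFrom H s t l u ^ 2) +
        ENNReal.ofReal ((1 - Real.exp (-((t - s) * l))) ^ 2) * ∫⁻ u, heatAmp H s l u ^ 2 := by
      rw [lintegral_add_right _ hm2, lintegral_const_mul' _ _ ENNReal.ofReal_ne_top]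
    _ ≤ ENNReal.ofReal (C * min (t - s) (1 / l) ^ (2 * H)) +
        ENNReal.ofReal ((1 - Real.exp (-((t - s) * l))) ^ 2) *
          ENNReal.ofReal (C * min (s - 0) (1 / l) ^ (2 * H)) := by
      gcongr
      · exact h s t l hs.le hst hl
      · exact h 0 s l le_rfl hs.le hl
    _ ≤ _ := by
      have hmn : 0 ≤ min (t - s) (1 / l) := le_min (by linarith) (by positivity)
      have hmn2 : 0 ≤ min (s - 0) (1 / l) := le_min (by linarith) (by positivity)
      rw [← ENNReal.ofReal_mul (sq_nonneg _), ← ENNReal.ofReal_add (by positivity) (by positivity)]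
      refine ENNReal.ofReal_le_ofReal ?_
      have := sq_one_sub_exp_mul_rpow_le hH hH1 (h := t - s) (by linarith) hs hl
      rw [sub_zero]
      nlinarith

end Amplitude

/-! ### Moment integrals -/

section Moments

variable {H β : ℝ}

lemma lintegral_Ioc_rpow {a b e : ℝ} (ha : 0 < a) (hab : a ≤ b) :
    ∫⁻ y in Ioc a b, ENNReal.ofReal (y ^ e) = ENNReal.ofReal (∫ y in a..b, y ^ e) := by
  have hi : IntegrableOn (fun y : ℝ => y ^ e) (Ioc a b) := by
    rw [← intervalIntegrable_iff_integrableOn_Ioc_of_le hab]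
    refine intervalIntegral.intervalIntegrable_rpow (Or.inr ?_)
    rw [uIcc_of_le hab]
    exact fun h => absurd h.1 (not_le.2 ha)
  rw [intervalIntegral.integral_of_le hab, ofReal_integral_eq_lintegral_ofReal hi
    ((ae_restrict_iff' measurableSet_Ioc).2
      (ae_of_all _ fun x hx => Real.rpow_nonneg (ha.trans hx.1).le _))]

lemma lintegral_Ioi_rpow {L e : ℝ} (hL : 0 < L) (he : e < -1) :
    ∫⁻ y in Ioi L, ENNReal.ofReal (y ^ e) = ENNReal.ofReal (L ^ (e + 1) / (-(e + 1))) := by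
  rw [← ofReal_integral_eq_lintegral_ofReal (integrableOn_Ioi_rpow_of_lt he hL)
    ((ae_restrict_iff' measurableSet_Ioi).2
      (ae_of_all _ fun x hx => Real.rpow_nonneg (hL.trans hx).le _)),
    integral_Ioi_rpow_of_lt he hL, neg_div, div_neg]

lemma lintegral_Ioi_split (L : ℝ) (hL : 0 ≤ L) (f : ℝ → ℝ≥0∞) :
    ∫⁻ y in Ioi 0, f y = (∫⁻ y in Ioc 0 L, f y) + ∫⁻ y in Ioi L, f y := by
  rw [← Ioc_union_Ioi_eq_Ioi hL, lintegral_union measurableSet_Ioi (Ioc_disjoint_Ioi le_rfl)]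

lemma one_div_sq_rpow {y : ℝ} (hy : 0 < y) (H : ℝ) : (1 / y ^ 2) ^ (2 * H) = y ^ (-(4 * H)) := by
  rw [one_div, ← Real.rpow_natCast, ← Real.rpow_neg hy.le, ← Real.rpow_mul hy.le]
  congr 1
  push_cast
  ring

lemma min_rpow_le_left {h y : ℝ} (hH : 0 < H) (hh : 0 ≤ h) (hy : 0 < y) :
    min h (1 / y ^ 2) ^ (2 * H) ≤ h ^ (2 * H) :=
  Real.rpow_le_rpow (le_min hh (by positivity)) (min_le_left _ _) (by linarith)

lemma min_rpow_le_right {h y : ℝ} (hH : 0 < H) (hh : 0 ≤ h) (hy : 0 < y) :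
    min h (1 / y ^ 2) ^ (2 * H) ≤ y ^ (-(4 * H)) := by
  rw [← one_div_sq_rpow hy]
  exact Real.rpow_le_rpow (le_min hh (by positivity)) (min_le_right _ _) (by linarith)

/-- Split at `y = h^{-1/2}`, where the two arguments of the minimum agree. Convergence at zero uses
`β > 0`, convergence at infinity `β < 4H`, and both parts scale as `h^{2H-β/2}`. -/
lemma exists_moment_le (hβ : 0 < β) (hβH : β < 4 * H) :
    ∃ C : ℝ, 0 < C ∧ ∀ h : ℝ, 0 ≤ h →
      ∫⁻ y in Ioi 0, ENNReal.ofReal (min h (1 / y ^ 2) ^ (2 * H)) * ENNReal.ofReal (y ^ (β - 1)) ≤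
        ENNReal.ofReal (C * h ^ (2 * H - β / 2)) := by
  have hH : 0 < H := by linarith
  have h4 : 0 < 4 * H - β := by linarith
  refine ⟨1 / β + 1 / (4 * H - β), by positivity, fun h hh => ?_⟩
  rcases hh.eq_or_lt with rfl | hh0
  · refine (le_of_eq (b := (0 : ℝ≥0∞)) ?_).trans bot_le
    rw [lintegral_eq_zero_iff (by fun_prop)]
    refine (ae_restrict_iff' measurableSet_Ioi).2 (ae_of_all _ fun y hy => ?_)
    have hy0 : (0 : ℝ) < y := hy
    have : min 0 (1 / y ^ 2) = 0 := min_eq_left (by positivity)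
    simp only [this, Real.zero_rpow (by linarith : 2 * H ≠ 0), ENNReal.ofReal_zero, zero_mul,
      Pi.zero_apply]
  obtain ⟨L, hL⟩ : ∃ L, L = h ^ (-(1 / 2) : ℝ) := ⟨_, rfl⟩
  have hL0 : 0 < L := by rw [hL]; positivity
  have hLr : ∀ e : ℝ, L ^ e = h ^ (-(e / 2)) := fun e => by
    rw [hL, ← Real.rpow_mul hh0.le]; congr 1; ring
  rw [lintegral_Ioi_split L hL0.le, add_mul, ENNReal.ofReal_add (by positivity) (by positivity)]
  refine add_le_add ?_ ?_
  · calc _ ≤ ∫⁻ y in Ioc 0 L, ENNReal.ofReal (h ^ (2 * H)) * ENNReal.ofReal (y ^ (β - 1)) := by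
          refine setLIntegral_mono' measurableSet_Ioc fun y hy => ?_
          gcongr
          exact min_le_left _ _
      _ = _ := by
          rw [lintegral_const_mul' _ _ ENNReal.ofReal_ne_top, ← restrict_Ioo_eq_restrict_Ioc,
            lintegral_Ioo_rpow (by linarith) hL0.le, ← ENNReal.ofReal_mul (by positivity),
            sub_add_cancel, hLr]
          congr 1
          rw [sub_eq_add_neg, Real.rpow_add hh0]
          ring
  · calc _ ≤ ∫⁻ y in Ioi L, ENNReal.ofReal (y ^ (β - 1 - 4 * H)) := by
          refine setLIntegral_mono' measurableSet_Ioi fun y hy => ?_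
          have hy0 : 0 < y := hL0.trans hy
          rw [← ENNReal.ofReal_mul (by positivity), show β - 1 - 4 * H = -(4 * H) + (β - 1) by ring,
            Real.rpow_add hy0]
          gcongr
          exact min_rpow_le_right hH hh hy0
      _ = _ := by
          rw [lintegral_Ioi_rpow hL0 (by linarith), hLr]
          congr 1
          rw [show -((β - 1 - 4 * H + 1) / 2) = 2 * H - β / 2 by ring,
            show -(β - 1 - 4 * H + 1) = 4 * H - β by ring]
          ring

lemma le_moment (hβ : 0 < β) {h : ℝ} (hh : 0 < h) :
    ENNReal.ofReal (1 / β * h ^ (2 * H - β / 2)) ≤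
      ∫⁻ y in Ioi 0, ENNReal.ofReal (min h (1 / y ^ 2) ^ (2 * H)) *
        ENNReal.ofReal (y ^ (β - 1)) := by
  obtain ⟨L, hL⟩ : ∃ L, L = h ^ (-(1 / 2) : ℝ) := ⟨_, rfl⟩
  have hL0 : 0 < L := by rw [hL]; positivity
  have hLr : ∀ e : ℝ, L ^ e = h ^ (-(e / 2)) := fun e => by
    rw [hL, ← Real.rpow_mul hh.le]; congr 1; ring
  calc _ = ∫⁻ y in Ioo 0 L, ENNReal.ofReal (h ^ (2 * H)) * ENNReal.ofReal (y ^ (β - 1)) := by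
        rw [lintegral_const_mul' _ _ ENNReal.ofReal_ne_top,
          lintegral_Ioo_rpow (by linarith) hL0.le, ← ENNReal.ofReal_mul (by positivity),
          sub_add_cancel, hLr]
        congr 1
        rw [sub_eq_add_neg, Real.rpow_add hh]
        ring
    _ ≤ ∫⁻ y in Ioo 0 L, ENNReal.ofReal (min h (1 / y ^ 2) ^ (2 * H)) *
          ENNReal.ofReal (y ^ (β - 1)) := by
        refine setLIntegral_mono' measurableSet_Ioo fun y hy => ?_
        have : h ≤ 1 / y ^ 2 := by
          rw [le_div_iff₀ (pow_pos hy.1 2)]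
          have h1 : y ^ 2 ≤ L ^ 2 := by
            have := hy.1.le
            have := hy.2.le
            gcongr
          have h2 : h * L ^ 2 = 1 := by
            rw [← Real.rpow_two, hLr, div_self two_ne_zero, Real.rpow_neg_one, mul_inv_cancel₀
                hh.ne']
          nlinarith
        rw [min_eq_left this]
    _ ≤ _ := lintegral_mono_set Ioo_subset_Ioi_self

/-- The gauge determined by the exponents in the spatial moment integrals. -/
def momentGauge (H β R r : ℝ) : ℝ :=
  if 4 * H - β = 2 then r ^ 2 * max 1 (Real.log (Real.exp 1 * R / r))
  else r ^ min 2 (4 * H - β)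

/-- The low frequencies will contribute `r²` and the high ones `r^{4H-β}`; on the bounded range of
`r` both are dominated by the gauge. -/
lemma sq_le_momentGauge {R : ℝ} (hR : 0 < R) :
    ∃ C : ℝ, 0 < C ∧ ∀ r, 0 < r → r ≤ R → r ^ 2 ≤ C * momentGauge H β R r ∧
      r ^ (4 * H - β) ≤ C * momentGauge H β R r := by
  unfold momentGauge
  split_ifs with h
  · refine ⟨1, one_pos, fun r hr hrR => ?_⟩
    rw [h, Real.rpow_two, one_mul]
    have : r ^ 2 ≤ r ^ 2 * max 1 (Real.log (Real.exp 1 * R / r)) :=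
      le_mul_of_one_le_right (by positivity) (le_max_left _ _)
    exact ⟨this, this⟩
  · obtain ⟨γ, hγ⟩ : ∃ γ, γ = min 2 (4 * H - β) := ⟨_, rfl⟩
    have h1 : γ ≤ 2 := hγ ▸ min_le_left _ _
    have h2 : γ ≤ 4 * H - β := hγ ▸ min_le_right _ _
    have key : ∀ e, γ ≤ e → ∀ r, 0 < r → r ≤ R → r ^ e ≤ R ^ (e - γ) * r ^ γ := by
      intro e he r hr hrR
      calc r ^ e = r ^ (e - γ) * r ^ γ := by rw [← Real.rpow_add hr, sub_add_cancel]
        _ ≤ _ := by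
          gcongr
    refine ⟨R ^ (2 - γ) + R ^ (4 * H - β - γ), by positivity, fun r hr hrR => ?_⟩
    have k1 := key 2 h1 r hr hrR
    have k2 := key _ h2 r hr hrR
    have p1 : 0 ≤ R ^ (2 - γ) * r ^ γ := by positivity
    have p2 : 0 ≤ R ^ (4 * H - β - γ) * r ^ γ := by positivity
    rw [Real.rpow_two] at k1
    rw [← hγ, add_mul]
    constructor <;> linarith

/-- The exponent decides which end of the range dominates, and the critical case `4H - β = 2` gives
a logarithm. The upper end is `e / r` instead of `1 / r` so that this logarithm is exactly `log (e R
/ r)`. -/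
lemma exists_middle_le {R : ℝ} (hR : 0 < R) :
    ∃ C : ℝ, 0 < C ∧ ∀ r, 0 < r → r ≤ R →
      r ^ 2 * ∫ y in (1 / R)..(Real.exp 1 / r), y ^ (β + 1 - 4 * H) ≤
        C * momentGauge H β R r := by
  have hab : ∀ r, 0 < r → r ≤ R → 1 / R ≤ Real.exp 1 / r := fun r hr hrR => by
    have : (1 : ℝ) ≤ Real.exp 1 := Real.one_le_exp (by norm_num)
    gcongr
  have h0 : ∀ r, 0 < r → r ≤ R → (0 : ℝ) ∉ uIcc (1 / R) (Real.exp 1 / r) := fun r hr hrR h => by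
    rw [uIcc_of_le (hab r hr hrR)] at h
    exact absurd h.1 (not_le.2 (by positivity))
  unfold momentGauge
  split_ifs with h
  · refine ⟨1, one_pos, fun r hr hrR => ?_⟩
    rw [show β + 1 - 4 * H = -1 by linarith, one_mul]
    simp_rw [Real.rpow_neg_one]
    rw [integral_inv (h0 r hr hrR), div_div_eq_mul_div, div_one, div_mul_eq_mul_div]
    gcongr
    exact le_max_right _ _
  · obtain ⟨k, hk⟩ : ∃ k, k = β + 1 - 4 * H + 1 := ⟨_, rfl⟩
    rcases lt_or_gt_of_ne h with h | h
    · have hk0 : 0 < k := by linarith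
      refine ⟨Real.exp 1 ^ k / k, by positivity, fun r hr hrR => ?_⟩
      rw [integral_rpow (Or.inr ⟨by linarith, h0 r hr hrR⟩), ← hk, min_eq_right h.le]
      have h1 : 0 ≤ (1 / R) ^ k := by positivity
      calc _ ≤ r ^ 2 * ((Real.exp 1 / r) ^ k / k) := by
            gcongr; linarith
        _ = Real.exp 1 ^ k / k * (r ^ (2 : ℝ) * r ^ (-k)) := by
            rw [Real.div_rpow (Real.exp_pos _).le hr.le, Real.rpow_neg hr.le, Real.rpow_two]
            ring
        _ = _ := by
            rw [← Real.rpow_add hr]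
            congr 2
            linarith
    · have hk0 : 0 < -k := by linarith
      refine ⟨(1 / R) ^ k / (-k), by positivity, fun r hr hrR => ?_⟩
      rw [integral_rpow (Or.inr ⟨by linarith, h0 r hr hrR⟩), ← hk, min_eq_left h.le, Real.rpow_two]
      have h1 : 0 ≤ (Real.exp 1 / r) ^ k := by positivity
      have h5 : ((Real.exp 1 / r) ^ k - (1 / R) ^ k) / k ≤ (1 / R) ^ k / (-k) := by
        rw [← neg_div_neg_eq]
        exact div_le_div_of_nonneg_right (by linarith) hk0.le
      linarith [mul_le_mul_of_nonneg_left h5 (sq_nonneg r)]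

/-- The lower end `1 / (2R)` keeps the range of integration nontrivial even for `r = R`; in the
critical case the integral is then at least `log 2`. -/
lemma exists_le_middle {R : ℝ} (hR : 0 < R) :
    ∃ c : ℝ, 0 < c ∧ ∀ r, 0 < r → r ≤ R →
      c * momentGauge H β R r ≤ r ^ 2 * ∫ y in (1 / (2 * R))..(1 / r), y ^ (β + 1 - 4 * H) := by
  have hab : ∀ r, 0 < r → r ≤ R → 1 / (2 * R) ≤ 1 / r := fun r hr hrR => by
    gcongr
    linarith
  have h0 : ∀ r, 0 < r → r ≤ R → (0 : ℝ) ∉ uIcc (1 / (2 * R)) (1 / r) := fun r hr hrR h => by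
    rw [uIcc_of_le (hab r hr hrR)] at h
    exact absurd h.1 (not_le.2 (by positivity))
  unfold momentGauge
  split_ifs with h
  · refine ⟨Real.log 2, Real.log_pos one_lt_two, fun r hr hrR => ?_⟩
    rw [show β + 1 - 4 * H = -1 by linarith]
    simp_rw [Real.rpow_neg_one]
    rw [integral_inv (h0 r hr hrR), mul_left_comm]
    have e1 : (1 : ℝ) / r / (1 / (2 * R)) = 2 * (R / r) := by field_simp
    have e2 : Real.exp 1 * R / r = Real.exp 1 * (R / r) := by ring
    have hx : 1 ≤ R / r := by rwa [le_div_iff₀ hr, one_mul]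
    have hlx : 0 ≤ Real.log (R / r) := Real.log_nonneg hx
    have hl2 : Real.log 2 ≤ 1 := by
      have := Real.log_le_sub_one_of_pos (x := 2) (by norm_num)
      linarith
    have hl0 : 0 < Real.log 2 := Real.log_pos one_lt_two
    have e3 : Real.log (Real.exp 1 * (R / r)) = 1 + Real.log (R / r) := by
      rw [Real.log_mul (Real.exp_pos _).ne' (by positivity), Real.log_exp]
    have e4 : Real.log (2 * (R / r)) = Real.log 2 + Real.log (R / r) :=
      Real.log_mul (by norm_num) (by positivity)
    rw [e1, e2, e3, e4, max_eq_right (by linarith)]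
    gcongr
    nlinarith
  · obtain ⟨k, hk⟩ : ∃ k, k = β + 1 - 4 * H + 1 := ⟨_, rfl⟩
    rcases lt_or_gt_of_ne h with h | h
    · have hk0 : 0 < k := by linarith
      have h2 : (1 / 2 : ℝ) ^ k < 1 := Real.rpow_lt_one (by norm_num) (by norm_num) hk0
      refine ⟨(1 - (1 / 2) ^ k) / k, div_pos (by linarith) hk0, fun r hr hrR => ?_⟩
      rw [integral_rpow (Or.inr ⟨by linarith, h0 r hr hrR⟩), ← hk, min_eq_right h.le]
      have h3 : (1 / (2 * R)) ^ k ≤ (1 / 2) ^ k * (1 / r) ^ k := by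
        rw [← Real.mul_rpow (by norm_num) (by positivity)]
        refine Real.rpow_le_rpow (by positivity) ?_ hk0.le
        rw [one_div_mul_one_div]
        gcongr
      calc _ = r ^ (2 : ℝ) * (((1 / r) ^ k - (1 / 2) ^ k * (1 / r) ^ k) / k) := by
            have : r ^ (4 * H - β) = r ^ (2 : ℝ) * (1 / r) ^ k := by
              rw [one_div, Real.inv_rpow hr.le, ← Real.rpow_neg hr.le, ← Real.rpow_add hr]
              congr 1
              linarith
            rw [this]
            ring
        _ ≤ _ := by
            rw [Real.rpow_two]
            gcongr
    · have hk0 : 0 < -k := by linarith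
      have h2 : 1 < (1 / 2 : ℝ) ^ k := by
        rw [one_div, Real.inv_rpow (by norm_num), ← Real.rpow_neg (by norm_num)]
        exact Real.one_lt_rpow one_lt_two hk0
      refine ⟨(1 / R) ^ k * ((1 / 2) ^ k - 1) / (-k), by
        have : 0 < (1 / 2 : ℝ) ^ k - 1 := by linarith
        positivity, fun r hr hrR => ?_⟩
      rw [integral_rpow (Or.inr ⟨by linarith, h0 r hr hrR⟩), ← hk, min_eq_left h.le, Real.rpow_two]
      have h3 : (1 / (2 * R)) ^ k = (1 / 2) ^ k * (1 / R) ^ k := by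
        rw [← Real.mul_rpow (by norm_num) (by positivity), one_div_mul_one_div]
      have h4 : (1 / r) ^ k ≤ (1 / R) ^ k :=
        Real.rpow_le_rpow_of_nonpos (by positivity) (by gcongr) (by linarith)
      have h5 : (1 / R) ^ k * ((1 / 2) ^ k - 1) / (-k) ≤ ((1 / r) ^ k - (1 / (2 * R)) ^ k) / k := by
        rw [← neg_div_neg_eq ((1 / r) ^ k - (1 / (2 * R)) ^ k), h3]
        exact div_le_div_of_nonneg_right (by linarith) hk0.le
      linarith [mul_le_mul_of_nonneg_left h5 (sq_nonneg r)]

/-- Three frequency ranges. Below `1/R` the factors are at most `r² y²` and `T^{2H}`; up to `e/r`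
they are at most `r² y²` and `y^{-4H}`, which is where the logarithm can arise; above `e/r` they are
at most `2` and `y^{-4H}`. -/
lemma exists_space_moment_le (hβ : 0 < β) (hβH : β < 4 * H) {T R : ℝ} (hT : 0 < T) (hR : 0 < R) :
    ∃ C : ℝ, 0 < C ∧ ∀ r, 0 < r → r ≤ R →
      ∫⁻ y in Ioi 0, ENNReal.ofReal (min 2 (r ^ 2 * y ^ 2 / 2) * min T (1 / y ^ 2) ^ (2 * H)) *
        ENNReal.ofReal (y ^ (β - 1)) ≤ ENNReal.ofReal (C * momentGauge H β R r) := by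
  have hH : 0 < H := by linarith
  have h4 : 0 < 4 * H - β := by linarith
  obtain ⟨C₀, hC₀, h₀⟩ := sq_le_momentGauge (R := R) hR
  obtain ⟨C₁, hC₁, h₁⟩ := exists_middle_le (H := H) (β := β) hR
  obtain ⟨A, hA⟩ : ∃ A, A = T ^ (2 * H) * ((1 / R) ^ (β + 2) / (β + 2)) := ⟨_, rfl⟩
  obtain ⟨B, hB⟩ : ∃ B, B = 2 * (Real.exp 1 ^ (β - 4 * H) / (4 * H - β)) := ⟨_, rfl⟩
  have hA0 : 0 < A := by rw [hA]; positivity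
  have hB0 : 0 < B := by rw [hB]; positivity
  refine ⟨A * C₀ + C₁ + B * C₀, by positivity, fun r hr hrR => ?_⟩
  obtain ⟨hr2, hr4⟩ := h₀ r hr hrR
  have hmid := h₁ r hr hrR
  have hδ : 0 < 1 / R := by positivity
  have hab : 1 / R ≤ Real.exp 1 / r := by
    have : (1 : ℝ) ≤ Real.exp 1 := Real.one_le_exp (by norm_num)
    gcongr
  have hmidnn : 0 ≤ ∫ y in (1 / R)..(Real.exp 1 / r), y ^ (β + 1 - 4 * H) :=
    intervalIntegral.integral_nonneg hab fun y hy => Real.rpow_nonneg (hδ.le.trans hy.1) _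
  have hsplit : Ioi (1 / R) = Ioc (1 / R) (Real.exp 1 / r) ∪ Ioi (Real.exp 1 / r) :=
    (Ioc_union_Ioi_eq_Ioi hab).symm
  rw [lintegral_Ioi_split (1 / R) hδ.le, hsplit,
    lintegral_union measurableSet_Ioi (Ioc_disjoint_Ioi le_rfl)]
  have b1 : ∫⁻ y in Ioc 0 (1 / R),
      ENNReal.ofReal (min 2 (r ^ 2 * y ^ 2 / 2) * min T (1 / y ^ 2) ^ (2 * H)) *
        ENNReal.ofReal (y ^ (β - 1)) ≤ ENNReal.ofReal (r ^ 2 * A) := by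
    calc _ ≤ ∫⁻ y in Ioc 0 (1 / R), ENNReal.ofReal (r ^ 2 * T ^ (2 * H)) *
          ENNReal.ofReal (y ^ (β + 1)) := by
          refine setLIntegral_mono' measurableSet_Ioc fun y hy => ?_
          have hy0 := hy.1
          rw [← ENNReal.ofReal_mul (mul_nonneg (le_min (by norm_num) (by positivity))
            (Real.rpow_nonneg (le_min hT.le (by positivity)) _)), ← ENNReal.ofReal_mul
            (by positivity)]
          refine ENNReal.ofReal_le_ofReal ?_
          have e : y ^ (β + 1) = y ^ 2 * y ^ (β - 1) := by
            rw [← Real.rpow_two, ← Real.rpow_add hy0]; congr 1; ring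
          rw [e]
          have m1 : min 2 (r ^ 2 * y ^ 2 / 2) ≤ r ^ 2 * y ^ 2 :=
            (min_le_right _ _).trans (half_le_self (by positivity))
          have m2 := min_rpow_le_left hH hT.le hy0
          have m3 : 0 ≤ min T (1 / y ^ 2) ^ (2 * H) :=
            Real.rpow_nonneg (le_min hT.le (by positivity)) _
          calc _ ≤ r ^ 2 * y ^ 2 * T ^ (2 * H) * y ^ (β - 1) := by gcongr
            _ = _ := by ring
      _ = _ := by
          rw [lintegral_const_mul' _ _ ENNReal.ofReal_ne_top, ← restrict_Ioo_eq_restrict_Ioc,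
            lintegral_Ioo_rpow (by linarith) hδ.le, ← ENNReal.ofReal_mul (by positivity), hA]
          congr 1
          rw [show β + 1 + 1 = β + 2 by ring]
          ring
  have b2 : ∫⁻ y in Ioc (1 / R) (Real.exp 1 / r),
      ENNReal.ofReal (min 2 (r ^ 2 * y ^ 2 / 2) * min T (1 / y ^ 2) ^ (2 * H)) *
        ENNReal.ofReal (y ^ (β - 1)) ≤
      ENNReal.ofReal (r ^ 2 * ∫ y in (1 / R)..(Real.exp 1 / r), y ^ (β + 1 - 4 * H)) := by
    rw [ENNReal.ofReal_mul (by positivity), ← lintegral_Ioc_rpow hδ hab,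
      ← lintegral_const_mul' _ _ ENNReal.ofReal_ne_top]
    refine setLIntegral_mono' measurableSet_Ioc fun y hy => ?_
    have hy0 := hδ.trans hy.1
    rw [← ENNReal.ofReal_mul (mul_nonneg (le_min (by norm_num) (by positivity))
      (Real.rpow_nonneg (le_min hT.le (by positivity)) _)), ← ENNReal.ofReal_mul (by positivity)]
    refine ENNReal.ofReal_le_ofReal ?_
    have e : y ^ (β + 1 - 4 * H) = y ^ 2 * y ^ (-(4 * H)) * y ^ (β - 1) := by
      rw [← Real.rpow_two, ← Real.rpow_add hy0, ← Real.rpow_add hy0]; congr 1; ring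
    rw [e]
    have m1 : min 2 (r ^ 2 * y ^ 2 / 2) ≤ r ^ 2 * y ^ 2 :=
      (min_le_right _ _).trans (half_le_self (by positivity))
    have m2 := min_rpow_le_right hH hT.le hy0
    have m3 : 0 ≤ min T (1 / y ^ 2) ^ (2 * H) :=
      Real.rpow_nonneg (le_min hT.le (by positivity)) _
    calc _ ≤ r ^ 2 * y ^ 2 * y ^ (-(4 * H)) * y ^ (β - 1) := by gcongr
      _ = _ := by ring
  have b3 : ∫⁻ y in Ioi (Real.exp 1 / r),
      ENNReal.ofReal (min 2 (r ^ 2 * y ^ 2 / 2) * min T (1 / y ^ 2) ^ (2 * H)) *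
        ENNReal.ofReal (y ^ (β - 1)) ≤ ENNReal.ofReal (B * r ^ (4 * H - β)) := by
    have hL : 0 < Real.exp 1 / r := by positivity
    calc _ ≤ ∫⁻ y in Ioi (Real.exp 1 / r), ENNReal.ofReal 2 *
          ENNReal.ofReal (y ^ (β - 1 - 4 * H)) := by
          refine setLIntegral_mono' measurableSet_Ioi fun y hy => ?_
          have hy0 := hL.trans hy
          rw [← ENNReal.ofReal_mul (mul_nonneg (le_min (by norm_num) (by positivity))
            (Real.rpow_nonneg (le_min hT.le (by positivity)) _)), ← ENNReal.ofReal_mul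
            (by positivity)]
          refine ENNReal.ofReal_le_ofReal ?_
          have e : y ^ (β - 1 - 4 * H) = y ^ (-(4 * H)) * y ^ (β - 1) := by
            rw [← Real.rpow_add hy0]; congr 1; ring
          rw [e]
          have m1 : min 2 (r ^ 2 * y ^ 2 / 2) ≤ 2 := min_le_left _ _
          have m2 := min_rpow_le_right hH hT.le hy0
          have m3 : 0 ≤ min T (1 / y ^ 2) ^ (2 * H) :=
            Real.rpow_nonneg (le_min hT.le (by positivity)) _
          calc _ ≤ 2 * y ^ (-(4 * H)) * y ^ (β - 1) := by gcongr
            _ = _ := by ring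
      _ = _ := by
          rw [lintegral_const_mul' _ _ ENNReal.ofReal_ne_top,
            lintegral_Ioi_rpow hL (by linarith), ← ENNReal.ofReal_mul (by norm_num), hB]
          congr 1
          rw [show β - 1 - 4 * H + 1 = β - 4 * H by ring, Real.div_rpow (Real.exp_pos _).le hr.le,
            show 4 * H - β = -(β - 4 * H) by ring, Real.rpow_neg hr.le]
          field_simp
  refine (add_le_add b1 (add_le_add b2 b3)).trans ?_
  rw [← ENNReal.ofReal_add (by positivity) (by positivity),
    ← ENNReal.ofReal_add (by positivity) (by positivity)]
  refine ENNReal.ofReal_le_ofReal ?_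
  nlinarith

end Moments

/-! ### Bounds for the covariance -/

section CovarianceBounds

variable {d : ℕ} {H α : ℝ} {μ : Measure (EuclideanSpace ℝ (Fin d))}

/-- The amplitude estimates require `l = ‖ξ‖² > 0`, so the spectral measure must not charge the
origin. -/
lemma IsComparableRiesz.ae_ne_zero (hμ : IsComparableRiesz α μ) (hd : 0 < d) :
    ∀ᵐ ξ ∂μ, ξ ≠ 0 := by
  have : Nonempty (Fin d) := ⟨⟨0, hd⟩⟩
  obtain ⟨c₁, c₂, -, -, h⟩ := hμ
  have h1 := (h (({0} : Set (EuclideanSpace ℝ (Fin d))).indicator 1)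
    (measurable_one.indicator (measurableSet_singleton _))).2
  have h2 : ∫⁻ ξ : EuclideanSpace ℝ (Fin d), ({0} : Set (EuclideanSpace ℝ (Fin d))).indicator 1 ξ *
      ENNReal.ofReal (‖ξ‖ ^ (-α)) = 0 := by
    rw [lintegral_eq_zero_iff' (by
      exact ((measurable_one.indicator (measurableSet_singleton _)).mul
          (by fun_prop)).aemeasurable)]
    have h3 : ∀ᵐ ξ : EuclideanSpace ℝ (Fin d), ξ ∉ ({0} : Set (EuclideanSpace ℝ (Fin d))) :=
      measure_eq_zero_iff_ae_notMem.1 (measure_singleton _)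
    filter_upwards [h3] with ξ hξ
    rw [indicator_of_notMem hξ, zero_mul, Pi.zero_apply]
  rw [h2, mul_zero, lintegral_indicator_one (measurableSet_singleton _)] at h1
  exact measure_eq_zero_iff_ae_notMem.1 (le_antisymm h1 bot_le)

lemma lintegral_prod_heatAmp_le [SFinite μ] (hμ : IsComparableRiesz α μ) (hd : 0 < d)
    {Φ : EuclideanSpace ℝ (Fin d) × ℝ → ℝ≥0∞} (hΦ : Measurable Φ) {f : ℝ → ℝ≥0∞}
    (h : ∀ ξ, ξ ≠ 0 → ∫⁻ u, Φ (ξ, u) ≤ f ‖ξ‖) :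
    ∫⁻ q, Φ q ∂(μ.prod volume) ≤ ∫⁻ ξ, f ‖ξ‖ ∂μ := by
  rw [lintegral_prod _ hΦ.aemeasurable]
  refine lintegral_mono_ae ?_
  filter_upwards [hμ.ae_ne_zero hd] with ξ hξ
  exact h ξ hξ

lemma exists_lintegral_sq_le [SFinite μ] (hμ : IsComparableRiesz α μ) (hd : 0 < d)
    (hH : 1 / 2 < H) (hH1 : H < 1) (hα : α < d) (hdα : (d : ℝ) - α < 4 * H) :
    ∃ C : ℝ, 0 < C ∧ (∀ t, 0 < t →
      ∫⁻ q, heatAmp H t (‖q.1‖ ^ 2) q.2 ^ 2 ∂(μ.prod volume) ≤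
        ENNReal.ofReal (C * t ^ (2 * timeExp d H α))) ∧
      ∀ s t, 0 < s → s ≤ t →
      ∫⁻ q, ENNReal.ofReal ((realAmp H t q - realAmp H s q) ^ 2) ∂(μ.prod volume) ≤
        ENNReal.ofReal (C * (t - s) ^ (2 * timeExp d H α)) := by
  obtain ⟨_, K, _, hK, hμr⟩ := hμ.exists_radial hd
  obtain ⟨C₁, hC₁, h₁⟩ := exists_moment_le (H := H) (β := d - α) (by linarith) hdα
  obtain ⟨C₂, hC₂, h₂⟩ := exists_lintegral_heatAmpFrom_le hH hH1
  obtain ⟨C₃, hC₃, h₃⟩ := exists_lintegral_heatAmp_sub_le hH hH1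
  have hmom : ∀ (C h : ℝ), 0 < C → 0 ≤ h →
      ∫⁻ ξ, ENNReal.ofReal (C * min h (1 / ‖ξ‖ ^ 2) ^ (2 * H)) ∂μ ≤
        ENNReal.ofReal (C * (K * (C₁ * h ^ (2 * timeExp d H α)))) := by
    intro C h hC hh
    have e : ∀ ξ : EuclideanSpace ℝ (Fin d),
        ENNReal.ofReal (C * min h (1 / ‖ξ‖ ^ 2) ^ (2 * H)) =
        ENNReal.ofReal C * ENNReal.ofReal (min h (1 / ‖ξ‖ ^ 2) ^ (2 * H)) := fun ξ =>
      ENNReal.ofReal_mul hC.le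
    simp_rw [e]
    rw [lintegral_const_mul' _ _ ENNReal.ofReal_ne_top, ENNReal.ofReal_mul hC.le,
      ENNReal.ofReal_mul hK.le]
    gcongr
    refine (hμr (fun y => ENNReal.ofReal (min h (1 / y ^ 2) ^ (2 * H))) (by fun_prop)).2.trans ?_
    gcongr
    refine (h₁ h hh).trans_eq ?_
    rw [timeExp]
    congr 3
    ring
  refine ⟨C₂ * (K * C₁) + C₃ * (K * C₁), by positivity, fun t ht => ?_, fun s t hs hst => ?_⟩
  · refine (lintegral_prod_heatAmp_le hμ hd ((measurable_heatAmp_norm H t).pow_const 2)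
      (f := fun y => ENNReal.ofReal (C₂ * min t (1 / y ^ 2) ^ (2 * H))) fun ξ hξ => ?_).trans
      ((hmom C₂ t hC₂ ht.le).trans (ENNReal.ofReal_le_ofReal ?_))
    · simpa using! h₂ 0 t (‖ξ‖ ^ 2) le_rfl ht.le (by positivity)
    · have : 0 ≤ C₃ * (K * C₁) * t ^ (2 * timeExp d H α) := by positivity
      linarith
  · refine (lintegral_prod_heatAmp_le hμ hd (((measurable_realAmp H t).sub
      (measurable_realAmp H s)).pow_const 2).ennreal_ofReal
      (f := fun y => ENNReal.ofReal (C₃ * min (t - s) (1 / y ^ 2) ^ (2 * H))) fun ξ hξ => ?_).trans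
      ((hmom C₃ (t - s) hC₃ (by linarith)).trans (ENNReal.ofReal_le_ofReal ?_))
    · exact h₃ s t (‖ξ‖ ^ 2) hs hst (by positivity)
    · have h0 : 0 ≤ t - s := by linarith
      have : 0 ≤ C₂ * (K * C₁) * (t - s) ^ (2 * timeExp d H α) := by positivity
      linarith

lemma exists_lintegral_one_sub_cos_le [SFinite μ] (hμ : IsComparableRiesz α μ) (hd : 0 < d)
    (hH : 1 / 2 < H) (hH1 : H < 1) (hα : α < d) (hdα : (d : ℝ) - α < 4 * H) {T R : ℝ}
    (hT : 0 < T) (hR : 0 < R) :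
    ∃ C : ℝ, 0 < C ∧ ∀ t, 0 < t → t ≤ T → ∀ z : EuclideanSpace ℝ (Fin d), z ≠ 0 → ‖z‖ ≤ R →
      ∫⁻ q, ENNReal.ofReal (1 - Real.cos (inner ℝ z q.1)) * heatAmp H t (‖q.1‖ ^ 2) q.2 ^ 2
        ∂(μ.prod volume) ≤ ENNReal.ofReal (C * momentGauge H (d - α) R ‖z‖) := by
  obtain ⟨_, K, _, hK, hμr⟩ := hμ.exists_radial hd
  obtain ⟨C₁, hC₁, h₁⟩ := exists_space_moment_le (H := H) (β := d - α) (by linarith) hdα hT hR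
  obtain ⟨C₂, hC₂, h₂⟩ := exists_lintegral_heatAmpFrom_le hH hH1
  refine ⟨C₂ * (K * C₁), by positivity, fun t ht htT z hz hzR => ?_⟩
  have hm : Measurable fun q : EuclideanSpace ℝ (Fin d) × ℝ =>
      ENNReal.ofReal (1 - Real.cos (inner ℝ z q.1)) * heatAmp H t (‖q.1‖ ^ 2) q.2 ^ 2 :=
    Measurable.mul (by fun_prop) ((measurable_heatAmp_norm H t).pow_const 2)
  refine (lintegral_prod_heatAmp_le hμ hd hm (f := fun y => ENNReal.ofReal C₂ *
    ENNReal.ofReal (min 2 (‖z‖ ^ 2 * y ^ 2 / 2) * min T (1 / y ^ 2) ^ (2 * H)))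
    fun ξ hξ => ?_).trans ?_
  · have hξ0 : 0 < ‖ξ‖ := norm_pos_iff.2 hξ
    dsimp only
    rw [lintegral_const_mul' _ _ ENNReal.ofReal_ne_top, ← ENNReal.ofReal_mul hC₂.le, mul_left_comm,
      ENNReal.ofReal_mul (le_min (by norm_num) (by positivity))]
    refine mul_le_mul' (ENNReal.ofReal_le_ofReal (le_min ?_ ?_)) ?_
    · linarith [Real.neg_one_le_cos (inner ℝ z ξ)]
    · have h1 := Real.one_sub_sq_div_two_le_cos (x := inner ℝ z ξ)
      have h2 : inner ℝ z ξ ^ 2 ≤ ‖z‖ ^ 2 * ‖ξ‖ ^ 2 := by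
        rw [← mul_pow, ← sq_abs]
        gcongr
        exact abs_real_inner_le_norm z ξ
      linarith
    · refine le_trans (by simpa using! h₂ 0 t (‖ξ‖ ^ 2) le_rfl ht.le (by positivity))
        (ENNReal.ofReal_le_ofReal ?_)
      have : 0 ≤ min t (1 / ‖ξ‖ ^ 2) := le_min ht.le (by positivity)
      simp only [one_div] at this ⊢
      gcongr
  · rw [lintegral_const_mul' _ _ ENNReal.ofReal_ne_top, mul_assoc, ENNReal.ofReal_mul hC₂.le,
      mul_assoc, ENNReal.ofReal_mul hK.le]
    gcongr
    refine (hμr (fun y => ENNReal.ofReal (min 2 (‖z‖ ^ 2 * y ^ 2 / 2) *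
      min T (1 / y ^ 2) ^ (2 * H))) (by fun_prop)).2.trans ?_
    gcongr
    exact h₁ ‖z‖ (norm_pos_iff.2 hz) hzR

/-- The restriction to `s < u < t` keeps only what is invisible at time `s`. With `s = 0` the same
estimate bounds the variance from below. -/
lemma exists_le_lintegral_sq [SFinite μ] (hμ : IsComparableRiesz α μ) (hd : 0 < d)
    (hH : 1 / 2 < H) (hα : α < d) :
    ∃ c : ℝ, 0 < c ∧ ∀ s t, 0 ≤ s → s < t →
      ENNReal.ofReal (c * (t - s) ^ (2 * timeExp d H α)) ≤
        ∫⁻ q, heatAmp H t (‖q.1‖ ^ 2) q.2 ^ 2 ∂(μ.prod (volume.restrict (Ioo s t))) := by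
  obtain ⟨k, _, hk, _, hμr⟩ := hμ.exists_radial hd
  obtain ⟨c, hc, h⟩ := exists_le_lintegral_heatAmp hH
  have hβ : 0 < (d : ℝ) - α := by linarith
  refine ⟨k * c * (1 / (d - α)), by positivity, fun s t hs hst => ?_⟩
  have hm := le_moment (H := H) hβ (sub_pos.2 hst)
  have e : 2 * H - ((d : ℝ) - α) / 2 = 2 * timeExp d H α := by rw [timeExp]; ring
  rw [e] at hm
  rw [lintegral_prod _ ((measurable_heatAmp_norm H t).pow_const 2).aemeasurable, mul_assoc,
    ENNReal.ofReal_mul (by positivity), ENNReal.ofReal_mul hk.le, mul_assoc]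
  calc _ ≤ ENNReal.ofReal k * (ENNReal.ofReal c * ∫⁻ y in Ioi 0,
        ENNReal.ofReal (min (t - s) (1 / y ^ 2) ^ (2 * H)) * ENNReal.ofReal
            (y ^ ((d : ℝ) - α - 1))) := by
        gcongr
    _ = ENNReal.ofReal k * ∫⁻ y in Ioi 0,
        ENNReal.ofReal (c * min (t - s) (1 / y ^ 2) ^ (2 * H)) *
          ENNReal.ofReal (y ^ ((d : ℝ) - α - 1)) := by
        rw [← lintegral_const_mul' _ _ ENNReal.ofReal_ne_top]
        simp_rw [ENNReal.ofReal_mul hc.le, mul_assoc]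
    _ ≤ ∫⁻ ξ, ENNReal.ofReal (c * min (t - s) (1 / ‖ξ‖ ^ 2) ^ (2 * H)) ∂μ :=
        (hμr (fun y => ENNReal.ofReal (c * min (t - s) (1 / y ^ 2) ^ (2 * H))) (by fun_prop)).1
    _ ≤ _ := by
        refine lintegral_mono_ae ?_
        filter_upwards [hμ.ae_ne_zero hd] with ξ hξ
        exact h s t (‖ξ‖ ^ 2) hs hst (by positivity)

lemma sq_div_four_le_sin_sq {x : ℝ} (hx : |x| ≤ 1) : x ^ 2 / 4 ≤ Real.sin x ^ 2 := by
  have h : |x| / 2 ≤ |Real.sin x| := by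
    rw [Real.abs_sin_eq_sin_abs_of_abs_le_pi (hx.trans (by linarith [Real.pi_gt_three]))]
    have h0 := abs_nonneg x
    rcases h0.eq_or_lt with h1 | h1
    · simp [← h1]
    · have h2 := Real.sin_gt_sub_cube h1
      have h3 : |x| ^ 3 ≤ |x| := pow_le_of_le_one h0 hx (by norm_num)
      linarith [le_abs_self (Real.sin |x|)]
  have h2 : (|x| / 2) ^ 2 ≤ |Real.sin x| ^ 2 := by gcongr
  rw [sq_abs, div_pow, sq_abs] at h2
  linarith

/-- For `‖ξ‖ ≤ 1/‖z‖` the sine is comparable to its argument, and rotational averaging replaces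
`⟨z,ξ⟩²` by a multiple of `‖z‖² ‖ξ‖²`. What remains is the middle frequency range, which also
determines the upper bound. -/
lemma exists_le_lintegral_sin_sq [SFinite μ] (hμ : IsComparableRiesz α μ) (hd : 0 < d)
    (hH : 1 / 2 < H) {t₀ R : ℝ} (ht₀ : 0 < t₀) (hR : 0 < R) :
    ∃ c : ℝ, 0 < c ∧ ∀ t, t₀ ≤ t → ∀ z : EuclideanSpace ℝ (Fin d), z ≠ 0 → ‖z‖ ≤ R →
      ENNReal.ofReal (c * momentGauge H (d - α) R ‖z‖) ≤
      ∫⁻ q, ENNReal.ofReal (Real.sin (inner ℝ z q.1) ^ 2) * heatAmp H t (‖q.1‖ ^ 2) q.2 ^ 2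
        ∂(μ.prod volume) := by
  obtain ⟨k, hk, hμr⟩ := hμ.exists_inner_sq hd
  obtain ⟨c₁, hc₁, h₁⟩ := exists_le_lintegral_heatAmp hH
  obtain ⟨c₂, hc₂, h₂⟩ := exists_le_middle (H := H) (β := d - α) hR
  -- Frequencies above `1/(2R)` and times above `t₀` satisfy `min t (1/‖ξ‖²) ^ (2H) ≥ b ‖ξ‖^{-4H}`.
  obtain ⟨b, hb⟩ : ∃ b, b = min (t₀ * (1 / (2 * R)) ^ 2) 1 ^ (2 * H) := ⟨_, rfl⟩
  have hb0 : 0 < b := by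
    rw [hb]; exact Real.rpow_pos_of_pos (lt_min (by positivity) one_pos) _
  refine ⟨k * (c₁ * b / 4) * c₂, by positivity, fun t ht z hz hzR => ?_⟩
  have hz0 : 0 < ‖z‖ := norm_pos_iff.2 hz
  have hδ : 0 < 1 / (2 * R) := by positivity
  have hab : 1 / (2 * R) ≤ 1 / ‖z‖ := by gcongr; linarith
  obtain ⟨f, hf⟩ : ∃ f : ℝ → ℝ≥0∞, f = (Ioc (1 / (2 * R)) (1 / ‖z‖)).indicator
    fun y => ENNReal.ofReal (c₁ * b / 4 * y ^ (-(4 * H))) := ⟨_, rfl⟩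
  have hfm : Measurable f := by rw [hf]; exact Measurable.indicator (by fun_prop) measurableSet_Ioc
  have hm : Measurable fun q : EuclideanSpace ℝ (Fin d) × ℝ =>
      ENNReal.ofReal (Real.sin (inner ℝ z q.1) ^ 2) * heatAmp H t (‖q.1‖ ^ 2) q.2 ^ 2 :=
    Measurable.mul (by fun_prop) ((measurable_heatAmp_norm H t).pow_const 2)
  have hnn : 0 ≤ ∫ y in (1 / (2 * R))..(1 / ‖z‖), y ^ ((d : ℝ) - α + 1 - 4 * H) :=
    intervalIntegral.integral_nonneg hab fun y hy => Real.rpow_nonneg (hδ.le.trans hy.1) _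
  rw [lintegral_prod _ hm.aemeasurable]
  calc _ ≤ ENNReal.ofReal (k * (c₁ * b / 4) * (‖z‖ ^ 2 *
          ∫ y in (1 / (2 * R))..(1 / ‖z‖), y ^ ((d : ℝ) - α + 1 - 4 * H))) := by
        refine ENNReal.ofReal_le_ofReal ?_
        rw [mul_assoc _ c₂]
        exact mul_le_mul_of_nonneg_left (h₂ ‖z‖ hz0 hzR) (by positivity)
    _ = ENNReal.ofReal (k * ‖z‖ ^ 2) * (ENNReal.ofReal (c₁ * b / 4) *
          ∫⁻ y in Ioc (1 / (2 * R)) (1 / ‖z‖), ENNReal.ofReal (y ^ ((d : ℝ) - α + 1 - 4 * H))) := by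
        rw [lintegral_Ioc_rpow hδ hab, ← ENNReal.ofReal_mul (by positivity),
          ← ENNReal.ofReal_mul (by positivity)]
        congr 1
        ring
    _ = ENNReal.ofReal (k * ‖z‖ ^ 2) * ∫⁻ y in Ioi (0 : ℝ),
          f y * ENNReal.ofReal (y ^ ((d : ℝ) - α + 1)) := by
        congr 1
        rw [← lintegral_const_mul' _ _ ENNReal.ofReal_ne_top, ← lintegral_indicator
          measurableSet_Ioc, ← lintegral_indicator measurableSet_Ioi]
        refine lintegral_congr fun y => ?_
        by_cases hy : y ∈ Ioc (1 / (2 * R)) (1 / ‖z‖)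
        · have hy0 : 0 < y := hδ.trans hy.1
          rw [indicator_of_mem hy, indicator_of_mem (show y ∈ Ioi 0 from hy0), hf,
            indicator_of_mem hy, ← ENNReal.ofReal_mul (by positivity),
            ← ENNReal.ofReal_mul (by positivity), mul_assoc, ← Real.rpow_add hy0]
          congr 3
          ring
        · rw [indicator_of_notMem hy, hf, indicator_apply, indicator_of_notMem hy, zero_mul,
            ite_self]
    _ ≤ ∫⁻ ξ, f ‖ξ‖ * ENNReal.ofReal (inner ℝ z ξ ^ 2) ∂μ := hμr f hfm z
    _ ≤ _ := by
        refine lintegral_mono_ae ?_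
        filter_upwards [hμ.ae_ne_zero hd] with ξ hξ
        have hξ0 : 0 < ‖ξ‖ := norm_pos_iff.2 hξ
        by_cases hy : ‖ξ‖ ∈ Ioc (1 / (2 * R)) (1 / ‖z‖)
        · rw [hf, indicator_of_mem hy, lintegral_const_mul' _ _ ENNReal.ofReal_ne_top, mul_comm]
          have hin : |inner ℝ z ξ| ≤ 1 := by
            refine (abs_real_inner_le_norm z ξ).trans ?_
            have := hy.2
            rw [le_div_iff₀ hz0] at this
            linarith
          have h3 := h₁ 0 t (‖ξ‖ ^ 2) le_rfl (ht₀.trans_le ht) (by positivity)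
          have h4 : ∫⁻ u in Ioo 0 t, heatAmp H t (‖ξ‖ ^ 2) u ^ 2 ≤
              ∫⁻ u, heatAmp H t (‖ξ‖ ^ 2) u ^ 2 := setLIntegral_le_lintegral _ _
          have h5 : b * ‖ξ‖ ^ (-(4 * H)) ≤ min (t - 0) (1 / ‖ξ‖ ^ 2) ^ (2 * H) := by
            rw [hb, ← one_div_sq_rpow hξ0, ← Real.mul_rpow (le_min (by positivity) one_pos.le)
              (by positivity), min_mul_of_nonneg _ _ (by positivity)]
            refine Real.rpow_le_rpow (le_min (by positivity) (by positivity)) ?_ (by linarith)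
            refine min_le_min ?_ (by rw [one_mul])
            rw [sub_zero, mul_assoc, ← mul_one_div]
            refine le_trans ?_ ht
            have h6 : (1 / (2 * R)) ^ 2 ≤ ‖ξ‖ ^ 2 := by
              have := hy.1.le
              gcongr
            have h7 : (1 / (2 * R)) ^ 2 * (1 * (1 / ‖ξ‖ ^ 2)) ≤ 1 := by
              rw [one_mul, mul_one_div, div_le_one (by positivity)]
              exact h6
            nlinarith
          calc _ = ENNReal.ofReal (inner ℝ z ξ ^ 2 / 4) *
                ENNReal.ofReal (c₁ * (b * ‖ξ‖ ^ (-(4 * H)))) := by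
                rw [← ENNReal.ofReal_mul (by positivity), ← ENNReal.ofReal_mul (by positivity)]
                congr 1
                ring
            _ ≤ _ := by
                refine mul_le_mul' (ENNReal.ofReal_le_ofReal (sq_div_four_le_sin_sq hin)) ?_
                refine le_trans (ENNReal.ofReal_le_ofReal ?_) (h3.trans h4)
                gcongr
        · rw [hf, indicator_of_notMem hy, zero_mul]
          exact bot_le

end CovarianceBounds

/-! ### The covariance is controlled by the gauges -/

section Control

variable {d : ℕ} {H α : ℝ} {μ : Measure (EuclideanSpace ℝ (Fin d))}

lemma heatCov_eq (κ H : ℝ) (μ : Measure (EuclideanSpace ℝ (Fin d)))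
    (p p' : ℝ × EuclideanSpace ℝ (Fin d)) :
    heatCov κ H μ p p' = κ * ∫ q, Real.cos (inner ℝ (p.2 - p'.2) q.1) *
      (realAmp H p.1 q * realAmp H p'.1 q) ∂(μ.prod volume) := rfl

lemma heatCov_self (κ H : ℝ) (μ : Measure (EuclideanSpace ℝ (Fin d)))
    (p : ℝ × EuclideanSpace ℝ (Fin d)) :
    heatCov κ H μ p p = κ * ∫ q, realAmp H p.1 q ^ 2 ∂(μ.prod volume) := by
  rw [heatCov_eq]
  simp [sq]

/-- The integrand of the variance of `V(p) - b V(p')`. -/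
def quadIntegrand (H : ℝ) (p p' : ℝ × EuclideanSpace ℝ (Fin d)) (b : ℝ)
    (q : EuclideanSpace ℝ (Fin d) × ℝ) : ℝ :=
  realAmp H p.1 q ^ 2 - 2 * b * (Real.cos (inner ℝ (p.2 - p'.2) q.1) *
    (realAmp H p.1 q * realAmp H p'.1 q)) + b ^ 2 * realAmp H p'.1 q ^ 2

/-- Completing the square: with amplitudes `a`, `a'` and `φ` the phase, the integrand is `sin² φ a²
+ (cos φ a - b a')²`. The bound is uniform in `b`, as needed for a regression. -/
lemma le_quadIntegrand (p p' : ℝ × EuclideanSpace ℝ (Fin d)) (b : ℝ)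
    (q : EuclideanSpace ℝ (Fin d) × ℝ) :
    Real.sin (inner ℝ (p.2 - p'.2) q.1) ^ 2 * realAmp H p.1 q ^ 2 ≤ quadIntegrand H p p' b q := by
  unfold quadIntegrand
  nlinarith [sq_nonneg (Real.cos (inner ℝ (p.2 - p'.2) q.1) * realAmp H p.1 q -
    b * realAmp H p'.1 q), Real.sin_sq_add_cos_sq (inner ℝ (p.2 - p'.2) q.1)]

lemma quadIntegrand_nonneg (p p' : ℝ × EuclideanSpace ℝ (Fin d)) (b : ℝ)
    (q : EuclideanSpace ℝ (Fin d) × ℝ) : 0 ≤ quadIntegrand H p p' b q :=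
  (by positivity : 0 ≤ Real.sin (inner ℝ (p.2 - p'.2) q.1) ^ 2 * realAmp H p.1 q ^ 2).trans
    (le_quadIntegrand p p' b q)

lemma integrable_quadIntegrand [SFinite μ] {p p' : ℝ × EuclideanSpace ℝ (Fin d)}
    (hp : MemLp (realAmp H p.1) 2 (μ.prod volume)) (hp' : MemLp (realAmp H p'.1) 2 (μ.prod volume))
    (b : ℝ) : Integrable (quadIntegrand H p p' b) (μ.prod volume) :=
  (hp.integrable_sq.sub ((integrable_cos_mul_realAmp hp hp' _).const_mul (2 * b))).add
    (hp'.integrable_sq.const_mul (b ^ 2))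

lemma heatCov_quadratic [SFinite μ] (κ : ℝ) {p p' : ℝ × EuclideanSpace ℝ (Fin d)}
    (hp : MemLp (realAmp H p.1) 2 (μ.prod volume)) (hp' : MemLp (realAmp H p'.1) 2 (μ.prod volume))
    (b : ℝ) :
    heatCov κ H μ p p - 2 * b * heatCov κ H μ p p' + b ^ 2 * heatCov κ H μ p' p' =
      κ * ∫ q, quadIntegrand H p p' b q ∂(μ.prod volume) := by
  have h1 : Integrable (fun q => realAmp H p.1 q ^ 2 - 2 * b *
      (Real.cos (inner ℝ (p.2 - p'.2) q.1) * (realAmp H p.1 q * realAmp H p'.1 q)))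
      (μ.prod volume) :=
    hp.integrable_sq.sub ((integrable_cos_mul_realAmp hp hp' _).const_mul (2 * b))
  unfold quadIntegrand
  rw [integral_add h1 (hp'.integrable_sq.const_mul (b ^ 2)), integral_sub hp.integrable_sq
    ((integrable_cos_mul_realAmp hp hp' _).const_mul (2 * b)), integral_const_mul,
    integral_const_mul, heatCov_self, heatCov_self, heatCov_eq]
  ring

lemma ofReal_heatCov_quadratic [SFinite μ] {κ : ℝ} (hκ : 0 ≤ κ)
    {p p' : ℝ × EuclideanSpace ℝ (Fin d)} (hp : MemLp (realAmp H p.1) 2 (μ.prod volume))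
    (hp' : MemLp (realAmp H p'.1) 2 (μ.prod volume)) (b : ℝ) :
    ENNReal.ofReal (heatCov κ H μ p p - 2 * b * heatCov κ H μ p p' + b ^ 2 * heatCov κ H μ p' p') =
      ENNReal.ofReal κ * ∫⁻ q, ENNReal.ofReal (quadIntegrand H p p' b q) ∂(μ.prod volume) := by
  rw [← ofReal_integral_eq_lintegral_ofReal (integrable_quadIntegrand hp hp' b)
    (ae_of_all _ fun q => quadIntegrand_nonneg p p' b q), ← ENNReal.ofReal_mul hκ,
    heatCov_quadratic κ hp hp' b]

lemma ofReal_mul_sq_realAmp_le (a : ℝ) (ha : 0 ≤ a) (t : ℝ) (q : EuclideanSpace ℝ (Fin d) × ℝ) :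
    ENNReal.ofReal (a * realAmp H t q ^ 2) ≤
      ENNReal.ofReal a * heatAmp H t (‖q.1‖ ^ 2) q.2 ^ 2 := by
  rw [ENNReal.ofReal_mul ha, ENNReal.ofReal_pow (realAmp_nonneg H t q)]
  gcongr
  exact ENNReal.ofReal_toReal_le

lemma timeExp_pos (hdα : (d : ℝ) - α < 4 * H) : 0 < timeExp d H α := by
  rw [timeExp]; linarith

lemma momentGauge_eq {M τ : ℝ} (hτ : 0 < τ) :
    momentGauge H (d - α) (2 * √d * M) τ = spaceGauge d H α M τ ^ 2 := by
  unfold momentGauge spaceGauge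
  split_ifs with h
  · rw [logGauge, mul_pow, Real.sq_sqrt (le_max_of_le_left zero_le_one)]
    ring_nf
  · rw [spaceExp, ← Real.rpow_natCast (τ ^ _), ← Real.rpow_mul hτ.le, Nat.cast_two,
      min_mul_of_nonneg _ _ zero_le_two]
    ring_nf

lemma spaceGauge_zero (hdα : (d : ℝ) - α < 4 * H) (M : ℝ) : spaceGauge d H α M 0 = 0 := by
  unfold spaceGauge
  split_ifs
  · simp [logGauge]
  · refine Real.zero_rpow (ne_of_gt ?_)
    rw [spaceExp]
    exact lt_min one_pos (by linarith)

/-- All four bounds are integrals of one quadratic expression in the amplitudes. Upper estimates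
separate the change of the amplitude in time from the change of phase in space. For the lower
estimate each of the two effects alone provides its own gauge, and the larger one is at least half
of the sum. -/
theorem exists_heatCov_bounds [SFinite μ] (hμ : IsComparableRiesz α μ) (hd : 0 < d)
    (hH : 1 / 2 < H) (hH1 : H < 1) (hα : α < d) (hdα : (d : ℝ) - α < 4 * H) {t₀ T M κ : ℝ}
    (ht₀ : 0 < t₀) (hT : t₀ < T) (hM : 0 < M) (hκ : 0 < κ) :
    ∃ c C : ℝ, 0 < c ∧ 0 < C ∧
      ∀ p p' : ℝ × EuclideanSpace ℝ (Fin d), p.1 ∈ Icc t₀ T → p'.1 ∈ Icc t₀ T →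
      ‖p.2 - p'.2‖ ≤ 2 * √d * M →
      c ≤ heatCov κ H μ p p ∧ heatCov κ H μ p p ≤ C ∧
      heatCov κ H μ p p - 2 * heatCov κ H μ p p' + heatCov κ H μ p' p' ≤
        C * (|p.1 - p'.1| ^ (2 * timeExp d H α) + spaceGauge d H α M ‖p.2 - p'.2‖ ^ 2) ∧
      (p'.1 ≤ p.1 → ∀ b : ℝ,
        c * (|p.1 - p'.1| ^ (2 * timeExp d H α) + spaceGauge d H α M ‖p.2 - p'.2‖ ^ 2) ≤
          heatCov κ H μ p p - 2 * b * heatCov κ H μ p p' + b ^ 2 * heatCov κ H μ p' p') := by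
  have hθ := timeExp_pos hdα
  have hR : 0 < 2 * √d * M := by
    have : (0 : ℝ) < d := Nat.cast_pos.2 hd
    positivity
  have hT0 : 0 < T := ht₀.trans hT
  obtain ⟨C₁, hC₁, hU, hUt⟩ := exists_lintegral_sq_le hμ hd hH hH1 hα hdα
  obtain ⟨C₂, hC₂, hUs⟩ := exists_lintegral_one_sub_cos_le hμ hd hH hH1 hα hdα hT0 hR
  obtain ⟨c₁, hc₁, hLt⟩ := exists_le_lintegral_sq hμ hd hH hα
  obtain ⟨c₂, hc₂, hLs⟩ := exists_le_lintegral_sin_sq hμ hd hH ht₀ hR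
  have hmem : ∀ t, 0 < t → MemLp (realAmp H t) 2 (μ.prod volume) := fun t ht =>
    memLp_realAmp ((hU t ht).trans_lt ENNReal.ofReal_lt_top)
  have hae : ∀ t, 0 < t → ∀ᵐ q ∂(μ.prod volume),
      ENNReal.ofReal (realAmp H t q) = heatAmp H t (‖q.1‖ ^ 2) q.2 := fun t ht =>
    ae_ofReal_realAmp ((hU t ht).trans_lt ENNReal.ofReal_lt_top)
  have hvar : ∀ p : ℝ × EuclideanSpace ℝ (Fin d), 0 < p.1 →
      ENNReal.ofReal (heatCov κ H μ p p) =
        ENNReal.ofReal κ * ∫⁻ q, heatAmp H p.1 (‖q.1‖ ^ 2) q.2 ^ 2 ∂(μ.prod volume) := by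
    intro p hp
    rw [heatCov_self, ENNReal.ofReal_mul hκ.le, ofReal_integral_eq_lintegral_ofReal
      (hmem p.1 hp).integrable_sq (ae_of_all _ fun q => sq_nonneg _)]
    congr 1
    refine lintegral_congr_ae ?_
    filter_upwards [hae p.1 hp] with q hq
    rw [ENNReal.ofReal_pow (realAmp_nonneg H p.1 q), hq]
  have hUt' : ∀ t s, 0 < t → 0 < s →
      ∫⁻ q, ENNReal.ofReal ((realAmp H t q - realAmp H s q) ^ 2) ∂(μ.prod volume) ≤
        ENNReal.ofReal (C₁ * |t - s| ^ (2 * timeExp d H α)) := by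
    intro t s ht hs
    rcases le_total s t with h | h
    · rw [abs_of_nonneg (by linarith)]
      exact hUt s t hs h
    · rw [abs_sub_comm, abs_of_nonneg (by linarith)]
      simp_rw [fun q => sub_sq_comm (realAmp (d := d) H t q) (realAmp H s q)]
      exact hUt t s ht h
  refine ⟨min (κ * c₁ * t₀ ^ (2 * timeExp d H α)) (κ * min c₁ c₂ / 2),
    max (κ * C₁ * T ^ (2 * timeExp d H α)) (κ * (C₁ + 2 * C₂)),
    by positivity, lt_max_of_lt_right (by positivity), fun p p' hp hp' hz => ?_⟩
  have hp0 : 0 < p.1 := ht₀.trans_le hp.1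
  have hp0' : 0 < p'.1 := ht₀.trans_le hp'.1
  obtain ⟨z, hzdef⟩ : ∃ z, z = p.2 - p'.2 := ⟨_, rfl⟩
  obtain ⟨h, hhdef⟩ : ∃ h, h = |p.1 - p'.1| ^ (2 * timeExp d H α) := ⟨_, rfl⟩
  have hh0 : 0 ≤ h := by rw [hhdef]; positivity
  rw [← hzdef] at hz ⊢
  rw [← hhdef]
  refine ⟨?_, ?_, ?_, fun hle b => ?_⟩
  · refine (min_le_left _ _).trans ?_
    have h1 : ENNReal.ofReal (κ * c₁ * t₀ ^ (2 * timeExp d H α)) ≤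
        ENNReal.ofReal (heatCov κ H μ p p) := by
      rw [hvar p hp0, mul_assoc, ENNReal.ofReal_mul hκ.le]
      gcongr
      have h2 := hLt 0 p.1 le_rfl hp0
      rw [sub_zero] at h2
      refine le_trans (ENNReal.ofReal_le_ofReal ?_) (h2.trans ?_)
      · have := hp.1
        gcongr
      · exact lintegral_mono' (Measure.prod_mono le_rfl Measure.restrict_le_self) le_rfl
    rw [ENNReal.ofReal_le_ofReal_iff'] at h1
    exact h1.resolve_right (not_le.2 (by positivity))
  · refine le_trans ?_ (le_max_left _ _)
    rw [← ENNReal.ofReal_le_ofReal_iff (by positivity), hvar p hp0, mul_assoc,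
      ENNReal.ofReal_mul hκ.le]
    gcongr
    refine (hU p.1 hp0).trans (ENNReal.ofReal_le_ofReal ?_)
    have := hp.2
    gcongr
  · refine le_trans ?_ (mul_le_mul_of_nonneg_right (le_max_right _ _) (by positivity))
    have hq := ofReal_heatCov_quadratic (μ := μ) hκ.le (hmem p.1 hp0) (hmem p'.1 hp0') 1
    simp only [mul_one, one_pow, one_mul] at hq
    rw [← ENNReal.ofReal_le_ofReal_iff (by positivity), hq, mul_assoc, ENNReal.ofReal_mul hκ.le]
    gcongr
    have hc : ∀ q : EuclideanSpace ℝ (Fin d) × ℝ, 0 ≤ 1 - Real.cos (inner ℝ z q.1) := fun q => by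
      linarith [Real.cos_le_one (inner ℝ z q.1)]
    have hpt : ∀ q, ENNReal.ofReal (quadIntegrand H p p' 1 q) ≤
        ENNReal.ofReal ((realAmp H p.1 q - realAmp H p'.1 q) ^ 2) +
        (ENNReal.ofReal (1 - Real.cos (inner ℝ z q.1)) * heatAmp H p.1 (‖q.1‖ ^ 2) q.2 ^ 2 +
        ENNReal.ofReal (1 - Real.cos (inner ℝ z q.1)) * heatAmp H p'.1 (‖q.1‖ ^ 2) q.2 ^ 2) := by
      intro q
      refine le_trans (ENNReal.ofReal_le_ofReal (q := (realAmp H p.1 q - realAmp H p'.1 q) ^ 2 +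
        ((1 - Real.cos (inner ℝ z q.1)) * realAmp H p.1 q ^ 2 +
        (1 - Real.cos (inner ℝ z q.1)) * realAmp H p'.1 q ^ 2)) ?_) ?_
      · unfold quadIntegrand
        rw [← hzdef]
        -- The integrand is `(a - a')² + 2 (1 - cos) a a'`, and `2 a a' ≤ a² + a'²`.
        nlinarith [mul_nonneg (hc q) (sq_nonneg (realAmp H p.1 q - realAmp H p'.1 q))]
      · rw [ENNReal.ofReal_add (sq_nonneg _) (add_nonneg (mul_nonneg (hc q) (sq_nonneg _))
          (mul_nonneg (hc q) (sq_nonneg _))), ENNReal.ofReal_add (mul_nonneg (hc q) (sq_nonneg _))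
          (mul_nonneg (hc q) (sq_nonneg _))]
        gcongr
        · exact ofReal_mul_sq_realAmp_le _ (hc q) _ q
        · exact ofReal_mul_sq_realAmp_le _ (hc q) _ q
    have hm1 : Measurable fun q : EuclideanSpace ℝ (Fin d) × ℝ =>
        ENNReal.ofReal ((realAmp H p.1 q - realAmp H p'.1 q) ^ 2) :=
      (((measurable_realAmp H p.1).sub (measurable_realAmp H p'.1)).pow_const 2).ennreal_ofReal
    have hm2 : Measurable fun q : EuclideanSpace ℝ (Fin d) × ℝ =>
        ENNReal.ofReal (1 - Real.cos (inner ℝ z q.1)) * heatAmp H p.1 (‖q.1‖ ^ 2) q.2 ^ 2 :=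
      Measurable.mul (by fun_prop) ((measurable_heatAmp_norm H p.1).pow_const 2)
    refine (lintegral_mono hpt).trans ?_
    rw [lintegral_add_left hm1, lintegral_add_left hm2]
    have hcos : ∀ t, 0 < t → t ≤ T → ∫⁻ q, ENNReal.ofReal (1 - Real.cos (inner ℝ z q.1)) *
        heatAmp H t (‖q.1‖ ^ 2) q.2 ^ 2 ∂(μ.prod volume) ≤
        ENNReal.ofReal (C₂ * spaceGauge d H α M ‖z‖ ^ 2) := by
      intro t ht htT
      by_cases hz0 : z = 0
      · simp [hz0]
      · rw [← momentGauge_eq (norm_pos_iff.2 hz0)]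
        exact hUs t ht htT z hz0 hz
    refine (add_le_add (hUt' _ _ hp0 hp0') (add_le_add (hcos _ hp0 hp.2) (hcos _ hp0' hp'.2))).trans
      ?_
    rw [← hhdef, ← ENNReal.ofReal_add (by positivity) (by positivity),
      ← ENNReal.ofReal_add (by positivity) (by positivity)]
    refine ENNReal.ofReal_le_ofReal ?_
    nlinarith [mul_nonneg hC₂.le hh0, mul_nonneg hC₁.le (sq_nonneg (spaceGauge d H α M ‖z‖))]
  · refine le_trans (mul_le_mul_of_nonneg_right (min_le_right _ _) (by positivity)) ?_
    have hq := ofReal_heatCov_quadratic (μ := μ) hκ.le (hmem p.1 hp0) (hmem p'.1 hp0') b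
    have hnn : 0 ≤ heatCov κ H μ p p - 2 * b * heatCov κ H μ p p' +
        b ^ 2 * heatCov κ H μ p' p' := by
      rw [heatCov_quadratic κ (hmem p.1 hp0) (hmem p'.1 hp0')]
      exact mul_nonneg hκ.le (integral_nonneg fun q => quadIntegrand_nonneg p p' b q)
    have htime : ENNReal.ofReal (c₁ * h) ≤
        ∫⁻ q, ENNReal.ofReal (quadIntegrand H p p' b q) ∂(μ.prod volume) := by
      rcases hle.eq_or_lt with heq | hlt
      · have : h = 0 := by
          rw [hhdef, heq, sub_self, abs_zero, Real.zero_rpow (by positivity)]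
        simp [this]
      · have h1 := hLt p'.1 p.1 hp0'.le hlt
        rw [hhdef, abs_of_pos (sub_pos.2 hlt)]
        refine h1.trans ?_
        have hr : μ.prod (volume.restrict (Ioo p'.1 p.1)) =
            (μ.prod volume).restrict (univ ×ˢ Ioo p'.1 p.1) := by
          rw [← Measure.prod_restrict, Measure.restrict_univ]
        rw [hr]
        refine le_trans ?_ (setLIntegral_le_lintegral (univ ×ˢ Ioo p'.1 p.1) _)
        refine setLIntegral_mono_ae' (MeasurableSet.univ.prod measurableSet_Ioo) ?_
        filter_upwards [hae p.1 hp0] with q hq1 hq2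
        -- On this strip of `u` the earlier amplitude vanishes, so the regression cannot reduce the
        -- square of the later one.
        have h0 : realAmp H p'.1 q = 0 := by
          rw [realAmp, heatAmp_eq_zero hq2.2.1.le, ENNReal.toReal_zero]
        rw [← hq1, ← ENNReal.ofReal_pow (realAmp_nonneg H p.1 q)]
        refine ENNReal.ofReal_le_ofReal ?_
        unfold quadIntegrand
        rw [h0]
        simp
    have hspace : ENNReal.ofReal (c₂ * spaceGauge d H α M ‖z‖ ^ 2) ≤
        ∫⁻ q, ENNReal.ofReal (quadIntegrand H p p' b q) ∂(μ.prod volume) := by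
      by_cases hz0 : z = 0
      · simp [hz0, spaceGauge_zero hdα]
      · rw [← momentGauge_eq (norm_pos_iff.2 hz0)]
        refine (hLs p.1 hp.1 z hz0 hz).trans (lintegral_mono_ae ?_)
        filter_upwards [hae p.1 hp0] with q hq1
        rw [← hq1, ← ENNReal.ofReal_pow (realAmp_nonneg H p.1 q),
          ← ENNReal.ofReal_mul (sq_nonneg _), hzdef]
        exact ENNReal.ofReal_le_ofReal (le_quadIntegrand p p' b q)
    rw [← ENNReal.ofReal_le_ofReal_iff hnn, hq]
    have h1 : ENNReal.ofReal (κ * min c₁ c₂ / 2 * (h + spaceGauge d H α M ‖z‖ ^ 2)) =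
        ENNReal.ofReal κ * ENNReal.ofReal (min c₁ c₂ * (h + spaceGauge d H α M ‖z‖ ^ 2) / 2) := by
      rw [← ENNReal.ofReal_mul hκ.le]
      congr 1
      ring
    rw [h1]
    gcongr
    have hmin0 : 0 < min c₁ c₂ := lt_min hc₁ hc₂
    rcases le_total h (spaceGauge d H α M ‖z‖ ^ 2) with hs | hs
    · refine le_trans (ENNReal.ofReal_le_ofReal ?_) hspace
      have : min c₁ c₂ * spaceGauge d H α M ‖z‖ ^ 2 ≤ c₂ * spaceGauge d H α M ‖z‖ ^ 2 := by
        gcongr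
        exact min_le_right _ _
      nlinarith
    · refine le_trans (ENNReal.ofReal_le_ofReal ?_) htime
      have : min c₁ c₂ * h ≤ c₁ * h := by
        gcongr
        exact min_le_left _ _
      nlinarith

end Control

/-! ### The gauges of the stochastic heat equation -/

section LogFactor

variable {K : ℝ}

/-- Lowering the argument from `t` to `s` adds `log (t/s)` to the logarithm; as the truncated
logarithm is at least one, the sum is bounded by a product. Monotonicity and scaling of the
logarithmic gauge both rest on this. -/
lemma max_one_log_div_le (hK : 0 < K) {s t : ℝ} (hs : 0 < s) (hst : s ≤ t) :
    max 1 (Real.log (K / s)) ≤ max 1 (Real.log (K / t)) * (1 + Real.log (t / s)) := by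
  have ht := hs.trans_le hst
  have h1 : 0 ≤ Real.log (t / s) := Real.log_nonneg ((one_le_div hs).2 hst)
  have h2 : Real.log (K / s) = Real.log (K / t) + Real.log (t / s) := by
    rw [← Real.log_mul (by positivity) (by positivity)]
    congr 1
    field_simp
  have h3 := le_max_left 1 (Real.log (K / t))
  have h4 := le_max_right 1 (Real.log (K / t))
  refine max_le ?_ ?_ <;> nlinarith

lemma mul_sqrt_max_one_log_div_le (hK : 0 < K) {s t : ℝ} (hs : 0 < s) (hst : s ≤ t) :
    s * √(max 1 (Real.log (K / s))) ≤ t * √(max 1 (Real.log (K / t))) := by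
  have ht := hs.trans_le hst
  have h1 : 1 ≤ t / s := (one_le_div hs).2 hst
  have h2 : 1 + Real.log (t / s) ≤ (t / s) ^ 2 := by
    have := Real.log_le_sub_one_of_pos (zero_lt_one.trans_le h1)
    nlinarith
  have h3 : (0 : ℝ) ≤ max 1 (Real.log (K / t)) := le_max_of_le_left zero_le_one
  calc s * √(max 1 (Real.log (K / s)))
      ≤ s * √(max 1 (Real.log (K / t)) * (t / s) ^ 2) := by
        gcongr
        exact (max_one_log_div_le hK hs hst).trans (by gcongr)
    _ = t * √(max 1 (Real.log (K / t))) := by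
        rw [Real.sqrt_mul h3, Real.sqrt_sq (by positivity)]
        field_simp

/-- A logarithm grows more slowly than any power: `1 + log x ≤ (1 + 1/(2(1-γ))) x^{2(1-γ)}` for `x =
1/l ≥ 1`. So the logarithmic factor costs an arbitrarily small part of the exponent `1`. -/
lemma mul_sqrt_max_one_log_mul_le (hK : 0 < K) {γ : ℝ} (hγ : γ < 1) {l τ : ℝ} (hl : 0 < l)
    (hl1 : l ≤ 1) (hτ : 0 < τ) :
    l * τ * √(max 1 (Real.log (K / (l * τ)))) ≤
      √(1 + 1 / (2 * (1 - γ))) * l ^ γ * (τ * √(max 1 (Real.log (K / τ)))) := by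
  have hε : 0 < 2 * (1 - γ) := by linarith
  have h0 : (0 : ℝ) ≤ max 1 (Real.log (K / τ)) := le_max_of_le_left zero_le_one
  have hx : 1 ≤ l⁻¹ := (one_le_inv₀ hl).2 hl1
  have h1 : 1 + Real.log l⁻¹ ≤ (1 + 1 / (2 * (1 - γ))) * (l⁻¹ ^ (1 - γ)) ^ 2 := by
    have e : (l⁻¹ ^ (1 - γ)) ^ 2 = l⁻¹ ^ (2 * (1 - γ)) := by
      rw [← Real.rpow_natCast, ← Real.rpow_mul (by positivity)]
      congr 1
      push_cast
      ring
    have h2 := Real.log_le_rpow_div (zero_le_one.trans hx) hε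
    have h3 := Real.one_le_rpow hx hε.le
    rw [e, add_mul, one_mul, one_div_mul_eq_div]
    linarith
  have h4 := max_one_log_div_le hK (s := l * τ) (t := τ) (by positivity)
    (mul_le_of_le_one_left hτ.le hl1)
  rw [show τ / (l * τ) = l⁻¹ by field_simp] at h4
  calc l * τ * √(max 1 (Real.log (K / (l * τ))))
      ≤ l * τ * √(max 1 (Real.log (K / τ)) *
          ((1 + 1 / (2 * (1 - γ))) * (l⁻¹ ^ (1 - γ)) ^ 2)) := by
        gcongr
        exact h4.trans (by gcongr)
    _ = √(1 + 1 / (2 * (1 - γ))) * (l * l⁻¹ ^ (1 - γ)) * (τ * √(max 1 (Real.log (K / τ)))) := by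
        rw [Real.sqrt_mul h0, Real.sqrt_mul (by positivity), Real.sqrt_sq (by positivity)]
        ring
    _ = _ := by
        congr 2
        rw [Real.inv_rpow hl.le, ← Real.rpow_neg hl.le]
        nth_rewrite 1 [← Real.rpow_one l]
        rw [← Real.rpow_add hl]
        congr 1
        ring

end LogFactor

lemma tendsto_zero_of_le_rpow {q : ℝ → ℝ} {γ C : ℝ} (hγ : 0 < γ) (h0 : ∀ τ, 0 < τ → 0 ≤ q τ)
    (h : ∀ l, 0 < l → l ≤ 1 → q l ≤ C * l ^ γ) : Tendsto q (𝓝[>] 0) (𝓝 0) := by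
  have hc : Tendsto (fun l : ℝ => C * l ^ γ) (𝓝[>] 0) (𝓝 0) := by
    have : ContinuousAt (fun l : ℝ => C * l ^ γ) 0 :=
      continuousAt_const.mul (Real.continuousAt_rpow_const _ _ (Or.inr hγ.le))
    have := this.tendsto
    rw [Real.zero_rpow hγ.ne', mul_zero] at this
    exact this.mono_left nhdsWithin_le_nhds
  refine tendsto_of_tendsto_of_tendsto_of_le_of_le' tendsto_const_nhds hc ?_ ?_
  · filter_upwards [self_mem_nhdsWithin] with τ hτ using h0 τ hτ
  · filter_upwards [Ioc_mem_nhdsGT (zero_lt_one (α := ℝ))] with l hl using h l hl.1 hl.2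

lemma IsGauge.tendsto_zero {q qi : ℝ → ℝ} {γ : ℝ} (hq : IsGauge q qi γ) :
    Tendsto q (𝓝[≥] 0) (𝓝 0) := by
  obtain ⟨C, _, hC⟩ := hq.scaling
  have h1 : Tendsto q (𝓝[>] 0) (𝓝 0) :=
    tendsto_zero_of_le_rpow (C := C * q 1) hq.exponent_pos (fun τ hτ => hq.nonneg hτ.le)
      fun l hl hl1 => by simpa [mul_right_comm] using hC 1 zero_le_one l hl hl1
  rw [← Ioi_insert, nhdsWithin_insert, tendsto_sup]
  refine ⟨?_, h1⟩
  rw [tendsto_pure_left]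
  intro s hs
  rw [hq.zero]
  exact mem_of_mem_nhds hs

/-! ### The logarithmic gauge and its inverse. -/

section LogGauge

variable {d : ℕ} {M : ℝ}

lemma logGauge_zero : logGauge d M 0 = 0 := by simp [logGauge]

lemma le_logGauge {τ : ℝ} (hτ : 0 ≤ τ) : τ ≤ logGauge d M τ := by
  refine le_mul_of_one_le_right hτ ?_
  rw [Real.one_le_sqrt]
  exact le_max_left _ _

lemma logGauge_scaling (hd : 0 < d) (hM : 0 < M) {γ : ℝ} (hγ : γ < 1) {l τ : ℝ} (hτ : 0 ≤ τ)
    (hl : 0 < l) (hl1 : l ≤ 1) :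
    logGauge d M (l * τ) ≤ √(1 + 1 / (2 * (1 - γ))) * l ^ γ * logGauge d M τ := by
  have hd' : (0 : ℝ) < d := Nat.cast_pos.2 hd
  rcases hτ.eq_or_lt with rfl | hτ
  · simp [logGauge]
  · exact mul_sqrt_max_one_log_mul_le (by positivity) hγ hl hl1 hτ

lemma monotoneOn_logGauge (hd : 0 < d) (hM : 0 < M) : MonotoneOn (logGauge d M) (Ici 0) := by
  have hd' : (0 : ℝ) < d := Nat.cast_pos.2 hd
  intro s hs t ht hst
  rcases (mem_Ici.1 hs).eq_or_lt with rfl | hs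
  · rw [logGauge_zero]
    exact ht.trans (le_logGauge ht)
  · exact mul_sqrt_max_one_log_div_le (by positivity) hs hst

/-- By the intermediate value theorem: the gauge tends to zero at the origin and is at least the
identity, so it passes the level `ρ` before the argument `ρ`. -/
lemma exists_logGauge_eq (hd : 0 < d) (hM : 0 < M) {ρ : ℝ} (hρ : 0 < ρ) :
    ∃ τ ∈ Ici (0 : ℝ), logGauge d M τ = ρ := by
  have hd' : (0 : ℝ) < d := Nat.cast_pos.2 hd
  have hlim : Tendsto (logGauge d M) (𝓝[>] 0) (𝓝 0) :=
    tendsto_zero_of_le_rpow (C := √(1 + 1 / (2 * (1 - 1 / 2))) * logGauge d M 1)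
      (one_half_pos (α := ℝ)) (fun τ hτ => hτ.le.trans (le_logGauge hτ.le)) fun l hl hl1 => by
        simpa [mul_right_comm] using
          logGauge_scaling hd hM (γ := 1 / 2) (by norm_num) zero_le_one hl hl1
  obtain ⟨l, hl, hlρ⟩ := ((hlim.eventually_lt_const hρ).and (Ioc_mem_nhdsGT hρ)).exists
  have hcont : ContinuousOn (logGauge d M) (Icc l ρ) := by
    unfold logGauge
    have hpos : ∀ τ ∈ Icc l ρ, 0 < τ := fun τ hτ => hlρ.1.trans_le hτ.1
    refine continuousOn_id.mul (Continuous.comp_continuousOn Real.continuous_sqrt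
      (continuousOn_const.sup (ContinuousOn.log (continuousOn_const.div continuousOn_id
        fun τ hτ => (hpos τ hτ).ne') fun τ hτ => ?_)))
    have := hpos τ hτ
    positivity
  obtain ⟨τ, hτ, h⟩ := intermediate_value_Icc hlρ.2 hcont ⟨hl.le, le_logGauge hρ.le⟩
  exact ⟨τ, hlρ.1.le.trans hτ.1, h⟩

lemma logGauge_logGaugeInv (hd : 0 < d) (hM : 0 < M) {ρ : ℝ} (hρ : 0 < ρ) :
    0 < logGaugeInv d M ρ ∧ logGauge d M (logGaugeInv d M ρ) = ρ := by
  have h := exists_logGauge_eq hd hM hρ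
  have h1 : logGaugeInv d M ρ ∈ Ici (0 : ℝ) := Function.invFunOn_mem h
  have h2 : logGauge d M (logGaugeInv d M ρ) = ρ := Function.invFunOn_eq h
  refine ⟨lt_of_le_of_ne h1 fun h0 => ?_, h2⟩
  rw [← h0, logGauge_zero] at h2
  exact hρ.ne h2

lemma logGaugeInv_zero : logGaugeInv d M 0 = 0 := by
  have h : ∃ τ ∈ Ici (0 : ℝ), logGauge d M τ = 0 := ⟨0, mem_Ici.2 le_rfl, logGauge_zero⟩
  have h1 : logGaugeInv d M 0 ∈ Ici (0 : ℝ) := Function.invFunOn_mem h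
  have h2 : logGauge d M (logGaugeInv d M 0) = 0 := Function.invFunOn_eq h
  exact le_antisymm ((le_logGauge h1).trans h2.le) h1

/-- The logarithmic gauge has every scaling exponent below `1`. -/
lemma isGauge_logGauge (hd : 0 < d) (hM : 0 < M) {γ : ℝ} (hγ : 0 < γ) (hγ1 : γ < 1) :
    IsGauge (logGauge d M) (logGaugeInv d M) γ where
  exponent_pos := hγ
  zero := logGauge_zero
  mono := monotoneOn_logGauge hd hM
  pos τ hτ := hτ.trans_le (le_logGauge hτ.le)
  scaling := by
    have : 0 < 1 - γ := by linarith
    exact ⟨√(1 + 1 / (2 * (1 - γ))), by positivity, fun τ hτ l hl hl1 =>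
      logGauge_scaling hd hM hγ1 hτ hl hl1⟩
  inverse ρ hρ := logGauge_logGaugeInv hd hM hρ

lemma measurable_logGauge : Measurable (logGauge d M) := by
  unfold logGauge
  fun_prop

/-- A right inverse of a monotone function is monotone wherever it is defined. Composing with `max τ
0` extends it to a monotone, hence measurable, function on the line. -/
lemma measurable_logGaugeInv_abs (hd : 0 < d) (hM : 0 < M) :
    Measurable fun τ => logGaugeInv d M |τ| := by
  have hmono : Monotone fun τ : ℝ => logGaugeInv d M (max τ 0) := by
    intro s t hst
    dsimp only
    rcases le_or_gt s 0 with hs | hs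
    · rw [max_eq_right hs, logGaugeInv_zero]
      rcases le_or_gt t 0 with ht | ht
      · rw [max_eq_right ht, logGaugeInv_zero]
      · rw [max_eq_left ht.le]
        exact (logGauge_logGaugeInv hd hM ht).1.le
    · have ht := hs.trans_le hst
      rw [max_eq_left hs.le, max_eq_left ht.le]
      obtain ⟨h1, h2⟩ := logGauge_logGaugeInv hd hM hs
      obtain ⟨h3, h4⟩ := logGauge_logGaugeInv hd hM ht
      by_contra! hlt
      have h5 := monotoneOn_logGauge hd hM (mem_Ici.2 h3.le) (mem_Ici.2 h1.le) hlt.le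
      rw [h2, h4] at h5
      rw [le_antisymm hst h5] at hlt
      exact lt_irrefl _ hlt
  have : (fun τ => logGaugeInv d M |τ|) =
      fun τ => (fun τ : ℝ => logGaugeInv d M (max τ 0)) |τ| := by
    ext τ
    simp
  rw [this]
  exact hmono.measurable.comp measurable_norm

end LogGauge

/-! ### Hitting probabilities of the solution -/

section Solution

variable {d D : ℕ} {H α T t₀ M : ℝ}

lemma norm_sub_le_of_mem_cube (hM : 0 ≤ M) {x y : EuclideanSpace ℝ (Fin d)} (hx : x ∈ cube d M)
    (hy : y ∈ cube d M) : ‖x - y‖ ≤ 2 * √d * M := by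
  rw [EuclideanSpace.norm_eq]
  refine Real.sqrt_le_iff.2 ⟨by positivity, ?_⟩
  have : ∀ i, ‖(x - y) i‖ ^ 2 ≤ (2 * M) ^ 2 := by
    intro i
    obtain ⟨h1, h2⟩ := hx i
    obtain ⟨h3, h4⟩ := hy i
    rw [Real.norm_eq_abs, sq_abs, PiLp.sub_apply]
    exact sq_le_sq' (by linarith) (by linarith)
  calc ∑ i, ‖(x - y) i‖ ^ 2 ≤ ∑ _i : Fin d, (2 * M) ^ 2 := Finset.sum_le_sum fun i _ => this i
    _ = (2 * √d * M) ^ 2 := by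
      rw [mul_pow (2 * √(d : ℝ)), mul_pow 2 √(d : ℝ), Real.sq_sqrt (Nat.cast_nonneg d)]
      simp
      ring

lemma gaugeDist_clampPoint_le {θ γ : ℝ} {q qi : ℝ → ℝ} (hq : IsGauge q qi γ) (hθ : 0 < θ)
    (p p' : SpaceTime d) :
    gaugeDist θ q (clampPoint t₀ T M p) (clampPoint t₀ T M p') ≤ gaugeDist θ q p p' := by
  refine add_le_add ?_ (hq.mono (norm_nonneg _) (norm_nonneg _) (norm_clampPoint_snd_sub_le p p'))
  exact Real.rpow_le_rpow (abs_nonneg _) (abs_clampPoint_fst_sub_le p p') hθ.le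

lemma continuous_of_abs_sub_le_gaugeDist {θ γ C : ℝ} {q qi : ℝ → ℝ} (hq : IsGauge q qi γ)
    (hθ : 0 < θ) {m : SpaceTime d → ℝ} (h : ∀ p p', |m p - m p'| ≤ C * gaugeDist θ q p p') :
    Continuous m := by
  rw [continuous_iff_continuousAt]
  intro p
  rw [ContinuousAt, tendsto_iff_norm_sub_tendsto_zero]
  have hx : Tendsto (fun p' : SpaceTime d => ‖p'.2 - p.2‖) (𝓝 p) (𝓝[≥] 0) := by
    refine tendsto_nhdsWithin_iff.2 ⟨?_, Eventually.of_forall fun _ => norm_nonneg _⟩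
    have : Continuous fun p' : SpaceTime d => ‖p'.2 - p.2‖ := by fun_prop
    simpa using this.tendsto p
  have ht : Tendsto (fun p' : SpaceTime d => |p'.1 - p.1| ^ θ) (𝓝 p) (𝓝 0) := by
    have : Continuous fun p' : SpaceTime d => |p'.1 - p.1| ^ θ :=
      (by fun_prop : Continuous fun p' : SpaceTime d => |p'.1 - p.1|).rpow_const
        fun _ => Or.inr hθ.le
    simpa [Real.zero_rpow hθ.ne'] using this.tendsto p
  have hlim : Tendsto (fun p' => C * gaugeDist θ q p' p) (𝓝 p) (𝓝 0) := by
    have := (ht.add (hq.tendsto_zero.comp hx)).const_mul C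
    simpa [gaugeDist, Function.comp_def] using this
  exact squeeze_zero (fun _ => norm_nonneg _) (fun p' => h p' p) hlim

end Solution

/-! ### From the heat equation to the abstract hitting estimates. -/

section Assembly

variable {d D : ℕ} {H α T t₀ M : ℝ} {Λ μ : Measure (EuclideanSpace ℝ (Fin d))}
  {v₀ : EuclideanSpace ℝ (Fin d) → ℝ}

/-- The covariance of the stochastic part of the solution, extended by the values at the nearest
points of the cylinder. -/
def clampCov (κ H t₀ T M : ℝ) (μ : Measure (EuclideanSpace ℝ (Fin d))) (p p' : SpaceTime d) : ℝ :=
  heatCov κ H μ (clampPoint t₀ T M p) (clampPoint t₀ T M p')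

/-- The deterministic part of the solution, extended by the values at the nearest points of the
cylinder. -/
def clampMean (t₀ T M : ℝ) (v₀ : EuclideanSpace ℝ (Fin d) → ℝ) (p : SpaceTime d) : ℝ :=
  initialPart v₀ (clampPoint t₀ T M p).1 (clampPoint t₀ T M p).2

/-- The projection onto the cylinder does not increase gauge distances, so the modulus of continuity
extends to all points; boundedness follows because the cylinder has finite gauge diameter. -/
lemma exists_clampMean_bounds {θ γ K : ℝ} {q qi : ℝ → ℝ} (hq : IsGauge q qi γ) (hθ : 0 < θ)
    (hT : t₀ ≤ T) (hM : 0 ≤ M)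
    (hK : ∀ t ∈ Icc t₀ T, ∀ s ∈ Icc t₀ T, ∀ x ∈ cube d M, ∀ y ∈ cube d M,
      |initialPart v₀ t x - initialPart v₀ s y| ≤ K * (|t - s| ^ θ + q ‖x - y‖)) :
    ∃ B : ℝ, 0 ≤ B ∧ (∀ p p' : SpaceTime d, |clampMean t₀ T M v₀ p - clampMean t₀ T M v₀ p'| ≤
      B * gaugeDist θ q p p') ∧ ∀ p : SpaceTime d, |clampMean t₀ T M v₀ p| ≤ B := by
  have hmem := fun p : SpaceTime d => clampPoint_mem hT hM p
  have h1 : ∀ p p' : SpaceTime d, |clampMean t₀ T M v₀ p - clampMean t₀ T M v₀ p'| ≤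
      |K| * gaugeDist θ q (clampPoint t₀ T M p) (clampPoint t₀ T M p') := fun p p' =>
    (hK _ (hmem p).1 _ (hmem p').1 _ (hmem p).2 _ (hmem p').2).trans
      (mul_le_mul_of_nonneg_right (le_abs_self K) (gaugeDist_nonneg hq _ _))
  have hdist : ∀ p p' : SpaceTime d, gaugeDist θ q (clampPoint t₀ T M p) (clampPoint t₀ T M p') ≤
      (T - t₀) ^ θ + q (2 * √d * M) := by
    intro p p'
    refine add_le_add (Real.rpow_le_rpow (abs_nonneg _) ?_ hθ.le)
      (hq.mono (norm_nonneg _) (mem_Ici.2 (by positivity))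
        (norm_sub_le_of_mem_cube hM (hmem p).2 (hmem p').2))
    obtain ⟨h2, h3⟩ := (hmem p).1
    obtain ⟨h4, h5⟩ := (hmem p').1
    exact abs_sub_le_iff.2 ⟨by linarith, by linarith⟩
  have hR : 0 ≤ (T - t₀) ^ θ + q (2 * √d * M) := (gaugeDist_nonneg hq _ _).trans (hdist 0 0)
  refine ⟨|K| + |clampMean t₀ T M v₀ 0| + |K| * ((T - t₀) ^ θ + q (2 * √d * M)), by positivity,
    fun p p' => (h1 p p').trans ?_, fun p => ?_⟩
  · refine mul_le_mul ?_ (gaugeDist_clampPoint_le hq hθ p p') (gaugeDist_nonneg hq _ _)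
      (by positivity)
    have : 0 ≤ |clampMean t₀ T M v₀ 0| + |K| * ((T - t₀) ^ θ + q (2 * √d * M)) := by positivity
    linarith
  · have h2 := (h1 p 0).trans (mul_le_mul_of_nonneg_left (hdist p 0) (abs_nonneg K))
    have h3 := abs_sub_abs_le_abs_sub (clampMean t₀ T M v₀ p) (clampMean t₀ T M v₀ 0)
    linarith [abs_nonneg K]

lemma exists_isControlled [SFinite μ] (hμ : IsComparableRiesz α μ) (hd : 0 < d)
    (hH : 1 / 2 < H) (hH1 : H < 1) (hα : α < d) (hdα : (d : ℝ) - α < 4 * H) {κ γ K : ℝ}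
    (ht₀ : 0 < t₀) (hT : t₀ < T) (hM : 0 < M) (hκ : 0 < κ) {qi : ℝ → ℝ}
    (hq : IsGauge (spaceGauge d H α M) qi γ)
    (hK : ∀ t ∈ Icc t₀ T, ∀ s ∈ Icc t₀ T, ∀ x ∈ cube d M, ∀ y ∈ cube d M,
      |initialPart v₀ t x - initialPart v₀ s y| ≤
        K * (|t - s| ^ timeExp d H α + spaceGauge d H α M ‖x - y‖)) :
    ∃ c C : ℝ, IsControlled (timeExp d H α) (spaceGauge d H α M) c C (clampCov κ H t₀ T M μ)
        (clampMean t₀ T M v₀) ∧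
      IsNondegenerate (timeExp d H α) (spaceGauge d H α M) c (Icc t₀ T ×ˢ cube d M)
        (clampCov κ H t₀ T M μ) := by
  have hθ := timeExp_pos hdα
  obtain ⟨B, hB, hB1, hB2⟩ := exists_clampMean_bounds hq hθ hT.le hM.le hK
  obtain ⟨c, C, hc, hC, hcov⟩ := exists_heatCov_bounds hμ hd hH hH1 hα hdα ht₀ hT hM hκ
  have hmem := fun p : SpaceTime d => clampPoint_mem hT.le hM.le p
  have hcov := fun p p' : SpaceTime d => hcov (clampPoint t₀ T M p) (clampPoint t₀ T M p')
    (hmem p).1 (hmem p').1 (norm_sub_le_of_mem_cube hM.le (hmem p).2 (hmem p').2)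
  have hsq : ∀ t : ℝ, |t| ^ (2 * timeExp d H α) = (|t| ^ timeExp d H α) ^ 2 := by
    intro t
    rw [mul_comm, Real.rpow_mul (abs_nonneg t), Real.rpow_two]
  have hg : ∀ p p' : SpaceTime d,
      0 ≤ gaugeDist (timeExp d H α) (spaceGauge d H α M) p p' := gaugeDist_nonneg hq
  -- The gauge distance is squared as a sum, hence `(a + b)² ≤ 2 (a² + b²)`. The lower constant
  -- satisfies `(min c (1/2))² ≤ c/2`, which absorbs the factor two, and the upper one satisfies `C
  -- ≤ (1 + C + B)²`.
  refine ⟨min c (1 / 2), 1 + C + B,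
    { const_pos := lt_min hc one_half_pos
      le_variance := fun p => (min_le_left _ _).trans (hcov p p).1
      variance_le := fun p => (hcov p p).2.1.trans (by linarith)
      increment_le := fun p p' => ?_
      mean_sub_le := fun p p' => (hB1 p p').trans
        (mul_le_mul_of_nonneg_right (by linarith) (hg p p'))
      mean_le := fun p => (hB2 p).trans (by linarith) }, fun p hp p' hp' hle b => ?_⟩
  · refine (hcov p p').2.2.1.trans ?_
    have h1 := gaugeDist_clampPoint_le (t₀ := t₀) (T := T) (M := M) hq hθ p p'
    have h2 := hg (clampPoint t₀ T M p) (clampPoint t₀ T M p')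
    have h3 : |(clampPoint t₀ T M p).1 - (clampPoint t₀ T M p').1| ^ (2 * timeExp d H α) +
        spaceGauge d H α M ‖(clampPoint t₀ T M p).2 - (clampPoint t₀ T M p').2‖ ^ 2 ≤
        gaugeDist (timeExp d H α) (spaceGauge d H α M) (clampPoint t₀ T M p)
          (clampPoint t₀ T M p') ^ 2 := by
      rw [hsq, gaugeDist]
      have h4 : 0 ≤ |(clampPoint t₀ T M p).1 - (clampPoint t₀ T M p').1| ^ timeExp d H α := by
        positivity
      have h5 := hq.nonneg (norm_nonneg ((clampPoint t₀ T M p).2 - (clampPoint t₀ T M p').2))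
      linarith [mul_nonneg h4 h5, add_sq (|(clampPoint t₀ T M p).1 -
        (clampPoint t₀ T M p').1| ^ timeExp d H α)
        (spaceGauge d H α M ‖(clampPoint t₀ T M p).2 - (clampPoint t₀ T M p').2‖)]
    calc _ ≤ C * gaugeDist (timeExp d H α) (spaceGauge d H α M) p p' ^ 2 := by
          gcongr
          exact h3.trans (by gcongr)
      _ ≤ (1 + C + B) ^ 2 * gaugeDist (timeExp d H α) (spaceGauge d H α M) p p' ^ 2 := by
          gcongr
          nlinarith
      _ = _ := by ring
  · have h1 := hcov p' p
    rw [clampPoint_of_mem hp, clampPoint_of_mem hp'] at h1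
    unfold clampCov
    rw [clampPoint_of_mem hp, clampPoint_of_mem hp']
    refine le_trans ?_ (h1.2.2.2 hle b)
    rw [hsq, gaugeDist_comm, gaugeDist, mul_pow]
    have h2 : min c (1 / 2) ^ 2 ≤ c * (1 / 2) := by
      rw [sq]
      exact mul_le_mul (min_le_left _ _) (min_le_right _ _) (le_min hc.le one_half_pos.le) hc.le
    have h3 := add_sq_le (a := |p'.1 - p.1| ^ timeExp d H α)
      (b := spaceGauge d H α M ‖p'.2 - p.2‖)
    calc _ ≤ c * (1 / 2) * (2 * ((|p'.1 - p.1| ^ timeExp d H α) ^ 2 +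
          spaceGauge d H α M ‖p'.2 - p.2‖ ^ 2)) :=
          mul_le_mul h2 h3 (sq_nonneg _) (by positivity)
      _ = _ := by ring

/-- Covariance and mean depend only on the data of the equation, so all constants are fixed before a
probability space or a solution is chosen. A solution enters only through its Gaussian copies. The
scaling exponent `γ` is auxiliary: it appears in the condition on `D` but not in `g`. -/
theorem upperBound_and_lowerBound (hH : 1 / 2 < H) (hH1 : H < 1) (hα0 : 0 ≤ α) (hα : α < d)
    (hdα : (d : ℝ) - α < 4 * H) (ht₀ : 0 < t₀) (hT : t₀ < T) (hM : 0 < M)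
    (hΛ : IsSpectralMeasure Λ μ) (hμ : IsComparableRiesz α μ) {γ : ℝ} {qi : ℝ → ℝ}
    (hq : IsGauge (spaceGauge d H α M) qi γ) (hqm : Measurable (spaceGauge d H α M))
    (hDQ : 1 / timeExp d H α + d / γ < D)
    (hI₀ : ∃ K : ℝ, ∀ t ∈ Icc t₀ T, ∀ s ∈ Icc t₀ T, ∀ x ∈ cube d M, ∀ y ∈ cube d M,
      |initialPart v₀ t x - initialPart v₀ s y| ≤
        K * (timeGauge d H α |t - s| + spaceGauge d H α M ‖x - y‖)) {g : ℝ → ℝ}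
    (hgm : Measurable fun τ => g |τ|) (hg0 : g 0 = 0)
    (hg : ∀ ρ, 0 < ρ → g ρ = ρ ^ ((D : ℝ) - 1 / timeExp d H α) * qi ρ ^ (-(d : ℝ))) :
    UpperBound.{u} d D H T t₀ M Λ v₀ g ∧ LowerBound.{u} d D H T t₀ M Λ v₀ g := by
  have hd : 0 < d := Nat.cast_pos.1 (hα0.trans_lt hα)
  have hθ := timeExp_pos hdα
  have hD : 0 < D := by
    have h1 := hq.exponent_pos
    exact Nat.cast_pos.1 ((by positivity : 0 < 1 / timeExp d H α + d / γ).trans hDQ)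
  have := (isLocallyFiniteMeasure_of_hasTemperateGrowth hΛ.temperate).2
  have := (isLocallyFiniteMeasure_of_hasTemperateGrowth hΛ.temperate_spectral).2
  obtain ⟨_, _, hamp, _⟩ := exists_lintegral_sq_le hμ hd hH hH1 hα hdα
  obtain ⟨κ, hκ, hcov⟩ := exists_integral_mul_eq_heatCov.{u} hH hH1 (ht₀.trans hT) hΛ
    fun t ht => (hamp t ht.1).trans_lt ENNReal.ofReal_lt_top
  obtain ⟨K, hK⟩ := hI₀
  obtain ⟨c, C, hΓ, hS⟩ := exists_isControlled hμ hd hH hH1 hα hdα ht₀ hT hM hκ hq hK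
  have hm : Continuous (clampMean t₀ T M v₀) :=
    continuous_of_abs_sub_le_gaugeDist hq hθ hΓ.mean_sub_le
  have hcopies : ∀ {Ω : Type u} [MeasurableSpace Ω] {P : Measure Ω} [IsProbabilityMeasure P]
      {W : Fin D → ℝ → Set (EuclideanSpace ℝ (Fin d)) → Ω → ℝ}
      {U : ℝ → EuclideanSpace ℝ (Fin d) → Ω → EuclideanSpace ℝ (Fin D)},
      IsSolution P H T Λ v₀ W U → HasContinuousPaths P t₀ T M U →
      ∃ V : Fin D → SpaceTime d → Ω → ℝ, IsGaussianCopies P (clampCov κ H t₀ T M μ) V ∧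
        ∀ A, P (hitting t₀ T M U A) =
          P (copyHitting (Icc t₀ T ×ˢ cube d M) (clampMean t₀ T M v₀) V A) :=
    fun hU hc => exists_isGaussianCopies ht₀ hT.le hM.le hU hc hm
      fun j p p' X Y => hcov _ _ (hU.noise j) p p' X Y
  constructor
  · obtain ⟨C₀, hC₀, hC₀'⟩ := exists_upper_bound.{u} hd hD hq hθ hΓ hT hM hg
    refine ⟨C₀, hC₀, fun Ω _ P _ W U hU hc A _ => ?_⟩
    obtain ⟨V, hV, hhit⟩ := hcopies hU hc
    rw [hhit]
    exact hC₀' P V hV A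
  · intro N hN
    obtain ⟨c₀, hc₀, hc₀'⟩ := exists_lower_bound.{u} hD hq (hqm.comp measurable_norm) hθ hDQ hΓ hm
      hT hM hS hgm hg0 hg hN
    refine ⟨c₀, hc₀, fun Ω _ P _ W U hU hc A hA hAN => ?_⟩
    obtain ⟨V, hV, hhit⟩ := hcopies hU hc
    rw [hhit]
    exact hc₀' P V hV A hA hAN

lemma spaceGauge_eq_rpow (h : 4 * H - (d - α) ≠ 2) :
    spaceGauge d H α M = fun τ => τ ^ spaceExp d H α := by
  ext τ
  rw [spaceGauge, if_neg h]

lemma spaceGauge_eq_logGauge (h : 4 * H - (d - α) = 2) : spaceGauge d H α M = logGauge d M := by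
  ext τ
  rw [spaceGauge, if_pos h]

end Assembly

end FracHeat

end

theorem theoremt3 (d D : ℕ) (H α T t₀ M : ℝ)
    (hH : 1 / 2 < H ∧ H < 1) (hα : 0 ≤ α ∧ α < d) (hdα : (d : ℝ) - α < 4 * H)
    (ht₀ : 0 < t₀) (hT : t₀ < T) (hM : 0 < M)
    (Λ μ : Measure (EuclideanSpace ℝ (Fin d)))
    (hΛ : FracHeat.IsSpectralMeasure Λ μ) (hμ : FracHeat.IsComparableRiesz α μ)
    (v₀ : EuclideanSpace ℝ (Fin d) → ℝ)
    (hv₀ : ∀ t ∈ Ioc 0 T, ∀ x : EuclideanSpace ℝ (Fin d),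
      Integrable (fun y => FracHeat.heatKernel t (x - y) * v₀ y))
    (hI₀ : ∃ K : ℝ, ∀ t ∈ Icc t₀ T, ∀ s ∈ Icc t₀ T, ∀ x ∈ FracHeat.cube d M,
      ∀ y ∈ FracHeat.cube d M,
        |FracHeat.initialPart v₀ t x - FracHeat.initialPart v₀ s y| ≤
          K * (FracHeat.timeGauge d H α |t - s| + FracHeat.spaceGauge d H α M ‖x - y‖)) :
    (4 * H - (d - α) ≠ 2 →
      1 / (H - (d - α) / 4) + d / min 1 (2 * H - (d - α) / 2) < (D : ℝ) →
      FracHeat.UpperBound.{u} d D H T t₀ M Λ v₀ (FracHeat.powerGbar d D H α) ∧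
      FracHeat.LowerBound.{u} d D H T t₀ M Λ v₀ (FracHeat.powerGbar d D H α)) ∧
    (4 * H - (d - α) = 2 →
      1 / (H - (d - α) / 4) + d < (D : ℝ) →
      FracHeat.UpperBound.{u} d D H T t₀ M Λ v₀ (FracHeat.logGbar d D H α M) ∧
      FracHeat.LowerBound.{u} d D H T t₀ M Λ v₀ (FracHeat.logGbar d D H α M)) := by
  have hd : 0 < d := Nat.cast_pos.1 (hα.1.trans_lt hα.2)
  have hd' : (0 : ℝ) < d := Nat.cast_pos.2 hd
  have hθ := FracHeat.timeExp_pos hdα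
  constructor
  · intro h hDQ
    have hγ : 0 < FracHeat.spaceExp d H α := lt_min one_pos (by linarith)
    have hDQ' : 1 / FracHeat.timeExp d H α + d / FracHeat.spaceExp d H α < D := hDQ
    have heq := FracHeat.spaceGauge_eq_rpow (M := M) h
    refine FracHeat.upperBound_and_lowerBound hH.1 hH.2 hα.1 hα.2 hdα ht₀ hT hM hΛ hμ
      (heq ▸ FracHeat.isGauge_rpow hγ) (heq ▸ by fun_prop) hDQ' hI₀ ?_ ?_ fun ρ hρ => ?_
    · unfold FracHeat.powerGbar
      fun_prop
    · exact Real.zero_rpow (sub_pos.2 hDQ').ne'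
    -- For a power gauge the inverse is explicit, and `qi(ρ)^{-d}` merges with the other power of
    -- `ρ`.
    · rw [FracHeat.powerGbar, ← Real.rpow_mul hρ.le, ← Real.rpow_add hρ]
      congr 1
      ring
  · intro h hDQ
    have hDQ' : 1 / FracHeat.timeExp d H α + d < D := hDQ
    have hpos : 0 < (D : ℝ) - 1 / FracHeat.timeExp d H α := by linarith
    have hlt : d / ((D : ℝ) - 1 / FracHeat.timeExp d H α) < 1 := (div_lt_one hpos).2 (by linarith)
    have hlt0 : 0 < d / ((D : ℝ) - 1 / FracHeat.timeExp d H α) := by positivity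
    -- The logarithmic gauge has every scaling exponent below `1` at its disposal. The strict
    -- inequality `1/θ + d < D` leaves room for some `γ < 1` with `1/θ + d/γ < D`.
    obtain ⟨γ, hγ, hγ1⟩ := exists_between hlt
    have hγ0 := hlt0.trans hγ
    have heq := FracHeat.spaceGauge_eq_logGauge (M := M) h
    refine FracHeat.upperBound_and_lowerBound hH.1 hH.2 hα.1 hα.2 hdα ht₀ hT hM hΛ hμ
      (heq ▸ FracHeat.isGauge_logGauge hd hM hγ0 hγ1) (heq ▸ FracHeat.measurable_logGauge)
      ?_ hI₀ ?_ ?_ fun ρ _ => rfl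
    · have := (div_lt_comm₀ hpos hγ0).1 hγ
      linarith
    · have := FracHeat.measurable_logGaugeInv_abs hd hM
      unfold FracHeat.logGbar
      fun_prop
    · rw [FracHeat.logGbar, Real.zero_rpow hpos.ne', zero_mul]
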